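/- **Setting.** Logarithms $\log$ are to base $2$. For $f:\{0,1\}^n\to\{0,1\}$ with $f^{-1}(1)\neq\emptyset$, the oracle $\mathrm{MQ}(f)$ returns $f(x)$ on query $x$ and each call of $\mathrm{SAMP}(f)$ returns an independent uniform element of $f^{-1}(1)$. Put $\mathsf{reldist}(f,g)=|f^{-1}(1)\,\triangle\, g^{-1}(1)|/|f^{-1}(1)|$; $f$ is *$\varepsilon$-far from every $s$-term DNF* if $\mathsf{reldist}(f,g)\ge\varepsilon$ for every $s$-term DNF $g$. A *$k$-term DNF* is a disjunction of at most $k$ terms (conjunctions of literals). An *$(r,\mu)$-factored-DNF* is a function $H\wedge(T_1\vee\dots\vee T_{\le r})$ where $H,T_1,T_2,\dots$ are terms, no variable of $H$ occurs in any $T_j$, and at most $\mu$ variables occur in the $T_j$ altogether. Let $\mathsf{Cube}(a,b)$ be the set of strings $z$ with $z_i\in\{a_i,b_i\}$ for all $i$. For randomized algorithms $\mathrm{MQ}^*$ (which returns a bit on each $x\in\{0,1\}^n$) and $\mathrm{SAMP}^*$ (which returns a point of $\{0,1\}^n$) and an accept/reject algorithm $\mathsf{ALG}$ that uses two oracles,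 $(\mathrm{MQ}^*,\mathrm{SAMP}^*)$ is an *adequate implementation of oracles for $h$ with respect to $\mathsf{ALG}$* if $$\bigl|\Pr[\mathsf{ALG}(\mathrm{MQ}(h),\mathrm{SAMP}(h))\text{ accepts}]-\Pr[\mathsf{ALG}(\mathrm{MQ}^*,\mathrm{SAMP}^*)\text{ accepts}]\bigr|\le 0.1 .$$ The query complexity of an algorithm is the total number of calls to its two oracles in the worst case over all oracle answers and all its random choices. Numbers of repetitions, samples and blocks are rounded to integers. Let $K=\log^2(s/\varepsilon)$ and $\mu=\lfloor 16s^2K\rfloor$. **Find-Factored-DNFs**$(\mathrm{MQ}(f),\mathrm{SAMP}(f),s,\varepsilon)$. Let $N=\lceil s/\varepsilon\rceil^{d}$, $\alpha=\log N$, $\omega=\lceil d'(s/\varepsilon)\log(s/\varepsilon)\rceil$, with constants $d,d'\in\mathbb N$. *Test-Equivalence*$(a,b)$ queries $f$ at $N^3$ independent uniform points of $\mathsf{Cube}(a,b)$ and returns True iff some answer is $1$. *In-Pool*$(a,\mathcal P)$ queries, for each $b\in\mathcal P$, $f$ at $10\alpha$ independent uniform points of $\mathsf{Cube}(a,b)$;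 it returns True if for some $b$ all these answers are $1$, and False otherwise. 1. Draw $N^3$ samples from $\mathrm{SAMP}(f)$; join two samples by an edge if Test-Equivalence returns True on them (it is run once on each pair). The *pools* are the connected components of this graph. 2. Reject if there are more than $s$ pools. 3. Draw $N^5$ fresh samples $z$ from $\mathrm{SAMP}(f)$ and run Test-Equivalence$(a,z)$ for each $a$ in a pool and each $z$. If for some $z$ it returned True for $a\in\mathcal P$ and $a'\in\mathcal P'$ with $\mathcal P\ne\mathcal P'$, replace $\mathcal P$ and $\mathcal P'$ by $\mathcal P\cup\mathcal P'$ and repeat this step. 4. For every pool $\mathcal P$ draw a random string $\mathrm{str}_{\mathcal P}$ that contains, for each $x\in\{0,1\}^n$, the random bits for In-Pool$(x,\mathcal P)$; from now on In-Pool uses these bits. Draw $\omega$ samples $z$ from $\mathrm{SAMP}(f)$ and run In-Pool$(z,\mathcal P)$ for all of them and all $\mathcal P$. Reject if for some $z$ it returned False for all $\mathcal P$. A pool is *heavy* if In-Pool returned True for it at least $\frac{\varepsilon}{20s}\omega$ times. 5. Return the list of the pairs $(\mathrm{MQ}^*,\mathrm{SAMP}^*)$ for the heavy pools $\mathcal P$,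 where $\mathrm{MQ}^*(x)$ returns $0$ if $f(x)=0$ and otherwise $1$ iff In-Pool$(x,\mathcal P)$ returns True; and $\mathrm{SAMP}^*$ draws up to $100(s/\varepsilon)\alpha$ samples from $\mathrm{SAMP}(f)$, returns the first sample $z$ with $\mathrm{MQ}^*(z)=1$, and returns $0^n$ if there is none. **Test-Factored-DNF**$(\mathrm{MQ}(h),\mathrm{SAMP}(h),r,\mu,\varepsilon)$. Let $\kappa=\varepsilon^2$ and $\xi=\frac{\kappa}{4000}\cdot\frac1{\log(100\cdot 2^{2\mu r})}$. The symbols $O(\cdot)$, $\Theta(\cdot)$ below stand for a constant times the argument, rounded to an integer where necessary. - Draw $O((\mu\log\mu)/\xi)$ samples from $\mathrm{SAMP}(h)$ and let $\mathsf R$ be the set of coordinates on which they do not all agree; accept if $\mathsf R=\emptyset$. Otherwise run, in this order, Approximate, FindCandidate, CheckLit and ConsCheck as follows; reject if one of them rejects, and accept if ConsCheck accepts. - *Approximate.* Partition $\mathsf R$ at random into $\Theta(\mu^2)$ blocks. Let $X=\emptyset$ and $L$ be the empty list. Repeatedly draw $z\sim\mathrm{SAMP}(h)$ and $w$ uniform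 in $\{0,1\}^{\mathsf R\setminus X}$; if $h(z_{[n]\setminus(\mathsf R\setminus X)}\circ w)=0$, find by binary search over the blocks not contained in $X$ such a block $X_i$ and a string $v$ with $h(v)=1$ and $h(w_{X_i}\circ v_{[n]\setminus X_i})=0$, add to $L$ the oracle for $g^i(y)=h(y\circ v_{[n]\setminus X_i})$ on $\{0,1\}^{X_i}$, and replace $X$ by $X\cup X_i$. Reject when $|L|>\mu$. Stop when $\lfloor 5\ln(200\mu)/\xi\rfloor+1$ consecutive draws gave no new block. Let $\ell=|L|$. If $\ell=0$, let $\mathrm{MQ}_{\mathfrak J}$ be constantly $1$ and $\mathrm{SAMP}_{\mathfrak J}$ return uniform points, and go to ConsCheck. - *Extract*$(L,w,\delta)$ returns $z\in\{0,1\}^\ell$, where for each $i$ it repeats $O(\log(\mu/\delta))$ times: draw $a$ uniform in $\{0,1\}^{X_i}$ and compare $g^i(a)$ with $g^i$ at the string obtained from $a$ by flipping the coordinates $j\in X_i$ with $w_j=0$; $z_i=0$ if the two values differed more often than not, and $z_i=1$ otherwise. - *FindCandidate.* For a function $D$ on $\{0,1\}^\mu$ let $\mathfrak J_D(z)$ be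 the more frequent value of $D(z\circ w)$, $w\in\{0,1\}^{\mu-\ell}$ (ties give $1$). Let $A$ be the set of all $\mathfrak J_D$ where $D$ is an $r$-term DNF on $\{0,1\}^\mu$ with $\mathsf{reldist}(D,D')\le\kappa/2$, $D'(x)=\mathfrak J_D(x_1,\dots,x_\ell)$. For each of $1/(200\xi)$ samples $w\sim\mathrm{SAMP}(h)$ remove from $A$ all $\mathfrak J$ with $\mathfrak J(\text{Extract}(L,w,1/2))=0$. Reject if $A=\emptyset$; otherwise fix $\mathfrak J\in A$ with $|\mathfrak J^{-1}(1)|$ smallest. - *CheckLit.* For each $i$: reject if UniformJunta$(g^i,1,1/30,1/100)$ rejects; draw $10$ uniform $a$ and reject if $g^i(a)=g^i(\bar a)$ for one of them. *UniformJunta*$(g,k,\varepsilon,\delta)$ is $O(\log(1/\delta))$ repetitions, each of which must accept, of Blais's one-sided junta tester: partition the coordinates at random into $O(k^9/\varepsilon^5)$ blocks, and $O((k+1)/\varepsilon)$ times draw a uniform $x$ and a string $y$ that agrees with $x$ on the blocks found so far and is uniform elsewhere; if $g(x)\ne g(y)$, find a new block by binary search, and reject when more than $k$ blocks have been found. - $\mathrm{MQ}_{\mathfrak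 J}(x)$ returns $\mathfrak J(\text{Extract}(L,x,\kappa))$. $\mathrm{SAMP}_{\mathfrak J}$ draws a uniform $y$ and a uniform $z\in\mathfrak J^{-1}(1)$, computes $x=\text{Extract}(L,y,\kappa)$, and returns $y$ with every block $X_i$ with $x_i\ne z_i$ flipped. - *ConsCheck.* $O(1/\varepsilon)$ times draw $z\sim\mathrm{SAMP}(h)$, reject if $\mathrm{MQ}_{\mathfrak J}(z)=0$, draw $100$ points $v\sim\mathrm{SAMP}_{\mathfrak J}$ and reject if $h(z_{[n]\setminus\mathsf R}\circ v_{\mathsf R})=0$ for one of them. Then $O(1/\varepsilon)$ times draw $z\sim\mathrm{SAMP}(h)$, $v\sim\mathrm{SAMP}_{\mathfrak J}$ and reject if $h(z_{[n]\setminus\mathsf R}\circ v_{\mathsf R})=0$. Finally run ConjTest with parameter $\varepsilon/10$ on $\{0,1\}^{[n]\setminus\mathsf R}$, with samples $z_{[n]\setminus\mathsf R}$, $z\sim\mathrm{SAMP}(h)$, and with a membership oracle that on a query $a$ draws $O(\log(1/\varepsilon))$ points $w\sim\mathrm{SAMP}_{\mathfrak J}$, answers $1$ if $h(a\circ w_{\mathsf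 R})=1$ for all of them, and otherwise makes the whole test reject. *ConjTest* draws a sample $y_0$ and runs the following test on $x\mapsto g(x\oplus y_0)$, where $g$ is the function behind its oracles: $O(1/\varepsilon)$ times draw two samples $x,y$ and reject if the oracle gives $0$ at $x\oplus y$; then $O(1)$ times draw samples $x,u$ and a uniform $y\le x$ and reject if the oracle gives $0$ at $y\oplus u$; otherwise accept. **Theorem.** For all sufficiently large values of the hidden constants in Test-Factored-DNF, and then for all sufficiently large constants $d,d'$ of Find-Factored-DNFs, there are absolute constants $C$ and $L$ such that the following holds for all $n$, all integers $s\ge1$ and all $0<\varepsilon\le\frac12$ with $s/\varepsilon\ge L$. Find-Factored-DNFs makes at most $(s/\varepsilon)^C$ queries to $\mathrm{MQ}(f),\mathrm{SAMP}(f)$. For every $f:\{0,1\}^n\to\{0,1\}$ with $f^{-1}(1)\ne\emptyset$ it either rejects or returns a list of $s'\le s$ pairs $(\mathrm{MQ}^*_1,\mathrm{SAMP}^*_1),\dots,(\mathrm{MQ}^*_{s'},\mathrm{SAMP}^*_{s'})$, and: 1. All $\mathrm{MQ}^*_i$ and $\mathrm{SAMP}^*_i$ are randomized algorithms with access to $\mathrm{MQ}(f)$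 and $\mathrm{SAMP}(f)$ that make at most $(s/\varepsilon)^C$ queries. 2. If $f$ is an $s$-term DNF, then with probability at least $0.9$ the algorithm does not reject and there are functions $h_1,\dots,h_{s'}:\{0,1\}^n\to\{0,1\}$ with $h_i^{-1}(1)\ne\emptyset$ and integers $k_i$ such that (a) each $h_i$ is a $k_i$-term DNF and $\sum_{i}k_i\le s$; (b) each $h_i$ is a $(k_i,\mu)$-factored-DNF; (c) each $(\mathrm{MQ}^*_i,\mathrm{SAMP}^*_i)$ is an adequate implementation of oracles for $h_i$ with respect to Test-Factored-DNF$(\cdot,\cdot,k_i,\mu,\varepsilon/(2s))$. 3. If $f$ is $\varepsilon$-far from every $s$-term DNF, then with probability at least $0.9$ the algorithm either rejects or there are functions $h_1,\dots,h_{s'}:\{0,1\}^n\to\{0,1\}$ with $h_i^{-1}(1)\ne\emptyset$ such that (a$'$) $h_i^{-1}(1)\subseteq f^{-1}(1)$ for all $i$, and $$\frac{|f^{-1}(1)\setminus\bigcup_i h_i^{-1}(1)|}{|f^{-1}(1)|}\le\frac{\varepsilon}{2};$$ (b$'$) for all $i$ and all $r\in\{1,\dots,s\}$, $(\mathrm{MQ}^*_i,\mathrm{SAMP}^*_i)$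 is an adequate implementation of oracles for $h_i$ with respect to Test-Factored-DNF$(\cdot,\cdot,r,\mu,\varepsilon/(2s))$. -/

import Mathlib

namespace RelDNF

/-! ### Strings, terms, DNFs, relative distance -/

/-- Strings in `{0,1}^n`. A string in `{0,1}^A` with `A ⊆ [n]` is represented by any full string
that has the right bits on `A`; the other bits are never used. -/
abbrev Str (n : ℕ) : Type := Fin n → Bool

/-- The set `f⁻¹(1)`. -/
def sat {n : ℕ} (f : Str n → Bool) : Finset (Str n) :=
  Finset.univ.filter fun x => f x = true

/-- `reldist (f, g) = |f⁻¹(1) ∆ g⁻¹(1)| / |f⁻¹(1)|`. -/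
noncomputable def reldist {n : ℕ} (f g : Str n → Bool) : ℝ :=
  ((symmDiff (sat f) (sat g)).card : ℝ) / ((sat f).card : ℝ)

/-- A term, i.e. a consistent set of literals: `T i = some b` means that `T` contains the literal
on variable `i` which is satisfied by the bit `b`. -/
abbrev Term (n : ℕ) : Type := Fin n → Option Bool

/-- The value of the conjunction `T` at `x`. -/
def Term.eval {n : ℕ} (T : Term n) (x : Str n) : Bool :=
  decide (∀ i : Fin n, ∀ b : Bool, T i = some b → x i = b)

/-- The variables that occur in `T`. -/
def Term.vars {n : ℕ} (T : Term n) : Finset (Fin n) :=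
  Finset.univ.filter fun i => (T i).isSome = true

/-- The disjunction of a finite set of terms. -/
def dnf {n : ℕ} (D : Finset (Term n)) (x : Str n) : Bool :=
  decide (∃ T ∈ D, Term.eval T x = true)

/-- `f` is a `k`-term DNF, `f = T₁ ∨ ⋯ ∨ T_{≤ k}`. -/
def IsTermDNF {n : ℕ} (k : ℕ) (f : Str n → Bool) : Prop :=
  ∃ D : Finset (Term n), D.card ≤ k ∧ f = dnf D

/-- `h = H ∧ (T₁ ∨ ⋯ ∨ T_{≤ r})`, where the variables of the head `H` are disjoint from those of
the tail and at most `μ` variables appear in the tail. -/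
def IsFactoredDNF {n : ℕ} (r μ : ℕ) (h : Str n → Bool) : Prop :=
  ∃ (H : Term n) (D : Finset (Term n)), D.card ≤ r ∧
    (∀ T ∈ D, Disjoint (Term.vars H) (Term.vars T)) ∧
    (D.biUnion Term.vars).card ≤ μ ∧
    ∀ x, h x = (Term.eval H x && dnf D x)

/-- The string `x_A ∘ y_{[n] ∖ A}`. -/
def splice {n : ℕ} (A : Finset (Fin n)) (x y : Str n) : Str n :=
  fun i => if i ∈ A then x i else y i

/-- The point of `Cube(a, b)` selected by `w`; it is uniform in `Cube(a, b)` for uniform `w`. -/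
def mix {n : ℕ} (w a b : Str n) : Str n :=
  fun i => if w i = true then a i else b i

/-- Bitwise exclusive or. -/
def bxor {n : ℕ} (x y : Str n) : Str n :=
  fun i => xor (x i) (y i)

/-! ### Randomized algorithms with a membership oracle and a sampling oracle -/

/-- A randomized algorithm over `{0,1}^n` with output in `α`: it stops with an output, or calls the
membership oracle at a point, or calls the sampling oracle, or draws a uniform element of
`{0, …, k}`, and goes on depending on the answer. -/
inductive Prog (n : ℕ) (α : Type) : Type where
  | ret (a : α) : Prog n α
  | mq (x : Str n) (next : Bool → Prog n α) : Prog n α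
  | samp (next : Str n → Prog n α) : Prog n α
  | rand (k : ℕ) (next : Fin (k + 1) → Prog n α) : Prog n α

namespace Prog

/-- Sequential composition. -/
def bind {n : ℕ} {α β : Type} : Prog n α → (α → Prog n β) → Prog n β
  | ret a, g => g a
  | mq x next, g => mq x fun b => bind (next b) g
  | samp next, g => samp fun x => bind (next x) g
  | rand k next, g => rand k fun i => bind (next i) g

instance {n : ℕ} : Monad (Prog n) where
  pure := ret
  bind := bind

/-- The law of the output when each oracle call is answered by an independent draw from the given
distributions. -/
noncomputable def eval {n : ℕ} {α : Type} (M : Str n → PMF Bool) (S : PMF (Str n)) :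
    Prog n α → PMF α
  | ret a => PMF.pure a
  | mq x next => (M x).bind fun b => eval M S (next b)
  | samp next => S.bind fun x => eval M S (next x)
  | rand k next => (PMF.uniformOfFintype (Fin (k + 1))).bind fun i => eval M S (next i)

/-- The law of the output when the oracles are `MQ(f)` and `SAMP(f)`. -/
noncomputable def run {n : ℕ} {α : Type} (f : Str n → Bool) (hf : (sat f).Nonempty)
    (p : Prog n α) : PMF α :=
  eval (fun x => PMF.pure (f x)) (PMF.uniformOfFinset (sat f) hf) p

/-- The algorithm `p` run with the algorithms `M` and `S` in place of its two oracles; each call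
uses fresh randomness. -/
def subst {n : ℕ} {α : Type} (M : Str n → Prog n Bool) (S : Prog n (Str n)) :
    Prog n α → Prog n α
  | ret a => ret a
  | mq x next => bind (M x) fun b => subst M S (next b)
  | samp next => bind S fun x => subst M S (next x)
  | rand k next => rand k fun i => subst M S (next i)

/-- Whatever the oracle answers and the random draws are, at most `q` oracle calls are made. -/
def QueriesAtMost {n : ℕ} {α : Type} : ℕ → Prog n α → Prop
  | _, ret _ => True
  | q, mq _ next => 1 ≤ q ∧ ∀ b, QueriesAtMost (q - 1) (next b)
  | q, samp next => 1 ≤ q ∧ ∀ x, QueriesAtMost (q - 1) (next x)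
  | q, rand _ next => ∀ i, QueriesAtMost q (next i)

/-- One call to the membership oracle. -/
def ask {n : ℕ} (x : Str n) : Prog n Bool := mq x ret

/-- One call to the sampling oracle. -/
def sample {n : ℕ} : Prog n (Str n) := samp ret

/-- A uniform element of a nonempty finite set. -/
noncomputable def unifOn {n : ℕ} {α : Type} (s : Finset α) (hs : s.Nonempty) : Prog n α :=
  rand (s.card - 1) fun i =>
    ret (s.equivFin.symm (Fin.cast (Nat.sub_add_cancel hs.card_pos) i)).1

/-- A uniform element of a nonempty finite type. -/
noncomputable def unif {n : ℕ} (α : Type) [Fintype α] [Nonempty α] : Prog n α :=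
  unifOn (Finset.univ : Finset α) Finset.univ_nonempty

/-- Run `p 0, …, p (m - 1)` and record all the outputs. -/
def tabulate {n : ℕ} {β : Type} : {m : ℕ} → (Fin m → Prog n β) → Prog n (Fin m → β)
  | 0, _ => pure Fin.elim0
  | _ + 1, p => do
    let b ← p 0
    let bs ← tabulate fun i => p i.succ
    pure (Fin.cons b bs)

/-- Run `p` up to `m` times and reject at its first rejection. -/
def repeatAll {n : ℕ} : ℕ → Prog n Bool → Prog n Bool
  | 0, _ => pure true
  | m + 1, p => do
    if ← p then repeatAll m p else pure false

end Prog

/-- `(M, S)` is an adequate implementation, by algorithms with access to `MQ(f)` and `SAMP(f)`, of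
oracles for `h` with respect to the accept / reject algorithm `alg`. -/
def IsAdequate {n : ℕ} (f : Str n → Bool) (hf : (sat f).Nonempty)
    (M : Str n → Prog n Bool) (S : Prog n (Str n))
    (h : Str n → Bool) (hh : (sat h).Nonempty) (alg : Prog n Bool) : Prop :=
  |(Prog.run h hh alg true).toReal - (Prog.run f hf (Prog.subst M S alg) true).toReal| ≤ 1 / 10

/-! ### The parameters `K` and `μ` -/

/-- `K = log² (s / ε)`. -/
noncomputable def paramK (s : ℕ) (ε : ℝ) : ℝ := (Real.logb 2 ((s : ℝ) / ε)) ^ 2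

/-- `μ = 16 s² K`, rounded down. -/
noncomputable def paramMu (s : ℕ) (ε : ℝ) : ℕ := ⌊16 * (s : ℝ) ^ 2 * paramK s ε⌋₊

/-! ### Find-Factored-DNFs -/

/-- The unspecified constants of Find-Factored-DNFs: the degree of the polynomial `N` of `s / ε`,
and the constant in the number `ω` of samples of the fourth phase. -/
structure FinderConsts where
  degree : ℕ
  draws : ℕ

/-- The polynomial `N` of `s / ε`. -/
noncomputable def FinderConsts.bigN (c : FinderConsts) (s : ℕ) (ε : ℝ) : ℕ :=
  ⌈(s : ℝ) / ε⌉₊ ^ c.degree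

/-- `ω = Θ ((s / ε) log (s / ε))`. -/
noncomputable def FinderConsts.omega (c : FinderConsts) (s : ℕ) (ε : ℝ) : ℕ :=
  ⌈(c.draws : ℝ) * ((s : ℝ) / ε) * Real.logb 2 ((s : ℝ) / ε)⌉₊

/-- `α = log N`. -/
noncomputable def alpha (N : ℕ) : ℝ := Real.logb 2 (N : ℝ)

/-- Test-Equivalence: query `N³` uniform points of `Cube(a, b)` and return true iff some answer
is `1`. -/
noncomputable def testEquivalence {n : ℕ} (N : ℕ) (a b : Str n) : Prog n Bool := do
  let ans ← Prog.tabulate fun _ : Fin (N ^ 3) => do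
    let w ← Prog.unif (Str n)
    Prog.ask (mix w a b)
  pure (decide (∃ j, ans j = true))

/-- The number `10 α` of repetitions in In-Pool. -/
noncomputable def poolReps (N : ℕ) : ℕ := ⌈10 * alpha N⌉₊

/-- The loop of In-Pool over the points `b` of the pool, with the random bits `ρ` (the `j`-th point
of `Cube(a, b)` that is queried is the one selected by `ρ b j`). -/
def inPoolList {n m : ℕ} (a : Str n) (ρ : Str n → Fin m → Str n) : List (Str n) → Prog n Bool
  | [] => pure false
  | b :: bs => do
    let ans ← Prog.tabulate fun j : Fin m => Prog.ask (mix (ρ b j) a b)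
    if ∀ j, ans j = true then pure true else inPoolList a ρ bs

/-- In-Pool with the random bits `ρ`. -/
noncomputable def inPool {n m : ℕ} (a : Str n) (P : Finset (Str n))
    (ρ : Str n → Fin m → Str n) : Prog n Bool :=
  inPoolList a ρ P.toList

/-- The simulator `MQ*` of a pool `P`, where `str x` are the random bits for In-Pool at `x`. -/
noncomputable def mqStar {n m : ℕ} (P : Finset (Str n)) (str : Str n → Str n → Fin m → Str n)
    (x : Str n) : Prog n Bool := do
  if ← Prog.ask x then inPool x P (str x) else pure false

/-- The simulator `SAMP*` of a pool `P` with the given number of attempts. -/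
noncomputable def sampStar {n m : ℕ} (P : Finset (Str n)) (str : Str n → Str n → Fin m → Str n) :
    ℕ → Prog n (Str n)
  | 0 => pure fun _ => false
  | k + 1 => do
    let z ← Prog.sample
    if ← mqStar P str z then pure z else sampStar P str k

open Classical in
/-- The vertex sets of the connected components of the graph with edge indicator `E`. -/
noncomputable def components {m : ℕ} (E : Fin m → Fin m → Bool) : Finset (Finset (Fin m)) :=
  Finset.univ.image fun i => Finset.univ.filter fun j =>
    (SimpleGraph.fromRel fun a b => E a b = true).Reachable i j

open Classical in
/-- The phase that merges pools: at most `k` rounds, each with `N⁵` fresh samples; a round in which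
no two pools have to be merged is the last one. (There is such a round within the first `|G|`
rounds, as each merge removes one pool.) Pools are sets of indices of the samples `S`. -/
noncomputable def mergePhase {n m : ℕ} (N : ℕ) (S : Fin m → Str n) :
    ℕ → Finset (Finset (Fin m)) → Prog n (Finset (Finset (Fin m)))
  | 0, G => pure G
  | k + 1, G => do
    let z ← Prog.tabulate fun _ : Fin (N ^ 5) => Prog.sample
    let t ← Prog.tabulate fun i : Fin m => Prog.tabulate fun j : Fin (N ^ 5) =>
      testEquivalence N (S i) (z j)
    if h : ∃ p : Finset (Fin m) × Finset (Fin m), p.1 ∈ G ∧ p.2 ∈ G ∧ p.1 ≠ p.2 ∧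
        ∃ j, (∃ i ∈ p.1, t i j = true) ∧ (∃ i ∈ p.2, t i j = true) then
      mergePhase N S k
        (insert (h.choose.1 ∪ h.choose.2) ((G.erase h.choose.1).erase h.choose.2))
    else pure G

open Classical in
/-- Find-Factored-DNFs. The output `none` means that it rejects; otherwise the output is the list
of pairs `(MQ*, SAMP*)`. -/
noncomputable def findFactoredDNFs {n : ℕ} (c : FinderConsts) (s : ℕ) (ε : ℝ) :
    Prog n (Option (List ((Str n → Prog n Bool) × Prog n (Str n)))) := do
  let N := c.bigN s ε
  let ω := c.omega s ε
  -- building pools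
  let S ← Prog.tabulate fun _ : Fin (N ^ 3) => Prog.sample
  let E ← Prog.tabulate fun i : Fin (N ^ 3) => Prog.tabulate fun j : Fin (N ^ 3) =>
    if i < j then testEquivalence N (S i) (S j) else pure false
  let G := components E
  -- sanity check
  if s < G.card then pure none else do
    -- merging pools
    let G' ← mergePhase N S G.card G
    let P : List (Finset (Str n)) := G'.toList.map fun A => A.image S
    -- removing low weight pools
    let str ← Prog.tabulate fun _ : Fin P.length =>
      Prog.unif (Str n → Str n → Fin (poolReps N) → Str n)
    let hit ← Prog.tabulate fun _ : Fin ω => do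
      let z ← Prog.sample
      Prog.tabulate fun i : Fin P.length => inPool z (P.get i) (str i z)
    if ∃ t, ∀ i, hit t i = false then pure none else do
      let heavy := (List.finRange P.length).filter fun i =>
        decide (ε / (20 * (s : ℝ)) * (ω : ℝ) ≤
          ((Finset.univ.filter fun t => hit t i = true).card : ℝ))
      -- returning oracles
      pure (some (heavy.map fun i => (mqStar (P.get i) (str i),
        sampStar (P.get i) (str i) ⌈100 * ((s : ℝ) / ε) * alpha N⌉₊)))

/-! ### Test-Factored-DNF -/

/-- The constants hidden in the `O(·)` and `Θ(·)` of Test-Factored-DNF and of its subroutines. -/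
structure TesterConsts where
  /-- for the number of initial samples -/
  start : ℕ
  /-- for the number of blocks in Approximate -/
  blocks : ℕ
  /-- for the number of repetitions in Extract -/
  extract : ℕ
  /-- for the number of blocks in UniformJunta -/
  juntaBlocks : ℕ
  /-- for the number of rounds in UniformJunta -/
  juntaRounds : ℕ
  /-- for the number of repetitions in UniformJunta -/
  juntaReps : ℕ
  /-- for the first loop of ConsCheck -/
  verify : ℕ
  /-- for the second loop of ConsCheck -/
  verify' : ℕ
  /-- for the number of samples in the membership simulator used by ConsCheck -/
  gamma : ℕ
  /-- for the first loop of ConjTest -/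
  conj : ℕ
  /-- for the second loop of ConjTest -/
  conj' : ℕ

/-- All the constants are at least `c₀`. -/
def TesterConsts.AtLeast (c : TesterConsts) (c₀ : ℕ) : Prop :=
  c₀ ≤ c.start ∧ c₀ ≤ c.blocks ∧ c₀ ≤ c.extract ∧ c₀ ≤ c.juntaBlocks ∧ c₀ ≤ c.juntaRounds ∧
  c₀ ≤ c.juntaReps ∧ c₀ ≤ c.verify ∧ c₀ ≤ c.verify' ∧ c₀ ≤ c.gamma ∧ c₀ ≤ c.conj ∧ c₀ ≤ c.conj'

/-- `κ = ε²`. -/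
noncomputable def kappa (ε : ℝ) : ℝ := ε ^ 2

/-- `ξ = (κ / 4000) / log (100 · 2^{2 μ r})`. -/
noncomputable def xi (r μ : ℕ) (ε : ℝ) : ℝ :=
  kappa ε / 4000 * (1 / Real.logb 2 (100 * 2 ^ (2 * μ * r)))

/-- Binary search over the blocks `X j`, `j ∈ U`: the strings `a` and `b` differ only on these
blocks and the oracle has answered `va` at `a` and differently at `b`. -/
def binarySearch {n m : ℕ} (X : Fin (m + 1) → Finset (Fin n)) (U : List (Fin (m + 1)))
    (va : Bool) (a b : Str n) : Prog n (Fin (m + 1) × Str n) :=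
  if 2 ≤ U.length then
    let U' := U.take (U.length / 2)
    let c := splice (U'.toFinset.biUnion X) b a
    do
      let vc ← Prog.ask c
      if vc = va then binarySearch X (U.drop (U.length / 2)) va c b
      else binarySearch X U' va a c
  else pure (U.headD 0, a)
termination_by U.length
decreasing_by
  · simp only [List.length_drop]; omega
  · simp only [List.length_take]; omega

/-- The union of the blocks with indices in `F`. -/
def blockUnion {n m : ℕ} (X : Fin (m + 1) → Finset (Fin n)) (F : List (Fin (m + 1))) :
    Finset (Fin n) :=
  F.toFinset.biUnion X

/-- The indices of the blocks that are not in `F`. -/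
def otherBlocks {m : ℕ} (F : List (Fin (m + 1))) : List (Fin (m + 1)) :=
  (List.finRange (m + 1)).filter fun j => j ∉ F

/-- The local oracle `(MQ(g), X)` with `g(z) = h (z_X ∘ v_{[n] ∖ X})` is given by `(X, v)`. -/
abbrev LocalOracle (n : ℕ) : Type := Finset (Fin n) × Str n

/-- One call to a local oracle. -/
def askLocal {n : ℕ} (o : LocalOracle n) (z : Str n) : Prog n Bool :=
  Prog.ask (splice o.1 z o.2)

/-- The main loop of Approximate. Here `T` is the number of consecutive draws without a new
block after which the loop ends, `rem` is how many of them are left, `slots` is the number of blocks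
that may still be added, and `L` is the list of the blocks found with their strings `v`. -/
noncomputable def approximateLoop {n m : ℕ} (R : Finset (Fin n))
    (X : Fin (m + 1) → Finset (Fin n)) (T : ℕ) (slots rem : ℕ)
    (L : List (Fin (m + 1) × Str n)) : Prog n (Option (List (Fin (m + 1) × Str n))) :=
  match slots, rem with
  | _, 0 => pure (some L)
  | slots, rem + 1 => do
    let z ← Prog.sample
    let w ← Prog.unif (Str n)
    let b := splice (R \ blockUnion X (L.map Prod.fst)) w z
    if ← Prog.ask b then approximateLoop R X T slots rem L
    else do
      let found ← binarySearch X (otherBlocks (L.map Prod.fst)) true z b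
      match slots with
      | 0 => pure none
      | slots + 1 => approximateLoop R X T slots T (L ++ [found])
termination_by (slots, rem)

/-- Approximate; the output `none` means that it rejects. -/
noncomputable def approximate {n : ℕ} (c : TesterConsts) (r μ : ℕ) (ε : ℝ)
    (R : Finset (Fin n)) : Prog n (Option (List (LocalOracle n))) := do
  let part ← Prog.unif (Fin n → Fin (c.blocks * μ ^ 2 + 1))
  let X : Fin (c.blocks * μ ^ 2 + 1) → Finset (Fin n) := fun j => R.filter fun i => part i = j
  let T := ⌊5 * Real.log (200 * (μ : ℝ)) / xi r μ ε⌋₊ + 1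
  match ← approximateLoop R X T μ T [] with
  | none => pure none
  | some L => pure (some (L.map fun p => (X p.1, p.2)))

/-- Extract: on a list of local oracles and `w`, one bit per local oracle. -/
noncomputable def extract {n : ℕ} (c : TesterConsts) (μ : ℕ) (L : List (LocalOracle n))
    (w : Str n) (δ : ℝ) : Prog n (Fin L.length → Bool) :=
  Prog.tabulate fun i => do
    let differ ← Prog.tabulate
      fun _ : Fin ⌈(c.extract : ℝ) * Real.logb 2 ((μ : ℝ) / δ)⌉₊ => do
        let a ← Prog.unif (Str n)
        let p ← askLocal (L.get i) a
        let q ← askLocal (L.get i) fun j => if w j = false then !(a j) else a j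
        pure (p != q)
    let G₀ := (Finset.univ.filter fun t => differ t = true).card
    let G₁ := (Finset.univ.filter fun t => differ t = false).card
    pure (if G₁ < G₀ then false else true)

/-- `𝔍_D(z)` is the more frequent value of `D(z ∘ w)` over `w ∈ {0,1}^{μ - ℓ}` (ties give `1`). -/
def majority {μ ℓ : ℕ} (hℓ : ℓ ≤ μ) (D : Str μ → Bool) (z : Str ℓ) : Bool :=
  decide ((Finset.univ.filter fun x : Str μ =>
      (fun i => x (Fin.castLE hℓ i)) = z ∧ D x = false).card ≤
    (Finset.univ.filter fun x : Str μ =>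
      (fun i => x (Fin.castLE hℓ i)) = z ∧ D x = true).card)

/-- DNF-Approx(`ℓ`): the functions `𝔍_D`, for all `r`-term DNFs `D` over `{0,1}^μ` with
`reldist (D, D') ≤ κ / 2`, where `D'(x) = 𝔍_D(x₁, …, x_ℓ)`. -/
def dnfApprox (r μ : ℕ) (ε : ℝ) (ℓ : ℕ) : Set (Str ℓ → Bool) :=
  {J | ∃ (hℓ : ℓ ≤ μ) (D : Str μ → Bool), IsTermDNF r D ∧
    reldist D (fun x => majority hℓ D fun i => x (Fin.castLE hℓ i)) ≤ kappa ε / 2 ∧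
    J = majority hℓ D}

open Classical in
/-- FindCandidate; the output `none` means that it rejects. -/
noncomputable def findCandidate {n : ℕ} (c : TesterConsts) (r μ : ℕ) (ε : ℝ)
    (L : List (LocalOracle n)) : Prog n (Option (Str L.length → Bool)) := do
  let z ← Prog.tabulate fun _ : Fin ⌈1 / (200 * xi r μ ε)⌉₊ => do
    let w ← Prog.sample
    extract c μ L w (1 / 2)
  let A : Set (Str L.length → Bool) := {J | J ∈ dnfApprox r μ ε L.length ∧ ∀ t, J (z t) = true}
  if hA : A.Nonempty then pure (some (Function.argminOn (fun J => (sat J).card) A hA))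
  else pure none

/-- The rounds of the one-sided tester for `k`-juntas under the uniform distribution; `F` lists the
blocks found so far. -/
noncomputable def juntaLoop {n m : ℕ} (X : Fin (m + 1) → Finset (Fin n)) (k : ℕ) :
    ℕ → List (Fin (m + 1)) → Prog n Bool
  | 0, _ => pure true
  | t + 1, F => do
    let x ← Prog.unif (Str n)
    let u ← Prog.unif (Str n)
    let y := splice (blockUnion X F) x u
    let p ← Prog.ask x
    let q ← Prog.ask y
    if p = q then juntaLoop X k t F
    else do
      let found ← binarySearch X (otherBlocks F) p x y
      if k < F.length + 1 then pure false else juntaLoop X k t (F ++ [found.1])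

/-- UniformJunta: Blais's one-sided `ε`-tester for `k`-juntas under the uniform distribution,
repeated `O(log (1 / δ))` times. -/
noncomputable def uniformJunta {n : ℕ} (c : TesterConsts) (k : ℕ) (ε δ : ℝ) : Prog n Bool :=
  Prog.repeatAll ⌈(c.juntaReps : ℝ) * Real.logb 2 (1 / δ)⌉₊ do
    let part ← Prog.unif (Fin n → Fin (⌈(c.juntaBlocks : ℝ) * (k : ℝ) ^ 9 / ε ^ 5⌉₊ + 1))
    juntaLoop (fun j => Finset.univ.filter fun i => part i = j) k
      ⌈(c.juntaRounds : ℝ) * ((k : ℝ) + 1) / ε⌉₊ []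

/-- CheckLit. -/
noncomputable def checkLit {n : ℕ} (c : TesterConsts) : List (LocalOracle n) → Prog n Bool
  | [] => pure true
  | o :: L => do
    if ← Prog.subst (askLocal o) Prog.sample (uniformJunta c 1 (1 / 30) (1 / 100)) then
      let ok ← Prog.repeatAll 10 do
        let a ← Prog.unif (Str n)
        let p ← askLocal o a
        let q ← askLocal o fun j => !(a j)
        pure (p != q)
      if ok then checkLit c L else pure false
    else pure false

/-- Sim-MQ-J. -/
noncomputable def simMQJ {n : ℕ} (c : TesterConsts) (μ : ℕ) (ε : ℝ) (L : List (LocalOracle n))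
    (J : Str L.length → Bool) (x : Str n) : Prog n Bool := do
  let z ← extract c μ L x (kappa ε)
  pure (J z)

open Classical in
/-- Sim-SAMP-J. (The set `𝔍⁻¹(1)` is nonempty whenever this is used.) -/
noncomputable def simSAMPJ {n : ℕ} (c : TesterConsts) (μ : ℕ) (ε : ℝ) (L : List (LocalOracle n))
    (J : Str L.length → Bool) : Prog n (Str n) := do
  let y ← Prog.unif (Str n)
  let z ← if hJ : (sat J).Nonempty then Prog.unifOn (sat J) hJ else pure fun _ => false
  let x ← extract c μ L y (kappa ε)
  pure fun j => if ∃ i, j ∈ (L.get i).1 ∧ x i ≠ z i then !(y j) else y j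

/-- DNFLearner; the output `none` means that it rejects, otherwise the output is a pair of
simulators for the oracles of a function `𝔍 : {0,1}^R → {0,1}`. -/
noncomputable def dnfLearner {n : ℕ} (c : TesterConsts) (r μ : ℕ) (ε : ℝ) (R : Finset (Fin n)) :
    Prog n (Option ((Str n → Prog n Bool) × Prog n (Str n))) := do
  match ← approximate c r μ ε R with
  | none => pure none
  | some [] => pure (some (fun _ => pure true, Prog.unif (Str n)))
  | some (o :: L) =>
    match ← findCandidate c r μ ε (o :: L) with
    | none => pure none
    | some J => do
      if ← checkLit c (o :: L) then
        pure (some (simMQJ c μ ε (o :: L) J, simSAMPJ c μ ε (o :: L) J))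
      else pure none

/-- The relative-error tester for anti-monotone conjunctions. -/
noncomputable def antiMonotoneConjTest {n : ℕ} (c : TesterConsts) (ε : ℝ) : Prog n Bool := do
  let ok ← Prog.repeatAll ⌈(c.conj : ℝ) / ε⌉₊ do
    let x ← Prog.sample
    let y ← Prog.sample
    Prog.ask (bxor x y)
  if ok then
    Prog.repeatAll c.conj' do
      let x ← Prog.sample
      let w ← Prog.unif (Str n)
      let y : Str n := fun i => x i && w i
      let u ← Prog.sample
      Prog.ask (bxor y u)
  else pure false

/-- ConjTest: draw `y₀` from the sampling oracle and run the tester for anti-monotone conjunctions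
on the function `x ↦ f (x ⊕ y₀)`. -/
noncomputable def conjTest {n : ℕ} (c : TesterConsts) (ε : ℝ) : Prog n Bool := do
  let y₀ ← Prog.sample
  Prog.subst (fun x => Prog.ask (bxor x y₀)) (do let x ← Prog.sample; pure (bxor x y₀))
    (antiMonotoneConjTest c ε)

/-- The membership simulator for the function `Γ` on `{0,1}^{[n] ∖ R}`. The answer `0` stands for
the rejection of the whole test: ConjTest rejects as soon as it gets such an answer. -/
noncomputable def simMQGamma {n : ℕ} (c : TesterConsts) (ε : ℝ) (R : Finset (Fin n))
    (sampJ : Prog n (Str n)) (a : Str n) : Prog n Bool :=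
  Prog.repeatAll ⌈(c.gamma : ℝ) * Real.logb 2 (1 / ε)⌉₊ do
    let w ← sampJ
    Prog.ask (splice R w a)

/-- ConsCheck. -/
noncomputable def consCheck {n : ℕ} (c : TesterConsts) (ε : ℝ) (R : Finset (Fin n))
    (mqJ : Str n → Prog n Bool) (sampJ : Prog n (Str n)) : Prog n Bool := do
  let ok₁ ← Prog.repeatAll ⌈(c.verify : ℝ) / ε⌉₊ do
    let z ← Prog.sample
    if ← mqJ z then
      Prog.repeatAll 100 do
        let v ← sampJ
        Prog.ask (splice R v z)
    else pure false
  if ok₁ then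
    let ok₂ ← Prog.repeatAll ⌈(c.verify' : ℝ) / ε⌉₊ do
      let z ← Prog.sample
      let v ← sampJ
      Prog.ask (splice R v z)
    if ok₂ then
      Prog.subst (simMQGamma c ε R sampJ) Prog.sample (conjTest c (ε / 10))
    else pure false
  else pure false

/-- Test-Factored-DNF(`MQ(h)`, `SAMP(h)`, `r`, `μ`, `ε`); the output `true` means that it accepts. -/
noncomputable def testFactoredDNF {n : ℕ} (c : TesterConsts) (r μ : ℕ) (ε : ℝ) :
    Prog n Bool := do
  let z ← Prog.tabulate
    fun _ : Fin ⌈(c.start : ℝ) * ((μ : ℝ) * Real.logb 2 (μ : ℝ)) / xi r μ ε⌉₊ => Prog.sample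
  let R : Finset (Fin n) :=
    Finset.univ.filter fun i => ∃ t t', z t i = true ∧ z t' i = false
  if R = ∅ then pure true
  else
    match ← dnfLearner c r μ ε R with
    | none => pure false
    | some (mqJ, sampJ) => consCheck c ε R mqJ sampJ

end RelDNF

open RelDNF

/-!
Both guarantees reduce to comparing runs of a program with few queries in two worlds. A *world*
consists of a membership oracle, a sample law and a set of *bad* points; the *risk* of a program is
the expectation of a random variable of its outcome, where a run that queries a bad point counts as
`1`. If two worlds have membership oracles that agree off the bad points and sample laws at distance
`τ`, then a program with at most `q` queries behaves in the two worlds in the same way, up to the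
risk of a bad query and `q * τ` (`abs_risk_sub_risk_le`). The probabilities of the theorem are risks
without bad points (`le_run_toOuterMeasure`, `run_true_toReal`).

*Pools as functions.* Once the random strings are fixed, In-Pool is deterministic, so `MQ*` computes
a function exactly, namely `poolFun`: the conjunction of `f` and In-Pool. `SAMP*` returns a uniform
satisfying string of this function unless all its draws fail, and for a pool of weight at least
`ε / (40 s)` this has probability at most `N⁻²` (`sampStar_failure_le`). By Chernoff bounds the
pools that are declared heavy have at least this weight, while all pools of weight `ε / (4 s)` are
heavy, and a set of this weight that lies in no pool leads to rejection (`risk_poolHits_faithful`).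

*Arbitrary `f`.* The functions `h_i = poolFun` lie below `f`, they cover all but `ε / 2` of
`f⁻¹(1)`, and their simulators are adequate for every algorithm with far fewer than `N²` queries
(`risk_selectPools_arbitrary`, `risk_findFactoredDNFs_arbitrary`). No property of `f` is used.

*`f` a DNF.* All samples are likely to be *generic*: a term that a sample nearly satisfies lacks few
literals of any term it satisfies, and the terms it satisfies are not much longer than other terms
(`expect_not_generic_le`). If Test-Equivalence returns True on two generic samples, some term is
nearly satisfied by both, so the terms that they satisfy differ in `O(log N)` literals
(`card_missing_le_of_frac`). Two samples of one term are always equivalent. Hence the terms are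
divided among the pools, and within a pool they are linked by small steps. A literal that is not
common to all terms of a pool is lost at one of these steps, so the disjunction `h_i` of the terms of
a pool is a factored DNF with few variables in the tail (`Linked.isFactoredDNF`). After merging,
hardly any string looks equivalent to two pools (`risk_mergePhase_le`), so that In-Pool exceeds
`h_i` only on a fraction of about `1 / N` (`expect_excess_le`).

*Test-Factored-DNF does not notice the difference.* If `h` is a factored DNF and `B` a set that is
small compared to `h⁻¹(1)`, then Test-Factored-DNF on `h` is unlikely to query a point of `B`
(`risk_testFactoredDNF_le`), which makes the simulators adequate (`isAdequate_of_pool`). The queries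
of Approximate arise by resampling coordinates of a sample, and this cannot concentrate its law on
`B` (`expect_sat_splice_le`). The local oracles that it finds are literals
(`risk_approximateLoop_le`), so the later queries to them are uniform and their answers
predictable. The candidate of FindCandidate is consistent with so many samples that it is `1` on at
least half of `h⁻¹(1)` (`risk_findCandidate_le`); therefore the simulated samples, whose density is
`2 ^ ℓ / |J⁻¹(1)|` (`risk_simSAMPJ_le`), are not concentrated on `B` either
(`expect_density_le`, `risk_consCheck_le`).

*Parameters.* With `y = ⌈s / ε⌉`, Test-Factored-DNF makes at most `y ^ 120` queries and tolerates
sets `B` of density `y ^ (-200) / 10000` (`isRobust_testFactoredDNF`). It therefore suffices that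
`N ≥ y ^ 300`, while `log N` stays far below `log² (s / ε)`, as the tail of a factored DNF requires
(`FinderScale`).
-/

namespace RelDNF

open scoped BigOperators

/-! ### The calculus of risks -/

/-- The real indicator of a proposition. -/
noncomputable def ind (P : Prop) : ℝ := by
  classical exact if P then 1 else 0

theorem ind_true {P : Prop} (h : P) : ind P = 1 := by simp [ind, h]
theorem ind_false {P : Prop} (h : ¬ P) : ind P = 0 := by simp [ind, h]
theorem ind_nonneg (P : Prop) : 0 ≤ ind P := by
  by_cases h : P <;> simp [ind, h]
theorem ind_le_one (P : Prop) : ind P ≤ 1 := by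
  by_cases h : P <;> simp [ind, h]
theorem ind_mono {P Q : Prop} (h : P → Q) : ind P ≤ ind Q := by
  by_cases hP : P
  · rw [ind_true hP, ind_true (h hP)]
  · rw [ind_false hP]; exact ind_nonneg _
theorem ind_or_le (P Q : Prop) : ind (P ∨ Q) ≤ ind P + ind Q := by
  by_cases hP : P <;> by_cases hQ : Q <;> simp [ind, hP, hQ]
theorem ind_congr {P Q : Prop} (h : P ↔ Q) : ind P = ind Q := by rw [propext h]
theorem ind_exists_le {ι : Type*} [Fintype ι] (P : ι → Prop) :
    ind (∃ i, P i) ≤ ∑ i, ind (P i) := by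
  by_cases h : ∃ i, P i
  · obtain ⟨i, hi⟩ := h
    rw [ind_true ⟨i, hi⟩, ← ind_true hi]
    exact Finset.single_le_sum (f := fun i => ind (P i)) (fun j _ => ind_nonneg _)
      (Finset.mem_univ i)
  · rw [ind_false h]; exact Finset.sum_nonneg fun i _ => ind_nonneg _

/-- A pair of oracles, namely a membership oracle that answers by a function and a sampling oracle
whose answers have the law `wt`, together with a set of points that should not be queried. -/
structure World (n : ℕ) where
  mq : Str n → Bool
  wt : Str n → ℝ
  bad : Set (Str n)
  wt_nonneg : ∀ x, 0 ≤ wt x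
  wt_sum : ∑ x, wt x = 1

/-- The world in which no point is bad. -/
def World.safe {n : ℕ} (w : World n) : World n := { w with bad := ∅ }

open Classical in
/-- The expectation, over a run of the program in the world `w`, of the random variable that is `1`
if a bad point is queried, and `φ` of the output otherwise. If there are no bad points, this is the
expectation of `φ`, and for `φ = 0` it is the probability that a bad point is queried. -/
noncomputable def risk {n : ℕ} {α : Type} (w : World n) : Prog n α → (α → ℝ) → ℝ
  | .ret a, φ => φ a
  | .mq x next, φ => if x ∈ w.bad then 1 else risk w (next (w.mq x)) φ
  | .samp next, φ => ∑ x, w.wt x * risk w (next x) φ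
  | .rand _ next, φ => 𝔼 i, risk w (next i) φ

section Calculus

variable {n : ℕ} {α β : Type} (w : World n)

theorem prog_bind_eq (p : Prog n α) (g : α → Prog n β) : p >>= g = Prog.bind p g := rfl

theorem risk_pure (a : α) (φ : α → ℝ) : risk w (pure a : Prog n α) φ = φ a := rfl

theorem risk_bind' (p : Prog n α) (g : α → Prog n β) (φ : β → ℝ) :
    risk w (Prog.bind p g) φ = risk w p fun a => risk w (g a) φ := by
  induction p with
  | ret a => rfl
  | mq x next ih => simp only [Prog.bind, risk, ih]
  | samp next ih => simp only [Prog.bind, risk, ih]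
  | rand k next ih => simp only [Prog.bind, risk, ih]

theorem risk_bind (p : Prog n α) (g : α → Prog n β) (φ : β → ℝ) :
    risk w (p >>= g) φ = risk w p fun a => risk w (g a) φ := risk_bind' w p g φ

theorem risk_mono (p : Prog n α) {φ ψ : α → ℝ} (h : ∀ a, φ a ≤ ψ a) :
    risk w p φ ≤ risk w p ψ := by
  induction p with
  | ret a => exact h a
  | mq x next ih =>
    simp only [risk]; split_ifs
    · exact le_rfl
    · exact ih _
  | samp next ih =>
    exact Finset.sum_le_sum fun x _ => mul_le_mul_of_nonneg_left (ih x) (w.wt_nonneg x)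
  | rand k next ih => exact Finset.expect_le_expect fun i _ => ih i

theorem risk_nonneg (p : Prog n α) {φ : α → ℝ} (h : ∀ a, 0 ≤ φ a) : 0 ≤ risk w p φ := by
  induction p with
  | ret a => exact h a
  | mq x next ih =>
    simp only [risk]; split_ifs
    · exact zero_le_one
    · exact ih _
  | samp next ih => exact Finset.sum_nonneg fun x _ => mul_nonneg (w.wt_nonneg x) (ih x)
  | rand k next ih => exact Finset.expect_nonneg fun i _ => ih i

theorem risk_add_const_le (p : Prog n α) (φ : α → ℝ) {c : ℝ} (hc : 0 ≤ c) :
    risk w p (fun a => φ a + c) ≤ risk w p φ + c := by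
  induction p with
  | ret a => exact le_rfl
  | mq x next ih =>
    simp only [risk]; split_ifs
    · linarith
    · exact ih _
  | samp next ih =>
    simp only [risk]
    calc ∑ x, w.wt x * risk w (next x) (fun a => φ a + c)
        ≤ ∑ x, (w.wt x * risk w (next x) φ + w.wt x * c) :=
          Finset.sum_le_sum fun x _ => by
            rw [← mul_add]; exact mul_le_mul_of_nonneg_left (ih x) (w.wt_nonneg x)
      _ = _ := by rw [Finset.sum_add_distrib, ← Finset.sum_mul, w.wt_sum, one_mul]
  | rand k next ih =>
    simp only [risk]
    calc 𝔼 i, risk w (next i) (fun a => φ a + c)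
        ≤ 𝔼 i, (risk w (next i) φ + c) := Finset.expect_le_expect fun i _ => ih i
      _ = _ := by rw [Finset.expect_add_distrib, Fintype.expect_const]

theorem risk_const_le (p : Prog n α) {c : ℝ} (hc : 0 ≤ c) :
    risk w p (fun _ => c) ≤ risk w p (fun _ => 0) + c := by
  simpa using risk_add_const_le w p (fun _ => 0) hc

theorem risk_le_one (p : Prog n α) {φ : α → ℝ} (h : ∀ a, φ a ≤ 1) : risk w p φ ≤ 1 := by
  induction p with
  | ret a => exact h a
  | mq x next ih =>
    simp only [risk]; split_ifs
    · exact le_rfl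
    · exact ih _
  | samp next ih =>
    calc _ ≤ ∑ x, w.wt x * 1 :=
          Finset.sum_le_sum fun x _ => mul_le_mul_of_nonneg_left (ih x) (w.wt_nonneg x)
      _ = 1 := by simp [w.wt_sum]
  | rand k next ih =>
    calc _ ≤ 𝔼 _i : Fin (k + 1), (1 : ℝ) := Finset.expect_le_expect fun i _ => ih i
      _ = 1 := Fintype.expect_const _

theorem risk_add_le (p : Prog n α) (φ ψ : α → ℝ) :
    risk w p (fun a => φ a + ψ a) ≤ risk w p φ + risk w p ψ := by
  induction p with
  | ret a => exact le_rfl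
  | mq x next ih =>
    simp only [risk]; split_ifs
    · norm_num
    · exact ih _
  | samp next ih =>
    simp only [risk]
    rw [← Finset.sum_add_distrib]
    refine Finset.sum_le_sum fun x _ => ?_
    rw [← mul_add]; exact mul_le_mul_of_nonneg_left (ih x) (w.wt_nonneg x)
  | rand k next ih =>
    simp only [risk]
    rw [← Finset.expect_add_distrib]
    exact Finset.expect_le_expect fun i _ => ih i

/-- The event that a bad point is queried may be split off. -/
theorem risk_le_add_safe (p : Prog n α) {φ : α → ℝ} (hφ : ∀ a, 0 ≤ φ a) :
    risk w p φ ≤ risk w p (fun _ => 0) + risk w.safe p φ := by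
  induction p with
  | ret a => simp [risk]
  | mq x next ih =>
    simp only [risk]
    split_ifs with h1 h2
    · norm_num
    · have := risk_nonneg w.safe (next (w.safe.mq x)) hφ
      linarith
    · rename_i h2; exact absurd h2 (by simp [World.safe])
    · exact ih _
  | samp next ih =>
    simp only [risk, World.safe]
    rw [← Finset.sum_add_distrib]
    refine Finset.sum_le_sum fun x _ => ?_
    rw [← mul_add]; exact mul_le_mul_of_nonneg_left (ih x) (w.wt_nonneg x)
  | rand k next ih =>
    simp only [risk]
    rw [← Finset.expect_add_distrib]
    exact Finset.expect_le_expect fun i _ => ih i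

theorem risk_safe_le (p : Prog n α) {φ : α → ℝ} (hφ : ∀ a, φ a ≤ 1) :
    risk w.safe p φ ≤ risk w p φ := by
  induction p with
  | ret a => exact le_rfl
  | mq x next ih =>
    simp only [risk]
    rw [if_neg (by simp [World.safe])]
    split_ifs
    · exact risk_le_one _ _ hφ
    · exact ih _
  | samp next ih =>
    exact Finset.sum_le_sum fun x _ => mul_le_mul_of_nonneg_left (ih x) (w.wt_nonneg x)
  | rand k next ih => exact Finset.expect_le_expect fun i _ => ih i

theorem risk_const_of_safe (hw : w.bad = ∅) (p : Prog n α) (c : ℝ) :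
    risk w p (fun _ => c) = c := by
  induction p with
  | ret a => rfl
  | mq x next ih => simp [risk, hw, ih]
  | samp next ih => simp [risk, ih, ← Finset.sum_mul, w.wt_sum]
  | rand k next ih => simp [risk, ih]

theorem risk_mul_of_safe (hw : w.bad = ∅) (p : Prog n α) (c : ℝ) (φ : α → ℝ) :
    risk w p (fun a => c * φ a) = c * risk w p φ := by
  induction p with
  | ret a => rfl
  | mq x next ih => simp [risk, hw, ih]
  | samp next ih => simp [risk, ih, Finset.mul_sum, mul_left_comm]
  | rand k next ih => simp [risk, ih, Finset.mul_expect]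

theorem risk_add_of_safe (hw : w.bad = ∅) (p : Prog n α) (φ ψ : α → ℝ) :
    risk w p (fun a => φ a + ψ a) = risk w p φ + risk w p ψ := by
  induction p with
  | ret a => rfl
  | mq x next ih => simp [risk, hw, ih]
  | samp next ih => simp [risk, ih, mul_add, Finset.sum_add_distrib]
  | rand k next ih => simp [risk, ih, Finset.expect_add_distrib]

theorem risk_sum_of_safe (hw : w.bad = ∅) {ι : Type} (s : Finset ι) (p : Prog n α)
    (φ : ι → α → ℝ) :
    risk w p (fun a => ∑ i ∈ s, φ i a) = ∑ i ∈ s, risk w p (φ i) := by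
  classical
  induction s using Finset.induction_on with
  | empty => simpa using risk_const_of_safe w hw p 0
  | insert i s hi ih => simp only [Finset.sum_insert hi, risk_add_of_safe w hw, ih]

/-- The sequencing rule: `Q` is the property of the intermediate result that the second program
relies on. -/
theorem risk_bind_le {p : Prog n α} {g : α → Prog n β} {φ : β → ℝ} (Q : α → Prop) {δ₁ δ₂ : ℝ}
    (hφ : ∀ b, φ b ≤ 1) (hδ : 0 ≤ δ₂) (h₁ : risk w p (fun a => ind (¬ Q a)) ≤ δ₁)
    (h₂ : ∀ a, Q a → risk w (g a) φ ≤ δ₂) : risk w (p >>= g) φ ≤ δ₁ + δ₂ := by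
  rw [risk_bind]
  refine le_trans (risk_mono w p (ψ := fun a => ind (¬ Q a) + δ₂) fun a => ?_)
    (le_trans (risk_add_const_le w p _ hδ) (by linarith))
  by_cases hQ : Q a
  · rw [ind_false (not_not.2 hQ)]; linarith [h₂ a hQ]
  · rw [ind_true hQ]; linarith [risk_le_one w (g a) hφ]

theorem risk_bind_le_of_forall {p : Prog n α} {g : α → Prog n β} {φ : β → ℝ} {δ₁ δ₂ : ℝ}
    (hδ : 0 ≤ δ₂) (h₁ : risk w p (fun _ => 0) ≤ δ₁)
    (h₂ : ∀ a, risk w (g a) φ ≤ δ₂) : risk w (p >>= g) φ ≤ δ₁ + δ₂ := by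
  rw [risk_bind]
  exact (risk_mono w p h₂).trans ((risk_const_le w p hδ).trans (by linarith))

/-- The union bound over the entries of a table. -/
theorem risk_tabulate_union {m : ℕ} (p : Fin m → Prog n β) (Q : Fin m → β → Prop) :
    risk w (Prog.tabulate p) (fun b => ind (¬ ∀ i, Q i (b i)))
      ≤ ∑ i, risk w (p i) fun b => ind (¬ Q i b) := by
  induction m with
  | zero =>
    simp only [Prog.tabulate, risk_pure, Finset.univ_eq_empty, Finset.sum_empty]
    rw [ind_false]; simp
  | succ m ih =>
    simp only [Prog.tabulate, risk_bind, risk_pure]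
    rw [Fin.sum_univ_succ]
    have h0 : 0 ≤ ∑ i : Fin m, risk w (p i.succ) fun b => ind (¬ Q i.succ b) :=
      Finset.sum_nonneg fun i _ => risk_nonneg w _ fun _ => ind_nonneg _
    refine le_trans (risk_mono w (p 0) (ψ := fun b => ind (¬ Q 0 b) +
      ∑ i : Fin m, risk w (p i.succ) fun b => ind (¬ Q i.succ b)) fun b => ?_)
      (risk_add_const_le w _ _ h0)
    refine le_trans (risk_mono w _ (ψ := fun bs =>
      ind (¬ ∀ i : Fin m, Q i.succ (bs i)) + ind (¬ Q 0 b)) fun bs => ?_) ?_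
    · refine le_trans (ind_mono ?_) (ind_or_le _ _)
      intro h
      by_contra! h'
      exact h (Fin.forall_fin_succ.2 ⟨by simpa using h'.2, by simpa using h'.1⟩)
    · refine (risk_add_const_le w _ _ (ind_nonneg _)).trans ?_
      linarith [ih (fun i => p i.succ) (fun i => Q i.succ)]

theorem risk_tabulate_zero {m : ℕ} (p : Fin m → Prog n β) :
    risk w (Prog.tabulate p) (fun _ => 0) ≤ ∑ i, risk w (p i) fun _ => 0 := by
  have := risk_tabulate_union w p (fun _ _ => True)
  have h : ind False = 0 := ind_false id
  simpa [h] using this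

/-- If the entries of the table are `b` up to small risks, then so is the table. -/
theorem risk_tabulate_le {m : ℕ} (p : Fin m → Prog n β) (b : Fin m → β) (φ : (Fin m → β) → ℝ)
    (h0 : 0 ≤ φ b) (h1 : ∀ b, φ b ≤ 1) :
    risk w (Prog.tabulate p) φ ≤ φ b + ∑ i, risk w (p i) fun a => ind (a ≠ b i) := by
  refine le_trans (risk_mono w _ (ψ := fun a => ind (¬ ∀ i, a i = b i) + φ b) fun a => ?_)
    ((risk_add_const_le w _ _ h0).trans ?_)
  · by_cases h : a = b
    · subst h; linarith [ind_nonneg (¬ ∀ i, a i = a i)]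
    · rw [ind_true fun h' => h (funext h')]; linarith [h1 a]
  · linarith [risk_tabulate_union w p fun i a => a = b i]

/-- The entries of a table are independent. -/
theorem risk_tabulate_prod (hw : w.bad = ∅) {m : ℕ} (p : Fin m → Prog n β)
    (φ : Fin m → β → ℝ) :
    risk w (Prog.tabulate p) (fun b => ∏ i, φ i (b i)) = ∏ i, risk w (p i) (φ i) := by
  induction m with
  | zero => simp [Prog.tabulate, risk_pure]
  | succ m ih =>
    simp only [Prog.tabulate, risk_bind, risk_pure, Fin.prod_univ_succ, Fin.cons_zero,
      Fin.cons_succ]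
    simp only [risk_mul_of_safe w hw, ih (fun i => p i.succ) (fun i => φ i.succ)]
    simp only [mul_comm _ (∏ i : Fin m, _), risk_mul_of_safe w hw]

theorem risk_repeatAll_zero (m : ℕ) (p : Prog n Bool) :
    risk w (Prog.repeatAll m p) (fun _ => 0) ≤ m * risk w p fun _ => 0 := by
  have hp : 0 ≤ risk w p fun _ => 0 := risk_nonneg w p fun _ => le_rfl
  induction m with
  | zero => simp [Prog.repeatAll, risk_pure]
  | succ m ih =>
    simp only [Prog.repeatAll]
    have := risk_bind_le_of_forall w (p := p)
      (g := fun b => if b = true then Prog.repeatAll m p else pure false) (φ := fun _ => 0)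
      (mul_nonneg (Nat.cast_nonneg m) hp) le_rfl (fun b => by
        split_ifs
        · exact ih
        · simp only [risk_pure]; positivity)
    refine this.trans ?_
    push_cast; linarith

theorem risk_unifOn {s : Finset α} (hs : s.Nonempty) (φ : α → ℝ) :
    risk w (Prog.unifOn s hs) φ = 𝔼 a ∈ s, φ a := by
  simp only [Prog.unifOn, risk]
  have h1 : s.card - 1 + 1 = s.card := Nat.sub_add_cancel hs.card_pos
  rw [Finset.expect_eq_sum_div_card, Finset.expect_eq_sum_div_card, Finset.card_univ,
    Fintype.card_fin]
  congr 1
  swap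
  · rw [h1]
  rw [← Finset.sum_coe_sort s]
  exact Fintype.sum_equiv ((finCongr h1).trans s.equivFin.symm) _ _ fun i => rfl

theorem risk_unif [Fintype α] [Nonempty α] (φ : α → ℝ) :
    risk w (Prog.unif α) φ = 𝔼 a, φ a := risk_unifOn w _ φ

open Classical in
theorem risk_ask (x : Str n) (φ : Bool → ℝ) :
    risk w (Prog.ask x) φ = if x ∈ w.bad then 1 else φ (w.mq x) := rfl

theorem risk_ask_le (x : Str n) {φ : Bool → ℝ} (hφ : ∀ b, 0 ≤ φ b) :
    risk w (Prog.ask x) φ ≤ ind (x ∈ w.bad) + φ (w.mq x) := by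
  rw [risk_ask]; split_ifs with h
  · rw [ind_true h]; linarith [hφ (w.mq x)]
  · rw [ind_false h]; simp

theorem risk_ask_zero (x : Str n) : risk w (Prog.ask x) (fun _ => 0) = ind (x ∈ w.bad) := by
  rw [risk_ask]; rfl

/-! #### The world of a function -/

/-- The oracles `MQ(f)` and `SAMP(f)`. -/
noncomputable def World.ofFun {n : ℕ} (f : Str n → Bool) (hf : (sat f).Nonempty)
    (B : Set (Str n)) : World n where
  mq := f
  wt x := ind (x ∈ sat f) / (sat f).card
  bad := B
  wt_nonneg x := div_nonneg (ind_nonneg _) (Nat.cast_nonneg _)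
  wt_sum := by
    have h : ((sat f).card : ℝ) ≠ 0 := Nat.cast_ne_zero.2 hf.card_pos.ne'
    rw [← Finset.sum_div, div_eq_one_iff_eq h]
    rw [← Finset.sum_subset (Finset.subset_univ (sat f)) (fun x _ hx => ind_false hx),
      Finset.sum_congr rfl (fun x hx => ind_true hx)]
    simp

theorem sum_wt_ofFun (f : Str n → Bool) (hf : (sat f).Nonempty) (B : Set (Str n))
    (φ : Str n → ℝ) : ∑ x, (World.ofFun f hf B).wt x * φ x = 𝔼 x ∈ sat f, φ x := by
  rw [Finset.expect_eq_sum_div_card]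
  simp only [World.ofFun, ind, div_mul_eq_mul_div, ← Finset.sum_div, ite_mul, one_mul, zero_mul,
    Finset.sum_ite_mem, Finset.univ_inter]

theorem risk_sample_ofFun (f : Str n → Bool) (hf : (sat f).Nonempty) (B : Set (Str n))
    (φ : Str n → ℝ) : risk (World.ofFun f hf B) Prog.sample φ = 𝔼 x ∈ sat f, φ x :=
  sum_wt_ofFun f hf B φ

theorem safe_ofFun (f : Str n → Bool) (hf : (sat f).Nonempty) (B : Set (Str n)) :
    (World.ofFun f hf B).safe = World.ofFun f hf ∅ := rfl

theorem mem_sat {f : Str n → Bool} {x : Str n} : x ∈ sat f ↔ f x = true := by simp [sat]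

/-- The probability of an event is its risk in the world of the function without bad points. -/
theorem eval_toOuterMeasure (f : Str n → Bool) (hf : (sat f).Nonempty) (p : Prog n α)
    (A : Set α) :
    (Prog.run f hf p).toOuterMeasure A =
      ENNReal.ofReal (risk (World.ofFun f hf ∅) p fun a => ind (a ∈ A)) := by
  unfold Prog.run
  induction p with
  | ret a =>
    classical
    simp only [Prog.eval, risk, PMF.toOuterMeasure_pure_apply, ind]
    split_ifs <;> simp
  | mq x next ih =>
    simp only [Prog.eval, PMF.pure_bind, risk]
    rw [ih]; simp [World.ofFun]
  | samp next ih =>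
    simp only [Prog.eval, risk, PMF.toOuterMeasure_bind_apply]
    rw [tsum_fintype, ENNReal.ofReal_sum_of_nonneg]
    · refine Finset.sum_congr rfl fun x _ => ?_
      rw [ih, ENNReal.ofReal_mul ((World.ofFun f hf ∅).wt_nonneg x)]
      congr 1
      classical
      simp only [PMF.uniformOfFinset_apply, World.ofFun, ind]
      split_ifs
      · rw [one_div, ENNReal.ofReal_inv_of_pos (Nat.cast_pos.2 hf.card_pos)]; simp
      · simp
    · exact fun x _ => mul_nonneg ((World.ofFun f hf ∅).wt_nonneg x)
        (risk_nonneg _ _ fun _ => ind_nonneg _)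
  | rand k next ih =>
    simp only [Prog.eval, risk, PMF.toOuterMeasure_bind_apply]
    rw [tsum_fintype, Finset.expect_eq_sum_div_card, div_eq_inv_mul, Finset.mul_sum,
      ENNReal.ofReal_sum_of_nonneg]
    · refine Finset.sum_congr rfl fun i _ => ?_
      rw [ih, ENNReal.ofReal_mul (by positivity)]
      congr 1
      rw [PMF.uniformOfFintype_apply, Finset.card_univ,
        ENNReal.ofReal_inv_of_pos (Nat.cast_pos.2 Fintype.card_pos), ENNReal.ofReal_natCast]
    · exact fun x _ => mul_nonneg (by positivity) (risk_nonneg _ _ fun _ => ind_nonneg _)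

/-- A run fails to produce an outcome in `A` with probability at most `1 / 10`. -/
theorem le_run_toOuterMeasure (f : Str n → Bool) (hf : (sat f).Nonempty) (p : Prog n α)
    (A : Set α) (h : risk (World.ofFun f hf ∅) p (fun a => ind (a ∉ A)) ≤ 1 / 10) :
    9 / 10 ≤ (Prog.run f hf p).toOuterMeasure A := by
  rw [eval_toOuterMeasure]
  have h2 : risk (World.ofFun f hf ∅) p (fun a => ind (a ∉ A) + ind (a ∈ A)) = 1 := by
    rw [← risk_const_of_safe (World.ofFun f hf ∅) rfl p 1]
    congr 1; funext a
    by_cases ha : a ∈ A <;> simp [ind, ha]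
  rw [risk_add_of_safe _ rfl] at h2
  have : ENNReal.ofReal (9 / 10) = 9 / 10 := by
    rw [ENNReal.ofReal_div_of_pos (by norm_num)]; norm_num
  rw [← this]
  exact ENNReal.ofReal_le_ofReal (by linarith)

theorem run_true_toReal (f : Str n → Bool) (hf : (sat f).Nonempty) (p : Prog n Bool) :
    (Prog.run f hf p true).toReal = risk (World.ofFun f hf ∅) p fun a => ind (a = true) := by
  have h := eval_toOuterMeasure f hf p {true}
  rw [PMF.toOuterMeasure_apply_singleton] at h
  rw [h, ENNReal.toReal_ofReal (risk_nonneg _ _ fun _ => ind_nonneg _)]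
  rfl

/-! #### Comparing two worlds -/

/-- A program that makes at most `q` queries behaves in almost the same way in two worlds, if it is
unlikely to query a point at which the membership oracles differ, and the laws of the samples have
statistical distance at most `τ`. -/
theorem abs_risk_sub_risk_le (w w' : World n) (hw' : w'.bad = ∅)
    (hmq : ∀ x, x ∉ w.bad → w.mq x = w'.mq x) {τ : ℝ} (h_tau : 0 ≤ τ)
    (hwt : ∀ ψ : Str n → ℝ, (∀ x, 0 ≤ ψ x) → (∀ x, ψ x ≤ 1) →
      |∑ x, w.wt x * ψ x - ∑ x, w'.wt x * ψ x| ≤ τ)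
    (p : Prog n α) (q : ℕ) (hq : Prog.QueriesAtMost q p) (φ : α → ℝ) (h0 : ∀ a, 0 ≤ φ a)
    (h1 : ∀ a, φ a ≤ 1) :
    |risk w.safe p φ - risk w' p φ| ≤ risk w p (fun _ => 0) + q * τ := by
  induction p generalizing q with
  | ret a => simp only [risk, sub_self, abs_zero]; positivity
  | mq x next ih =>
    simp only [Prog.QueriesAtMost] at hq
    have hx : x ∉ w.safe.bad := by simp [World.safe]
    have hx' : x ∉ w'.bad := by simp [hw']
    simp only [risk, if_neg hx, if_neg hx']
    have hqq : ((q - 1 : ℕ) : ℝ) * τ ≤ q * τ :=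
      mul_le_mul_of_nonneg_right (by exact_mod_cast Nat.sub_le _ _) h_tau
    split_ifs with h
    · have a1 := risk_nonneg w.safe (next (w.safe.mq x)) h0
      have a2 := risk_le_one w.safe (next (w.safe.mq x)) h1
      have a3 := risk_nonneg w' (next (w'.mq x)) h0
      have a4 := risk_le_one w' (next (w'.mq x)) h1
      have : 0 ≤ q * τ := by positivity
      rw [abs_le]; constructor <;> linarith
    · rw [← hmq x h]
      exact (ih (w.mq x) _ (hq.2 _)).trans (by linarith)
  | samp next ih =>
    simp only [Prog.QueriesAtMost] at hq
    simp only [risk]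
    have hq1 : ((q - 1 : ℕ) : ℝ) = q - 1 := by rw [Nat.cast_sub hq.1]; simp
    have e : ∑ x, w.safe.wt x * risk w.safe (next x) φ - ∑ x, w'.wt x * risk w' (next x) φ =
        ∑ x, w.wt x * (risk w.safe (next x) φ - risk w' (next x) φ) +
        (∑ x, w.wt x * risk w' (next x) φ - ∑ x, w'.wt x * risk w' (next x) φ) := by
      rw [← add_sub_assoc, ← Finset.sum_add_distrib]
      congr 1
      exact Finset.sum_congr rfl fun x _ => by simp only [World.safe]; ring
    rw [e]
    refine (abs_add_le _ _).trans ?_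
    have b2 := hwt (fun x => risk w' (next x) φ) (fun x => risk_nonneg _ _ h0)
      (fun x => risk_le_one _ _ h1)
    have b1 : |∑ x, w.wt x * (risk w.safe (next x) φ - risk w' (next x) φ)| ≤
        ∑ x, w.wt x * risk w (next x) (fun _ => 0) + (q - 1) * τ := by
      refine (Finset.abs_sum_le_sum_abs _ _).trans ?_
      calc _ ≤ ∑ x, (w.wt x * risk w (next x) (fun _ => 0) + w.wt x * ((q - 1) * τ)) := by
            refine Finset.sum_le_sum fun x _ => ?_
            rw [abs_mul, abs_of_nonneg (w.wt_nonneg x), ← mul_add]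
            refine mul_le_mul_of_nonneg_left ?_ (w.wt_nonneg x)
            have := ih x _ (hq.2 x)
            rwa [hq1] at this
        _ = _ := by rw [Finset.sum_add_distrib, ← Finset.sum_mul, w.wt_sum, one_mul]
    linarith
  | rand k next ih =>
    simp only [Prog.QueriesAtMost] at hq
    simp only [risk]
    rw [← Finset.expect_sub_distrib]
    refine (Finset.abs_expect_le _ _).trans ?_
    calc _ ≤ 𝔼 i, (risk w (next i) (fun _ => 0) + q * τ) :=
          Finset.expect_le_expect fun i _ => ih i q (hq i)
      _ = _ := by rw [Finset.expect_add_distrib, Fintype.expect_const]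

/-- Simulated oracles behave like the world whose membership oracle and sample law they realize. -/
theorem risk_subst_of_safe (w w' : World n) (hw' : w'.bad = ∅)
    (M : Str n → Prog n Bool) (S : Prog n (Str n))
    (hM : ∀ x ψ, risk w (M x) ψ = ψ (w'.mq x))
    (hS : ∀ ψ, risk w S ψ = ∑ x, w'.wt x * ψ x) (p : Prog n α) (φ : α → ℝ) :
    risk w (Prog.subst M S p) φ = risk w' p φ := by
  induction p with
  | ret a => rfl
  | mq x next ih => simp [Prog.subst, risk_bind', hM, risk, hw', ih]
  | samp next ih => simp [Prog.subst, risk_bind', hS, risk, ih]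
  | rand k next ih => simp [Prog.subst, risk, ih]

/-- The world seen through the membership oracle `x ↦ MQ(e x)`. -/
def World.pull (w : World n) (e : Str n → Str n) : World n :=
  { w with mq := fun x => w.mq (e x), bad := {x | e x ∈ w.bad} }

theorem risk_subst_ask (e : Str n → Str n) (p : Prog n α) (φ : α → ℝ) :
    risk w (Prog.subst (fun x => Prog.ask (e x)) Prog.sample p) φ = risk (w.pull e) p φ := by
  induction p with
  | ret a => rfl
  | mq x next ih =>
    simp only [Prog.subst, risk_bind', risk_ask, ih]; rfl
  | samp next ih => simp only [Prog.subst, risk_bind', ih]; rfl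
  | rand k next ih => simp only [Prog.subst, risk, ih]

theorem subst_bind (M : Str n → Prog n Bool) (S : Prog n (Str n)) (p : Prog n α)
    (g : α → Prog n β) :
    Prog.subst M S (p >>= g) = Prog.subst M S p >>= fun a => Prog.subst M S (g a) := by
  have assoc : ∀ {α β γ : Type} (p : Prog n α) (g : α → Prog n β) (k : β → Prog n γ),
      Prog.bind (Prog.bind p g) k = Prog.bind p fun a => Prog.bind (g a) k := by
    intro α β γ p g k
    induction p with
    | ret a => rfl
    | mq x next ih => simp only [Prog.bind, ih]
    | samp next ih => simp only [Prog.bind, ih]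
    | rand k next ih => simp only [Prog.bind, ih]
  simp only [prog_bind_eq]
  induction p with
  | ret a => rfl
  | mq x next ih => simp only [Prog.bind, Prog.subst, ih, assoc]
  | samp next ih => simp only [Prog.bind, Prog.subst, ih, assoc]
  | rand k next ih => simp only [Prog.bind, Prog.subst, ih]

theorem subst_pure (M : Str n → Prog n Bool) (S : Prog n (Str n)) (a : α) :
    Prog.subst M S (pure a) = pure a := rfl

theorem subst_repeatAll (M : Str n → Prog n Bool) (S : Prog n (Str n)) (m : ℕ)
    (p : Prog n Bool) :
    Prog.subst M S (Prog.repeatAll m p) = Prog.repeatAll m (Prog.subst M S p) := by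
  induction m with
  | zero => rfl
  | succ m ih =>
    simp only [Prog.repeatAll, subst_bind]
    congr 1; funext b
    split_ifs
    · exact ih
    · rfl

theorem bind_ret' (p : Prog n α) : Prog.bind p Prog.ret = p := by
  induction p with
  | ret a => rfl
  | mq x next ih => simp only [Prog.bind, ih]
  | samp next ih => simp only [Prog.bind, ih]
  | rand k next ih => simp only [Prog.bind, ih]

theorem subst_ask (M : Str n → Prog n Bool) (S : Prog n (Str n)) (x : Str n) :
    Prog.subst M S (Prog.ask x) = M x := bind_ret' (M x)

theorem subst_unif (M : Str n → Prog n Bool) (S : Prog n (Str n)) [Fintype α] [Nonempty α] :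
    Prog.subst M S (Prog.unif α) = Prog.unif α := rfl

theorem subst_sample (M : Str n → Prog n Bool) (S : Prog n (Str n)) :
    Prog.subst M S Prog.sample = S := bind_ret' S

end Calculus

/-! ### Query complexity -/

/-- Whatever the oracle answers and the random draws are, the program makes at most `q` oracle calls
and its output satisfies `Q`. -/
def Meets {n : ℕ} {α : Type} : ℕ → (α → Prop) → Prog n α → Prop
  | _, Q, .ret a => Q a
  | q, Q, .mq _ next => 1 ≤ q ∧ ∀ b, Meets (q - 1) Q (next b)
  | q, Q, .samp next => 1 ≤ q ∧ ∀ x, Meets (q - 1) Q (next x)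
  | q, Q, .rand _ next => ∀ i, Meets q Q (next i)

section Meets

variable {n : ℕ} {α β : Type}

theorem Meets.queriesAtMost {q : ℕ} {Q : α → Prop} {p : Prog n α} (h : Meets q Q p) :
    Prog.QueriesAtMost q p := by
  induction p generalizing q with
  | ret a => trivial
  | mq x next ih => exact ⟨h.1, fun b => ih b (h.2 b)⟩
  | samp next ih => exact ⟨h.1, fun b => ih b (h.2 b)⟩
  | rand k next ih => exact fun i => ih i (h i)

theorem Meets.mono {q q' : ℕ} {Q Q' : α → Prop} {p : Prog n α} (h : Meets q Q p) (hq : q ≤ q')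
    (hQ : ∀ a, Q a → Q' a) : Meets q' Q' p := by
  induction p generalizing q q' with
  | ret a => exact hQ a h
  | mq x next ih => exact ⟨h.1.trans hq, fun b => ih b (h.2 b) (by omega)⟩
  | samp next ih => exact ⟨h.1.trans hq, fun b => ih b (h.2 b) (by omega)⟩
  | rand k next ih => exact fun i => ih i (h i) hq

theorem Meets.bind {q₁ q₂ : ℕ} {Q : α → Prop} {Q' : β → Prop} {p : Prog n α} {g : α → Prog n β}
    (h₁ : Meets q₁ Q p) (h₂ : ∀ a, Q a → Meets q₂ Q' (g a)) : Meets (q₁ + q₂) Q' (p >>= g) := by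
  rw [prog_bind_eq]
  induction p generalizing q₁ with
  | ret a => exact (h₂ a h₁).mono (by omega) fun _ h => h
  | mq x next ih =>
    exact ⟨by have := h₁.1; omega, fun b => (ih b (h₁.2 b)).mono
      (by have := h₁.1; omega) fun _ h => h⟩
  | samp next ih =>
    exact ⟨by have := h₁.1; omega, fun b => (ih b (h₁.2 b)).mono
      (by have := h₁.1; omega) fun _ h => h⟩
  | rand k next ih => exact fun i => ih i (h₁ i)

theorem Meets.bind_le {q q₁ q₂ : ℕ} {Q : α → Prop} {Q' : β → Prop} {p : Prog n α}
    {g : α → Prog n β} (h₁ : Meets q₁ Q p) (h₂ : ∀ a, Q a → Meets q₂ Q' (g a))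
    (hq : q₁ + q₂ ≤ q) : Meets q Q' (p >>= g) := (h₁.bind h₂).mono hq fun _ h => h

theorem meets_pure {q : ℕ} {Q : α → Prop} {a : α} (h : Q a) : Meets q Q (pure a : Prog n α) := h

theorem meets_ask (x : Str n) : Meets 1 (fun _ => True) (Prog.ask x) :=
  ⟨le_rfl, fun _ => trivial⟩

theorem meets_sample : Meets 1 (fun _ => True) (Prog.sample (n := n)) :=
  ⟨le_rfl, fun _ => trivial⟩

theorem meets_unifOn {s : Finset α} (hs : s.Nonempty) :
    Meets 0 (fun _ => True) (Prog.unifOn (n := n) s hs) := fun _ => trivial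

theorem meets_unif [Fintype α] [Nonempty α] :
    Meets 0 (fun _ => True) (Prog.unif (n := n) α) := meets_unifOn _

theorem meets_tabulate {m q : ℕ} {Q : Fin m → β → Prop} {p : Fin m → Prog n β}
    (h : ∀ i, Meets q (Q i) (p i)) :
    Meets (m * q) (fun b => ∀ i, Q i (b i)) (Prog.tabulate p) := by
  induction m with
  | zero => exact fun i => i.elim0
  | succ m ih =>
    simp only [Prog.tabulate]
    refine (h 0).bind_le (q₂ := m * q) (fun b hb => ?_) (by rw [Nat.succ_mul]; omega)
    refine (ih fun i => h i.succ).bind_le (q₂ := 0) (fun bs hbs => ?_) le_rfl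
    refine meets_pure ?_
    rw [Fin.forall_fin_succ]
    exact ⟨by simpa using hb, by simpa using hbs⟩

theorem meets_repeatAll {q : ℕ} (m : ℕ) {p : Prog n Bool} (h : Meets q (fun _ => True) p) :
    Meets (m * q) (fun _ => True) (Prog.repeatAll m p) := by
  induction m with
  | zero => trivial
  | succ m ih =>
    simp only [Prog.repeatAll]
    refine h.bind_le (q₂ := m * q) (fun b hb => ?_) (by rw [Nat.succ_mul]; omega)
    split_ifs
    · exact ih
    · trivial

theorem Meets.subst {q a : ℕ} {Q : α → Prop} {p : Prog n α} {M : Str n → Prog n Bool}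
    {S : Prog n (Str n)} (h : Meets q Q p) (hM : ∀ x, Meets a (fun _ => True) (M x))
    (hS : Meets a (fun _ => True) S) : Meets (q * a) Q (Prog.subst M S p) := by
  induction p generalizing q with
  | ret b => exact h
  | mq x next ih =>
    obtain ⟨k, rfl⟩ : ∃ k, q = k + 1 := ⟨q - 1, by have := h.1; omega⟩
    exact (hM x).bind_le (q₂ := k * a) (fun b _ => ih b (h.2 b)) (by rw [Nat.succ_mul]; omega)
  | samp next ih =>
    obtain ⟨k, rfl⟩ : ∃ k, q = k + 1 := ⟨q - 1, by have := h.1; omega⟩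
    exact hS.bind_le (q₂ := k * a) (fun b _ => ih b (h.2 b)) (by rw [Nat.succ_mul]; omega)
  | rand k next ih => exact fun i => ih i (h i)

theorem Meets.of_mem_support {q : ℕ} {Q : α → Prop} {p : Prog n α} (h : Meets q Q p)
    (f : Str n → Bool) (hf : (sat f).Nonempty) {a : α} (ha : a ∈ (Prog.run f hf p).support) :
    Q a := by
  unfold Prog.run at ha
  induction p generalizing q with
  | ret b =>
    simp only [Prog.eval, PMF.mem_support_pure_iff] at ha
    subst ha; exact h
  | mq x next ih =>
    simp only [Prog.eval, PMF.mem_support_bind_iff] at ha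
    obtain ⟨b, -, hb⟩ := ha
    exact ih b (h.2 b) hb
  | samp next ih =>
    simp only [Prog.eval, PMF.mem_support_bind_iff] at ha
    obtain ⟨b, -, hb⟩ := ha
    exact ih b (h.2 b) hb
  | rand k next ih =>
    simp only [Prog.eval, PMF.mem_support_bind_iff] at ha
    obtain ⟨b, -, hb⟩ := ha
    exact ih b (h b) hb

end Meets

/-! ### Query complexity of Test-Factored-DNF -/

/-- `M` bounds all the numbers of repetitions, samples and blocks of Test-Factored-DNF. -/
structure ParamBound (c : TesterConsts) (r μ : ℕ) (ε : ℝ) (M : ℕ) : Prop where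
  hundred : 100 ≤ M
  mu : μ ≤ M
  start : ⌈(c.start : ℝ) * ((μ : ℝ) * Real.logb 2 (μ : ℝ)) / xi r μ ε⌉₊ ≤ M
  blocks : c.blocks * μ ^ 2 + 1 ≤ M
  draws : ⌊5 * Real.log (200 * (μ : ℝ)) / xi r μ ε⌋₊ + 1 ≤ M
  candidates : ⌈1 / (200 * xi r μ ε)⌉₊ ≤ M
  extract_half : ⌈(c.extract : ℝ) * Real.logb 2 ((μ : ℝ) / (1 / 2))⌉₊ ≤ M
  extract_kappa : ⌈(c.extract : ℝ) * Real.logb 2 ((μ : ℝ) / kappa ε)⌉₊ ≤ M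
  junta_reps : ⌈(c.juntaReps : ℝ) * Real.logb 2 (1 / (1 / 100))⌉₊ ≤ M
  junta_blocks : ⌈(c.juntaBlocks : ℝ) * ((1 : ℕ) : ℝ) ^ 9 / (1 / 30) ^ 5⌉₊ + 1 ≤ M
  junta_rounds : ⌈(c.juntaRounds : ℝ) * (((1 : ℕ) : ℝ) + 1) / (1 / 30)⌉₊ ≤ M
  verify : ⌈(c.verify : ℝ) / ε⌉₊ ≤ M
  verify' : ⌈(c.verify' : ℝ) / ε⌉₊ ≤ M
  gamma : ⌈(c.gamma : ℝ) * Real.logb 2 (1 / ε)⌉₊ ≤ M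
  conj : ⌈(c.conj : ℝ) / (ε / 10)⌉₊ ≤ M
  conj' : c.conj' ≤ M

section TesterQueries

variable {n : ℕ}

theorem otherBlocks_length_le {m : ℕ} (F : List (Fin (m + 1))) :
    (otherBlocks F).length ≤ m + 1 := by
  refine (List.length_filter_le _ _).trans ?_
  simp

theorem meets_binarySearch {m : ℕ} (X : Fin (m + 1) → Finset (Fin n)) (U : List (Fin (m + 1)))
    (va : Bool) (a b : Str n) :
    Meets U.length (fun _ => True) (binarySearch X U va a b) := by
  induction hk : U.length using Nat.strong_induction_on generalizing U a b with
  | _ k ih =>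
    subst hk
    rw [binarySearch]
    split_ifs with h
    · refine (meets_ask _).bind_le (q₂ := U.length - 1) (fun vc _ => ?_) (by omega)
      split_ifs
      · exact (ih _ (by rw [List.length_drop]; omega) _ _ _ rfl).mono
          (by rw [List.length_drop]; omega) fun _ h => h
      · exact (ih _ (by rw [List.length_take]; omega) _ _ _ rfl).mono
          (by rw [List.length_take]; omega) fun _ h => h
    · exact meets_pure trivial

theorem meets_approximateLoop {m : ℕ} (R : Finset (Fin n)) (X : Fin (m + 1) → Finset (Fin n))
    (T slots rem : ℕ) (L : List (Fin (m + 1) × Str n)) :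
    Meets ((slots * T + rem) * (m + 3)) (fun o => ∀ l, o = some l → l.length ≤ L.length + slots)
      (approximateLoop R X T slots rem L) := by
  induction slots generalizing rem L with
  | zero =>
    induction rem generalizing L with
    | zero =>
      rw [approximateLoop]
      exact meets_pure (by rintro l ⟨⟩; simp)
    | succ rem ih =>
      rw [approximateLoop]
      refine meets_sample.bind_le (q₂ := 1 + (m + 1 + (rem * (m + 3)))) (fun z _ => ?_)
        (by simp only [Nat.add_mul]; omega)
      refine meets_unif.bind_le (q₂ := 1 + (m + 1 + (rem * (m + 3)))) (fun w _ => ?_) (by omega)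
      refine (meets_ask _).bind_le (q₂ := m + 1 + (rem * (m + 3))) (fun b _ => ?_) le_rfl
      split_ifs
      · exact (ih L).mono (by simp only [Nat.zero_mul, Nat.zero_add]; omega) fun _ h => h
      · refine ((meets_binarySearch _ _ _ _ _).mono (otherBlocks_length_le _)
          fun _ h => h).bind_le (q₂ := 0) (fun fd _ => ?_) (by omega)
        exact meets_pure (by rintro l ⟨⟩)
  | succ slots ihs =>
    induction rem generalizing L with
    | zero =>
      rw [approximateLoop]
      exact meets_pure (by rintro l ⟨⟩; simp)
    | succ rem ih =>
      rw [approximateLoop]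
      have e : ((slots + 1) * T + (rem + 1)) * (m + 3) =
        1 + (1 + (m + 1 + ((slots + 1) * T + rem) * (m + 3))) := by ring
      refine meets_sample.bind_le (q₂ := 1 + (m + 1 + ((slots + 1) * T + rem) * (m + 3)))
        (fun z _ => ?_) e.ge
      refine meets_unif.bind_le (q₂ := 1 + (m + 1 + ((slots + 1) * T + rem) * (m + 3)))
        (fun w _ => ?_) (by omega)
      refine (meets_ask _).bind_le (q₂ := m + 1 + ((slots + 1) * T + rem) * (m + 3))
        (fun b _ => ?_) le_rfl
      split_ifs
      · exact (ih L).mono (by omega) fun _ h => h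
      · refine ((meets_binarySearch _ _ _ _ _).mono (otherBlocks_length_le _)
          fun _ h => h).bind_le (q₂ := ((slots + 1) * T + rem) * (m + 3)) (fun fd _ => ?_) le_rfl
        refine (ihs T (L ++ [fd])).mono (Nat.mul_le_mul_right _ ?_) fun o h l hl => ?_
        · rw [Nat.succ_mul]; omega
        · have := h l hl; simp only [List.length_append, List.length_singleton] at this; omega

theorem meets_extract {c : TesterConsts} {μ M : ℕ} (L : List (LocalOracle n)) (w : Str n) (δ : ℝ)
    (hM : ⌈(c.extract : ℝ) * Real.logb 2 ((μ : ℝ) / δ)⌉₊ ≤ M) (hL : L.length ≤ M) :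
    Meets (M * (M * 2)) (fun _ => True) (extract c μ L w δ) := by
  refine (meets_tabulate (q := M * 2) (Q := fun _ _ => True) fun i => ?_).mono
    (Nat.mul_le_mul_right _ hL) fun _ _ => trivial
  refine (meets_tabulate (q := 2) (Q := fun _ _ => True) fun i => ?_).bind_le (q₂ := 0)
    (fun _ _ => meets_pure trivial) (by rw [Nat.add_zero]; exact Nat.mul_le_mul_right _ hM)
  refine meets_unif.bind_le (q₂ := 2) (fun a _ => ?_) le_rfl
  refine (meets_ask _).bind_le (q₂ := 1) (fun a _ => ?_) le_rfl
  exact (meets_ask _).bind_le (q₂ := 0) (fun a _ => meets_pure trivial) le_rfl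

theorem meets_approximate {c : TesterConsts} {r μ M : ℕ} {ε : ℝ} (h : ParamBound c r μ ε M)
    (R : Finset (Fin n)) :
    Meets (M ^ 4) (fun o => ∀ l, o = some l → l.length ≤ M) (approximate c r μ ε R) := by
  refine meets_unif.bind_le (q₂ := M ^ 4) (fun part _ => ?_) (by omega)
  refine (meets_approximateLoop R _ _ μ _ []).bind_le (q₂ := 0) (fun o ho => ?_) ?_
  · rcases o with _ | l
    · exact meets_pure (by rintro l ⟨⟩)
    · refine meets_pure ?_
      rintro l' ⟨⟩
      rw [List.length_map]
      have := ho l rfl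
      have := h.mu
      simp only [List.length_nil] at *; omega
  · have h1 := h.mu
    have h2 := h.draws
    have h3 := h.blocks
    have h4 := h.hundred
    set T := ⌊5 * Real.log (200 * (μ : ℝ)) / xi r μ ε⌋₊ + 1
    set m := c.blocks * μ ^ 2
    have e1 : 100 * M ^ 3 ≤ M * M ^ 3 := Nat.mul_le_mul_right _ h4
    have e2 : 100 * M ^ 2 ≤ M * M ^ 2 := Nat.mul_le_mul_right _ h4
    have e3 : 100 * M ≤ M * M := Nat.mul_le_mul_right _ h4
    calc (μ * T + T) * (m + 3) + 0 ≤ (M * M + M) * (M + 2) := by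
          rw [add_zero]
          exact Nat.mul_le_mul (Nat.add_le_add (Nat.mul_le_mul h1 h2) h2) (by omega)
      _ ≤ M ^ 4 := by ring_nf; ring_nf at e1 e2 e3; omega

theorem meets_juntaLoop {m : ℕ} (X : Fin (m + 1) → Finset (Fin n)) (k t : ℕ)
    (F : List (Fin (m + 1))) :
    Meets (t * (m + 3)) (fun _ => True) (juntaLoop X k t F) := by
  induction t generalizing F with
  | zero => trivial
  | succ t ih =>
    rw [juntaLoop]
    refine meets_unif.bind_le (q₂ := (t + 1) * (m + 3)) (fun x _ => ?_) (by omega)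
    refine meets_unif.bind_le (q₂ := (t + 1) * (m + 3)) (fun u _ => ?_) (by omega)
    refine (meets_ask _).bind_le (q₂ := 1 + (m + 1 + t * (m + 3))) (fun p _ => ?_)
      (by rw [Nat.succ_mul]; omega)
    refine (meets_ask _).bind_le (q₂ := m + 1 + t * (m + 3)) (fun p _ => ?_) le_rfl
    split
    · exact (ih F).mono (by omega) fun _ h => h
    · refine ((meets_binarySearch _ _ _ _ _).mono (otherBlocks_length_le _)
          fun _ h => h).bind_le (q₂ := t * (m + 3)) (fun fd _ => ?_) le_rfl
      split_ifs
      · exact meets_pure trivial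
      · exact ih _

theorem meets_uniformJunta {c : TesterConsts} {r μ M : ℕ} {ε : ℝ} (h : ParamBound c r μ ε M) :
    Meets (M * (M * (M + 2))) (fun _ => True)
      (uniformJunta (n := n) c 1 (1 / 30) (1 / 100)) := by
  refine (meets_repeatAll (q := M * (M + 2)) _ ?_).mono (Nat.mul_le_mul_right _ h.junta_reps)
    fun _ h => h
  refine meets_unif.bind_le (q₂ := M * (M + 2)) (fun part _ => ?_) (by omega)
  refine (meets_juntaLoop _ _ _ _).mono ?_ fun _ h => h
  have := h.junta_blocks
  exact Nat.mul_le_mul h.junta_rounds (by omega)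

theorem meets_checkLit {c : TesterConsts} {r μ M : ℕ} {ε : ℝ} (h : ParamBound c r μ ε M)
    (L : List (LocalOracle n)) :
    Meets (L.length * (M * (M * (M + 2)) + 20)) (fun _ => True) (checkLit c L) := by
  induction L with
  | nil => trivial
  | cons o L ih =>
    rw [checkLit, List.length_cons, Nat.succ_mul]
    set K := M * (M * (M + 2))
    refine ((meets_uniformJunta h).subst (a := 1) (fun x => meets_ask _) meets_sample).bind_le
      (q₂ := 20 + L.length * (K + 20)) (fun b _ => ?_) (by omega)
    split_ifs
    · refine (meets_repeatAll (q := 2) 10 ?_).bind_le (q₂ := L.length * (K + 20)) (fun b _ => ?_)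
        (by omega)
      · refine meets_unif.bind_le (q₂ := 2) (fun a _ => ?_) le_rfl
        refine (meets_ask _).bind_le (q₂ := 1) (fun a _ => ?_) le_rfl
        exact (meets_ask _).bind_le (q₂ := 0) (fun a _ => meets_pure trivial) le_rfl
      · split_ifs
        · exact ih
        · exact meets_pure trivial
    · exact meets_pure trivial

theorem meets_findCandidate {c : TesterConsts} {r μ M : ℕ} {ε : ℝ} (h : ParamBound c r μ ε M)
    (L : List (LocalOracle n)) (hL : L.length ≤ M) :
    Meets (M * (1 + M * (M * 2))) (fun _ => True) (findCandidate c r μ ε L) := by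
  refine (meets_tabulate (q := 1 + M * (M * 2)) (Q := fun _ _ => True) fun i => ?_).bind_le
    (q₂ := 0) (fun z _ => ?_) (by rw [Nat.add_zero]; exact Nat.mul_le_mul_right _ h.candidates)
  · exact meets_sample.bind_le (fun w _ => meets_extract L w _ h.extract_half hL) le_rfl
  · dsimp only
    split_ifs <;> exact meets_pure trivial

theorem meets_simSAMPJ {c : TesterConsts} {r μ M : ℕ} {ε : ℝ} (h : ParamBound c r μ ε M)
    (L : List (LocalOracle n)) (hL : L.length ≤ M) (J : Str L.length → Bool) :
    Meets (M * (M * 2)) (fun _ => True) (simSAMPJ c μ ε L J) := by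
  refine meets_unif.bind_le (q₂ := M * (M * 2)) (fun y _ => ?_) (by omega)
  have h1 : ∀ z : Str L.length, Meets (M * (M * 2)) (fun _ => True) (do
      let x ← extract c μ L y (kappa ε)
      pure fun j => if ∃ i, j ∈ (L.get i).1 ∧ x i ≠ z i then !(y j) else y j : Prog n (Str n)) :=
    fun z => (meets_extract L _ _ h.extract_kappa hL).bind_le (q₂ := 0)
      (fun x _ => meets_pure trivial) le_rfl
  dsimp only
  split_ifs
  · exact (meets_unifOn _).bind_le (fun z _ => h1 z) (by omega)
  · exact h1 _

theorem meets_dnfLearner {c : TesterConsts} {r μ M : ℕ} {ε : ℝ} (h : ParamBound c r μ ε M)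
    (R : Finset (Fin n)) :
    Meets (M ^ 5) (fun o => ∀ l, o = some l → (∀ x, Meets (M * (M * 2)) (fun _ => True) (l.1 x)) ∧
      Meets (M * (M * 2)) (fun _ => True) l.2) (dnfLearner c r μ ε R) := by
  have h4 := h.hundred
  have hq : M ^ 4 + (M * (1 + M * (M * 2)) + M * (M * (M * (M + 2)) + 20)) ≤ M ^ 5 := by
    have e1 : 100 * M ^ 4 ≤ M * M ^ 4 := Nat.mul_le_mul_right _ h4
    have e2 : 100 * M ^ 3 ≤ M * M ^ 3 := Nat.mul_le_mul_right _ h4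
    have e3 : 100 * M ^ 2 ≤ M * M ^ 2 := Nat.mul_le_mul_right _ h4
    have e4 : 100 * M ≤ M * M := Nat.mul_le_mul_right _ h4
    nlinarith
  refine (meets_approximate h R).bind_le (fun o ho => ?_) hq
  rcases o with _ | L
  · exact meets_pure (by rintro l ⟨⟩)
  · rcases L with _ | ⟨o, L⟩
    · refine meets_pure ?_
      rintro l ⟨⟩
      exact ⟨fun x => meets_pure trivial, meets_unif.mono (Nat.zero_le _) fun _ h => h⟩
    · have hL := ho _ rfl
      refine (meets_findCandidate h _ hL).bind_le (fun J _ => ?_) le_rfl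
      rcases J with _ | J
      · exact meets_pure (by rintro l ⟨⟩)
      · refine ((meets_checkLit h (o :: L)).mono (Nat.mul_le_mul_right _ hL)
          fun _ h => h).bind_le (q₂ := 0) (fun b _ => ?_) le_rfl
        split_ifs
        · refine meets_pure ?_
          rintro l ⟨⟩
          refine ⟨fun x => ?_, meets_simSAMPJ h _ hL J⟩
          exact (meets_extract _ _ _ h.extract_kappa hL).bind_le (q₂ := 0)
            (fun z _ => meets_pure trivial) le_rfl
        · exact meets_pure (by rintro l ⟨⟩)

theorem meets_conjTest {c : TesterConsts} {r μ M : ℕ} {ε : ℝ} (h : ParamBound c r μ ε M) :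
    Meets (1 + (M * 3 + M * 3)) (fun _ => True) (conjTest (n := n) c (ε / 10)) := by
  have h1 : Meets (M * 3 + M * 3) (fun _ => True) (antiMonotoneConjTest (n := n) c (ε / 10)) := by
    refine ((meets_repeatAll (q := 3) _ ?_).mono (Nat.mul_le_mul_right _ h.conj)
      fun _ h => h).bind_le (q₂ := M * 3) (fun b _ => ?_) le_rfl
    · refine meets_sample.bind_le (q₂ := 2) (fun x _ => ?_) le_rfl
      exact meets_sample.bind_le (q₂ := 1) (fun y _ => meets_ask _) le_rfl
    · split_ifs
      · refine (meets_repeatAll (q := 3) _ ?_).mono (Nat.mul_le_mul_right _ h.conj')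
          fun _ h => h
        refine meets_sample.bind_le (q₂ := 2) (fun x _ => ?_) le_rfl
        refine meets_unif.bind_le (q₂ := 2) (fun w _ => ?_) le_rfl
        exact meets_sample.bind_le (q₂ := 1) (fun y _ => meets_ask _) le_rfl
      · exact meets_pure trivial
  refine meets_sample.bind_le (q₂ := M * 3 + M * 3) (fun y₀ _ => ?_) le_rfl
  refine (h1.subst (a := 1) (fun x => meets_ask _) ?_).mono (by omega) fun _ h => h
  exact meets_sample.bind_le (q₂ := 0) (fun _ _ => meets_pure trivial) le_rfl

/-- Test-Factored-DNF makes a number of queries that is polynomial in its parameters. -/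
theorem meets_testFactoredDNF {c : TesterConsts} {r μ M : ℕ} {ε : ℝ}
    (h : ParamBound c r μ ε M) :
    Meets (M ^ 6) (fun _ => True) (testFactoredDNF (n := n) c r μ ε) := by
  have h4 := h.hundred
  set K := M * (M * 2) with hK
  have hq : M + (M ^ 5 + (M * (1 + (K + 100 * (K + 1))) +
      (M * (1 + (K + 1)) + (1 + (M * 3 + M * 3)) * (M * (K + 1))))) ≤ M ^ 6 := by
    have e1 : 100 * M ^ 5 ≤ M * M ^ 5 := Nat.mul_le_mul_right _ h4
    have e2 : 100 * M ^ 4 ≤ M * M ^ 4 := Nat.mul_le_mul_right _ h4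
    have e3 : 100 * M ^ 3 ≤ M * M ^ 3 := Nat.mul_le_mul_right _ h4
    have e4 : 100 * M ^ 2 ≤ M * M ^ 2 := Nat.mul_le_mul_right _ h4
    have e5 : 100 * M ≤ M * M := Nat.mul_le_mul_right _ h4
    rw [hK]; ring_nf; ring_nf at e1 e2 e3 e4 e5; omega
  refine ((meets_tabulate (q := 1) (Q := fun _ _ => True) fun i => meets_sample).mono
    (q' := M) (by have := h.start; omega) (fun _ h => h)).bind_le (fun z _ => ?_) hq
  dsimp only
  split_ifs
  · exact meets_pure trivial
  · refine (meets_dnfLearner h _).bind_le (fun o ho => ?_) le_rfl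
    rcases o with _ | ⟨mqJ, sampJ⟩
    · exact meets_pure trivial
    · obtain ⟨hm, hs⟩ := ho _ rfl
      refine ((meets_repeatAll (q := 1 + (K + 100 * (K + 1))) _ ?_).mono
        (Nat.mul_le_mul_right _ h.verify) fun _ h => h).bind_le (fun b _ => ?_) le_rfl
      · refine meets_sample.bind_le (fun z _ => ?_) le_rfl
        refine (hm z).bind_le (fun b _ => ?_) le_rfl
        split_ifs
        · exact meets_repeatAll _ (hs.bind_le (fun v _ => meets_ask _) le_rfl)
        · exact meets_pure trivial
      · split_ifs
        · refine ((meets_repeatAll (q := 1 + (K + 1)) _ ?_).mono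
            (Nat.mul_le_mul_right _ h.verify') fun _ h => h).bind_le (fun b _ => ?_) le_rfl
          · exact meets_sample.bind_le (fun z _ => hs.bind_le (fun v _ => meets_ask _) le_rfl)
              le_rfl
          · split_ifs
            · refine (meets_conjTest h).subst (fun x => ?_) (meets_sample.mono ?_ fun _ h => h)
              · exact (meets_repeatAll _ (hs.bind_le (fun v _ => meets_ask _) le_rfl)).mono
                  (Nat.mul_le_mul_right _ h.gamma) fun _ h => h
              · exact Nat.one_le_iff_ne_zero.2 (by positivity)
            · exact meets_pure trivial
        · exact meets_pure trivial

end TesterQueries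

/-! ### Averages over the cube -/

section Averages

variable {n : ℕ}

/-- Resampling one coordinate of a uniform function. -/
theorem expect_update {ι κ : Type} [Fintype ι] [DecidableEq ι] [Fintype κ] [Nonempty κ]
    (i : ι) (φ : (ι → κ) → ℝ) :
    𝔼 g : ι → κ, 𝔼 k, φ (Function.update g i k) = 𝔼 g, φ g := by
  have e : 𝔼 g : ι → κ, 𝔼 k, φ (Function.update g i k) = 𝔼 g : ι → κ, 𝔼 _k : κ, φ g := by
    rw [← Finset.expect_product', ← Finset.expect_product']
    refine Finset.expect_nbij' (fun p => (Function.update p.1 i p.2, p.1 i))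
      (fun p => (Function.update p.1 i p.2, p.1 i)) ?_ ?_ ?_ ?_ ?_ <;> simp
  simpa using e

theorem expect_apply {ι κ : Type} [Fintype ι] [DecidableEq ι] [Fintype κ] [Nonempty κ]
    (i : ι) (φ : κ → ℝ) : 𝔼 g : ι → κ, φ (g i) = 𝔼 k, φ k := by
  rw [← expect_update i]
  simp

theorem splice_splice_self (A : Finset (Fin n)) (x y : Str n) :
    splice A (splice A x y) (splice A y x) = x := by
  funext i; simp only [splice]; split_ifs <;> rfl

theorem splice_self (A : Finset (Fin n)) (x : Str n) : splice A x x = x := by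
  funext i; simp [splice]

/-- Resampling any fixed set of coordinates of a uniform string gives a uniform string. -/
theorem expect_splice (A : Finset (Fin n)) (ψ : Str n → ℝ) :
    𝔼 z, 𝔼 w, ψ (splice A w z) = 𝔼 x, ψ x := by
  have e : 𝔼 z : Str n, 𝔼 w : Str n, ψ (splice A w z) = 𝔼 z : Str n, 𝔼 _w : Str n, ψ z := by
    rw [← Finset.expect_product', ← Finset.expect_product']
    refine Finset.expect_nbij' (fun p => (splice A p.2 p.1, splice A p.1 p.2))
      (fun p => (splice A p.2 p.1, splice A p.1 p.2)) ?_ ?_ ?_ ?_ ?_ <;>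
      simp [splice_splice_self]
  simpa using e

theorem expect_involutive {α : Type} [Fintype α] (e : α → α) (he : Function.Involutive e)
    (ψ : α → ℝ) : 𝔼 x, ψ (e x) = 𝔼 x, ψ x :=
  Fintype.expect_equiv he.toPerm _ _ fun _ => rfl

/-- Resampling coordinates cannot concentrate the uniform law on `h⁻¹(1)`. -/
theorem expect_sat_splice_le (h : Str n → Bool) (A : Finset (Fin n)) (ψ : Str n → ℝ)
    (hψ : ∀ x, 0 ≤ ψ x) :
    𝔼 z ∈ sat h, 𝔼 w, ψ (splice A w z) ≤ (∑ x, ψ x) / (sat h).card := by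
  rw [Finset.expect_eq_sum_div_card]
  refine div_le_div_of_nonneg_right ?_ (Nat.cast_nonneg _)
  calc ∑ z ∈ sat h, 𝔼 w, ψ (splice A w z) ≤ ∑ z, 𝔼 w, ψ (splice A w z) :=
        Finset.sum_le_sum_of_subset_of_nonneg (Finset.subset_univ _) fun z _ _ =>
          Finset.expect_nonneg fun w _ => hψ _
    _ = ∑ x, ψ x := by
        have := expect_splice A ψ
        rw [Finset.expect_eq_sum_div_card, Finset.expect_eq_sum_div_card] at this
        have hc : ((Finset.univ : Finset (Str n)).card : ℝ) ≠ 0 := by simp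
        field_simp at this
        exact this

/-- The same for two successive resamplings. -/
theorem expect_sat_splice_splice_le (h : Str n → Bool) (A A' : Finset (Fin n)) (ψ : Str n → ℝ)
    (hψ : ∀ x, 0 ≤ ψ x) :
    𝔼 z ∈ sat h, 𝔼 w, 𝔼 a, ψ (splice A' a (splice A w z)) ≤ (∑ x, ψ x) / (sat h).card := by
  refine (expect_sat_splice_le h A (fun x => 𝔼 a, ψ (splice A' a x))
    fun x => Finset.expect_nonneg fun _ _ => hψ _).trans (le_of_eq ?_)
  congr 1
  have := expect_splice A' ψ
  rw [Finset.expect_eq_sum_div_card, Finset.expect_eq_sum_div_card] at this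
  have hc : ((Finset.univ : Finset (Str n)).card : ℝ) ≠ 0 := by simp
  field_simp at this
  exact this

theorem card_agree (S : Finset (Fin n)) (a : Str n) :
    (Finset.univ.filter fun x : Str n => ∀ i ∈ S, x i = a i).card = 2 ^ (n - S.card) := by
  classical
  have e : (Finset.univ.filter fun x : Str n => ∀ i ∈ S, x i = a i) =
      Fintype.piFinset fun i => if i ∈ S then {a i} else Finset.univ := by
    ext x
    simp only [Finset.mem_filter, Finset.mem_univ, true_and, Fintype.mem_piFinset]
    refine forall_congr' fun i => ?_
    by_cases h : i ∈ S <;> simp [h]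
  rw [e, Fintype.card_piFinset]
  have : ∀ i : Fin n, (if i ∈ S then ({a i} : Finset Bool) else Finset.univ).card =
      if i ∈ S then 1 else 2 := fun i => by split_ifs <;> simp
  simp only [this]
  rw [Finset.prod_ite]
  simp only [Finset.prod_const_one, Finset.prod_const, one_mul]
  congr 1
  rw [Finset.filter_not, Finset.card_sdiff_of_subset (Finset.filter_subset _ _)]
  simp

/-- The average of `ψ` over a subcube whose free coordinates are `G`. -/
theorem expect_splice_eq (G : Finset (Fin n)) (a : Str n) (ψ : Str n → ℝ) :
    𝔼 w, ψ (splice G w a) =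
      (∑ x ∈ Finset.univ.filter fun x : Str n => ∀ i ∉ G, x i = a i, ψ x) / 2 ^ G.card := by
  classical
  have hG : G.card ≤ n := by simpa using Finset.card_le_univ G
  have h1 : ∑ w, ψ (splice G w a) =
      ∑ x ∈ Finset.univ.filter fun x : Str n => ∀ i ∉ G, x i = a i,
        (2 ^ (n - G.card) : ℝ) * ψ x := by
    rw [← Finset.sum_fiberwise_of_maps_to (s := Finset.univ)
      (t := Finset.univ.filter fun x : Str n => ∀ i ∉ G, x i = a i)
      (g := fun w => splice G w a)]
    · refine Finset.sum_congr rfl fun x hx => ?_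
      rw [Finset.sum_congr rfl (g := fun _ => ψ x), Finset.sum_const, nsmul_eq_mul]
      · congr 1
        have : (Finset.univ.filter fun w : Str n => splice G w a = x) =
            Finset.univ.filter fun w : Str n => ∀ i ∈ G, w i = x i := by
          ext w
          simp only [Finset.mem_filter, Finset.mem_univ, true_and] at hx ⊢
          constructor
          · rintro rfl i hi; simp [splice, hi]
          · intro h; funext i
            by_cases hi : i ∈ G
            · simp [splice, hi, h i hi]
            · simp [splice, hi, hx i hi]
        rw [this, card_agree]; simp
      · intro w hw
        rw [(Finset.mem_filter.1 hw).2]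
    · intro w _
      simp only [Finset.mem_filter, Finset.mem_univ, true_and]
      intro i hi; simp [splice, hi]
  rw [Finset.expect_eq_sum_div_card, h1, ← Finset.mul_sum]
  have hc : ((Finset.univ : Finset (Str n)).card : ℝ) = 2 ^ (n - G.card) * 2 ^ G.card := by
    rw [← pow_add, Nat.sub_add_cancel hG]; simp
  rw [hc, mul_div_mul_left]
  positivity

theorem bxor_comm (x y : Str n) : bxor x y = bxor y x := by
  funext i; simp [bxor, Bool.xor_comm]
theorem bxor_involutive (q : Str n) : Function.Involutive (bxor q) := by
  intro x; funext i; simp [bxor]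

/-- A shifted sample of `h` is uniform on the coordinates on which `h` does not depend. -/
theorem expect_sat_shift_le (h : Str n → Bool) (hh : (sat h).Nonempty) (F : Finset (Fin n))
    (hF : ∀ u z, h (splice F u z) = h z)
    (ψ : Str n → ℝ) {δ : ℝ} (hδ : ∀ a, 𝔼 u, ψ (splice F u a) ≤ δ) (q : Str n) :
    𝔼 z ∈ sat h, ψ (bxor q z) ≤ δ := by
  have hc : (0 : ℝ) < (sat h).card := Nat.cast_pos.2 hh.card_pos
  have hc' : (0 : ℝ) < (Finset.univ : Finset (Str n)).card := by simp
  have h1 : ∀ φ : Str n → ℝ, ∑ z ∈ sat h, φ z = ∑ z, ind (h z = true) * φ z := by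
    intro φ
    rw [sat, Finset.sum_filter]
    refine Finset.sum_congr rfl fun z _ => ?_
    by_cases hz : h z = true <;> simp [ind, hz]
  have h2 : ∑ z ∈ sat h, ψ (bxor q z) = ∑ z ∈ sat h, 𝔼 u, ψ (splice F u (bxor q z)) := by
    rw [h1, h1]
    have := expect_splice F fun z => ind (h z = true) * ψ (bxor q z)
    rw [Finset.expect_eq_sum_div_card, Finset.expect_eq_sum_div_card,
      div_left_inj' hc'.ne'] at this
    rw [← this]
    refine Finset.sum_congr rfl fun z _ => ?_
    simp only [hF]
    rw [← Finset.mul_expect]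
    congr 1
    rw [← expect_involutive (bxor q) (bxor_involutive q)]
    refine Finset.expect_congr rfl fun u _ => ?_
    congr 1; funext i
    simp only [bxor, splice]
    split_ifs <;> simp
  rw [Finset.expect_eq_sum_div_card, h2, ← Finset.expect_eq_sum_div_card]
  calc _ ≤ 𝔼 _z ∈ sat h, δ := Finset.expect_le_expect fun z _ => hδ _
    _ = δ := Finset.expect_const hh _

theorem bxor_zero_left (z : Str n) : bxor (fun _ => false) z = z := by
  funext i; simp [bxor]

/-- The values of a uniform string at distinct coordinates are uniform. -/
theorem expect_comp_injective {ℓ : ℕ} (t : Fin ℓ → Fin n) (ht : Function.Injective t)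
    (ψ : Str ℓ → ℝ) : 𝔼 w : Str n, ψ (fun i => w (t i)) = 𝔼 z, ψ z := by
  classical
  have h1 : ∀ w : Str n, 𝔼 z : Str ℓ, ψ (fun i => bxor w (fun j =>
      if h : ∃ i, t i = j then z h.choose else false) (t i)) = 𝔼 z, ψ z := by
    intro w
    rw [← expect_involutive (bxor fun i => w (t i)) (bxor_involutive _) ψ]
    refine Finset.expect_congr rfl fun z _ => ?_
    congr 1; funext i
    have hex : ∃ i', t i' = t i := ⟨i, rfl⟩
    have : hex.choose = i := ht hex.choose_spec
    simp only [bxor, dif_pos hex, this]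
  have h2 : 𝔼 w : Str n, 𝔼 z : Str ℓ, ψ (fun i => bxor w (fun j =>
      if h : ∃ i, t i = j then z h.choose else false) (t i)) =
      𝔼 w : Str n, ψ (fun i => w (t i)) := by
    rw [Finset.expect_comm]
    calc _ = 𝔼 _z : Str ℓ, 𝔼 w : Str n, ψ (fun i => w (t i)) := by
          refine Finset.expect_congr rfl fun z _ => ?_
          simp only [bxor_comm _ (fun j => if h : ∃ i, t i = j then z h.choose else false)]
          exact expect_involutive (bxor _) (bxor_involutive _) fun w => ψ fun i => w (t i)
      _ = _ := Fintype.expect_const _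
  rw [← h2, Finset.expect_congr rfl fun w _ => h1 w, Fintype.expect_const]

/-- Markov's inequality. -/
theorem ind_lt_le {x η : ℝ} (hη : 0 < η) (hx : 0 ≤ x) : ind (η < x) ≤ x / η := by
  by_cases h : η < x
  · rw [ind_true h, le_div_iff₀ hη]; linarith
  · rw [ind_false h]; positivity

end Averages

/-! ### Binary search -/

section Search

variable {n m : ℕ}

theorem mem_blockUnion {X : Fin (m + 1) → Finset (Fin n)} {F : List (Fin (m + 1))} {i : Fin n} :
    i ∈ blockUnion X F ↔ ∃ j ∈ F, i ∈ X j := by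
  simp [blockUnion]

/-- The string that agrees with `b` on the first `p` of the blocks `U`, and with `a` elsewhere. -/
def prefixPoint (X : Fin (m + 1) → Finset (Fin n)) (U : List (Fin (m + 1))) (b a : Str n)
    (p : ℕ) : Str n :=
  splice (blockUnion X (U.take p)) b a

theorem prefixPoint_zero (X : Fin (m + 1) → Finset (Fin n)) (U : List (Fin (m + 1)))
    (b a : Str n) : prefixPoint X U b a 0 = a := by
  funext i; simp [prefixPoint, splice, mem_blockUnion]

theorem splice_prefixPoint (X : Fin (m + 1) → Finset (Fin n)) (U : List (Fin (m + 1)))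
    (b a : Str n) (p k len : ℕ) (hk : k ≤ len) :
    splice ((((U.drop p).take k).toFinset).biUnion X) (prefixPoint X U b a (p + len))
      (prefixPoint X U b a p) = prefixPoint X U b a (p + k) := by
  have h1 : ∀ i, i ∈ blockUnion X (U.take (p + k)) ↔
      i ∈ blockUnion X (U.take p) ∨ i ∈ blockUnion X ((U.drop p).take k) := by
    intro i
    simp only [mem_blockUnion, List.take_add, List.mem_append]
    constructor
    · rintro ⟨j, hj | hj, hi⟩
      exacts [.inl ⟨j, hj, hi⟩, .inr ⟨j, hj, hi⟩]
    · rintro (⟨j, hj, hi⟩ | ⟨j, hj, hi⟩)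
      exacts [⟨j, .inl hj, hi⟩, ⟨j, .inr hj, hi⟩]
  have h2 : ∀ i, i ∈ blockUnion X (U.take (p + k)) → i ∈ blockUnion X (U.take (p + len)) := by
    intro i
    simp only [mem_blockUnion]
    rintro ⟨j, hj, hi⟩
    exact ⟨j, (List.take_subset_take_left U (by omega)) hj, hi⟩
  funext i
  change (if i ∈ blockUnion X ((U.drop p).take k) then _ else _) = _
  simp only [prefixPoint, splice]
  have h1i := h1 i
  have h2i := h2 i
  by_cases ha : i ∈ blockUnion X (U.take p) <;>
    by_cases hb : i ∈ blockUnion X ((U.drop p).take k) <;> simp_all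

/-- Binary search queries only strings that interpolate between `b` and `a` along a prefix of the
list of blocks, and it is deterministic. -/
theorem risk_binarySearch_aux (w : World n) (X : Fin (m + 1) → Finset (Fin n))
    (U : List (Fin (m + 1))) (va : Bool) (b a : Str n)
    (hP : ∀ p ≤ U.length, prefixPoint X U b a p ∉ w.bad) (len p : ℕ) (hlen : 1 ≤ len)
    (hp : p + len ≤ U.length) (h₁ : w.mq (prefixPoint X U b a p) = va)
    (h₂ : w.mq (prefixPoint X U b a (p + len)) ≠ va) :
    ∃ (i : ℕ) (hi : i < U.length), w.mq (prefixPoint X U b a i) = va ∧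
      w.mq (prefixPoint X U b a (i + 1)) ≠ va ∧
      ∀ φ, risk w (binarySearch X ((U.drop p).take len) va (prefixPoint X U b a p)
        (prefixPoint X U b a (p + len))) φ = φ (U[i], prefixPoint X U b a i) := by
  induction len using Nat.strong_induction_on generalizing p with
  | _ len ih =>
    have hl : ((U.drop p).take len).length = len := by
      rw [List.length_take, List.length_drop]; omega
    rw [binarySearch]
    by_cases h2 : 2 ≤ len
    · rw [if_pos (by rw [hl]; exact h2)]
      have hk : len / 2 ≤ len := Nat.div_le_self _ _
      simp only [hl]
      rw [List.take_take, min_eq_left hk, splice_prefixPoint X U b a p _ _ hk]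
      have hbad := hP (p + len / 2) (by omega)
      by_cases hv : w.mq (prefixPoint X U b a (p + len / 2)) = va
      · obtain ⟨i, hi, e1, e2, e3⟩ := ih (len - len / 2) (by omega) (p + len / 2) (by omega)
          (by omega) hv (by rw [show p + len / 2 + (len - len / 2) = p + len by omega]; exact h₂)
        refine ⟨i, hi, e1, e2, fun φ => ?_⟩
        rw [risk_bind, risk_ask, if_neg hbad, if_pos hv, ← e3 φ]
        rw [List.drop_take, List.drop_drop, show p + len / 2 + (len - len / 2) = p + len by omega]
      · obtain ⟨i, hi, e1, e2, e3⟩ := ih (len / 2) (by omega) p (by omega)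
          (by omega) h₁ hv
        refine ⟨i, hi, e1, e2, fun φ => ?_⟩
        rw [risk_bind, risk_ask, if_neg hbad, if_neg hv, ← e3 φ]
    · obtain rfl : len = 1 := by omega
      refine ⟨p, by omega, h₁, h₂, fun φ => ?_⟩
      rw [if_neg (by rw [hl]; omega), risk_pure]
      congr 2
      rw [List.headD_eq_head?_getD, List.head?_take, if_neg one_ne_zero, List.head?_drop,
        List.getElem?_eq_getElem (by omega)]
      rfl

/-- Binary search returns a block at which the value changes, if no string between `b` and `a` is
bad. Its outcome is determined by the list of the blocks. -/
theorem risk_binarySearch (w : World n) (X : Fin (m + 1) → Finset (Fin n))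
    (U : List (Fin (m + 1))) (va : Bool) (b a : Str n)
    (hP : ∀ p ≤ U.length, prefixPoint X U b a p ∉ w.bad)
    (hb : prefixPoint X U b a U.length = b)
    (h₁ : w.mq a = va) (h₂ : w.mq b ≠ va) :
    ∃ (i : ℕ) (hi : i < U.length), w.mq (prefixPoint X U b a i) = va ∧
      w.mq (prefixPoint X U b a (i + 1)) ≠ va ∧
      ∀ φ, risk w (binarySearch X U va a b) φ = φ (U[i], prefixPoint X U b a i) := by
  have h0 : prefixPoint X U b a (0 + U.length) = b := by rw [Nat.zero_add, hb]
  have hU : 1 ≤ U.length := by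
    by_contra h
    have : U.length = 0 := by omega
    rw [this, prefixPoint_zero] at hb
    subst hb; exact h₂ h₁
  have := risk_binarySearch_aux w X U va b a hP U.length 0 hU (by omega)
    (by rwa [prefixPoint_zero]) (by rwa [h0])
  simp only [List.drop_zero, List.take_length, prefixPoint_zero, h0] at this
  exact this

theorem prefixPoint_succ (X : Fin (m + 1) → Finset (Fin n)) (U : List (Fin (m + 1)))
    (b a : Str n) (i : ℕ) (hi : i < U.length) :
    prefixPoint X U b a (i + 1) = splice (X U[i]) b (prefixPoint X U b a i) := by
  funext k
  have : k ∈ blockUnion X (U.take (i + 1)) ↔ k ∈ blockUnion X (U.take i) ∨ k ∈ X U[i] := by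
    rw [← List.take_append_getElem hi]
    simp only [mem_blockUnion, List.mem_append, List.mem_singleton]
    constructor
    · rintro ⟨j, hj | rfl, hk⟩
      exacts [.inl ⟨j, hj, hk⟩, .inr hk]
    · rintro (⟨j, hj, hk⟩ | hk)
      exacts [⟨j, .inl hj, hk⟩, ⟨_, .inr rfl, hk⟩]
  simp only [prefixPoint, splice, this]
  split_ifs <;> simp_all

theorem mem_otherBlocks {F : List (Fin (m + 1))} {j : Fin (m + 1)} :
    j ∈ otherBlocks F ↔ j ∉ F := by
  simp [otherBlocks]

/-- The blocks that a map to the block indices cuts out of `R`. -/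
def blockOf (R : Finset (Fin n)) (part : Fin n → Fin (m + 1)) (j : Fin (m + 1)) :
    Finset (Fin n) := R.filter fun i => part i = j

theorem mem_blockOf {R : Finset (Fin n)} {part : Fin n → Fin (m + 1)} {j : Fin (m + 1)}
    {i : Fin n} : i ∈ blockOf R part j ↔ i ∈ R ∧ part i = j := by
  simp [blockOf]

theorem mem_blockUnion_blockOf {R : Finset (Fin n)} {part : Fin n → Fin (m + 1)}
    {F : List (Fin (m + 1))} {i : Fin n} :
    i ∈ blockUnion (blockOf R part) F ↔ i ∈ R ∧ part i ∈ F := by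
  rw [mem_blockUnion]
  constructor
  · rintro ⟨j, hj, hi⟩
    rw [mem_blockOf] at hi
    exact ⟨hi.1, hi.2 ▸ hj⟩
  · rintro ⟨hi, hF⟩
    exact ⟨_, hF, mem_blockOf.2 ⟨hi, rfl⟩⟩

/-- The strings that the binary search over the blocks outside `F` visits arise by resampling. -/
theorem prefixPoint_otherBlocks (R : Finset (Fin n)) (part : Fin n → Fin (m + 1))
    (F : List (Fin (m + 1))) (w z : Str n) (p : ℕ) :
    prefixPoint (blockOf R part) (otherBlocks F)
      (splice (R \ blockUnion (blockOf R part) F) w z) z p =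
    splice (blockUnion (blockOf R part) ((otherBlocks F).take p)) w z := by
  funext i
  simp only [prefixPoint, splice]
  split_ifs with h1 h2
  · rfl
  · exfalso
    rw [mem_blockUnion_blockOf] at h1
    rw [Finset.mem_sdiff, mem_blockUnion_blockOf] at h2
    exact h2 ⟨h1.1, fun h => mem_otherBlocks.1 (List.mem_of_mem_take h1.2) h.2⟩
  · rfl

theorem prefixPoint_otherBlocks_length (R : Finset (Fin n)) (part : Fin n → Fin (m + 1))
    (F : List (Fin (m + 1))) (w z : Str n) :
    prefixPoint (blockOf R part) (otherBlocks F)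
      (splice (R \ blockUnion (blockOf R part) F) w z) z (otherBlocks F).length =
    splice (R \ blockUnion (blockOf R part) F) w z := by
  rw [prefixPoint_otherBlocks, List.take_length]
  congr 1
  ext i
  simp only [mem_blockUnion_blockOf, Finset.mem_sdiff, mem_otherBlocks]
  tauto

end Search

/-! ### Approximate finds literals -/

/-- The local oracle `o` computes a literal on the variable `t` of its block, and a uniform query to
it is bad with probability at most `η`. -/
structure IsLiteral {n : ℕ} (w : World n) (η : ℝ) (o : LocalOracle n) (t : Fin n) : Prop where
  mem : t ∈ o.1
  eval : ∀ y, w.mq (splice o.1 y o.2) = decide (y t = o.2 t)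
  dens : 𝔼 a, ind (splice o.1 a o.2 ∈ w.bad) ≤ η

section Approximate

variable {n m : ℕ}

/-- A pair of a sample `z` and a uniform string `w` for which neither the binary search nor the
local oracles that it may find are likely to query bad points. -/
def GoodDraw (B : Set (Str n)) (η : ℝ) (X : Fin (m + 1) → Finset (Fin n))
    (F : List (Fin (m + 1))) (z w : Str n) : Prop :=
  ∀ p : Fin (m + 2), (splice (blockUnion X ((otherBlocks F).take p)) w z ∉ B) ∧
    ∀ j : Fin (m + 1), ¬ η < 𝔼 a, ind (splice (X j) a
      (splice (blockUnion X ((otherBlocks F).take p)) w z) ∈ B)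

/-- There are few strings that a draw may visit and few blocks whose local oracle it may find, and
each arises from the sample by resampling; Markov's inequality takes care of the local oracles. -/
theorem expect_not_goodDraw_le (h : Str n → Bool) (B : Set (Str n))
    {η : ℝ} (hη : 0 < η) (hη1 : η ≤ 1) (X : Fin (m + 1) → Finset (Fin n))
    (F : List (Fin (m + 1))) :
    𝔼 z ∈ sat h, 𝔼 w, ind (¬ GoodDraw B η X F z w) ≤
      ((m : ℝ) + 2) ^ 2 * ((∑ x, ind (x ∈ B)) / (sat h).card / η) := by
  set β := (∑ x, ind (x ∈ B)) / ((sat h).card : ℝ)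
  have hβ : 0 ≤ β := div_nonneg (Finset.sum_nonneg fun _ _ => ind_nonneg _) (Nat.cast_nonneg _)
  set A : Fin (m + 2) → Finset (Fin n) := fun p => blockUnion X ((otherBlocks F).take p)
  have key : ∀ z w, ind (¬ GoodDraw B η X F z w) ≤ ∑ p : Fin (m + 2), (ind (splice (A p) w z ∈ B) +
      ∑ j : Fin (m + 1), (𝔼 a, ind (splice (X j) a (splice (A p) w z) ∈ B)) / η) := by
    intro z w
    calc ind (¬ GoodDraw B η X F z w) ≤ ind (∃ p : Fin (m + 2), splice (A p) w z ∈ B ∨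
          ∃ j : Fin (m + 1), η < 𝔼 a, ind (splice (X j) a (splice (A p) w z) ∈ B)) :=
          ind_mono fun hg => by
            unfold GoodDraw at hg
            push Not at hg
            obtain ⟨p, hp⟩ := hg
            refine ⟨p, ?_⟩
            by_cases hb : splice (A p) w z ∈ B
            · exact .inl hb
            · exact .inr (hp hb)
      _ ≤ _ := (ind_exists_le _).trans (Finset.sum_le_sum fun p _ =>
          (ind_or_le _ _).trans (add_le_add le_rfl ((ind_exists_le _).trans
            (Finset.sum_le_sum fun j _ => ind_lt_le hη
              (Finset.expect_nonneg fun _ _ => ind_nonneg _)))))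
  calc 𝔼 z ∈ sat h, 𝔼 w, ind (¬ GoodDraw B η X F z w)
      ≤ 𝔼 z ∈ sat h, 𝔼 w, ∑ p : Fin (m + 2), (ind (splice (A p) w z ∈ B) +
      ∑ j : Fin (m + 1), (𝔼 a, ind (splice (X j) a (splice (A p) w z) ∈ B)) / η) :=
        Finset.expect_le_expect fun z _ => Finset.expect_le_expect fun w _ => key z w
    _ = ∑ p : Fin (m + 2), (𝔼 z ∈ sat h, 𝔼 w, ind (splice (A p) w z ∈ B) +
      ∑ j : Fin (m + 1),
        (𝔼 z ∈ sat h, 𝔼 w, 𝔼 a, ind (splice (X j) a (splice (A p) w z) ∈ B)) / η) := by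
        simp only [Finset.expect_sum_comm, Finset.expect_add_distrib, Finset.expect_div]
    _ ≤ ∑ p : Fin (m + 2), (β + ∑ j : Fin (m + 1), β / η) := by
        refine Finset.sum_le_sum fun p _ => add_le_add ?_ (Finset.sum_le_sum fun j _ => ?_)
        · exact expect_sat_splice_le h (A p) (fun x => ind (x ∈ B)) fun _ => ind_nonneg _
        · exact div_le_div_of_nonneg_right (expect_sat_splice_splice_le h (A p) (X j)
            (fun x => ind (x ∈ B)) fun _ => ind_nonneg _) hη.le
    _ ≤ ∑ p : Fin (m + 2), (β / η + ∑ j : Fin (m + 1), β / η) := by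
        refine Finset.sum_le_sum fun p _ => add_le_add ?_ le_rfl
        exact le_div_self hβ hη hη1
    _ = _ := by
        simp only [Finset.sum_const, Finset.card_univ, Fintype.card_fin, nsmul_eq_mul]
        push_cast; ring

/-- Every block of `part` contains at most one of the variables `V`. -/
def Separates (V : Finset (Fin n)) (part : Fin n → Fin (m + 1)) : Prop :=
  ∀ i ∈ V, ∀ j ∈ V, part i = part j → i = j

/-- Two distinct variables fall into the same block with probability `1 / (m + 1)`. -/
theorem expect_not_separates_le (V : Finset (Fin n)) :
    𝔼 part : Fin n → Fin (m + 1), ind (¬ Separates V part) ≤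
      (V.card : ℝ) ^ 2 / ((m : ℝ) + 1) := by
  have pair : ∀ i j : Fin n, i ≠ j →
      𝔼 part : Fin n → Fin (m + 1), ind (part i = part j) ≤ 1 / ((m : ℝ) + 1) := by
    intro i j hij
    rw [← expect_update i]
    refine le_of_eq ?_
    calc _ = 𝔼 _g : Fin n → Fin (m + 1), 1 / ((m : ℝ) + 1) := by
          refine Finset.expect_congr rfl fun g _ => ?_
          simp only [Function.update_self, Function.update_of_ne hij.symm]
          rw [Finset.expect_eq_sum_div_card, Finset.sum_eq_single (g j)
            (fun k _ hk => ind_false hk) (by simp), ind_true rfl]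
          simp
      _ = _ := Fintype.expect_const _
  calc 𝔼 part : Fin n → Fin (m + 1), ind (¬ Separates V part)
      ≤ 𝔼 part : Fin n → Fin (m + 1), ∑ p ∈ V ×ˢ V,
          ind (p.1 ≠ p.2 ∧ part p.1 = part p.2) := by
        refine Finset.expect_le_expect fun part _ => ?_
        by_cases hs : Separates V part
        · rw [ind_false (not_not.2 hs)]
          exact Finset.sum_nonneg fun _ _ => ind_nonneg _
        · rw [ind_true hs]
          unfold Separates at hs
          push Not at hs
          obtain ⟨i, hi, j, hj, h1, h2⟩ := hs
          rw [← ind_true (P := i ≠ j ∧ part i = part j) ⟨h2, h1⟩]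
          exact Finset.single_le_sum (f := fun p : Fin n × Fin n =>
            ind (p.1 ≠ p.2 ∧ part p.1 = part p.2)) (fun _ _ => ind_nonneg _)
            (Finset.mk_mem_product hi hj)
    _ = ∑ p ∈ V ×ˢ V, 𝔼 part : Fin n → Fin (m + 1), ind (p.1 ≠ p.2 ∧ part p.1 = part p.2) :=
        Finset.expect_sum_comm _ _ _
    _ ≤ ∑ p ∈ V ×ˢ V, 1 / ((m : ℝ) + 1) := by
        refine Finset.sum_le_sum fun p _ => ?_
        by_cases hp : p.1 = p.2
        · simp only [hp, ne_eq, not_true_eq_false, false_and, ind_false not_false]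
          rw [Finset.expect_const_zero]; positivity
        · refine le_trans (Finset.expect_le_expect fun g _ => ind_mono ?_) (pair _ _ hp)
          exact fun h => h.2
    _ = _ := by
        rw [Finset.sum_const, Finset.card_product, nsmul_eq_mul]; push_cast; ring

variable (h : Str n → Bool) (hh : (sat h).Nonempty) (B : Set (Str n))

/-- The lists that Approximate builds: distinct blocks with local oracles that are literals. -/
def GoodList (η : ℝ) (X : Fin (m + 1) → Finset (Fin n)) (L : List (Fin (m + 1) × Str n)) : Prop :=
  (L.map Prod.fst).Nodup ∧
    ∀ p ∈ L, ∃ t, IsLiteral (World.ofFun h hh B) η (X p.1, p.2) t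

/-- If resampling a block with at most one relevant variable changes the value from `1`, then the
block contains a relevant variable, and the local oracle is the literal on it. -/
theorem isLiteral_of_ne {η : ℝ} {V : Finset (Fin n)} (hV : ∀ x y, (∀ i ∈ V, x i = y i) → h x = h y)
    {S : Finset (Fin n)} (hS : ∀ i ∈ S, ∀ j ∈ S, i ∈ V → j ∈ V → i = j) {b v : Str n}
    (hv : h v = true) (hb : h (splice S b v) ≠ true)
    (hd : 𝔼 a, ind (splice S a v ∈ B) ≤ η) : ∃ t, IsLiteral (World.ofFun h hh B) η (S, v) t := by
  have hex : ∃ t ∈ S, t ∈ V ∧ b t ≠ v t := by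
    by_contra! hc
    refine hb (hv ▸ hV _ _ fun i hi => ?_)
    simp only [splice]
    split_ifs with hiS
    · exact hc i hiS hi
    · rfl
  obtain ⟨t, htS, htV, hbt⟩ := hex
  have hdep : ∀ y y' : Str n, y t = y' t → h (splice S y v) = h (splice S y' v) := by
    intro y y' hy
    refine hV _ _ fun i hi => ?_
    simp only [splice]
    split_ifs with hiS
    · rw [hS i hiS t htS hi htV, hy]
    · rfl
  refine ⟨t, htS, fun y => ?_, hd⟩
  change h (splice S y v) = decide (y t = v t)
  by_cases hy : y t = v t
  · rw [hdep y v hy, splice_self, hv]; simp [hy]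
  · have : y t = b t := by
      revert hy hbt; cases y t <;> cases v t <;> cases b t <;> simp
    rw [hdep y b this]; simp [hy, hb]

/-- A draw fails to be good only with a small probability, and after a good draw the list remains
good. The loop ends after at most `slots * T + rem` draws. -/
theorem risk_approximateLoop_le {η : ℝ} (hη : 0 < η) (hη1 : η ≤ 1) {V : Finset (Fin n)}
    (hV : ∀ x y, (∀ i ∈ V, x i = y i) → h x = h y) (R : Finset (Fin n))
    (part : Fin n → Fin (m + 1)) (hS : Separates (R ∩ V) part) (T : ℕ) (slots rem : ℕ)
    (L : List (Fin (m + 1) × Str n)) (hL : GoodList h hh B η (blockOf R part) L) :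
    risk (World.ofFun h hh B) (approximateLoop R (blockOf R part) T slots rem L)
      (fun o => ind (¬ ∀ l, o = some l → GoodList h hh B η (blockOf R part) l)) ≤
      ((slots : ℝ) * T + rem) *
        (((m : ℝ) + 2) ^ 2 * ((∑ x, ind (x ∈ B)) / (sat h).card / η)) := by
  set δ := ((m : ℝ) + 2) ^ 2 * ((∑ x, ind (x ∈ B)) / (sat h).card / η) with hδ
  have hβ : 0 ≤ (∑ x, ind (x ∈ B)) / ((sat h).card : ℝ) :=
    div_nonneg (Finset.sum_nonneg fun _ _ => ind_nonneg _) (Nat.cast_nonneg _)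
  have hδ0 : 0 ≤ δ := by positivity
  have base : ∀ L, GoodList h hh B η (blockOf R part) L →
      risk (World.ofFun h hh B) (pure (some L)) (fun o =>
        ind (¬ ∀ l, o = some l → GoodList h hh B η (blockOf R part) l)) = 0 := by
    intro L hL
    rw [risk_pure, ind_false]
    push Not; rintro l ⟨⟩; exact hL
  -- one draw, whatever the loop does when no block or a new block has been found
  have step : ∀ (L : List (Fin (m + 1) × Str n)), GoodList h hh B η (blockOf R part) L →
      ∀ (K : ℝ), 0 ≤ K →
      ∀ (p : Prog n (Option (List (Fin (m + 1) × Str n))))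
        (g : Fin (m + 1) × Str n → Prog n (Option (List (Fin (m + 1) × Str n)))),
      risk (World.ofFun h hh B) p (fun o =>
        ind (¬ ∀ l, o = some l → GoodList h hh B η (blockOf R part) l)) ≤ K →
      (∀ e, GoodList h hh B η (blockOf R part) (L ++ [e]) → risk (World.ofFun h hh B) (g e)
        (fun o => ind (¬ ∀ l, o = some l → GoodList h hh B η (blockOf R part) l)) ≤ K) →
      risk (World.ofFun h hh B) (do
        let z ← Prog.sample
        let w ← Prog.unif (Str n)
        let b := splice (R \ blockUnion (blockOf R part) (L.map Prod.fst)) w z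
        if ← Prog.ask b then p
        else do
          let found ← binarySearch (blockOf R part) (otherBlocks (L.map Prod.fst)) true z b
          g found) (fun o => ind (¬ ∀ l, o = some l → GoodList h hh B η (blockOf R part) l))
        ≤ δ + K := by
    intro L hL K hK p g hp hg
    rw [risk_bind, risk_sample_ofFun]
    refine le_trans (Finset.expect_le_expect (g := fun z =>
      𝔼 w, (ind (¬ GoodDraw B η (blockOf R part) (L.map Prod.fst) z w) + K)) fun z hz => ?_) ?_
    · rw [risk_bind, risk_unif]
      refine Finset.expect_le_expect fun w _ => ?_
      by_cases hg' : GoodDraw B η (blockOf R part) (L.map Prod.fst) z w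
      swap
      · rw [ind_true hg']
        exact (risk_le_one _ _ fun _ => ind_le_one _).trans (by linarith)
      rw [ind_false (not_not.2 hg'), zero_add]
      set F := L.map Prod.fst with hF
      set U := otherBlocks F with hU
      have hUlen : U.length ≤ m + 1 := otherBlocks_length_le F
      set b := splice (R \ blockUnion (blockOf R part) F) w z with hb
      have hP : ∀ p ≤ U.length, prefixPoint (blockOf R part) U b z p ∉ B := by
        intro p hp
        rw [hb, prefixPoint_otherBlocks]
        exact (hg' ⟨p, by omega⟩).1
      have hbU : prefixPoint (blockOf R part) U b z U.length = b :=
        prefixPoint_otherBlocks_length R part F w z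
      have hbB : b ∉ (World.ofFun h hh B).bad := by
        have := hP _ le_rfl
        rwa [hbU] at this
      rw [risk_bind, risk_ask, if_neg hbB]
      by_cases hbv : (World.ofFun h hh B).mq b = true
      · rw [if_pos hbv]; exact hp
      · rw [if_neg hbv]
        obtain ⟨i, hi, e1, e2, e3⟩ := risk_binarySearch (World.ofFun h hh B) (blockOf R part) U
          true b z hP hbU (mem_sat.1 hz) hbv
        rw [risk_bind, e3]
        refine hg _ ⟨?_, ?_⟩
        · rw [List.map_append, List.nodup_append]
          refine ⟨hL.1, by simp, ?_⟩
          rintro a ha b' hb' rfl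
          simp only [List.map_cons, List.map_nil, List.mem_singleton] at hb'
          have : U[i] ∈ U := List.getElem_mem hi
          rw [← hb'] at this
          exact mem_otherBlocks.1 this ha
        · intro e he
          rw [List.mem_append, List.mem_singleton] at he
          rcases he with he | rfl
          · exact hL.2 e he
          · rw [prefixPoint_succ _ _ _ _ _ hi] at e2
            refine isLiteral_of_ne h hh B hV ?_ e1 e2 ?_
            · intro k hk k' hk' hkV hk'V
              rw [mem_blockOf] at hk hk'
              exact hS k (Finset.mem_inter.2 ⟨hk.1, hkV⟩) k' (Finset.mem_inter.2 ⟨hk'.1, hk'V⟩)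
                (hk.2.trans hk'.2.symm)
            · have := (hg' ⟨i, by omega⟩).2 U[i]
              rw [hb, prefixPoint_otherBlocks]
              exact not_lt.1 this
    · have := expect_not_goodDraw_le h B hη hη1 (blockOf R part) (L.map Prod.fst)
      simp only [Finset.expect_add_distrib, Fintype.expect_const, Finset.expect_const hh]
      linarith
  induction slots generalizing rem L with
  | zero =>
    induction rem generalizing L with
    | zero => rw [approximateLoop, base L hL]; positivity
    | succ rem ih =>
      rw [approximateLoop]
      refine (step L hL (((0 : ℕ) : ℝ) * T * δ + rem * δ) (by positivity) _ (fun _ => pure none)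
        ((ih L hL).trans (by linarith)) fun e _ => ?_).trans ?_
      · rw [risk_pure, ind_false (by simp)]; positivity
      · push_cast; linarith
  | succ slots ihs =>
    induction rem generalizing L with
    | zero => rw [approximateLoop, base L hL]; positivity
    | succ rem ih =>
      rw [approximateLoop]
      refine (step L hL (((slots + 1 : ℕ) : ℝ) * T * δ + rem * δ) (by positivity) _ _
        ((ih L hL).trans (by linarith)) fun e he => ?_).trans ?_
      · refine (ihs T _ he).trans ?_
        push_cast
        have : 0 ≤ (rem : ℝ) * δ := by positivity
        linarith
      · push_cast; linarith

end Approximate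

/-! ### The subroutines on literals -/

section Literals

variable {n : ℕ} (w : World n) {η : ℝ}

/-- A local oracle that is a literal answers by this literal, unless a bad point is queried. -/
theorem risk_askLocal_le {o : LocalOracle n} {t : Fin n} (ho : IsLiteral w η o t) (z : Str n)
    {φ : Bool → ℝ} (hφ : ∀ b, 0 ≤ φ b) :
    risk w (askLocal o z) φ ≤ ind (splice o.1 z o.2 ∈ w.bad) + φ (decide (z t = o.2 t)) := by
  rw [← ho.eval]
  exact risk_ask_le w _ hφ

/-- Asking a local oracle at a uniform point and at the image of this point under an involution. -/
theorem risk_ask_twice_le {o : LocalOracle n} {t : Fin n} (ho : IsLiteral w η o t)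
    (e : Str n → Str n) (he : Function.Involutive e) {φ : Bool → ℝ} (hφ : ∀ b, 0 ≤ φ b) {K : ℝ}
    (hK : ∀ a : Str n, φ (decide (a t = o.2 t) != decide (e a t = o.2 t)) ≤ K) :
    risk w (do
      let a ← Prog.unif (Str n)
      let p ← askLocal o a
      let q ← askLocal o (e a)
      pure (p != q)) φ ≤ 2 * η + K := by
  rw [risk_bind, risk_unif]
  calc _ ≤ 𝔼 a : Str n, (ind (splice o.1 a o.2 ∈ w.bad) +
        (ind (splice o.1 (e a) o.2 ∈ w.bad) + K)) := by
        refine Finset.expect_le_expect fun a _ => ?_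
        rw [risk_bind]
        refine (risk_askLocal_le w ho a fun p => risk_nonneg _ _ hφ).trans (add_le_add le_rfl ?_)
        rw [risk_bind]
        simp only [risk_pure]
        refine (risk_askLocal_le w ho _ fun q => hφ _).trans (add_le_add le_rfl ?_)
        exact hK a
    _ ≤ η + (η + K) := by
        rw [Finset.expect_add_distrib, Finset.expect_add_distrib, Fintype.expect_const,
          expect_involutive e he fun a => ind (splice o.1 a o.2 ∈ w.bad)]
        linarith [ho.dens]
    _ = _ := by ring

/-- If the local oracles are literals, Extract returns the bits of `x` at their variables. Each
repetition compares a literal at two points at which it takes always the same or always different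
values, and each of the points is uniform. -/
theorem risk_extract_le (c : TesterConsts) (μ : ℕ) (L : List (LocalOracle n))
    (t : Fin L.length → Fin n) (ht : ∀ i, IsLiteral w η (L.get i) (t i)) (x : Str n) (δ : ℝ)
    {M : ℕ} (hη : 0 ≤ η) (hL : L.length ≤ M)
    (h1 : 1 ≤ ⌈(c.extract : ℝ) * Real.logb 2 ((μ : ℝ) / δ)⌉₊)
    (hM : ⌈(c.extract : ℝ) * Real.logb 2 ((μ : ℝ) / δ)⌉₊ ≤ M) (φ : (Fin L.length → Bool) → ℝ)
    (h0 : ∀ z, 0 ≤ φ z) (hφ : ∀ z, φ z ≤ 1) :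
    risk w (extract c μ L x δ) φ ≤ φ (fun i => x (t i)) + M * (M * (2 * η)) := by
  refine (risk_tabulate_le w _ (fun i => x (t i)) φ (h0 _) hφ).trans (add_le_add le_rfl ?_)
  set reps := ⌈(c.extract : ℝ) * Real.logb 2 ((μ : ℝ) / δ)⌉₊ with hreps
  have hM' : (reps : ℝ) * (2 * η) ≤ M * (2 * η) :=
    mul_le_mul_of_nonneg_right (Nat.cast_le.2 hM) (by positivity)
  calc _ ≤ ∑ _i : Fin L.length, (M : ℝ) * (2 * η) := Finset.sum_le_sum fun i _ => ?_
    _ = L.length * (M * (2 * η)) := by simp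
    _ ≤ _ := mul_le_mul_of_nonneg_right (Nat.cast_le.2 hL) (by positivity)
  refine le_trans ?_ hM'
  rw [risk_bind]
  refine (risk_tabulate_le w _ (fun _ => decide (x (t i) = false)) _ (ind_nonneg _)
    (fun _ => ind_le_one _)).trans ?_
  have e0 : ind ((if (Finset.univ.filter fun _ : Fin reps => decide (x (t i) = false) = false).card
      < (Finset.univ.filter fun _ : Fin reps => decide (x (t i) = false) = true).card
      then false else true) ≠ x (t i)) = 0 := by
    apply ind_false
    push Not
    cases hx : x (t i)
    · simp; omega
    · simp
  refine (add_le_add (le_of_eq e0) (Finset.sum_le_sum fun k _ =>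
    risk_ask_twice_le w (ht i) (fun a j => if x j = false then !(a j) else a j) ?_
      (fun _ => ind_nonneg _) (K := 0) fun a => ?_)).trans ?_
  · intro a; funext j
    dsimp only; split_ifs <;> simp
  · rw [ind_false]
    push Not
    cases hx : x (t i)
    · cases a (t i) <;> cases (L.get i).2 (t i) <;> simp
    · simp
  · simp

/-- All the strings queried in one round of the junta tester are uniform, although they depend on
each other. -/
theorem risk_juntaLoop_le {m : ℕ} (part : Fin n → Fin (m + 1)) (k t : ℕ)
    (F : List (Fin (m + 1))) (hη : 0 ≤ η) (hd : 𝔼 a, ind (a ∈ w.bad) ≤ η) :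
    risk w (juntaLoop (fun j => Finset.univ.filter fun i => part i = j) k t F) (fun _ => 0) ≤
      t * (((m : ℝ) + 2) * η) := by
  change risk w (juntaLoop (blockOf Finset.univ part) k t F) (fun _ => 0) ≤ _
  induction t generalizing F with
  | zero => simp [juntaLoop, risk_pure]
  | succ t ih =>
    rw [juntaLoop, risk_bind, risk_unif]
    set U := otherBlocks F with hU
    have hUlen : U.length ≤ m + 1 := otherBlocks_length_le F
    set X := blockOf Finset.univ part with hX
    have hb : ∀ x u : Str n, splice (blockUnion X F) x u = splice (Finset.univ \ blockUnion X F) u x := by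
      intro x u; funext i; simp only [splice]
      by_cases hi : i ∈ blockUnion X F <;> simp [hi]
    set G : Str n → Str n → Prop := fun x u =>
      ∀ p : Fin (m + 2), splice (blockUnion X (U.take p)) u x ∉ w.bad with hG
    have hK : 0 ≤ (t : ℝ) * (((m : ℝ) + 2) * η) := by positivity
    calc _ ≤ 𝔼 x : Str n, 𝔼 u : Str n, (ind (¬ G x u) + t * (((m : ℝ) + 2) * η)) := by
          refine Finset.expect_le_expect fun x _ => ?_
          rw [risk_bind, risk_unif]
          refine Finset.expect_le_expect fun u _ => ?_
          by_cases hg : G x u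
          swap
          · rw [ind_true hg]
            exact (risk_le_one _ _ fun _ => zero_le_one).trans (by linarith)
          rw [ind_false (not_not.2 hg), zero_add]
          have hP : ∀ p ≤ U.length, prefixPoint X U (splice (blockUnion X F) x u) x p ∉ w.bad := by
            intro p hp
            rw [hb, hX, prefixPoint_otherBlocks]
            exact hg ⟨p, by omega⟩
          have hbU : prefixPoint X U (splice (blockUnion X F) x u) x U.length =
              splice (blockUnion X F) x u := by
            rw [hb]; exact prefixPoint_otherBlocks_length _ part F u x
          have hx : x ∉ w.bad := by
            have := hP 0 (Nat.zero_le _)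
            rwa [prefixPoint_zero] at this
          have hy : splice (blockUnion X F) x u ∉ w.bad := by
            have := hP _ le_rfl
            rwa [hbU] at this
          rw [risk_bind, risk_ask, if_neg hx, risk_bind, risk_ask, if_neg hy]
          split
          · exact ih F
          · rename_i hne
            obtain ⟨i, hi, -, -, e3⟩ := risk_binarySearch w X U _ _ x hP hbU rfl (Ne.symm hne)
            rw [risk_bind, e3]
            split_ifs
            · rw [risk_pure]; exact hK
            · exact ih _
      _ ≤ ((m : ℝ) + 2) * η + t * (((m : ℝ) + 2) * η) := by
          simp only [Finset.expect_add_distrib, Fintype.expect_const]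
          refine add_le_add ?_ le_rfl
          calc 𝔼 x : Str n, 𝔼 u : Str n, ind (¬ G x u)
              ≤ 𝔼 x : Str n, 𝔼 u : Str n, ∑ p : Fin (m + 2),
                ind (splice (blockUnion X (U.take p)) u x ∈ w.bad) := by
                refine Finset.expect_le_expect fun x _ => Finset.expect_le_expect fun u _ => ?_
                refine le_trans (ind_mono ?_) (ind_exists_le _)
                intro h; simpa [hG] using h
            _ = ∑ p : Fin (m + 2), 𝔼 x : Str n, 𝔼 u : Str n,
                ind (splice (blockUnion X (U.take p)) u x ∈ w.bad) := by
                simp only [Finset.expect_sum_comm]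
            _ ≤ ∑ p : Fin (m + 2), η := Finset.sum_le_sum fun p _ => by
                rw [expect_splice _ fun x => ind (x ∈ w.bad)]; exact hd
            _ = _ := by simp
      _ = _ := by push_cast; ring

/-- CheckLit asks only queries that are uniform on a block. -/
theorem risk_checkLit_le {c : TesterConsts} {r μ M : ℕ} {ε : ℝ} (h : ParamBound c r μ ε M)
    (hη : 0 ≤ η) (L : List (LocalOracle n)) (hL : ∀ o ∈ L, ∃ t, IsLiteral w η o t) :
    risk w (checkLit c L) (fun _ => 0) ≤ L.length * (M * (M * ((M + 2) * η)) + 20 * η) := by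
  induction L with
  | nil => simp [checkLit, risk_pure]
  | cons o L ih =>
    obtain ⟨t, ho⟩ := hL o List.mem_cons_self
    have ih' := ih fun o' ho' => hL o' (List.mem_cons_of_mem _ ho')
    set K : ℝ := M * (M * ((M + 2) * η)) with hKdef
    have hK : 0 ≤ K := by positivity
    have hLK : 0 ≤ (L.length : ℝ) * (K + 20 * η) := by positivity
    rw [checkLit]
    have j1 : risk w (Prog.subst (askLocal o) Prog.sample (uniformJunta c 1 (1 / 30) (1 / 100)))
        (fun _ => 0) ≤ K := by
      change risk w (Prog.subst (fun x => Prog.ask (splice o.1 x o.2)) Prog.sample _) _ ≤ _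
      rw [risk_subst_ask]
      refine (risk_repeatAll_zero _ _ _).trans ?_
      refine mul_le_mul (Nat.cast_le.2 h.junta_reps) ?_ (risk_nonneg _ _ fun _ => le_rfl)
        (Nat.cast_nonneg _)
      rw [risk_bind, risk_unif]
      calc _ ≤ 𝔼 _part : Fin n → Fin (⌈(c.juntaBlocks : ℝ) * ((1 : ℕ) : ℝ) ^ 9 / (1 / 30) ^ 5⌉₊ + 1),
            M * ((M + 2) * η) := by
            refine Finset.expect_le_expect fun part _ => ?_
            refine (risk_juntaLoop_le (w.pull fun x => splice o.1 x o.2) part 1 _ [] hη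
              ho.dens).trans ?_
            have h1 : ((⌈(c.juntaBlocks : ℝ) * ((1 : ℕ) : ℝ) ^ 9 / (1 / 30) ^ 5⌉₊ : ℕ) : ℝ) ≤ M :=
              Nat.cast_le.2 (by have := h.junta_blocks; omega)
            exact mul_le_mul (Nat.cast_le.2 h.junta_rounds)
              (mul_le_mul_of_nonneg_right (by linarith) hη) (by positivity) (by positivity)
        _ = _ := Fintype.expect_const _
    have j2 : risk w (Prog.repeatAll 10 (do
        let a ← Prog.unif (Str n)
        let p ← askLocal o a
        let q ← askLocal o fun j => !(a j)
        pure (p != q))) (fun _ => 0) ≤ 20 * η := by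
      refine (risk_repeatAll_zero _ _ _).trans ?_
      have := risk_ask_twice_le w ho (fun a j => !(a j)) (fun a => by simp) (φ := fun _ => 0)
        (fun _ => le_rfl) (K := 0) fun a => le_rfl
      push_cast
      linarith
    refine (risk_bind_le_of_forall w (δ₁ := K) (δ₂ := 20 * η + L.length * (K + 20 * η))
      (by positivity) j1 fun b => ?_).trans (by rw [List.length_cons]; push_cast; linarith)
    split_ifs
    · refine risk_bind_le_of_forall w hLK j2 fun b => ?_
      split_ifs
      · exact ih'
      · rw [risk_pure]; exact hLK
    · rw [risk_pure]; positivity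

/-- Flipping some of the blocks of a string is an involution. -/
theorem flip_involutive (L : List (LocalOracle n)) (b : Fin L.length → Bool) :
    Function.Involutive fun (y : Str n) j =>
      if ∃ i, j ∈ (L.get i).1 ∧ b i = true then !(y j) else y j := by
  intro y; funext j
  dsimp only; split_ifs <;> simp

/-- The law of Sim-SAMP-J has a density of at most `2 ^ ℓ / |J⁻¹(1)|` with respect to the uniform
law, because every set of flipped blocks contributes a density of at most `1 / |J⁻¹(1)|`. -/
theorem risk_simSAMPJ_le {c : TesterConsts} {r μ M : ℕ} {ε : ℝ} (h : ParamBound c r μ ε M)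
    (h1 : 1 ≤ ⌈(c.extract : ℝ) * Real.logb 2 ((μ : ℝ) / kappa ε)⌉₊) (hη : 0 ≤ η)
    (L : List (LocalOracle n)) (hL : L.length ≤ M)
    (t : Fin L.length → Fin n) (ht : ∀ i, IsLiteral w η (L.get i) (t i)) (J : Str L.length → Bool)
    (hJ : (sat J).Nonempty) (φ : Str n → ℝ) (h0 : ∀ z, 0 ≤ φ z) (hφ : ∀ z, φ z ≤ 1) :
    risk w (simSAMPJ c μ ε L J) φ ≤
      M * (M * (2 * η)) + 2 ^ L.length / (sat J).card * 𝔼 y, φ y := by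
  classical
  rw [simSAMPJ, risk_bind, risk_unif]
  simp only [dif_pos hJ]
  set K : ℝ := M * (M * (2 * η))
  have hc : (0 : ℝ) < (sat J).card := Nat.cast_pos.2 hJ.card_pos
  -- `fl b` flips the blocks selected by `b`; Sim-SAMP-J applies it for a `b` that depends on `y`,
  -- so all `b` are summed over
  set fl : (Fin L.length → Bool) → Str n → Str n := fun b y j =>
    if ∃ i, j ∈ (L.get i).1 ∧ b i = true then !(y j) else y j with hfl
  calc _ ≤ 𝔼 y : Str n, (K + (∑ b : Str L.length, φ (fl b y)) / (sat J).card) := by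
        refine Finset.expect_le_expect fun y _ => ?_
        rw [risk_bind, risk_unifOn]
        have key : ∀ z : Str L.length, risk w (do
            let x ← extract c μ L y (kappa ε)
            pure fun j => if ∃ i, j ∈ (L.get i).1 ∧ x i ≠ z i then !(y j) else y j) φ ≤
            φ (fl (bxor (fun i => y (t i)) z) y) + K := by
          intro z
          rw [risk_bind]
          simp only [risk_pure]
          refine (risk_extract_le w c μ L t ht y _ hη hL h1 h.extract_kappa _ (fun _ => h0 _)
            (fun _ => hφ _)).trans (le_of_eq ?_)
          congr 2
          funext j
          simp only [hfl, bxor]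
          congr 1
          refine propext (exists_congr fun i => and_congr_right fun _ => ?_)
          cases y (t i) <;> cases z i <;> simp
        refine (Finset.expect_le_expect fun z _ => key z).trans ?_
        rw [Finset.expect_add_distrib, Finset.expect_const hJ, add_comm,
          Finset.expect_eq_sum_div_card]
        refine add_le_add le_rfl (div_le_div_of_nonneg_right ?_ hc.le)
        rw [← Fintype.sum_equiv (bxor_involutive fun i => y (t i)).toPerm
          (fun z => φ (fl (bxor (fun i => y (t i)) z) y)) (fun b => φ (fl b y)) fun z => rfl]
        exact Finset.sum_le_sum_of_subset_of_nonneg (Finset.subset_univ _) fun _ _ _ => h0 _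
    _ = _ := by
        rw [Finset.expect_add_distrib, Fintype.expect_const, ← Finset.expect_div,
          Finset.expect_sum_comm]
        congr 1
        rw [Finset.sum_congr rfl fun b _ =>
          expect_involutive (fl b) (flip_involutive L b) φ]
        simp; ring

end Literals

/-! ### The consistency checks -/

section ConsCheck

variable {n : ℕ} (h : Str n → Bool) (hh : (sat h).Nonempty) (B : Set (Str n))

/-- The consistency checks are unlikely to query a bad point if the law of the simulated samples has
a density of at most `Λ`, and `h` does not depend on the coordinates `F`. -/
theorem risk_consCheck_le {c : TesterConsts} {r μ M : ℕ} {ε : ℝ} (hp : ParamBound c r μ ε M)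
    (R F : Finset (Fin n)) (hF : ∀ u z, h (splice F u z) = h z) (mqJ : Str n → Prog n Bool)
    (sampJ : Prog n (Str n)) {η₁ η₂ Λ : ℝ} (hη₁ : 0 ≤ η₁) (hη₂ : 0 ≤ η₂)
    (hmq : ∀ z, risk (World.ofFun h hh B) (mqJ z) (fun _ => 0) ≤ η₁)
    (hsamp : ∀ φ : Str n → ℝ, (∀ z, 0 ≤ φ z) → (∀ z, φ z ≤ 1) →
      risk (World.ofFun h hh B) sampJ φ ≤ η₁ + Λ * 𝔼 y, φ y)
    (hdens : ∀ a, 𝔼 u, Λ * 𝔼 y, ind (splice R y (splice F u a) ∈ B) ≤ η₂) :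
    risk (World.ofFun h hh B) (consCheck c ε R mqJ sampJ) (fun _ => 0) ≤
      4 * M ^ 2 * (η₁ + η₂) := by
  set w := World.ofFun h hh B with hw
  set ρ : Str n → ℝ := fun a => η₁ + Λ * 𝔼 y, ind (splice R y a ∈ B) with hρ
  have hask : ∀ a, risk w (do let v ← sampJ; Prog.ask (splice R v a)) (fun _ => 0) ≤ ρ a := by
    intro a
    rw [risk_bind]
    simp only [risk_ask_zero]
    exact hsamp _ (fun _ => ind_nonneg _) fun _ => ind_le_one _
  -- the conjunction test queries the sum of a sample and of other points, hence the shift by `q`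
  have hshift : ∀ q, 𝔼 z ∈ sat h, ρ (bxor q z) ≤ η₁ + η₂ := by
    intro q
    refine expect_sat_shift_le h hh F hF ρ (fun a => ?_) q
    rw [Finset.expect_add_distrib, Fintype.expect_const]
    linarith [hdens a]
  have h0 : 𝔼 z ∈ sat h, ρ z ≤ η₁ + η₂ := by
    have := hshift fun _ => false
    simpa only [bxor_zero_left] using this
  have hη : 0 ≤ η₁ + η₂ := by positivity
  have hM := hp.hundred
  have hMr : (100 : ℝ) ≤ M := by exact_mod_cast hM
  have one : ∀ {α : Type} (q : Str n) (g : Str n → Prog n α) (K : ℝ), 0 ≤ K →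
      (∀ z, risk w (g z) (fun _ => 0) ≤ K * ρ (bxor q z)) →
      risk w (Prog.sample >>= g) (fun _ => 0) ≤ K * (η₁ + η₂) := by
    intro α q g K hK hg
    rw [risk_bind, risk_sample_ofFun]
    refine (Finset.expect_le_expect fun z _ => hg z).trans ?_
    rw [← Finset.mul_expect]
    exact mul_le_mul_of_nonneg_left (hshift q) hK
  have g1 : risk w (Prog.repeatAll ⌈(c.verify : ℝ) / ε⌉₊ (do
      let z ← Prog.sample
      if ← mqJ z then
        Prog.repeatAll 100 do
          let v ← sampJ
          Prog.ask (splice R v z)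
      else pure false)) (fun _ => 0) ≤ M * (101 * (η₁ + η₂)) := by
    refine (risk_repeatAll_zero w _ _).trans (mul_le_mul (Nat.cast_le.2 hp.verify) ?_
      (risk_nonneg _ _ fun _ => le_rfl) (Nat.cast_nonneg _))
    rw [risk_bind, risk_sample_ofFun]
    have key : ∀ z, risk w (do
        if ← mqJ z then
          Prog.repeatAll 100 do
            let v ← sampJ
            Prog.ask (splice R v z)
        else pure false) (fun _ => 0) ≤ η₁ + 100 * ρ z := by
      intro z
      have hρ0 : 0 ≤ ρ z := le_trans (risk_nonneg _ _ fun _ => le_rfl) (hask z)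
      refine risk_bind_le_of_forall w (by positivity) (hmq z) fun b => ?_
      split_ifs
      · refine (risk_repeatAll_zero w _ _).trans ?_
        push_cast
        exact mul_le_mul_of_nonneg_left (hask z) (by norm_num)
      · rw [risk_pure]; positivity
    refine (Finset.expect_le_expect fun z _ => key z).trans ?_
    rw [Finset.expect_add_distrib, Finset.expect_const hh, ← Finset.mul_expect]
    linarith
  have g2 : risk w (Prog.repeatAll ⌈(c.verify' : ℝ) / ε⌉₊ (do
      let z ← Prog.sample
      let v ← sampJ
      Prog.ask (splice R v z))) (fun _ => 0) ≤ M * (1 * (η₁ + η₂)) := by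
    refine (risk_repeatAll_zero w _ _).trans (mul_le_mul (Nat.cast_le.2 hp.verify') ?_
      (risk_nonneg _ _ fun _ => le_rfl) (Nat.cast_nonneg _))
    refine one (fun _ => false) _ 1 zero_le_one fun z => ?_
    rw [bxor_zero_left, one_mul]; exact hask z
  have hgamma : ∀ a, risk w (simMQGamma c ε R sampJ a) (fun _ => 0) ≤ M * ρ a := fun a =>
    (risk_repeatAll_zero w _ _).trans (mul_le_mul (Nat.cast_le.2 hp.gamma) (hask a)
      (risk_nonneg _ _ fun _ => le_rfl) (Nat.cast_nonneg _))
  have hMη : 0 ≤ (M : ℝ) * (η₁ + η₂) := by positivity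
  have g3 : risk w (Prog.subst (simMQGamma c ε R sampJ) Prog.sample (conjTest c (ε / 10)))
      (fun _ => 0) ≤ M * (M * (η₁ + η₂)) + M * (M * (η₁ + η₂)) := by
    -- each query of the test is the shift of a fresh sample by a string that does not depend on it
    simp only [conjTest, antiMonotoneConjTest, subst_bind, subst_sample]
    have s0 : risk w (Prog.sample (n := n)) (fun _ => 0) ≤ 0 := by
      rw [risk_sample_ofFun, Finset.expect_const_zero]
    refine (risk_bind_le_of_forall w (δ₂ := M * (M * (η₁ + η₂)) + M * (M * (η₁ + η₂)))
      (by positivity) s0 fun y₀ => ?_).trans (by rw [zero_add])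
    simp only [subst_repeatAll, subst_bind, subst_sample, subst_ask, subst_pure]
    refine risk_bind_le_of_forall w (by positivity) ?_ fun b => ?_
    · refine (risk_repeatAll_zero w _ _).trans (mul_le_mul (Nat.cast_le.2 hp.conj) ?_
        (risk_nonneg _ _ fun _ => le_rfl) (Nat.cast_nonneg _))
      rw [risk_bind]
      simp only [risk_bind w Prog.sample, risk_pure]
      rw [risk_sample_ofFun]
      refine (Finset.expect_le_expect (g := fun _ => (M : ℝ) * (η₁ + η₂)) fun x _ => ?_).trans
        (by rw [Finset.expect_const hh])
      rw [risk_bind, risk_bind]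
      simp only [risk_pure]
      have := one (bxor (bxor x y₀) (bxor y₀ y₀))
        (fun y => simMQGamma c ε R sampJ (bxor (bxor (bxor x y₀) (bxor y y₀)) y₀)) M
        (Nat.cast_nonneg _) fun y => by
          have e : bxor (bxor (bxor x y₀) (bxor y y₀)) y₀ =
              bxor (bxor (bxor x y₀) (bxor y₀ y₀)) y := by
            funext i; simp only [bxor]
            cases x i <;> cases y i <;> cases y₀ i <;> rfl
          rw [e]; exact hgamma _
      rwa [risk_bind] at this
    · split_ifs
      · rw [subst_repeatAll, subst_repeatAll]
        refine (risk_repeatAll_zero w _ _).trans (mul_le_mul (Nat.cast_le.2 hp.conj') ?_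
          (risk_nonneg _ _ fun _ => le_rfl) (Nat.cast_nonneg _))
        simp only [subst_bind, subst_sample, subst_ask, subst_pure, subst_unif]
        rw [risk_bind, risk_bind, risk_sample_ofFun]
        refine (Finset.expect_le_expect (g := fun _ => (M : ℝ) * (η₁ + η₂)) fun x _ => ?_).trans
          (by rw [Finset.expect_const hh])
        simp only [risk_pure]
        rw [risk_bind, risk_unif]
        refine (Finset.expect_le_expect (g := fun _ => (M : ℝ) * (η₁ + η₂)) fun v _ => ?_).trans
          (by rw [Fintype.expect_const])
        rw [risk_bind, risk_bind]
        simp only [risk_pure]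
        have := one (bxor (fun i => bxor x y₀ i && v i) (bxor y₀ y₀))
          (fun u => simMQGamma c ε R sampJ (bxor (bxor (fun i => bxor x y₀ i && v i)
            (bxor u y₀)) y₀)) M (Nat.cast_nonneg _) fun u => by
            have e : bxor (bxor (fun i => bxor x y₀ i && v i) (bxor u y₀)) y₀ =
                bxor (bxor (fun i => bxor x y₀ i && v i) (bxor y₀ y₀)) u := by
              funext i; simp only [bxor]
              cases x i <;> cases v i <;> cases u i <;> cases y₀ i <;> rfl
            rw [e]; exact hgamma _
        rwa [risk_bind] at this
      · rw [subst_pure, subst_pure, risk_pure]; positivity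
  rw [consCheck]
  refine (risk_bind_le_of_forall w (δ₂ := M * (1 * (η₁ + η₂)) +
    (M * (M * (η₁ + η₂)) + M * (M * (η₁ + η₂)))) (by positivity) g1 fun b => ?_).trans ?_
  · split_ifs
    · refine risk_bind_le_of_forall w (by positivity) g2 fun b => ?_
      split_ifs
      · exact g3
      · rw [risk_pure]; positivity
    · rw [risk_pure]; positivity
  · nlinarith [mul_le_mul_of_nonneg_right hMr hMη]

end ConsCheck

/-! ### The candidate of FindCandidate -/

section Candidate

variable {n : ℕ} (h : Str n → Bool) (hh : (sat h).Nonempty) (B : Set (Str n))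

/-- A set of at most `r` elements is enumerated by `r` optional elements. -/
theorem exists_option_family {r : ℕ} {α : Type} (D : Finset α) (hD : D.card ≤ r) :
    ∃ g : Fin r → Option α, ∀ T, T ∈ D ↔ ∃ i, g i = some T := by
  refine ⟨fun i => D.toList[(i : ℕ)]?, fun T => ?_⟩
  rw [← Finset.mem_toList, List.mem_iff_getElem?]
  constructor
  · rintro ⟨i, hi⟩
    have : i < D.toList.length := (List.getElem?_eq_some_iff.1 hi).1
    rw [Finset.length_toList] at this
    exact ⟨⟨i, by omega⟩, hi⟩
  · rintro ⟨i, hi⟩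
    exact ⟨i, hi⟩

open Classical in
/-- With few exceptions, a function that is consistent with the extracted samples is `1` on most
extracted samples, as there are at most `4 ^ (μ r)` candidates. -/
theorem risk_findCandidate_le {c : TesterConsts} {r μ M : ℕ} {ε : ℝ} (hp : ParamBound c r μ ε M)
    (h1 : 1 ≤ ⌈(c.extract : ℝ) * Real.logb 2 ((μ : ℝ) / (1 / 2))⌉₊) (hμ : 1 ≤ μ)
    (hocc : (4 : ℝ) ^ (μ * r) * (1 / 2) ^ ⌈1 / (200 * xi r μ ε)⌉₊ ≤ 1 / 100)
    {η : ℝ} (hη : 0 ≤ η) (L : List (LocalOracle n)) (hL : L.length ≤ M)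
    (t : Fin L.length → Fin n) (ht : ∀ i, IsLiteral (World.ofFun h hh B) η (L.get i) (t i)) :
    risk (World.ofFun h hh B) (findCandidate c r μ ε L) (fun o => ind (¬ ∀ J, o = some J →
      1 / 2 ≤ 𝔼 z ∈ sat h, ind (J (fun i => z (t i)) = true))) ≤
      M * (M * (M * (2 * η))) + 1 / 100 := by
  set w := World.ofFun h hh B with hw
  set m := ⌈1 / (200 * xi r μ ε)⌉₊ with hm
  set big : (Str L.length → Bool) → Prop := fun J =>
    1 / 2 ≤ 𝔼 z ∈ sat h, ind (J (fun i => z (t i)) = true) with hbig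
  set p : Prog n (Fin L.length → Bool) := do
    let w ← Prog.sample
    extract c μ L w (1 / 2) with hpdef
  set φ : (Fin m → Fin L.length → Bool) → ℝ := fun z =>
    ind (∃ J ∈ dnfApprox r μ ε L.length, (∀ k, J (z k) = true) ∧ ¬ big J) with hφ
  have e1 : risk w (findCandidate c r μ ε L) (fun o => ind (¬ ∀ J, o = some J → big J)) ≤
      risk w (Prog.tabulate fun _ : Fin m => p) φ := by
    rw [findCandidate, risk_bind]
    refine risk_mono _ _ fun z => ?_
    dsimp only
    split_ifs with hA
    · rw [risk_pure]
      refine ind_mono fun hn => ?_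
      push Not at hn
      obtain ⟨J, hJ, hnb⟩ := hn
      have hmem := Function.argminOn_mem (fun J => (sat J).card)
        {J | J ∈ dnfApprox r μ ε L.length ∧ ∀ t, J (z t) = true} hA
      rw [Option.some.injEq] at hJ
      rw [hJ] at hmem
      exact ⟨J, hmem.1, hmem.2, hnb⟩
    · rw [risk_pure, ind_false (by simp)]
      exact ind_nonneg _
  have pz : risk w p (fun _ => 0) ≤ M * (M * (2 * η)) := by
    rw [hpdef, risk_bind, risk_sample_ofFun]
    refine (Finset.expect_le_expect fun x _ => risk_extract_le w c μ L t ht x _ hη hL h1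
      hp.extract_half (fun _ => 0) (fun _ => le_rfl) fun _ => zero_le_one).trans ?_
    rw [zero_add, Finset.expect_const hh]
  have e2 : risk w (Prog.tabulate fun _ : Fin m => p) (fun _ => 0) ≤
      M * (M * (M * (2 * η))) := by
    refine (risk_tabulate_zero w _).trans ?_
    rw [Finset.sum_const, Finset.card_univ, Fintype.card_fin, nsmul_eq_mul]
    exact mul_le_mul (Nat.cast_le.2 hp.candidates) pz (risk_nonneg _ _ fun _ => le_rfl)
      (Nat.cast_nonneg _)
  -- Without bad queries the extracted samples are independent; a candidate that is `1` on less
  -- than half of them survives with probability at most `2 ^ (-m)`. The candidates are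
  -- parametrized by the `r` optional terms of the DNF `D`.
  have e3 : risk w.safe (Prog.tabulate fun _ : Fin m => p) φ ≤ 1 / 100 := by
    by_cases hℓ : L.length ≤ μ
    swap
    · have : φ = fun _ => 0 := by
        funext z
        refine ind_false ?_
        rintro ⟨J, ⟨hℓ', -⟩, -⟩
        exact hℓ hℓ'
      rw [this, risk_const_of_safe _ rfl]; norm_num
    set Jof : (Fin r → Option (Term μ)) → Str L.length → Bool := fun g =>
      majority hℓ (dnf (Finset.univ.filter fun T => ∃ i, g i = some T)) with hJof
    have ps : ∀ J : Str L.length → Bool, risk w.safe p (fun z => ind (J z = true)) ≤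
        𝔼 z ∈ sat h, ind (J (fun i => z (t i)) = true) := by
      intro J
      rw [hpdef, hw, safe_ofFun, risk_bind, risk_sample_ofFun]
      refine Finset.expect_le_expect fun x _ => ?_
      refine (risk_extract_le (η := 0) (World.ofFun h hh ∅) c μ L t (fun i =>
        ⟨(ht i).mem, (ht i).eval, ?_⟩) x _ le_rfl hL h1 hp.extract_half _ (fun _ => ind_nonneg _)
        fun _ => ind_le_one _).trans (le_of_eq (by simp))
      have : ∀ a : Str n, ind (splice (L.get i).1 a (L.get i).2 ∈ (World.ofFun h hh ∅).bad) = 0 :=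
        fun a => ind_false (Set.notMem_empty _)
      simp only [this, Finset.expect_const_zero, le_refl]
    calc risk w.safe (Prog.tabulate fun _ : Fin m => p) φ
        ≤ risk w.safe (Prog.tabulate fun _ : Fin m => p) (fun z => ∑ g : Fin r → Option (Term μ),
            ind (¬ big (Jof g)) * ∏ k, ind (Jof g (z k) = true)) := by
          refine risk_mono _ _ fun z => ?_
          have hnn : ∀ g : Fin r → Option (Term μ),
              0 ≤ ind (¬ big (Jof g)) * ∏ k, ind (Jof g (z k) = true) := fun g =>
            mul_nonneg (ind_nonneg _) (Finset.prod_nonneg fun _ _ => ind_nonneg _)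
          by_cases hex : ∃ J ∈ dnfApprox r μ ε L.length, (∀ k, J (z k) = true) ∧ ¬ big J
          swap
          · rw [hφ]; dsimp only; rw [ind_false hex]
            exact Finset.sum_nonneg fun g _ => hnn g
          · rw [hφ]; dsimp only; rw [ind_true hex]
            obtain ⟨J, ⟨hℓ', D, ⟨E, hE, rfl⟩, -, rfl⟩, hall, hnb⟩ := hex
            obtain ⟨g, hg⟩ := exists_option_family E hE
            have hEg : (Finset.univ.filter fun T => ∃ i, g i = some T) = E := by
              ext T; simp [hg]
            have hJg : Jof g = majority hℓ (dnf E) := by rw [hJof]; dsimp only; rw [hEg]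
            refine le_trans (le_of_eq ?_) (Finset.single_le_sum (fun g _ => hnn g)
              (Finset.mem_univ g))
            rw [hJg, ind_true hnb, Finset.prod_congr rfl fun k _ => ind_true (hall k)]
            simp
      _ = ∑ g : Fin r → Option (Term μ),
            ind (¬ big (Jof g)) * ∏ _k : Fin m, risk w.safe p (fun z => ind (Jof g z = true)) := by
          rw [risk_sum_of_safe _ rfl]
          refine Finset.sum_congr rfl fun g _ => ?_
          rw [risk_mul_of_safe _ rfl,
            risk_tabulate_prod _ rfl _ fun _ z => ind (Jof g z = true)]
      _ ≤ ∑ _g : Fin r → Option (Term μ), (1 / 2 : ℝ) ^ m := by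
          refine Finset.sum_le_sum fun g _ => ?_
          by_cases hb : big (Jof g)
          · rw [ind_false (not_not.2 hb), zero_mul]; positivity
          · rw [ind_true hb, one_mul, Finset.prod_const, Finset.card_univ, Fintype.card_fin]
            refine pow_le_pow_left₀ (risk_nonneg _ _ fun _ => ind_nonneg _) ?_ _
            exact (ps _).trans (not_le.1 hb).le
      _ = ((3 ^ μ + 1) ^ r : ℕ) * (1 / 2 : ℝ) ^ m := by
          rw [Finset.sum_const, nsmul_eq_mul]
          congr 2
          simp [Finset.card_univ, Term]
      _ ≤ (4 : ℝ) ^ (μ * r) * (1 / 2) ^ m := by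
          refine mul_le_mul_of_nonneg_right ?_ (by positivity)
          rw [pow_mul]; push_cast
          refine pow_le_pow_left₀ (by positivity) ?_ _
          have : 3 ^ μ + 1 ≤ 4 ^ μ := Nat.succ_le_of_lt
            (Nat.pow_lt_pow_left (by norm_num) (by omega))
          exact_mod_cast this
      _ ≤ 1 / 100 := hocc
  calc _ ≤ _ := e1
    _ ≤ risk w (Prog.tabulate fun _ : Fin m => p) (fun _ => 0) +
        risk w.safe (Prog.tabulate fun _ : Fin m => p) φ :=
      risk_le_add_safe w _ fun _ => ind_nonneg _
    _ ≤ _ := add_le_add e2 e3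

end Candidate

/-! ### The coordinates on which the samples differ -/

section Relevant

variable {n : ℕ} (h : Str n → Bool) (hh : (sat h).Nonempty) (B : Set (Str n))

/-- The function depends only on the variables `H ∪ V`, and on `H` its satisfying strings agree. -/
structure IsHeadTail (H V : Finset (Fin n)) : Prop where
  congr : ∀ x y, (∀ i ∈ H ∪ V, x i = y i) → h x = h y
  const : ∃ c : Str n, ∀ z, h z = true → ∀ i ∈ H, z i = c i

/-- Outside `G`, a satisfying string of `h` is `c` with probability at least `3 / 4`. -/
def IsConcentrated (G : Finset (Fin n)) (c : Str n) : Prop :=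
  𝔼 z ∈ sat h, ind (¬ ∀ i ∉ G, z i = c i) ≤ 1 / 4

/-- The coordinates on which the given strings do not all agree. -/
def nonconstant {m : ℕ} (z : Fin m → Str n) : Finset (Fin n) :=
  Finset.univ.filter fun i => ∃ t t', z t i = true ∧ z t' i = false

theorem expect_ind_not (s : Finset (Str n)) (hs : s.Nonempty) (P : Str n → Prop) :
    𝔼 z ∈ s, ind (¬ P z) = 1 - 𝔼 z ∈ s, ind (P z) := by
  rw [eq_sub_iff_add_eq, ← Finset.expect_add_distrib, ← Finset.expect_const hs (1 : ℝ)]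
  refine Finset.expect_congr rfl fun z _ => ?_
  by_cases hz : P z <;> simp [ind, hz]

/-- The initial samples find all the variables of the tail, except for those that are nearly
constant. -/
theorem risk_samples_le {μ : ℕ} (hμ : 1 ≤ μ) {H V : Finset (Fin n)} (hHV : IsHeadTail h H V)
    (hV : V.card ≤ μ) (m : ℕ) :
    risk (World.ofFun h hh B) (Prog.tabulate fun _ : Fin m => Prog.sample) (fun z => ind (¬
      (Disjoint (nonconstant z) H ∧ ∃ c, IsConcentrated h (nonconstant z ∪ (H ∪ V)ᶜ) c))) ≤
      μ * (2 * (1 - 1 / (4 * (μ : ℝ))) ^ m) := by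
  classical
  have hμr : (1 : ℝ) ≤ μ := by exact_mod_cast hμ
  have hδ0 : 0 < 1 / (4 * (μ : ℝ)) := by positivity
  have hδ1 : 1 / (4 * (μ : ℝ)) ≤ 1 / 4 := by
    rw [div_le_div_iff₀ (by positivity) (by norm_num)]; linarith
  set δ := 1 / (4 * (μ : ℝ)) with hδ
  -- `c` is the more frequent value of each coordinate, and `q` the frequency of the other value
  set c : Str n := fun i => decide (1 / 2 ≤ 𝔼 z ∈ sat h, ind (z i = true)) with hc
  set q : Fin n → ℝ := fun i => 𝔼 z ∈ sat h, ind (z i ≠ c i) with hq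
  have hq2 : ∀ i, q i ≤ 1 / 2 := by
    intro i
    by_cases hci : 1 / 2 ≤ 𝔼 z ∈ sat h, ind (z i = true)
    · have : c i = true := by simp only [hc, hci, decide_true]
      simp only [hq, this, ne_eq]
      rw [expect_ind_not _ hh]; linarith
    · have : c i = false := by simp only [hc, hci, decide_false]
      simp only [hq, this, ne_eq, Bool.not_eq_false]
      linarith
  obtain ⟨cH, hcH⟩ := hHV.const
  set w := World.ofFun h hh B with hw
  have hz : risk w (Prog.tabulate fun _ : Fin m => Prog.sample) (fun _ => 0) = 0 := by
    refine le_antisymm ((risk_tabulate_zero w _).trans ?_) (risk_nonneg _ _ fun _ => le_rfl)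
    simp [hw, risk_sample_ofFun]
  have hall : risk w (Prog.tabulate fun _ : Fin m => Prog.sample)
      (fun z => ind (¬ ∀ t, h (z t) = true)) ≤ 0 := by
    refine (risk_tabulate_union w (fun _ : Fin m => Prog.sample)
      fun _ z => h z = true).trans (le_of_eq ?_)
    refine Finset.sum_eq_zero fun i _ => ?_
    rw [hw, risk_sample_ofFun, Finset.expect_congr rfl fun z hz =>
      ind_false (not_not.2 (mem_sat.1 hz)), Finset.expect_const_zero]
  have hpow : ∀ P : Str n → Prop, risk w (Prog.tabulate fun _ : Fin m => Prog.sample)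
      (fun z => ind (∀ t, P (z t))) ≤ (𝔼 z ∈ sat h, ind (P z)) ^ m := by
    intro P
    refine (risk_le_add_safe w _ fun _ => ind_nonneg _).trans ?_
    rw [hz, zero_add, hw, safe_ofFun]
    have : ∀ z : Fin m → Str n, ind (∀ t, P (z t)) = ∏ t, ind (P (z t)) := by
      intro z
      by_cases hP : ∀ t, P (z t)
      · rw [ind_true hP, Finset.prod_congr rfl fun t _ => ind_true (hP t), Finset.prod_const_one]
      · rw [ind_false hP]
        push Not at hP
        obtain ⟨t, ht⟩ := hP
        rw [Finset.prod_eq_zero (Finset.mem_univ t) (ind_false ht)]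
    simp only [this]
    rw [risk_tabulate_prod _ rfl _ fun _ z => ind (P z)]
    simp [risk_sample_ofFun]
  -- a variable that is not nearly constant differs between two of the samples
  have hone : ∀ i, risk w (Prog.tabulate fun _ : Fin m => Prog.sample)
      (fun z => ind (δ < q i ∧ ((∀ t, z t i = c i) ∨ ∀ t, z t i ≠ c i))) ≤
      2 * (1 - δ) ^ m := by
    intro i
    have hpos : 0 ≤ (1 - δ) ^ m := pow_nonneg (by linarith) _
    by_cases hi : δ < q i
    swap
    · simp only [hi, false_and, ind_false not_false]
      rw [hz]; linarith
    · simp only [hi, true_and]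
      refine (risk_mono _ _ fun z => ind_or_le _ _).trans ((risk_add_le _ _ _ _).trans ?_)
      have a1 := hpow fun z => z i = c i
      have a2 := hpow fun z => z i ≠ c i
      have b1 : 𝔼 z ∈ sat h, ind (z i = c i) ≤ 1 - δ := by
        have := expect_ind_not (sat h) hh fun z => z i = c i
        have hqi : q i = 𝔼 z ∈ sat h, ind (¬ z i = c i) := rfl
        linarith
      have b2 : 𝔼 z ∈ sat h, ind (z i ≠ c i) ≤ 1 - δ := (hq2 i).trans (by linarith)
      have c1 := pow_le_pow_left₀ (Finset.expect_nonneg fun _ _ => ind_nonneg _) b1 m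
      have c2 := pow_le_pow_left₀ (Finset.expect_nonneg fun _ _ => ind_nonneg _) b2 m
      linarith
  have hpos : 0 ≤ 2 * (1 - δ) ^ m := mul_nonneg two_pos.le (pow_nonneg (by linarith) _)
  calc _ ≤ risk w (Prog.tabulate fun _ : Fin m => Prog.sample) (fun z =>
        ind (¬ ∀ t, h (z t) = true) +
        ∑ i ∈ V, ind (δ < q i ∧ ((∀ t, z t i = c i) ∨ ∀ t, z t i ≠ c i))) := by
        refine risk_mono _ _ fun z => ?_
        by_cases hs : ∀ t, h (z t) = true
        swap
        · rw [ind_true hs]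
          exact (ind_le_one _).trans (le_add_of_nonneg_right
            (Finset.sum_nonneg fun _ _ => ind_nonneg _))
        by_cases hi : ∃ i ∈ V, δ < q i ∧ ((∀ t, z t i = c i) ∨ ∀ t, z t i ≠ c i)
        · obtain ⟨i, hiV, hi⟩ := hi
          refine (ind_le_one _).trans ?_
          rw [← ind_true hi, ind_false (not_not.2 hs), zero_add]
          exact Finset.single_le_sum (f := fun i =>
            ind (δ < q i ∧ ((∀ t, z t i = c i) ∨ ∀ t, z t i ≠ c i)))
            (fun _ _ => ind_nonneg _) hiV
        · refine le_of_eq_of_le (ind_false (not_not.2 ⟨?_, ?_⟩))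
            (add_nonneg (ind_nonneg _) (Finset.sum_nonneg fun _ _ => ind_nonneg _))
          · rw [Finset.disjoint_left]
            intro i hi hiH
            simp only [nonconstant, Finset.mem_filter, Finset.mem_univ, true_and] at hi
            obtain ⟨t, t', h1, h2⟩ := hi
            rw [hcH _ (hs t) i hiH] at h1
            rw [hcH _ (hs t') i hiH, h1] at h2
            cases h2
          · refine ⟨fun i => if i ∈ H then cH i else c i, ?_⟩
            unfold IsConcentrated
            calc _ ≤ 𝔼 z' ∈ sat h, ∑ i ∈ V \ nonconstant z, ind (z' i ≠ c i) := by
                  refine Finset.expect_le_expect fun z' hz' => ?_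
                  by_cases hgood : ∀ i ∉ nonconstant z ∪ (H ∪ V)ᶜ,
                      z' i = if i ∈ H then cH i else c i
                  · rw [ind_false (not_not.2 hgood)]
                    exact Finset.sum_nonneg fun _ _ => ind_nonneg _
                  · rw [ind_true hgood]
                    push Not at hgood
                    obtain ⟨i, hi, hne⟩ := hgood
                    simp only [Finset.mem_union, Finset.mem_compl, not_or] at hi
                    have hiH : i ∉ H := fun hiH => by
                      rw [if_pos hiH] at hne
                      exact hne (hcH _ (mem_sat.1 hz') i hiH)
                    rw [if_neg hiH] at hne
                    rw [← ind_true hne]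
                    exact Finset.single_le_sum (f := fun i => ind (z' i ≠ c i))
                      (fun _ _ => ind_nonneg _)
                      (Finset.mem_sdiff.2 ⟨by by_contra hiV; exact hi.2 ⟨hiH, hiV⟩, hi.1⟩)
              _ = ∑ i ∈ V \ nonconstant z, q i := Finset.expect_sum_comm _ _ _
              _ ≤ ∑ i ∈ V \ nonconstant z, δ := by
                  refine Finset.sum_le_sum fun i hi' => ?_
                  rw [Finset.mem_sdiff] at hi'
                  by_contra hlt
                  refine hi ⟨i, hi'.1, not_le.1 hlt, ?_⟩
                  by_contra! hne
                  obtain ⟨⟨t, ht⟩, t', ht'⟩ := hne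
                  refine hi'.2 ?_
                  simp only [nonconstant, Finset.mem_filter, Finset.mem_univ, true_and]
                  cases hci : c i
                  · rw [hci] at ht ht'
                    exact ⟨t, t', by simpa using ht, ht'⟩
                  · rw [hci] at ht ht'
                    exact ⟨t', t, ht', by simpa using ht⟩
              _ ≤ μ * δ := by
                  rw [Finset.sum_const, nsmul_eq_mul]
                  refine mul_le_mul_of_nonneg_right (Nat.cast_le.2 ?_) hδ0.le
                  exact (Finset.card_le_card Finset.sdiff_subset).trans hV
              _ = 1 / 4 := by rw [hδ]; field_simp
    _ ≤ 0 + ∑ i ∈ V, 2 * (1 - δ) ^ m := by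
        refine (risk_add_le _ _ _ _).trans (add_le_add hall ?_)
        refine (risk_le_add_safe w _ fun _ => Finset.sum_nonneg fun _ _ => ind_nonneg _).trans ?_
        rw [hz, zero_add, risk_sum_of_safe _ rfl]
        refine Finset.sum_le_sum fun i _ => ?_
        exact (risk_safe_le w _ fun _ => ind_le_one _).trans (hone i)
    _ ≤ _ := by
        rw [zero_add, Finset.sum_const, nsmul_eq_mul]
        exact mul_le_mul_of_nonneg_right (Nat.cast_le.2 hV) hpos

end Relevant

/-! ### Test-Factored-DNF on a factored DNF -/

section Tester

variable {n : ℕ} (h : Str n → Bool) (hh : (sat h).Nonempty) (B : Set (Str n))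

/-- Fraction of the bad points, relative to `h⁻¹(1)`. -/
noncomputable def badRatio : ℝ := (∑ x, ind (x ∈ B)) / (sat h).card

theorem badRatio_nonneg : 0 ≤ badRatio h B :=
  div_nonneg (Finset.sum_nonneg fun _ _ => ind_nonneg _) (Nat.cast_nonneg _)

/-- If the strings of `h⁻¹(1)` that lie in a certain subcube and satisfy `P` are a quarter of all,
then `P` cannot be rare on this subcube. The bound is stated in terms of the set `B`. -/
theorem expect_density_le (hh : (sat h).Nonempty) (R F : Finset (Fin n)) (c : Str n)
    (P : Str n → Prop) {Λ : ℝ} (hΛ : 0 < Λ)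
    (h1 : 1 / 4 ≤ 𝔼 z ∈ sat h, ind ((∀ i ∉ R ∪ F, z i = c i) ∧ P z))
    (h2 : Λ * 𝔼 w, ind (P (splice (R ∪ F) w c)) ≤ 1) (a : Str n) :
    𝔼 u, Λ * 𝔼 y, ind (splice R y (splice F u a) ∈ B) ≤ 4 * badRatio h B := by
  classical
  have hc : (0 : ℝ) < (sat h).card := Nat.cast_pos.2 hh.card_pos
  set G := R ∪ F with hG
  -- resampling `F` and then `R` amounts to resampling their union `G`
  have e1 : 𝔼 u, 𝔼 y, ind (splice R y (splice F u a) ∈ B) = 𝔼 w, ind (splice G w a ∈ B) := by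
    rw [← expect_splice R fun w => ind (splice G w a ∈ B)]
    refine Finset.expect_congr rfl fun u _ => Finset.expect_congr rfl fun y _ => ?_
    congr 2
    funext i
    simp only [splice, hG, Finset.mem_union]
    by_cases hR : i ∈ R <;> by_cases hF : i ∈ F <;> simp [hR, hF]
  have hpos : (0 : ℝ) < 2 ^ G.card := by positivity
  have e2 : (𝔼 w, ind (splice G w a ∈ B)) * 2 ^ G.card ≤ ∑ x, ind (x ∈ B) := by
    rw [expect_splice_eq G a fun x => ind (x ∈ B), div_mul_cancel₀ _ hpos.ne']
    exact Finset.sum_le_sum_of_subset_of_nonneg (Finset.subset_univ _) fun _ _ _ => ind_nonneg _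
  have e3 : (sat h).card / 4 ≤ (𝔼 w, ind (P (splice G w c))) * 2 ^ G.card := by
    rw [expect_splice_eq G c fun x => ind (P x), div_mul_cancel₀ _ hpos.ne']
    rw [Finset.expect_eq_sum_div_card, le_div_iff₀ hc] at h1
    calc ((sat h).card : ℝ) / 4 ≤ ∑ z ∈ sat h, ind ((∀ i ∉ G, z i = c i) ∧ P z) := by linarith
      _ ≤ ∑ z, ind ((∀ i ∉ G, z i = c i) ∧ P z) :=
          Finset.sum_le_sum_of_subset_of_nonneg (Finset.subset_univ _) fun _ _ _ => ind_nonneg _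
      _ = _ := by
          rw [Finset.sum_filter]
          refine Finset.sum_congr rfl fun z _ => ?_
          split_ifs with hz
          · exact ind_congr (and_iff_right hz)
          · exact ind_false fun h => hz h.1
  rw [← Finset.mul_expect, e1]
  set x := 𝔼 w, ind (splice G w a ∈ B)
  set y := 𝔼 w, ind (P (splice G w c))
  set N : ℝ := 2 ^ G.card
  have hx : 0 ≤ x := Finset.expect_nonneg fun _ _ => ind_nonneg _
  rw [badRatio, ← mul_div_assoc, le_div_iff₀ hc]
  -- `Λ x |h| ≤ 4 Λ x y N ≤ 4 x N ≤ 4 |B|`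
  have i1 : x * ((sat h).card / 4) ≤ x * (y * N) := mul_le_mul_of_nonneg_left e3 hx
  have i2 : Λ * (x * ((sat h).card / 4)) ≤ Λ * (x * (y * N)) := mul_le_mul_of_nonneg_left i1 hΛ.le
  have i3 : (Λ * y) * (x * N) ≤ 1 * (x * N) := mul_le_mul_of_nonneg_right h2 (by positivity)
  nlinarith

/-- What the consistency checks need to know about the simulators. -/
def GoodSim (R F : Finset (Fin n)) (η₁ η₂ : ℝ) (l : (Str n → Prog n Bool) × Prog n (Str n)) :
    Prop :=
  ∃ Λ : ℝ, (∀ z, risk (World.ofFun h hh B) (l.1 z) (fun _ => 0) ≤ η₁) ∧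
    (∀ φ : Str n → ℝ, (∀ z, 0 ≤ φ z) → (∀ z, φ z ≤ 1) →
      risk (World.ofFun h hh B) l.2 φ ≤ η₁ + Λ * 𝔼 y, φ y) ∧
    ∀ a, 𝔼 u, Λ * 𝔼 y, ind (splice R y (splice F u a) ∈ B) ≤ η₂

/-- The outcome of Approximate that the analysis needs: literals on distinct variables of `R`. -/
def GoodLocals (η : ℝ) (R : Finset (Fin n)) (L : List (LocalOracle n)) : Prop :=
  ∃ t : Fin L.length → Fin n, Function.Injective t ∧ (∀ i, t i ∈ R) ∧
    ∀ i, IsLiteral (World.ofFun h hh B) η (L.get i) (t i)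

/-- As the blocks of the list are distinct, so are the variables of the literals. -/
theorem GoodList.goodLocals {m : ℕ} {η : ℝ} {R : Finset (Fin n)} {part : Fin n → Fin (m + 1)}
    {L : List (Fin (m + 1) × Str n)} (hL : GoodList h hh B η (blockOf R part) L) :
    GoodLocals h hh B η R (L.map fun p => (blockOf R part p.1, p.2)) := by
  set L' := L.map fun p => (blockOf R part p.1, p.2) with hL'
  have hlen : L'.length = L.length := by rw [hL', List.length_map]
  have hget : ∀ i : Fin L'.length, L'.get i =
      (blockOf R part (L[(i : ℕ)]'(by omega)).1, (L[(i : ℕ)]'(by omega)).2) := by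
    intro i; simp [hL']
  have hex : ∀ i : Fin L'.length, ∃ t, IsLiteral (World.ofFun h hh B) η (L'.get i) t := by
    intro i
    rw [hget]
    exact hL.2 _ (List.getElem_mem _)
  choose t ht using hex
  have hmem : ∀ i : Fin L'.length, t i ∈ blockOf R part (L[(i : ℕ)]'(by omega)).1 := by
    intro i
    have := (ht i).mem
    rwa [hget] at this
  refine ⟨t, fun i j hij => ?_, fun i => (mem_blockOf.1 (hmem i)).1, ht⟩
  have h1 := (mem_blockOf.1 (hmem i)).2
  have h2 := (mem_blockOf.1 (hmem j)).2
  rw [hij, h2] at h1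
  have h3 : (L.map Prod.fst)[(i : ℕ)]'(lt_of_lt_of_eq i.2 (hlen.trans (List.length_map _).symm)) =
      (L.map Prod.fst)[(j : ℕ)]'(lt_of_lt_of_eq j.2
        (hlen.trans (List.length_map _).symm)) := by
    simp only [List.getElem_map]; exact h1.symm
  exact Fin.ext ((List.Nodup.getElem_inj_iff hL.1).1 h3)

/-- Approximate returns literals on distinct variables of `R`, unless the random partition fails to
separate the variables of the tail or a draw is bad. -/
theorem risk_approximate_le {c : TesterConsts} {r μ M : ℕ} {ε : ℝ} (hp : ParamBound c r μ ε M)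
    (hμ : 1 ≤ μ) (hblocks : 100 ≤ c.blocks) {H V : Finset (Fin n)} (hHV : IsHeadTail h H V)
    (hV : V.card ≤ μ) {R : Finset (Fin n)} (hR : Disjoint R H) {η : ℝ} (hη : 0 < η) (hη1 : η ≤ 1)
    (hB : badRatio h B ≤ η ^ 2) :
    risk (World.ofFun h hh B) (approximate c r μ ε R) (fun o => ind (¬ ∀ l, o = some l →
      GoodLocals h hh B η R l)) ≤ 1 / 100 + M ^ 5 * η := by
  have hM := hp.hundred
  have hMr : (100 : ℝ) ≤ M := by exact_mod_cast hM
  have hμr : (1 : ℝ) ≤ μ := by exact_mod_cast hμ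
  rw [approximate]
  refine risk_bind_le _ (fun part => Separates V part) (fun _ => ind_le_one _) (by positivity)
    ?_ fun part hpart => ?_
  · rw [risk_unif]
    refine (expect_not_separates_le V).trans ?_
    rw [div_le_div_iff₀ (by positivity) (by norm_num)]
    have h1 : (V.card : ℝ) ^ 2 ≤ (μ : ℝ) ^ 2 :=
      pow_le_pow_left₀ (Nat.cast_nonneg _) (Nat.cast_le.2 hV) 2
    have h2 : (100 : ℝ) ≤ c.blocks := by exact_mod_cast hblocks
    push_cast
    nlinarith [mul_le_mul_of_nonneg_right h2 (sq_nonneg (μ : ℝ))]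
  · rw [risk_bind]
    have hsep : Separates (R ∩ (H ∪ V)) part := by
      intro i hi j hj
      rw [Finset.mem_inter, Finset.mem_union] at hi hj
      exact hpart i (hi.2.resolve_left (Finset.disjoint_left.1 hR hi.1)) j
        (hj.2.resolve_left (Finset.disjoint_left.1 hR hj.1))
    refine le_trans (risk_mono _ _ fun o => ?_) ((risk_approximateLoop_le h hh B hη hη1
      hHV.congr R part hsep _ μ _ [] ⟨by simp, by simp⟩).trans ?_)
    · rcases o with _ | L
      · rw [risk_pure, ind_false (by simp)]; exact ind_nonneg _
      · rw [risk_pure]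
        refine ind_mono fun hn hg => hn ?_
        rintro l ⟨⟩
        exact GoodList.goodLocals h hh B (hg L rfl)
    · have d1 : ((⌊5 * Real.log (200 * (μ : ℝ)) / xi r μ ε⌋₊ + 1 : ℕ) : ℝ) ≤ M :=
        Nat.cast_le.2 hp.draws
      have d2 : (μ : ℝ) ≤ M := Nat.cast_le.2 hp.mu
      have d3 : ((c.blocks * μ ^ 2 : ℕ) : ℝ) + 2 ≤ M + 1 := by
        have := hp.blocks
        have : ((c.blocks * μ ^ 2 + 1 : ℕ) : ℝ) ≤ M := Nat.cast_le.2 this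
        push_cast at this ⊢; linarith
      have d4 : (∑ x, ind (x ∈ B)) / ((sat h).card : ℝ) / η ≤ η := by
        rw [div_le_iff₀ hη, ← sq]; exact hB
      set T : ℝ := ((⌊5 * Real.log (200 * (μ : ℝ)) / xi r μ ε⌋₊ + 1 : ℕ) : ℝ)
      have hT : 0 ≤ T := Nat.cast_nonneg _
      calc (μ * T + T) * ((((c.blocks * μ ^ 2 : ℕ) : ℝ) + 2) ^ 2 *
            ((∑ x, ind (x ∈ B)) / ((sat h).card : ℝ) / η))
          ≤ (M * M + M) * ((M + 1) ^ 2 * η) := by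
            have := badRatio_nonneg h B
            refine mul_le_mul (add_le_add (mul_le_mul d2 d1 hT (by positivity)) d1)
              (mul_le_mul (pow_le_pow_left₀ (by positivity) d3 2) d4 ?_ (by positivity))
              ?_ (by positivity)
            · exact div_nonneg this hη.le
            · exact mul_nonneg (by positivity) (div_nonneg this hη.le)
        _ = ((M * M + M) * (M + 1) ^ 2) * η := by ring
        _ ≤ M ^ 5 * η := by
            refine mul_le_mul_of_nonneg_right ?_ hη.le
            have : (M : ℝ) * (M + 1) ^ 3 ≤ M ^ 5 := by
              have h3 : ((M : ℝ) + 1) ^ 3 ≤ M ^ 4 := by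
                have h4 : (M : ℝ) + 1 ≤ 2 * M := by linarith
                calc ((M : ℝ) + 1) ^ 3 ≤ (2 * M) ^ 3 := pow_le_pow_left₀ (by positivity) h4 3
                  _ = 8 * M ^ 3 := by ring
                  _ ≤ M * M ^ 3 := by
                    refine mul_le_mul_of_nonneg_right ?_ (by positivity); linarith
                  _ = M ^ 4 := by ring
              calc (M : ℝ) * (M + 1) ^ 3 ≤ M * M ^ 4 := mul_le_mul_of_nonneg_left h3 (by positivity)
                _ = M ^ 5 := by ring
            nlinarith

/-- The risk of querying a bad point in FindCandidate. -/
theorem candidate_bound {M η : ℝ} (hM : 100 ≤ M) (hη : 0 ≤ η) :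
    M * (M * (M * (2 * η))) ≤ M ^ 5 * η := by
  have e : M * (M * (M * (2 * η))) = (2 * M ^ 3) * η := by ring
  have e' : M ^ 5 = M ^ 2 * M ^ 3 := by ring
  rw [e, e']
  refine mul_le_mul_of_nonneg_right (mul_le_mul_of_nonneg_right (by nlinarith) ?_) hη
  exact pow_nonneg (by linarith) _

/-- The risk of querying a bad point in CheckLit. -/
theorem literal_bound {M η : ℝ} (hM : 100 ≤ M) (hη : 0 ≤ η) :
    M * (M * (M * ((M + 2) * η)) + 20 * η) ≤ M ^ 5 * η := by
  have e : M * (M * (M * ((M + 2) * η)) + 20 * η) = (M ^ 4 + 2 * M ^ 3 + 20 * M) * η := by ring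
  rw [e]
  refine mul_le_mul_of_nonneg_right ?_ hη
  have h1 : 1 ≤ M := by linarith
  have h3 : M ^ 3 ≤ M ^ 4 := pow_le_pow_right₀ h1 (by norm_num)
  have h4 : M ≤ M ^ 4 := le_self_pow₀ h1 (by norm_num)
  have h5 : 100 * M ^ 4 ≤ M ^ 5 := by
    rw [pow_succ' M 4]; exact mul_le_mul_of_nonneg_right hM (by positivity)
  linarith

/-- The simulators that are returned query bad points rarely, and the density of the simulated
samples is bounded: the candidate is `1` on at least half of `h⁻¹(1)`, and three quarters of
`h⁻¹(1)` lie in the subcube given by `b`. -/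
theorem risk_dnfLearner_le {c : TesterConsts} {r μ M : ℕ} {ε : ℝ} (hp : ParamBound c r μ ε M)
    (hμ : 1 ≤ μ) (hblocks : 100 ≤ c.blocks)
    (h1 : 1 ≤ ⌈(c.extract : ℝ) * Real.logb 2 ((μ : ℝ) / (1 / 2))⌉₊)
    (h2 : 1 ≤ ⌈(c.extract : ℝ) * Real.logb 2 ((μ : ℝ) / kappa ε)⌉₊)
    (hocc : (4 : ℝ) ^ (μ * r) * (1 / 2) ^ ⌈1 / (200 * xi r μ ε)⌉₊ ≤ 1 / 100)
    {H V : Finset (Fin n)} (hHV : IsHeadTail h H V)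
    (hV : V.card ≤ μ) {R : Finset (Fin n)} (hR : Disjoint R H) {b : Str n}
    (hc : IsConcentrated h (R ∪ (H ∪ V)ᶜ) b) {η : ℝ} (hη : 0 < η) (hη1 : η ≤ 1)
    (hB : badRatio h B ≤ η ^ 2) :
    risk (World.ofFun h hh B) (dnfLearner c r μ ε R) (fun o => ind (¬ ∀ l, o = some l →
      GoodSim h hh B R (H ∪ V)ᶜ (M * (M * (2 * η))) (4 * η) l)) ≤ 2 / 100 + 3 * (M ^ 5 * η) := by
  have hM := hp.hundred
  have hMr : (100 : ℝ) ≤ M := by exact_mod_cast hM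
  set w := World.ofFun h hh B with hw
  set F := (H ∪ V)ᶜ with hF
  have hB4 : 4 * badRatio h B ≤ 4 * η := by nlinarith
  have hc' : 3 / 4 ≤ 𝔼 z ∈ sat h, ind (∀ i ∉ R ∪ F, z i = b i) := by
    have := expect_ind_not (sat h) hh fun z => ∀ i ∉ R ∪ F, z i = b i
    unfold IsConcentrated at hc
    linarith
  have hM5 : 0 ≤ (M : ℝ) ^ 5 * η := by positivity
  rw [dnfLearner]
  have ha : risk w (approximate c r μ ε R) (fun o => ind (¬ ∀ l, o = some l →
      GoodLocals h hh B η R l ∧ l.length ≤ M)) ≤ 1 / 100 + M ^ 5 * η := by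
    refine le_trans (le_of_eq ?_) (risk_approximate_le h hh B hp hμ hblocks hHV hV hR hη hη1 hB)
    -- the length is bounded for every output
    have : ∀ (q : ℕ) (p : Prog n (Option (List (LocalOracle n)))) (Q : List (LocalOracle n) → Prop),
        Meets q (fun o => ∀ l, o = some l → l.length ≤ M) p →
        risk w p (fun o => ind (¬ ∀ l, o = some l → Q l ∧ l.length ≤ M)) =
        risk w p (fun o => ind (¬ ∀ l, o = some l → Q l)) := by
      intro q p Q hm
      induction p generalizing q with
      | ret a =>
        exact ind_congr (not_congr (forall_congr' fun l => ⟨fun hl e => (hl e).1,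
          fun hl e => ⟨hl e, hm l e⟩⟩))
      | mq x next ih => simp only [risk]; rw [ih _ _ (hm.2 _)]
      | samp next ih => simp only [risk]; exact Finset.sum_congr rfl fun x _ => by rw [ih _ _ (hm.2 _)]
      | rand k next ih => simp only [risk]; exact Finset.expect_congr rfl fun i _ => by rw [ih _ _ (hm i)]
    exact this _ _ _ (meets_approximate hp R)
  refine (risk_bind_le w (fun o => ∀ l, o = some l → GoodLocals h hh B η R l ∧ l.length ≤ M)
    (fun _ => ind_le_one _) (δ₂ := 1 / 100 + 2 * (M ^ 5 * η)) (by positivity) ha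
    fun o ho => ?_).trans (by linarith)
  rcases o with _ | L
  · dsimp only; rw [risk_pure, ind_false (by simp)]; positivity
  obtain ⟨⟨t, htinj, htR, ht⟩, hlen⟩ := ho L rfl
  rcases L with _ | ⟨o, L⟩
  · dsimp only
    rw [risk_pure, ind_false]
    · positivity
    push Not
    rintro l ⟨⟩
    -- there are no literals: the simulated samples are uniform, of density `1`
    refine ⟨1, fun z => ?_, fun φ h0 hφ => ?_, fun a => ?_⟩
    · dsimp only; rw [risk_pure]; positivity
    · dsimp only
      rw [risk_unif]
      have : 0 ≤ (M : ℝ) * (M * (2 * η)) := by positivity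
      linarith
    · refine (expect_density_le h B hh R F b (fun _ => True) one_pos ?_ ?_ a).trans hB4
      · simp only [and_true]; linarith
      · rw [one_mul]
        refine (Finset.expect_le_expect fun _ _ => ind_le_one _).trans ?_
        rw [Fintype.expect_const]
  · dsimp only
    have hfc := risk_findCandidate_le h hh B hp h1 hμ hocc hη.le (o :: L) hlen t ht
    have q1 : (M : ℝ) * (M * (M * (2 * η))) ≤ M ^ 5 * η := candidate_bound hMr hη.le
    have q2 : ((o :: L).length : ℝ) * (M * (M * ((M + 2) * η)) + 20 * η) ≤ M ^ 5 * η :=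
      (mul_le_mul_of_nonneg_right (Nat.cast_le.2 hlen) (by positivity)).trans
        (literal_bound hMr hη.le)
    refine (risk_bind_le w (p := findCandidate c r μ ε (o :: L)) (fun o' => ∀ J, o' = some J →
      1 / 2 ≤ 𝔼 z ∈ sat h, ind (J (fun i => z (t i)) = true)) (fun _ => ind_le_one _)
      (δ₁ := M * (M * (M * (2 * η))) + 1 / 100) (δ₂ := M ^ 5 * η) hM5 hfc
      fun o' ho' => ?_).trans ?_
    · rcases o' with _ | J
      · dsimp only; rw [risk_pure, ind_false (by simp)]; positivity
      dsimp only
      have hJ := ho' J rfl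
      have hcl := risk_checkLit_le w hp hη.le (o :: L) fun o' ho' => by
        obtain ⟨i, rfl⟩ := List.get_of_mem ho'
        exact ⟨_, ht i⟩
      refine le_trans ?_ q2
      refine le_trans ?_ hcl
      rw [risk_bind]
      refine risk_mono _ _ fun b' => ?_
      split_ifs
      swap
      · rw [risk_pure, ind_false (by simp)]
      rw [risk_pure, ind_false]
      push Not
      rintro l ⟨⟩
      have hJne : (sat J).Nonempty := by
        by_contra hne
        rw [Finset.not_nonempty_iff_eq_empty] at hne
        have : ∀ z : Str n, ind (J (fun i => z (t i)) = true) = 0 := by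
          intro z
          refine ind_false fun hz => ?_
          have := mem_sat.2 hz
          rw [hne] at this
          simp at this
        simp only [this, Finset.expect_const_zero] at hJ
        norm_num at hJ
      have hJc : (0 : ℝ) < (sat J).card := Nat.cast_pos.2 hJne.card_pos
      -- the density of the simulated samples is the inverse of the fraction of strings with `J =
      -- 1`
      refine ⟨2 ^ (o :: L).length / (sat J).card, fun z => ?_, fun φ h0 hφ => ?_, fun a => ?_⟩
      · change risk w (simMQJ c μ ε (o :: L) J z) _ ≤ _
        rw [simMQJ, risk_bind]
        simp only [risk_pure]
        have := risk_extract_le w c μ (o :: L) t ht z (kappa ε) hη.le hlen h2 hp.extract_kappa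
          (fun _ => 0) (fun _ => le_rfl) fun _ => zero_le_one
        linarith
      · exact risk_simSAMPJ_le w hp h2 hη.le (o :: L) hlen t ht J hJne φ h0 hφ
      · refine (expect_density_le h B hh R F b (fun z => J (fun i => z (t i)) = true)
          (by positivity) ?_ ?_ a).trans hB4
        -- events of probability `3 / 4` and `1 / 2` meet with probability at least `1 / 4`
        · have : 𝔼 z ∈ sat h, (ind (∀ i ∉ R ∪ F, z i = b i) +
              ind (J (fun i => z (t i)) = true)) ≤
              𝔼 z ∈ sat h, (ind ((∀ i ∉ R ∪ F, z i = b i) ∧ J (fun i => z (t i)) = true) + 1) := by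
            refine Finset.expect_le_expect fun z _ => ?_
            by_cases p1 : ∀ i ∉ R ∪ F, z i = b i
            · rw [ind_true p1, ind_congr (and_iff_right p1)]; linarith
            · rw [ind_false p1]
              linarith [ind_le_one (J (fun i => z (t i)) = true), ind_nonneg
                ((∀ i ∉ R ∪ F, z i = b i) ∧ J (fun i => z (t i)) = true)]
          rw [Finset.expect_add_distrib, Finset.expect_add_distrib, Finset.expect_const hh] at this
          linarith
        · have : ∀ v : Str n, (fun i => splice (R ∪ F) v b (t i)) = fun i => v (t i) := by
            intro v; funext i; simp [splice, htR i]
          simp only [this]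
          rw [expect_comp_injective t htinj fun z => ind (J z = true),
            Finset.expect_eq_sum_div_card]
          have e : ∑ z, ind (J z = true) = ((sat J).card : ℝ) := by
            rw [sat, Finset.card_filter]
            push_cast
            refine Finset.sum_congr rfl fun z _ => ?_
            by_cases hz : J z = true <;> simp [ind, hz]
          have e' : ((Finset.univ : Finset (Str (o :: L).length)).card : ℝ) =
              2 ^ (o :: L).length := by simp
          rw [e, e', div_mul_div_comm, mul_comm, div_self]
          positivity
    · linarith

/-- In a factored DNF, `H` consists of the variables of the head, and `V` of those of the tail. -/
theorem IsFactoredDNF.isHeadTail {r μ : ℕ} {h : Str n → Bool} (hf : IsFactoredDNF r μ h) :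
    ∃ H V, V.card ≤ μ ∧ IsHeadTail h H V := by
  obtain ⟨T, D, -, -, hV, he⟩ := hf
  have hev : ∀ (S : Term n) (x y : Str n), (∀ i ∈ S.vars, x i = y i) → S.eval x = S.eval y := by
    intro S x y hxy
    unfold Term.eval
    rw [decide_eq_decide]
    refine forall_congr' fun i => forall_congr' fun b => ?_
    by_cases hi : S i = some b
    · rw [hxy i (by simp [Term.vars, hi])]
    · simp [hi]
  refine ⟨T.vars, D.biUnion Term.vars, hV, fun x y hxy => ?_, ?_⟩
  · rw [he, he, hev T x y fun i hi => hxy i (Finset.mem_union_left _ hi)]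
    congr 1
    unfold dnf
    rw [decide_eq_decide]
    refine exists_congr fun S => and_congr_right fun hS => ?_
    rw [hev S x y fun i hi => hxy i (Finset.mem_union_right _ (Finset.mem_biUnion.2 ⟨S, hS, hi⟩))]
  · refine ⟨fun i => (T i).getD false, fun z hz i hi => ?_⟩
    rw [he, Bool.and_eq_true] at hz
    have h1 := hz.1
    simp only [Term.eval, decide_eq_true_eq] at h1
    simp only [Term.vars, Finset.mem_filter, Finset.mem_univ, true_and] at hi
    obtain ⟨b, hb⟩ := Option.isSome_iff_exists.1 hi
    rw [h1 i b hb]; simp [hb]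

/-- If `h` is a factored DNF, and the set `B` is small, then Test-Factored-DNF is unlikely to query
a point of `B`. -/
theorem risk_testFactoredDNF_le {c : TesterConsts} {r μ M : ℕ} {ε : ℝ}
    (hp : ParamBound c r μ ε M) (hfac : ∃ H V : Finset (Fin n), V.card ≤ μ ∧ IsHeadTail h H V)
    (hμ : 1 ≤ μ) (hblocks : 100 ≤ c.blocks)
    (h1 : 1 ≤ ⌈(c.extract : ℝ) * Real.logb 2 ((μ : ℝ) / (1 / 2))⌉₊)
    (h2 : 1 ≤ ⌈(c.extract : ℝ) * Real.logb 2 ((μ : ℝ) / kappa ε)⌉₊)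
    (hocc : (4 : ℝ) ^ (μ * r) * (1 / 2) ^ ⌈1 / (200 * xi r μ ε)⌉₊ ≤ 1 / 100)
    (hstart : μ * (2 * (1 - 1 / (4 * (μ : ℝ))) ^
      ⌈(c.start : ℝ) * ((μ : ℝ) * Real.logb 2 (μ : ℝ)) / xi r μ ε⌉₊) ≤ 1 / 100)
    {η : ℝ} (hη : 0 < η) (hη1 : η ≤ 1) (hB : badRatio h B ≤ η ^ 2) (hM : M ^ 5 * η ≤ 1 / 100) :
    risk (World.ofFun h hh B) (testFactoredDNF c r μ ε) (fun _ => 0) ≤ 7 / 100 := by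
  obtain ⟨H, V, hV, hHV⟩ := hfac
  have hMr : (100 : ℝ) ≤ M := by exact_mod_cast hp.hundred
  rw [testFactoredDNF]
  refine (risk_bind_le _ (fun z => Disjoint (nonconstant z) H ∧
    ∃ c, IsConcentrated h (nonconstant z ∪ (H ∪ V)ᶜ) c) (fun _ => zero_le_one)
    (δ₁ := 1 / 100) (δ₂ := 6 / 100) (by norm_num)
    ((risk_samples_le h hh B hμ hHV hV _).trans hstart) fun z hz => ?_).trans (by norm_num)
  obtain ⟨hR, b, hc⟩ := hz
  change risk _ (if nonconstant z = ∅ then _ else _) _ ≤ _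
  split_ifs with hne
  · rw [risk_pure]; norm_num
  change risk _ (dnfLearner c r μ ε (nonconstant z) >>= _) _ ≤ _
  refine (risk_bind_le _ _ (fun _ => zero_le_one) (δ₂ := 1 / 100) (by norm_num)
    (risk_dnfLearner_le h hh B hp hμ hblocks h1 h2 hocc hHV hV hR hc hη hη1 hB)
    fun o ho => ?_).trans (by linarith)
  rcases o with _ | ⟨mqJ, sampJ⟩
  · dsimp only; rw [risk_pure]; norm_num
  dsimp only
  obtain ⟨Λ, g1, g2, g3⟩ := ho _ rfl
  refine (risk_consCheck_le h hh B hp (nonconstant z) (H ∪ V)ᶜ (fun u x => ?_) mqJ sampJ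
    (by positivity) (by positivity) g1 g2 g3).trans ?_
  · refine hHV.congr _ _ fun i hi => ?_
    simp only [splice]
    rw [if_neg (by rw [Finset.mem_compl, not_not]; exact hi)]
  · have e : 4 * (M : ℝ) ^ 2 * (M * (M * (2 * η)) + 4 * η) = (8 * M ^ 4 + 16 * M ^ 2) * η := by ring
    rw [e]
    refine le_trans (mul_le_mul_of_nonneg_right ?_ hη.le) hM
    have e1 : (M : ℝ) ^ 5 = M * M ^ 4 := by ring
    have e2 : (M : ℝ) ^ 4 = M ^ 2 * M ^ 2 := by ring
    have h2 : (1 : ℝ) ≤ M ^ 2 := by nlinarith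
    have h4 : (M : ℝ) ^ 2 ≤ M ^ 4 := by rw [e2]; nlinarith
    rw [e1]
    nlinarith [mul_nonneg (by linarith : (0 : ℝ) ≤ M - 100) (by positivity : (0 : ℝ) ≤ (M : ℝ) ^ 4)]

end Tester

/-! ### The simulated oracles of a pool -/

section Simulators

variable {n m : ℕ}

/-- The answer of In-Pool with fixed random bits. -/
def inPoolVal (f : Str n → Bool) (a : Str n) (P : Finset (Str n)) (ρ : Str n → Fin m → Str n) :
    Bool :=
  decide (∃ b ∈ P, ∀ j, f (mix (ρ b j) a b) = true)

/-- The function whose membership oracle is `MQ*`. -/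
def poolFun (f : Str n → Bool) (P : Finset (Str n)) (str : Str n → Str n → Fin m → Str n)
    (x : Str n) : Bool :=
  f x && inPoolVal f x P (str x)

theorem risk_tabulate_ask (w : World n) (hw : w.bad = ∅) {k : ℕ} (x : Fin k → Str n)
    (φ : (Fin k → Bool) → ℝ) :
    risk w (Prog.tabulate fun j => Prog.ask (x j)) φ = φ fun j => w.mq (x j) := by
  induction k with
  | zero => rw [Prog.tabulate, risk_pure]; congr 1; funext i; exact i.elim0
  | succ k ih =>
    rw [Prog.tabulate, risk_bind, risk_ask, if_neg (by simp [hw]), risk_bind, ih]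
    rw [risk_pure]; congr 1; funext i
    refine Fin.cases ?_ (fun i => ?_) i <;> simp

/-- With fixed random bits, In-Pool is deterministic. -/
theorem risk_inPool (w : World n) (hw : w.bad = ∅) (a : Str n) (P : Finset (Str n))
    (ρ : Str n → Fin m → Str n) (φ : Bool → ℝ) :
    risk w (inPool a P ρ) φ = φ (inPoolVal w.mq a P ρ) := by
  have key : ∀ l : List (Str n), risk w (inPoolList a ρ l) φ =
      φ (decide (∃ b ∈ l, ∀ j, w.mq (mix (ρ b j) a b) = true)) := by
    intro l
    induction l with
    | nil => simp [inPoolList, risk_pure]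
    | cons b l ih =>
      rw [inPoolList, risk_bind, risk_tabulate_ask w hw]
      split_ifs with h
      · rw [risk_pure]; congr 1; symm
        exact decide_eq_true ⟨b, List.mem_cons_self, h⟩
      · rw [ih]; congr 1
        rw [decide_eq_decide]
        simp only [List.mem_cons, exists_eq_or_imp, h, false_or]
  rw [inPool, key, inPoolVal]
  simp only [Finset.mem_toList]

/-- The simulated membership oracle computes `poolFun`. -/
theorem risk_mqStar (w : World n) (hw : w.bad = ∅) (P : Finset (Str n))
    (str : Str n → Str n → Fin m → Str n) (x : Str n) (φ : Bool → ℝ) :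
    risk w (mqStar P str x) φ = φ (poolFun w.mq P str x) := by
  rw [mqStar, risk_bind, risk_ask, if_neg (by simp [hw])]
  by_cases h : w.mq x = true
  · rw [if_pos h, risk_inPool w hw, poolFun, h, Bool.true_and]
  · rw [if_neg h, risk_pure, poolFun]; simp [h]

variable (f : Str n → Bool) (hf : (sat f).Nonempty)

theorem sat_poolFun_subset (P : Finset (Str n)) (str : Str n → Str n → Fin m → Str n) :
    sat (poolFun f P str) ⊆ sat f := by
  intro x hx
  rw [mem_sat] at hx ⊢
  simp only [poolFun, Bool.and_eq_true] at hx
  exact hx.1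

theorem expect_ind_sat {f g : Str n → Bool} (hgf : sat g ⊆ sat f) :
    𝔼 z ∈ sat f, ind (g z = true) = ((sat g).card : ℝ) / (sat f).card := by
  rw [Finset.expect_eq_sum_div_card]
  congr 1
  rw [← Finset.sum_subset hgf fun x _ hx => ind_false fun h => hx (mem_sat.2 h),
    Finset.sum_congr rfl fun x hx => ind_true (mem_sat.1 hx)]
  simp

/-- Each point of `(MQ*)⁻¹(1)` is returned by `SAMP*` with about the right probability. -/
theorem le_risk_sampStar (P : Finset (Str n)) (str : Str n → Str n → Fin m → Str n) (k : ℕ)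
    {x : Str n} (hx : poolFun f P str x = true) :
    (1 - (1 - ((sat (poolFun f P str)).card : ℝ) / (sat f).card) ^ k) /
      (sat (poolFun f P str)).card ≤
    risk (World.ofFun f hf ∅) (sampStar P str k) (fun z => ind (z = x)) := by
  set g := poolFun f P str with hg
  have hgf : sat g ⊆ sat f := sat_poolFun_subset f P str
  have hfc : (0 : ℝ) < (sat f).card := Nat.cast_pos.2 hf.card_pos
  have hgc : (0 : ℝ) < (sat g).card := Nat.cast_pos.2 (Finset.card_pos.2 ⟨x, mem_sat.2 hx⟩)
  have hle : ((sat g).card : ℝ) / (sat f).card ≤ 1 := by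
    rw [div_le_one hfc]; exact_mod_cast Finset.card_le_card hgf
  induction k with
  | zero => simp only [pow_zero, sub_self, zero_div]; exact risk_nonneg _ _ fun _ => ind_nonneg _
  | succ k ih =>
    set a := risk (World.ofFun f hf ∅) (sampStar P str k) (fun z => ind (z = x))
    have e : risk (World.ofFun f hf ∅) (sampStar P str (k + 1)) (fun z => ind (z = x)) =
        𝔼 z ∈ sat f, (ind (z = x) + ind (¬ g z = true) * a) := by
      rw [sampStar, risk_bind, risk_sample_ofFun]
      refine Finset.expect_congr rfl fun z _ => ?_
      rw [risk_bind, risk_mqStar _ rfl]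
      change risk _ (if g z = true then _ else _) _ = _
      by_cases hz : g z = true
      · rw [if_pos hz, risk_pure, ind_false (not_not.2 hz), zero_mul, add_zero]
      · rw [if_neg hz, ind_true hz, one_mul, ind_false, zero_add]
        rintro rfl; exact hz hx
    have e2 : 𝔼 z ∈ sat f, ind (z = x) = 1 / ((sat f).card : ℝ) := by
      rw [Finset.expect_eq_sum_div_card, Finset.sum_eq_single x (fun z _ hz => ind_false hz)
        (fun h => absurd (hgf (mem_sat.2 hx)) h), ind_true rfl]
    rw [e, Finset.expect_add_distrib, e2, ← Finset.expect_mul, expect_ind_not _ hf,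
      expect_ind_sat hgf]
    calc _ = 1 / ((sat f).card : ℝ) + (1 - ((sat g).card : ℝ) / (sat f).card) *
          ((1 - (1 - ((sat g).card : ℝ) / (sat f).card) ^ k) / (sat g).card) := by
          rw [pow_succ]
          generalize (1 - ((sat g).card : ℝ) / (sat f).card) ^ k = t
          field_simp; ring
      _ ≤ _ := add_le_add le_rfl (mul_le_mul_of_nonneg_left ih (by linarith))

/-- Two laws are close if the first exceeds the second only slightly. -/
theorem abs_sum_mul_sub_le {σ σ' e : Str n → ℝ} {τ : ℝ} (h1 : ∑ x, σ x = 1) (h2 : ∑ x, σ' x = 1)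
    (he : ∀ x, σ x - σ' x ≤ e x) (he0 : ∀ x, 0 ≤ e x) (het : ∑ x, e x ≤ τ) (ψ : Str n → ℝ)
    (h0 : ∀ x, 0 ≤ ψ x) (hψ : ∀ x, ψ x ≤ 1) :
    |∑ x, σ x * ψ x - ∑ x, σ' x * ψ x| ≤ τ := by
  -- the other direction follows by passing to `1 - ψ`, as both laws have total mass `1`
  have key : ∀ ψ : Str n → ℝ, (∀ x, 0 ≤ ψ x) → (∀ x, ψ x ≤ 1) →
      ∑ x, σ x * ψ x - ∑ x, σ' x * ψ x ≤ τ := by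
    intro ψ h0 hψ
    rw [← Finset.sum_sub_distrib]
    refine (Finset.sum_le_sum fun x _ => ?_).trans het
    rw [← sub_mul]
    calc (σ x - σ' x) * ψ x ≤ e x * ψ x := mul_le_mul_of_nonneg_right (he x) (h0 x)
      _ ≤ e x * 1 := mul_le_mul_of_nonneg_left (hψ x) (he0 x)
      _ = e x := mul_one _
  have k1 := key ψ h0 hψ
  have k2 := key (fun x => 1 - ψ x) (fun x => by linarith [hψ x]) fun x => by linarith [h0 x]
  simp only [mul_sub, mul_one, Finset.sum_sub_distrib, h1, h2] at k2
  rw [abs_le]; constructor <;> linarith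

/-- The world that the simulators of a pool realize. -/
noncomputable def simWorld (P : Finset (Str n)) (str : Str n → Str n → Fin m → Str n) (k : ℕ) :
    World n where
  mq := poolFun f P str
  wt x := risk (World.ofFun f hf ∅) (sampStar P str k) fun z => ind (z = x)
  bad := ∅
  wt_nonneg x := risk_nonneg _ _ fun _ => ind_nonneg _
  wt_sum := by
    rw [← risk_sum_of_safe _ rfl, ← risk_const_of_safe (World.ofFun f hf ∅) rfl
      (sampStar P str k) 1]
    congr 1; funext z
    rw [Finset.sum_eq_single z (fun x _ hx => ind_false hx.symm) (by simp), ind_true rfl]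

/-- The simulators are adequate if the algorithm makes few queries, is unlikely to query a point at
which `h` differs from the simulated function, and the simulated function has enough satisfying
strings, most of which satisfy `h`. -/
theorem isAdequate_of_risk_le (P : Finset (Str n)) (str : Str n → Str n → Fin m → Str n) (k : ℕ)
    (h : Str n → Bool) (hh : (sat h).Nonempty) (hsub : sat h ⊆ sat (poolFun f P str))
    (alg : Prog n Bool) (q : ℕ) (hq : Prog.QueriesAtMost q alg) {δ τ : ℝ}
    (hrisk : risk (World.ofFun h hh {x | h x ≠ poolFun f P str x}) alg (fun _ => 0) ≤ δ)
    (h_tau : (1 - ((sat (poolFun f P str)).card : ℝ) / (sat f).card) ^ k +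
      (1 - ((sat h).card : ℝ) / (sat (poolFun f P str)).card) ≤ τ)
    (hsum : δ + q * τ ≤ 1 / 10) :
    IsAdequate f hf (mqStar P str) (sampStar P str k) h hh alg := by
  set g := poolFun f P str with hg
  have hhc : (0 : ℝ) < (sat h).card := Nat.cast_pos.2 hh.card_pos
  have hgc' : (sat h).card ≤ (sat g).card := Finset.card_le_card hsub
  have hgc : ((sat h).card : ℝ) ≤ (sat g).card := Nat.cast_le.2 hgc'
  have hgpos : (0 : ℝ) < (sat g).card := hhc.trans_le hgc
  have hfc : (0 : ℝ) < (sat f).card := Nat.cast_pos.2 hf.card_pos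
  have hgf : sat g ⊆ sat f := sat_poolFun_subset f P str
  have hle : ((sat g).card : ℝ) / (sat f).card ≤ 1 := by
    rw [div_le_one hfc]; exact_mod_cast Finset.card_le_card hgf
  have hle' : ((sat h).card : ℝ) / (sat g).card ≤ 1 := by rwa [div_le_one hgpos]
  set fail := (1 - ((sat g).card : ℝ) / (sat f).card) ^ k with hfail
  have hfail0 : 0 ≤ fail := pow_nonneg (by linarith) _
  have htau0 : 0 ≤ τ := le_trans (by linarith) h_tau
  rw [IsAdequate, run_true_toReal, run_true_toReal,
    risk_subst_of_safe (World.ofFun f hf ∅) (simWorld f hf P str k) rfl _ _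
      (fun x ψ => risk_mqStar _ rfl P str x ψ) ?_]
  · set w := World.ofFun h hh {x | h x ≠ g x} with hw
    have hsafe : World.ofFun h hh ∅ = w.safe := rfl
    rw [hsafe]
    refine (abs_risk_sub_risk_le w (simWorld f hf P str k) rfl (fun x hx => ?_) htau0 ?_ alg q hq
      _ (fun _ => ind_nonneg _) fun _ => ind_le_one _).trans (by linarith)
    · by_contra hne; exact hx hne
    -- A point of `h⁻¹(1)` has mass `1 / |h|` under the true law, and at least `(1 - fail) / |g|`
    -- under the simulated one.
    · refine abs_sum_mul_sub_le (e := fun x => ind (x ∈ sat h) *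
        (1 / (sat h).card - (1 - fail) / (sat g).card)) w.wt_sum (simWorld f hf P str k).wt_sum
        (fun x => ?_) (fun x => ?_) ?_
      · by_cases hx : x ∈ sat h
        · rw [ind_true hx, one_mul]
          have := le_risk_sampStar f hf P str k (mem_sat.1 (hsub hx))
          change ind (x ∈ sat h) / _ - risk _ _ _ ≤ _
          rw [ind_true hx]
          linarith
        · rw [ind_false hx, zero_mul]
          change ind (x ∈ sat h) / _ - risk _ _ _ ≤ _
          rw [ind_false hx, zero_div, zero_sub, neg_nonpos]
          exact risk_nonneg _ _ fun _ => ind_nonneg _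
      · refine mul_nonneg (ind_nonneg _) ?_
        rw [sub_nonneg]
        calc (1 - fail) / ((sat g).card : ℝ) ≤ 1 / (sat g).card :=
              div_le_div_of_nonneg_right (by linarith) hgpos.le
          _ ≤ _ := one_div_le_one_div_of_le hhc hgc
      · rw [← Finset.sum_mul]
        have : ∑ x, ind (x ∈ sat h) = ((sat h).card : ℝ) := by
          rw [← Finset.sum_subset (Finset.subset_univ (sat h)) (fun x _ hx => ind_false hx),
            Finset.sum_congr rfl (fun x hx => ind_true hx)]
          simp
        rw [this]
        refine le_trans ?_ h_tau
        have e : ((sat h).card : ℝ) * (1 / (sat h).card - (1 - fail) / (sat g).card) =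
            1 - (1 - fail) * (((sat h).card : ℝ) / (sat g).card) := by field_simp
        rw [e]
        nlinarith
  · intro ψ
    change _ = ∑ x, risk (World.ofFun f hf ∅) (sampStar P str k) (fun z => ind (z = x)) * ψ x
    simp only [mul_comm _ (ψ _)]
    simp only [← risk_mul_of_safe (World.ofFun f hf ∅) rfl]
    rw [← risk_sum_of_safe _ rfl]
    congr 1; funext z
    rw [Finset.sum_eq_single z (fun x _ hx => by rw [ind_false hx.symm, mul_zero]) (by simp),
      ind_true rfl, mul_one]

end Simulators

/-! ### Selecting the heavy pools -/

section Selection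

variable {n m : ℕ} {β : Type}

theorem risk_tabulate_det (w : World n) {k : ℕ} (p : Fin k → Prog n β) (v : Fin k → β)
    (h : ∀ i (φ : β → ℝ), risk w (p i) φ = φ (v i)) (φ : (Fin k → β) → ℝ) :
    risk w (Prog.tabulate p) φ = φ v := by
  induction k with
  | zero => rw [Prog.tabulate, risk_pure]; congr 1; funext i; exact i.elim0
  | succ k ih =>
    rw [Prog.tabulate, risk_bind, h, risk_bind, ih _ (fun i => v i.succ) fun i => h i.succ,
      risk_pure]
    congr 1; funext i
    refine Fin.cases ?_ (fun i => ?_) i <;> simp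

/-- The samples on which the weights of the pools are estimated, with the answers of In-Pool. -/
noncomputable def poolHits (P : List (Finset (Str n)))
    (str : Fin P.length → Str n → Str n → Fin m → Str n) (ω : ℕ) :
    Prog n (Fin ω → Fin P.length → Bool) :=
  Prog.tabulate fun _ => do
    let z ← Prog.sample
    Prog.tabulate fun i => inPool z (P.get i) (str i z)

/-- The part of Find-Factored-DNFs after the pools have been merged. -/
noncomputable def selectPools (s : ℕ) (ε : ℝ) (N ω : ℕ) (P : List (Finset (Str n))) :
    Prog n (Option (List ((Str n → Prog n Bool) × Prog n (Str n)))) := do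
  let str ← Prog.tabulate fun _ : Fin P.length =>
    Prog.unif (Str n → Str n → Fin (poolReps N) → Str n)
  let hit ← poolHits P str ω
  if ∃ t, ∀ i, hit t i = false then pure none else do
    let heavy := (List.finRange P.length).filter fun i =>
      decide (ε / (20 * (s : ℝ)) * (ω : ℝ) ≤
        ((Finset.univ.filter fun t => hit t i = true).card : ℝ))
    pure (some (heavy.map fun i => (mqStar (P.get i) (str i),
      sampStar (P.get i) (str i) ⌈100 * ((s : ℝ) / ε) * alpha N⌉₊)))

variable (f : Str n → Bool) (hf : (sat f).Nonempty)

theorem risk_poolHit (P : List (Finset (Str n)))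
    (str : Fin P.length → Str n → Str n → Fin m → Str n) (φ : (Fin P.length → Bool) → ℝ) :
    risk (World.ofFun f hf ∅) (do
      let z ← Prog.sample
      Prog.tabulate fun i => inPool z (P.get i) (str i z)) φ =
    𝔼 z ∈ sat f, φ fun i => poolFun f (P.get i) (str i) z := by
  rw [risk_bind, risk_sample_ofFun]
  refine Finset.expect_congr rfl fun z hz => ?_
  rw [risk_tabulate_det _ _ (fun i => poolFun f (P.get i) (str i) z)]
  intro i φ
  rw [risk_inPool _ rfl]
  congr 1
  change inPoolVal f z _ _ = _
  rw [poolFun, mem_sat.1 hz, Bool.true_and]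

/-- The hits of different samples are independent. -/
theorem risk_poolHits_prod (P : List (Finset (Str n)))
    (str : Fin P.length → Str n → Str n → Fin m → Str n) (ω : ℕ)
    (φ : (Fin P.length → Bool) → ℝ) :
    risk (World.ofFun f hf ∅) (poolHits P str ω) (fun b => ∏ t, φ (b t)) =
      (𝔼 z ∈ sat f, φ fun i => poolFun f (P.get i) (str i) z) ^ ω := by
  rw [poolHits, risk_tabulate_prod _ rfl _ fun _ => φ]
  simp only [risk_poolHit]
  simp

/-- The fraction of the satisfying strings of `f` that lie in none of the pools. -/
noncomputable def uncovered (P : List (Finset (Str n)))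
    (str : Fin P.length → Str n → Str n → Fin m → Str n) : ℝ :=
  𝔼 z ∈ sat f, ind (∀ i, poolFun f (P.get i) (str i) z = false)

/-- The fraction of the satisfying strings of `f` that lie in a pool. -/
noncomputable def poolWeight (P : Finset (Str n)) (str : Str n → Str n → Fin m → Str n) : ℝ :=
  ((sat (poolFun f P str)).card : ℝ) / (sat f).card

theorem prod_ite_eq_pow_card {ω : ℕ} (b : Fin ω → Bool) (y : ℝ) :
    ∏ t, (if b t = true then y else 1) =
      y ^ (Finset.univ.filter fun t => b t = true).card := by
  rw [Finset.prod_ite]; simp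

theorem expect_ite_poolFun (hf : (sat f).Nonempty) (P : Finset (Str n)) (str : Str n → Str n → Fin m → Str n)
    (y : ℝ) : 𝔼 z ∈ sat f, (if poolFun f P str z = true then y else 1) =
      1 + (y - 1) * poolWeight f P str := by
  have e : ∀ z, (if poolFun f P str z = true then y else 1) =
      1 + (y - 1) * ind (poolFun f P str z = true) := by
    intro z; split_ifs with h
    · rw [ind_true h]; ring
    · rw [ind_false h]; ring
  simp only [e]
  rw [Finset.expect_add_distrib, Finset.expect_const hf, ← Finset.mul_expect,
    expect_ind_sat (sat_poolFun_subset f P str), poolWeight]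

theorem poolWeight_nonneg_le_one (hf : (sat f).Nonempty) (P : Finset (Str n)) (str : Str n → Str n → Fin m → Str n) :
    0 ≤ poolWeight f P str ∧ poolWeight f P str ≤ 1 := by
  have hfc : (0 : ℝ) < (sat f).card := Nat.cast_pos.2 hf.card_pos
  refine ⟨by rw [poolWeight]; positivity, ?_⟩
  rw [poolWeight, div_le_one hfc]
  exact_mod_cast Finset.card_le_card (sat_poolFun_subset f P str)

theorem one_add_pow_le_exp {a : ℝ} (h : 0 ≤ 1 + a) (k : ℕ) :
    (1 + a) ^ k ≤ Real.exp (a * k) := by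
  rw [mul_comm, Real.exp_nat_mul]
  exact pow_le_pow_left₀ h (by linarith [Real.add_one_le_exp a]) _

/-- A light pool is unlikely to be declared heavy. -/
theorem risk_poolHits_light (P : List (Finset (Str n)))
    (str : Fin P.length → Str n → Str n → Fin m → Str n) (ω : ℕ) {θ : ℝ} (hθ : 0 ≤ θ)
    (i : Fin P.length) (hi : poolWeight f (P.get i) (str i) ≤ θ / 2) :
    risk (World.ofFun f hf ∅) (poolHits P str ω) (fun b => ind (θ * ω ≤
      ((Finset.univ.filter fun t => b t i = true).card : ℝ))) ≤ Real.exp (-(θ * ω / 6)) := by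
  have h0 := (poolWeight_nonneg_le_one f hf (P.get i) (str i)).1
  -- the exponential moment with base `2`
  refine (risk_mono _ _ (ψ := fun b => Real.exp (-(Real.log 2 * (θ * ω))) *
    ∏ t, (if b t i = true then 2 else 1)) fun b => ?_).trans ?_
  · rw [prod_ite_eq_pow_card fun t => b t i]
    by_cases h : θ * ω ≤ ((Finset.univ.filter fun t => b t i = true).card : ℝ)
    · rw [ind_true h, ← Real.rpow_natCast, Real.rpow_def_of_pos (by norm_num), ← Real.exp_add]
      rw [Real.one_le_exp_iff]
      nlinarith [Real.log_two_gt_d9]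
    · rw [ind_false h]; positivity
  · rw [risk_mul_of_safe _ rfl, risk_poolHits_prod f hf P str ω
      fun b => if b i = true then 2 else 1, expect_ite_poolFun f hf]
    have h1 := one_add_pow_le_exp (a := (2 - 1) * poolWeight f (P.get i) (str i)) (by linarith) ω
    refine (mul_le_mul_of_nonneg_left h1 (Real.exp_pos _).le).trans ?_
    rw [← Real.exp_add, Real.exp_le_exp]
    have h2 := Real.log_two_gt_d9
    have h3 : (0 : ℝ) ≤ θ * ω := by positivity
    have h4 : poolWeight f (P.get i) (str i) * ω ≤ θ / 2 * ω :=
      mul_le_mul_of_nonneg_right hi (Nat.cast_nonneg _)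
    nlinarith

/-- A pool of large weight is likely to be declared heavy. -/
theorem risk_poolHits_heavy (P : List (Finset (Str n)))
    (str : Fin P.length → Str n → Str n → Fin m → Str n) (ω : ℕ) {θ : ℝ} (hθ : 0 ≤ θ)
    (i : Fin P.length) (hi : 5 * θ ≤ poolWeight f (P.get i) (str i)) :
    risk (World.ofFun f hf ∅) (poolHits P str ω) (fun b => ind (¬ θ * ω ≤
      ((Finset.univ.filter fun t => b t i = true).card : ℝ))) ≤ Real.exp (-(θ * ω / 6)) := by
  have h0 := (poolWeight_nonneg_le_one f hf (P.get i) (str i)).2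
  refine (risk_mono _ _ (ψ := fun b => Real.exp (Real.log 2 * (θ * ω)) *
    ∏ t, (if b t i = true then 1 / 2 else 1)) fun b => ?_).trans ?_
  · rw [prod_ite_eq_pow_card fun t => b t i]
    by_cases h : θ * ω ≤ ((Finset.univ.filter fun t => b t i = true).card : ℝ)
    · rw [ind_false (not_not.2 h)]; positivity
    · rw [ind_true h, ← Real.rpow_natCast, Real.rpow_def_of_pos (by norm_num), ← Real.exp_add]
      rw [Real.one_le_exp_iff, one_div, Real.log_inv]
      nlinarith [Real.log_two_gt_d9]
  · rw [risk_mul_of_safe _ rfl, risk_poolHits_prod f hf P str ω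
      fun b => if b i = true then 1 / 2 else 1, expect_ite_poolFun f hf]
    have h1 := one_add_pow_le_exp (a := (1 / 2 - 1) * poolWeight f (P.get i) (str i))
      (by linarith) ω
    refine (mul_le_mul_of_nonneg_left h1 (Real.exp_pos _).le).trans ?_
    rw [← Real.exp_add, Real.exp_le_exp]
    have h2 := Real.log_two_lt_d9
    have h3 : (0 : ℝ) ≤ θ * ω := by positivity
    have h4 : 5 * θ * ω ≤ poolWeight f (P.get i) (str i) * ω :=
      mul_le_mul_of_nonneg_right hi (Nat.cast_nonneg _)
    nlinarith

/-- Rejection means that some sample lies in no pool. -/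
theorem risk_poolHits_reject (P : List (Finset (Str n)))
    (str : Fin P.length → Str n → Str n → Fin m → Str n) (ω : ℕ) :
    risk (World.ofFun f hf ∅) (poolHits P str ω)
      (fun b => ind (∃ t, ∀ i, b t i = false)) ≤ ω * uncovered f P str := by
  have h := risk_tabulate_union (World.ofFun f hf ∅) (fun _ : Fin ω => do
    let z ← Prog.sample
    Prog.tabulate fun i => inPool z (P.get i) (str i z)) fun _ b => ¬ ∀ i, b i = false
  simp only [risk_poolHit, not_not] at h
  rw [poolHits]
  refine (risk_mono _ _ fun b => ind_mono ?_).trans (h.trans (le_of_eq ?_))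
  · rintro ⟨t, ht⟩ h'; exact h' t ht
  · simp [uncovered]

/-- If the pools leave out a substantial part of `f⁻¹(1)`, some sample is likely to lie in none. -/
theorem risk_poolHits_accept (P : List (Finset (Str n)))
    (str : Fin P.length → Str n → Str n → Fin m → Str n) (ω : ℕ) {θ : ℝ} (hθ : 0 ≤ θ)
    (hu : 5 * θ ≤ uncovered f P str) :
    risk (World.ofFun f hf ∅) (poolHits P str ω)
      (fun b => ind (¬ ∃ t, ∀ i, b t i = false)) ≤ Real.exp (-(θ * ω / 6)) := by
  have e : ∀ b : Fin ω → Fin P.length → Bool, ind (¬ ∃ t, ∀ i, b t i = false) =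
      ∏ t, ind (¬ ∀ i, b t i = false) := by
    intro b
    by_cases h : ∃ t, ∀ i, b t i = false
    · obtain ⟨t, ht⟩ := h
      rw [ind_false (not_not.2 ⟨t, ht⟩), Finset.prod_eq_zero (Finset.mem_univ t)
        (ind_false (not_not.2 ht))]
    · rw [ind_true h, Finset.prod_eq_one fun t _ => ind_true fun h' => h ⟨t, h'⟩]
  simp only [e]
  rw [risk_poolHits_prod f hf P str ω fun b => ind (¬ ∀ i, b i = false),
    expect_ind_not _ hf]
  have h1 : uncovered f P str ≤ 1 :=
    (Finset.expect_le_expect fun _ _ => ind_le_one _).trans (Finset.expect_const hf _).le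
  have h2 := one_add_pow_le_exp (a := -uncovered f P str) (by linarith) ω
  rw [← sub_eq_add_neg] at h2
  refine h2.trans ?_
  rw [Real.exp_le_exp]
  have h3 : (0 : ℝ) ≤ θ * ω := by positivity
  have h4 : 5 * θ * ω ≤ uncovered f P str * ω :=
    mul_le_mul_of_nonneg_right hu (Nat.cast_nonneg _)
  nlinarith

/-- What the hits reveal: strings outside the pools cause rejection, and only pools of substantial
weight are declared heavy. -/
def FaithfulHits (P : List (Finset (Str n)))
    (str : Fin P.length → Str n → Str n → Fin m → Str n) {ω : ℕ} (θ : ℝ)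
    (b : Fin ω → Fin P.length → Bool) : Prop :=
  (5 * θ ≤ uncovered f P str → ∃ t, ∀ i, b t i = false) ∧
  ∀ i, (poolWeight f (P.get i) (str i) ≤ θ / 2 →
      ¬ θ * ω ≤ ((Finset.univ.filter fun t => b t i = true).card : ℝ)) ∧
    (5 * θ ≤ poolWeight f (P.get i) (str i) →
      θ * ω ≤ ((Finset.univ.filter fun t => b t i = true).card : ℝ))

/-- The union of the bad events for the uncovered strings and for the single pools. -/
theorem risk_poolHits_faithful (P : List (Finset (Str n)))
    (str : Fin P.length → Str n → Str n → Fin m → Str n) (ω : ℕ) {θ : ℝ} (hθ : 0 ≤ θ) :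
    risk (World.ofFun f hf ∅) (poolHits P str ω)
      (fun b => ind (¬ FaithfulHits f P str θ b)) ≤
      (2 * P.length + 1) * Real.exp (-(θ * ω / 6)) := by
  set e := Real.exp (-(θ * ω / 6)) with he
  have he0 : 0 ≤ e := (Real.exp_pos _).le
  have key : ∀ {Q : Prop} {φ : (Fin ω → Fin P.length → Bool) → Prop},
      (Q → risk (World.ofFun f hf ∅) (poolHits P str ω) (fun b => ind (φ b)) ≤ e) →
      risk (World.ofFun f hf ∅) (poolHits P str ω) (fun b => ind (Q ∧ φ b)) ≤ e := by
    intro Q φ h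
    by_cases hQ : Q
    · simpa [hQ] using h hQ
    · have : ∀ b, ind (Q ∧ φ b) = 0 := fun b => ind_false fun h => hQ h.1
      simp only [this]
      rw [risk_const_of_safe _ rfl]; exact he0
  refine (risk_mono _ _ (ψ := fun b =>
    ind (5 * θ ≤ uncovered f P str ∧ ¬ ∃ t, ∀ i, b t i = false) +
    ∑ i, (ind (poolWeight f (P.get i) (str i) ≤ θ / 2 ∧
        θ * ω ≤ ((Finset.univ.filter fun t => b t i = true).card : ℝ)) +
      ind (5 * θ ≤ poolWeight f (P.get i) (str i) ∧
        ¬ θ * ω ≤ ((Finset.univ.filter fun t => b t i = true).card : ℝ)))) fun b => ?_).trans ?_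
  · refine le_trans ?_ (add_le_add le_rfl (Finset.sum_le_sum fun i _ => ind_or_le _ _))
    refine le_trans ?_ (add_le_add le_rfl (ind_exists_le _))
    refine le_trans (ind_mono fun h => ?_) (ind_or_le _ _)
    by_contra! hc
    refine h ⟨hc.1, fun i => ⟨fun h1 => not_le.2 ((hc.2 i).1 h1), (hc.2 i).2⟩⟩
  · rw [risk_add_of_safe _ rfl, risk_sum_of_safe _ rfl]
    simp only [risk_add_of_safe (World.ofFun f hf ∅) rfl]
    refine (add_le_add (key fun h => risk_poolHits_accept f hf P str ω hθ h)
      (Finset.sum_le_sum fun i _ => add_le_add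
        (key fun h => risk_poolHits_light f hf P str ω hθ i h)
        (key fun h => risk_poolHits_heavy f hf P str ω hθ i h))).trans (le_of_eq ?_)
    rw [Finset.sum_const, Finset.card_univ, Fintype.card_fin, nsmul_eq_mul]; ring

end Selection

/-! ### Soundness: pools as functions -/

section Soundness

variable {n : ℕ}

/-- The entries of a mapped list, with their preimages in the original list. -/
theorem exists_index_map {α β : Type*} (l : List α) (F : α → β) :
    ∃ idx : Fin (l.map F).length → α, (∀ j, (l.map F).get j = F (idx j)) ∧
      (∀ j, idx j ∈ l) ∧ (∀ a ∈ l, ∃ j, idx j = a) ∧ (l.Nodup → Function.Injective idx) := by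
  refine ⟨fun j => l.get (Fin.cast (List.length_map _) j), fun j => by simp,
    fun j => List.get_mem _ _, fun a ha => ?_, fun hl i j h => ?_⟩
  · obtain ⟨i, rfl⟩ := List.mem_iff_get.1 ha
    exact ⟨Fin.cast (List.length_map _).symm i, rfl⟩
  · have := hl.injective_get h
    exact Fin.cast_injective _ this

/-- `SAMP*` rarely fails for a pool of substantial weight. -/
theorem sampStar_failure_le {s N : ℕ} {ε ρ : ℝ} (hs : 1 ≤ s) (hε : 0 < ε) (hN : 1 ≤ N)
    (h : ε / (40 * s) ≤ ρ) (h1 : ρ ≤ 1) :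
    (1 - ρ) ^ ⌈100 * ((s : ℝ) / ε) * alpha N⌉₊ ≤ 1 / (N : ℝ) ^ 2 := by
  have hs' : (1 : ℝ) ≤ s := by exact_mod_cast hs
  have hN' : (1 : ℝ) ≤ N := by exact_mod_cast hN
  have hlog : 0 ≤ Real.log N := Real.log_nonneg hN'
  have ha : Real.log N ≤ alpha N := by
    rw [alpha, Real.logb, le_div_iff₀ (Real.log_pos (by norm_num))]
    nlinarith [Real.log_two_lt_d9]
  have h0 := one_add_pow_le_exp (a := -ρ) (by linarith) ⌈100 * ((s : ℝ) / ε) * alpha N⌉₊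
  rw [← sub_eq_add_neg] at h0
  refine h0.trans ?_
  have hk : 2 * Real.log N ≤ ρ * ⌈100 * ((s : ℝ) / ε) * alpha N⌉₊ := by
    have h2 := Nat.le_ceil (100 * ((s : ℝ) / ε) * alpha N)
    have h3 : 0 < ε / (40 * s) := by positivity
    calc 2 * Real.log N ≤ ε / (40 * s) * (100 * ((s : ℝ) / ε) * alpha N) := by
          have : ε / (40 * s) * (100 * ((s : ℝ) / ε) * alpha N) = 5 / 2 * alpha N := by
            field_simp; ring
          rw [this]; linarith
      _ ≤ ρ * ⌈100 * ((s : ℝ) / ε) * alpha N⌉₊ :=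
          mul_le_mul h h2 (mul_nonneg (by positivity) (hlog.trans ha)) (h3.le.trans h)
  calc Real.exp (-ρ * ⌈100 * ((s : ℝ) / ε) * alpha N⌉₊) ≤ Real.exp (-(2 * Real.log N)) := by
        rw [Real.exp_le_exp]; linarith
    _ = 1 / (N : ℝ) ^ 2 := by
        rw [Real.exp_neg, one_div]; congr 1
        rw [show (2 : ℝ) * Real.log N = ((2 : ℕ) : ℝ) * Real.log N by norm_num,
          Real.exp_nat_mul, Real.exp_log (by linarith)]

variable (f : Str n → Bool) (hf : (sat f).Nonempty)

theorem expect_ind_eq_card {α : Type*} (s : Finset α) (Q : α → Prop) [DecidablePred Q] :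
    𝔼 z ∈ s, ind (Q z) = ((s.filter Q).card : ℝ) / s.card := by
  rw [Finset.expect_eq_sum_div_card]
  congr 1
  rw [Finset.card_filter, Nat.cast_sum]
  refine Finset.sum_congr rfl fun z _ => ?_
  split_ifs with h
  · rw [ind_true h, Nat.cast_one]
  · rw [ind_false h, Nat.cast_zero]

/-- The strings outside the pools `I` lie in no pool at all, or in one of the light pools outside
`I`. -/
theorem uncovered_union_le {m : ℕ} (P : List (Finset (Str n)))
    (str : Fin P.length → Str n → Str n → Fin m → Str n) {θ : ℝ} (I : Finset (Fin P.length))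
    (hu : uncovered f P str < 5 * θ) (hI : ∀ i ∉ I, poolWeight f (P.get i) (str i) ≤ 5 * θ) :
    ((sat f \ I.biUnion fun i => sat (poolFun f (P.get i) (str i))).card : ℝ) / (sat f).card ≤
      (P.length + 1) * (5 * θ) := by
  classical
  set U := (sat f).filter fun z => ∀ i, poolFun f (P.get i) (str i) z = false
  have hθ : 0 ≤ 5 * θ :=
    le_trans (Finset.expect_nonneg fun _ _ => ind_nonneg _) hu.le
  have hsub : sat f \ I.biUnion (fun i => sat (poolFun f (P.get i) (str i))) ⊆
      U ∪ Iᶜ.biUnion fun i => sat (poolFun f (P.get i) (str i)) := by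
    intro z hz
    rw [Finset.mem_sdiff] at hz
    by_cases h : ∀ i, poolFun f (P.get i) (str i) z = false
    · exact Finset.mem_union_left _ (Finset.mem_filter.2 ⟨hz.1, h⟩)
    · push Not at h
      obtain ⟨i, hi⟩ := h
      rw [Bool.ne_false_iff] at hi
      refine Finset.mem_union_right _ (Finset.mem_biUnion.2 ⟨i, ?_, mem_sat.2 hi⟩)
      rw [Finset.mem_compl]
      exact fun hiI => hz.2 (Finset.mem_biUnion.2 ⟨i, hiI, mem_sat.2 hi⟩)
  have hc : ((sat f \ I.biUnion fun i => sat (poolFun f (P.get i) (str i))).card : ℝ) ≤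
      U.card + ∑ i ∈ Iᶜ, ((sat (poolFun f (P.get i) (str i))).card : ℝ) := by
    exact_mod_cast (Finset.card_le_card hsub).trans ((Finset.card_union_le _ _).trans
      (add_le_add le_rfl Finset.card_biUnion_le))
  refine (div_le_div_of_nonneg_right hc (Nat.cast_nonneg _)).trans ?_
  rw [add_div, Finset.sum_div]
  have h1 : (U.card : ℝ) / (sat f).card ≤ 5 * θ := by
    rw [uncovered, expect_ind_eq_card] at hu; exact hu.le
  have h2 : ∑ i ∈ Iᶜ, ((sat (poolFun f (P.get i) (str i))).card : ℝ) / (sat f).card ≤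
      P.length * (5 * θ) := by
    calc _ ≤ ∑ i ∈ Iᶜ, 5 * θ := Finset.sum_le_sum fun i hi => hI i (Finset.mem_compl.1 hi)
      _ ≤ _ := by
        rw [Finset.sum_const, nsmul_eq_mul]
        refine mul_le_mul_of_nonneg_right ?_ hθ
        exact_mod_cast (Finset.card_le_univ _).trans (Fintype.card_fin _).le
  linarith

/-- For an arbitrary `f` the heavy pools, regarded as functions, cover nearly all of `f⁻¹(1)`, and
their simulators are adequate for every algorithm with few queries. -/
theorem risk_selectPools_arbitrary {s N q : ℕ} {ε : ℝ} (hs : 1 ≤ s) (hε : 0 < ε) (hN : 1 ≤ N)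
    (ω : ℕ) (P : List (Finset (Str n))) (hP : P.length ≤ s) (𝒜 : Set (Prog n Bool))
    (hq : ∀ alg ∈ 𝒜, Prog.QueriesAtMost q alg) (hqN : q * (1 / (N : ℝ) ^ 2) ≤ 1 / 10) :
    risk (World.ofFun f hf ∅) (selectPools s ε N ω P) (fun out => ind (out ∉
      {out | out = none ∨ ∃ l, out = some l ∧
        ∃ (h : Fin l.length → Str n → Bool) (hh : ∀ i, (sat (h i)).Nonempty),
          (∀ i, sat (h i) ⊆ sat f) ∧
          ((sat f \ Finset.univ.biUnion fun i => sat (h i)).card : ℝ) / ((sat f).card : ℝ)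
            ≤ ε / 2 ∧
          ∀ i, ∀ alg ∈ 𝒜, IsAdequate f hf (l.get i).1 (l.get i).2 (h i) (hh i) alg})) ≤
      (2 * s + 1) * Real.exp (-(ε / (20 * s) * ω / 6)) := by
  classical
  set θ := ε / (20 * (s : ℝ)) with hθ
  have hs' : (1 : ℝ) ≤ s := by exact_mod_cast hs
  have hθ0 : 0 < θ := by rw [hθ]; positivity
  have hfc : (0 : ℝ) < (sat f).card := Nat.cast_pos.2 hf.card_pos
  have hE := Real.exp_pos (-(θ * ω / 6))
  set A := {out : Option (List ((Str n → Prog n Bool) × Prog n (Str n))) | out = none ∨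
        ∃ l, out = some l ∧
        ∃ (h : Fin l.length → Str n → Bool) (hh : ∀ i, (sat (h i)).Nonempty),
          (∀ i, sat (h i) ⊆ sat f) ∧
          ((sat f \ Finset.univ.biUnion fun i => sat (h i)).card : ℝ) / ((sat f).card : ℝ)
            ≤ ε / 2 ∧
          ∀ i, ∀ alg ∈ 𝒜, IsAdequate f hf (l.get i).1 (l.get i).2 (h i) (hh i) alg} with hA
  rw [selectPools]
  refine (risk_bind_le_of_forall _ (δ₁ := 0)
    (δ₂ := (2 * s + 1) * Real.exp (-(θ * ω / 6))) (by positivity)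
    (risk_const_of_safe _ rfl _ 0).le fun str => ?_).trans (zero_add _).le
  refine (risk_bind_le _ (FaithfulHits f P str θ) (fun _ => ind_le_one _) le_rfl
    (risk_poolHits_faithful f hf P str ω hθ0.le) fun b hb => ?_).trans ?_
  · split_ifs with hrej
    · rw [risk_pure, ind_false (not_not.2 (show _ ∈ A from Or.inl rfl))]
    · rw [risk_pure]
      refine (ind_false (not_not.2 (show _ ∈ A from ?_))).le
      refine Or.inr ⟨_, rfl, ?_⟩
      obtain ⟨idx, h1, h2, h3, -⟩ := exists_index_map
        ((List.finRange P.length).filter fun i =>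
          decide (ε / (20 * (s : ℝ)) * (ω : ℝ) ≤
            ((Finset.univ.filter fun t => b t i = true).card : ℝ)))
        (fun i => (mqStar (P.get i) (str i),
          sampStar (P.get i) (str i) ⌈100 * ((s : ℝ) / ε) * alpha N⌉₊))
      have hheavy : ∀ j, θ / 2 < poolWeight f (P.get (idx j)) (str (idx j)) := by
        intro j
        by_contra! hc
        have := h2 j
        simp only [List.mem_filter, List.mem_finRange, true_and, decide_eq_true_eq] at this
        exact (hb.2 (idx j)).1 hc this
      have hne : ∀ j, (sat (poolFun f (P.get (idx j)) (str (idx j)))).Nonempty := by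
        intro j
        rw [← Finset.card_pos]
        by_contra hc
        have h0 : (sat (poolFun f (P.get (idx j)) (str (idx j)))).card = 0 := by omega
        have := hheavy j
        rw [poolWeight, h0] at this
        simp at this; linarith
      refine ⟨fun j => poolFun f (P.get (idx j)) (str (idx j)), hne,
        fun j => sat_poolFun_subset f _ _, ?_, fun j alg halg => ?_⟩
      -- there was no rejection, so less than `5 θ` is uncovered, and the pools that are not heavy
      -- have a weight of less than `5 θ`
      · have hI := uncovered_union_le f P str (Finset.univ.image idx) (θ := θ) (not_le.1 fun h =>
          hrej (hb.1 h)) fun i hi => ?_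
        · rw [Finset.image_biUnion] at hI
          refine hI.trans ?_
          have hP' : (P.length : ℝ) ≤ s := by exact_mod_cast hP
          calc (P.length + 1) * (5 * θ) ≤ (s + s) * (5 * θ) := by gcongr
            _ = ε / 2 := by rw [hθ]; field_simp; norm_num
        · by_contra! hc
          obtain ⟨j, rfl⟩ := h3 i (by simpa using (hb.2 i).2 hc.le)
          exact hi (Finset.mem_image_of_mem _ (Finset.mem_univ j))
      · rw [h1 j]
        refine isAdequate_of_risk_le f hf (P.get (idx j)) (str (idx j)) _ _ (hne j) subset_rfl alg
          q (hq alg halg) (δ := 0) (τ := 1 / (N : ℝ) ^ 2) (le_of_eq ?_) ?_ (by linarith)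
        · have : {x | poolFun f (P.get (idx j)) (str (idx j)) x ≠
              poolFun f (P.get (idx j)) (str (idx j)) x} = ∅ := by ext; simp
          rw [this, risk_const_of_safe _ rfl]
        · have hgc : ((sat (poolFun f (P.get (idx j)) (str (idx j)))).card : ℝ) ≠ 0 :=
            Nat.cast_ne_zero.2 (Finset.card_pos.2 (hne j)).ne'
          rw [div_self hgc, sub_self, add_zero]
          refine sampStar_failure_le hs hε hN ?_
            (poolWeight_nonneg_le_one f hf (P.get (idx j)) (str (idx j))).2
          have := hheavy j
          rw [hθ] at this
          refine le_trans (le_of_eq ?_) this.le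
          field_simp; norm_num
  · rw [add_zero]
    refine mul_le_mul_of_nonneg_right ?_ hE.le
    have : (P.length : ℝ) ≤ s := by exact_mod_cast hP
    linarith

end Soundness

/-! ### Query complexity of Find-Factored-DNFs -/

section FinderQueries

variable {n m : ℕ}

/-- A property of all outcomes fails with risk zero. -/
theorem Meets.risk_eq_zero {α : Type} {q : ℕ} {Q : α → Prop} {p : Prog n α} (h : Meets q Q p)
    (w : World n) (hw : w.bad = ∅) : risk w p (fun a => ind (¬ Q a)) = 0 := by
  induction p generalizing q with
  | ret b => exact ind_false (not_not.2 h)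
  | mq x next ih => simp only [risk, hw, Set.mem_empty_iff_false, if_false]; exact ih _ (h.2 _)
  | samp next ih =>
    simp only [risk]
    exact Finset.sum_eq_zero fun x _ => by rw [ih x (h.2 x), mul_zero]
  | rand k next ih =>
    simp only [risk]
    rw [Finset.expect_congr rfl fun i _ => ih i (h i)]; simp

theorem meets_testEquivalence (N : ℕ) (a b : Str n) :
    Meets (N ^ 3) (fun _ => True) (testEquivalence N a b) := by
  rw [testEquivalence]
  refine (meets_tabulate (q := 1) (Q := fun _ _ => True) fun _ => ?_).bind_le (q₂ := 0)
    (fun _ _ => meets_pure trivial) (by omega)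
  exact meets_unif.bind_le (q₂ := 1) (fun w _ => meets_ask _) (by omega)

theorem meets_inPool (a : Str n) (P : Finset (Str n)) (ρ : Str n → Fin m → Str n) :
    Meets (P.card * m) (fun _ => True) (inPool a P ρ) := by
  have key : ∀ l : List (Str n), Meets (l.length * m) (fun _ => True) (inPoolList a ρ l) := by
    intro l
    induction l with
    | nil => exact meets_pure trivial
    | cons b l ih =>
      rw [inPoolList]
      refine (meets_tabulate (q := 1) (Q := fun _ _ => True) fun _ => meets_ask _).bind_le
        (q₂ := l.length * m) (fun _ _ => ?_) (by rw [List.length_cons, Nat.succ_mul]; omega)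
      split_ifs
      · exact meets_pure trivial
      · exact ih
  simpa [inPool] using key P.toList

theorem meets_mqStar (P : Finset (Str n)) (str : Str n → Str n → Fin m → Str n) (x : Str n) :
    Meets (1 + P.card * m) (fun _ => True) (mqStar P str x) := by
  rw [mqStar]
  refine (meets_ask x).bind fun b _ => ?_
  split_ifs
  · exact meets_inPool _ _ _
  · exact meets_pure trivial

theorem meets_sampStar (P : Finset (Str n)) (str : Str n → Str n → Fin m → Str n) (k : ℕ) :
    Meets (k * (2 + P.card * m)) (fun _ => True) (sampStar P str k) := by
  induction k with
  | zero => exact meets_pure trivial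
  | succ k ih =>
    rw [sampStar]
    refine meets_sample.bind_le (q₂ := 1 + P.card * m + k * (2 + P.card * m)) (fun z _ => ?_)
      (by rw [Nat.succ_mul]; omega)
    refine (meets_mqStar P str z).bind fun b _ => ?_
    split_ifs
    · exact meets_pure trivial
    · exact ih

theorem card_merge_lt (G : Finset (Finset (Fin m))) {A B : Finset (Fin m)} (hA : A ∈ G)
    (hB : B ∈ G) (hAB : A ≠ B) :
    (insert (A ∪ B) ((G.erase A).erase B)).card < G.card := by
  have h1 := Finset.card_insert_le (A ∪ B) ((G.erase A).erase B)
  have h2 := Finset.card_erase_of_mem (Finset.mem_erase.2 ⟨hAB.symm, hB⟩)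
  have h3 := Finset.card_erase_of_mem hA
  have h4 : 0 < (G.erase A).card := Finset.card_pos.2 ⟨B, Finset.mem_erase.2 ⟨hAB.symm, hB⟩⟩
  omega

/-- Each merge decreases the number of pools, so that at most `k` rounds take place. -/
theorem meets_mergePhase (N : ℕ) (S : Fin m → Str n) (k : ℕ) (G : Finset (Finset (Fin m))) :
    Meets (k * (N ^ 5 + m * (N ^ 5 * N ^ 3))) (fun G' => G'.card ≤ G.card)
      (mergePhase N S k G) := by
  induction k generalizing G with
  | zero => exact meets_pure le_rfl
  | succ k ih =>
    rw [mergePhase]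
    refine (meets_tabulate (q := 1) (Q := fun _ _ => True) fun _ => meets_sample).bind_le
      (q₂ := m * (N ^ 5 * N ^ 3) + k * (N ^ 5 + m * (N ^ 5 * N ^ 3))) (fun z _ => ?_)
      (by rw [Nat.succ_mul]; omega)
    refine (meets_tabulate (Q := fun _ _ => True) fun i => ?_).bind (fun t _ => ?_)
    · exact (meets_tabulate (Q := fun _ _ => True)
        fun j => meets_testEquivalence N _ _).mono le_rfl fun _ _ => trivial
    · split_ifs with h
      · obtain ⟨h1, h2, h3, -⟩ := h.choose_spec
        exact (ih _).mono le_rfl fun G' hG' => hG'.trans (card_merge_lt G h1 h2 h3).le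
      · exact meets_pure le_rfl

theorem meets_poolHits (P : List (Finset (Str n)))
    (str : Fin P.length → Str n → Str n → Fin m → Str n) (ω b : ℕ) (hb : ∀ A ∈ P, A.card ≤ b) :
    Meets (ω * (1 + P.length * (b * m))) (fun _ => True) (poolHits P str ω) := by
  rw [poolHits]
  refine (meets_tabulate (Q := fun _ _ => True) fun _ => ?_).mono le_rfl fun _ _ => trivial
  refine meets_sample.bind fun z _ => ?_
  refine (meets_tabulate (Q := fun _ _ => True) fun i => ?_).mono le_rfl fun _ _ => trivial
  exact (meets_inPool z _ _).mono (Nat.mul_le_mul_right _ (hb _ (List.get_mem _ _)))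
    fun _ _ => trivial

/-- At most `s` pairs are returned, and the simulators make at most `q` queries. -/
def SmallSimulators (s q : ℕ)
    (out : Option (List ((Str n → Prog n Bool) × Prog n (Str n)))) : Prop :=
  ∀ l, out = some l → l.length ≤ s ∧
    ∀ p ∈ l, (∀ x, Prog.QueriesAtMost q (p.1 x)) ∧ Prog.QueriesAtMost q p.2

theorem meets_selectPools {s N b q : ℕ} {ε : ℝ} (ω : ℕ) (P : List (Finset (Str n)))
    (hP : P.length ≤ s) (hb : ∀ A ∈ P, A.card ≤ b) (h1 : 1 + b * poolReps N ≤ q)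
    (h2 : ⌈100 * ((s : ℝ) / ε) * alpha N⌉₊ * (2 + b * poolReps N) ≤ q) :
    Meets (ω * (1 + s * (b * poolReps N))) (SmallSimulators s q) (selectPools s ε N ω P) := by
  rw [selectPools]
  refine (meets_tabulate (q := 0) (Q := fun _ _ => True) fun _ => meets_unif).bind_le
    (q₂ := ω * (1 + P.length * (b * poolReps N))) (fun str _ => ?_)
    (by rw [mul_zero, zero_add]; gcongr)
  refine (meets_poolHits P str ω b hb).bind_le (q₂ := 0) (fun hit _ => ?_) (by omega)
  split_ifs
  · refine meets_pure fun l hl => ?_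
    simp at hl
  · refine meets_pure fun l hl => ?_
    obtain rfl := Option.some.inj hl
    refine ⟨?_, fun p hp => ?_⟩
    · rw [List.length_map]
      refine (List.length_filter_le _ _).trans ?_
      simpa using hP
    · obtain ⟨i, -, rfl⟩ := List.mem_map.1 hp
      have hbi : (P.get i).card * poolReps N ≤ b * poolReps N :=
        Nat.mul_le_mul_right _ (hb _ (List.get_mem _ _))
      exact ⟨fun x => ((meets_mqStar _ _ x).mono (by omega) fun _ _ => trivial).queriesAtMost,
        ((meets_sampStar _ _ _).mono ((Nat.mul_le_mul_left _ (by omega)).trans h2)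
          fun _ _ => trivial).queriesAtMost⟩

/-- Find-Factored-DNFs builds the pools, merges them, and then selects the heavy ones. -/
theorem findFactoredDNFs_eq (c : FinderConsts) (s : ℕ) (ε : ℝ) :
    findFactoredDNFs (n := n) c s ε = (do
      let S ← Prog.tabulate fun _ : Fin (c.bigN s ε ^ 3) => Prog.sample
      let E ← Prog.tabulate fun i : Fin (c.bigN s ε ^ 3) =>
        Prog.tabulate fun j : Fin (c.bigN s ε ^ 3) =>
          if i < j then testEquivalence (c.bigN s ε) (S i) (S j) else pure false
      if s < (components E).card then pure none else do
        let G' ← mergePhase (c.bigN s ε) S (components E).card (components E)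
        selectPools s ε (c.bigN s ε) (c.omega s ε) (G'.toList.map fun A => A.image S)) := rfl

theorem card_image_le_of_mem {G : Finset (Finset (Fin m))} (S : Fin m → Str n)
    {A : Finset (Str n)} (hA : A ∈ G.toList.map fun A => A.image S) : A.card ≤ m := by
  obtain ⟨B, -, rfl⟩ := List.mem_map.1 hA
  exact Finset.card_image_le.trans ((Finset.card_le_univ _).trans (Fintype.card_fin _).le)

theorem meets_findFactoredDNFs (c : FinderConsts) (s : ℕ) (ε : ℝ) {N ω q : ℕ}
    (hN : c.bigN s ε = N) (hω : c.omega s ε = ω) (h1 : 1 + N ^ 3 * poolReps N ≤ q)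
    (h2 : ⌈100 * ((s : ℝ) / ε) * alpha N⌉₊ * (2 + N ^ 3 * poolReps N) ≤ q) :
    Meets (N ^ 3 + N ^ 9 + s * (N ^ 5 + N ^ 11) + ω * (1 + s * (N ^ 3 * poolReps N)))
      (SmallSimulators s q) (findFactoredDNFs (n := n) c s ε) := by
  rw [findFactoredDNFs_eq, hN, hω]
  refine (meets_tabulate (q := 1) (Q := fun _ _ => True) fun _ => meets_sample).bind_le
    (q₂ := N ^ 9 + (s * (N ^ 5 + N ^ 11) + ω * (1 + s * (N ^ 3 * poolReps N)))) (fun S _ => ?_)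
    (by omega)
  refine (meets_tabulate (q := N ^ 3 * N ^ 3) (Q := fun _ _ => True) fun i => ?_).bind_le
    (q₂ := s * (N ^ 5 + N ^ 11) + ω * (1 + s * (N ^ 3 * poolReps N))) (fun E _ => ?_)
    (by ring_nf; rfl)
  · refine (meets_tabulate (Q := fun _ _ => True) fun j => ?_).mono le_rfl fun _ _ => trivial
    split_ifs
    · exact meets_testEquivalence _ _ _
    · exact meets_pure trivial
  · split_ifs with hs
    · refine meets_pure fun l hl => ?_
      simp at hl
    · refine (meets_mergePhase N S _ _).bind_le (fun G' hG' => ?_) (add_le_add ?_ le_rfl)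
      · refine meets_selectPools ω _ ?_ (fun A hA => card_image_le_of_mem S hA) h1 h2
        rw [List.length_map, Finset.length_toList]; omega
      · rw [show N ^ 3 * (N ^ 5 * N ^ 3) = N ^ 11 by ring]
        exact Nat.mul_le_mul_right _ (not_lt.1 hs)

/-- The guarantee of Find-Factored-DNFs for an arbitrary function. -/
theorem risk_findFactoredDNFs_arbitrary (f : Str n → Bool) (hf : (sat f).Nonempty)
    (c : FinderConsts) {s q N ω : ℕ} {ε : ℝ} (hNc : c.bigN s ε = N) (hω : c.omega s ε = ω)
    (hs : 1 ≤ s) (hε : 0 < ε) (hN : 1 ≤ N) (𝒜 : Set (Prog n Bool))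
    (hq : ∀ alg ∈ 𝒜, Prog.QueriesAtMost q alg) (hqN : q * (1 / (N : ℝ) ^ 2) ≤ 1 / 10)
    (hsel : (2 * s + 1) * Real.exp (-(ε / (20 * s) * ω / 6)) ≤ 1 / 10) :
    risk (World.ofFun f hf ∅) (findFactoredDNFs c s ε) (fun out => ind (out ∉
      {out | out = none ∨ ∃ l, out = some l ∧
        ∃ (h : Fin l.length → Str n → Bool) (hh : ∀ i, (sat (h i)).Nonempty),
          (∀ i, sat (h i) ⊆ sat f) ∧
          ((sat f \ Finset.univ.biUnion fun i => sat (h i)).card : ℝ) / ((sat f).card : ℝ)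
            ≤ ε / 2 ∧
          ∀ i, ∀ alg ∈ 𝒜, IsAdequate f hf (l.get i).1 (l.get i).2 (h i) (hh i) alg})) ≤
      1 / 10 := by
  have hz : ∀ {α : Type} (p : Prog n α), risk (World.ofFun f hf ∅) p (fun _ => 0) ≤ 0 :=
    fun p => (risk_const_of_safe _ rfl p 0).le
  have h10 : (0 : ℝ) ≤ 1 / 10 := by norm_num
  rw [findFactoredDNFs_eq, hNc, hω]
  refine (risk_bind_le_of_forall _ h10 (hz _) fun S => ?_).trans (zero_add _).le
  refine (risk_bind_le_of_forall _ h10 (hz _) fun E => ?_).trans (zero_add _).le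
  split_ifs with hG
  · rw [risk_pure, ind_false (not_not.2 (show _ ∈ _ from Or.inl rfl))]; exact h10
  · refine (risk_bind_le _ (fun G' => G'.card ≤ (components E).card) (fun _ => ind_le_one _) h10
      ((meets_mergePhase N S _ _).risk_eq_zero _ rfl).le fun G' hG' => ?_).trans (zero_add _).le
    refine (risk_selectPools_arbitrary f hf hs hε hN ω _ ?_ 𝒜 hq hqN).trans hsel
    rw [List.length_map, Finset.length_toList]; omega

end FinderQueries

/-! ### Terms that are close to each other -/

section Terms

variable {n : ℕ}

/-- The literals of `T` that are violated by `a`. -/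
def violations (a : Str n) (T : Term n) : Finset (Fin n) :=
  Finset.univ.filter fun i => T i = some (!(a i))

/-- The literals of `T` that do not occur in `U`. -/
def missing (T U : Term n) : Finset (Fin n) :=
  Finset.univ.filter fun i => (T i).isSome = true ∧ T i ≠ U i

theorem eval_eq_true_iff {T : Term n} {x : Str n} :
    Term.eval T x = true ↔ ∀ i b, T i = some b → x i = b := by
  rw [Term.eval, decide_eq_true_eq]

theorem dnf_eq_true_iff {D : Finset (Term n)} {x : Str n} :
    dnf D x = true ↔ ∃ T ∈ D, Term.eval T x = true := by
  rw [dnf, decide_eq_true_eq]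

theorem sat_term_subset {D : Finset (Term n)} {T : Term n} (hT : T ∈ D) :
    sat (Term.eval T) ⊆ sat (dnf D) := fun _ hx =>
  mem_sat.2 (dnf_eq_true_iff.2 ⟨T, hT, mem_sat.1 hx⟩)

theorem Term.card_vars_le (T : Term n) : T.vars.card ≤ n := by simpa using Finset.card_le_univ T.vars

theorem card_sat_term (T : Term n) : (sat (Term.eval T)).card = 2 ^ (n - T.vars.card) := by
  rw [← card_agree T.vars fun i => (T i).getD false]
  congr 1; ext x
  simp only [mem_sat, eval_eq_true_iff, Term.vars, Finset.mem_filter, Finset.mem_univ, true_and]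
  refine forall_congr' fun i => ?_
  cases h : T i with
  | none => simp
  | some b => simp

/-- Both sides count the literals that occur in `T` or in `U`. -/
theorem card_vars_add_card_missing (T U : Term n) :
    U.vars.card + (missing T U).card = T.vars.card + (missing U T).card := by
  classical
  set I := Finset.univ.filter fun i => (T i).isSome = true ∧ T i = U i with hI
  have key : ∀ A B : Term n, A.vars.card = (missing A B).card +
      (Finset.univ.filter fun i => (A i).isSome = true ∧ A i = B i).card := by
    intro A B
    rw [← Finset.card_union_of_disjoint]
    · congr 1; ext i
      simp only [Term.vars, missing, Finset.mem_filter, Finset.mem_univ, true_and,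
        Finset.mem_union]
      tauto
    · rw [missing, Finset.disjoint_filter]; intro i _ h h'; exact h.2 h'.2
  have e : (Finset.univ.filter fun i => (U i).isSome = true ∧ U i = T i) = I := by
    rw [hI]; ext i
    simp only [Finset.mem_filter, Finset.mem_univ, true_and]
    constructor
    · rintro ⟨h, h'⟩; exact ⟨h' ▸ h, h'.symm⟩
    · rintro ⟨h, h'⟩; exact ⟨h' ▸ h, h'.symm⟩
  have h1 := key T U
  have h2 := key U T
  rw [e] at h2
  rw [← hI] at h1
  omega

theorem card_missing_le (T U V : Term n) :
    (missing U V).card ≤ (missing U T).card + (missing T V).card := by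
  classical
  refine (Finset.card_le_card (t := missing U T ∪ missing T V) fun i hi => ?_).trans
    (Finset.card_union_le _ _)
  simp only [missing, Finset.mem_filter, Finset.mem_univ, true_and, Finset.mem_union] at hi ⊢
  by_cases h : U i = T i
  · right; rw [← h]; exact hi
  · left; exact ⟨hi.1, h⟩

/-- A uniform satisfying string of `U` violates few literals of a term `T` only with a probability
that is exponentially small in the number of literals of `T` missing from `U`. -/
theorem sum_sat_violations_le (T U : Term n) :
    ∑ a ∈ sat (Term.eval U), (1 / 2 : ℝ) ^ (violations a T).card ≤
      (sat (Term.eval U)).card * (3 / 4 : ℝ) ^ (missing T U).card := by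
  classical
  set u : Fin n → Bool → ℝ := fun i b => if U i = some (!b) then 0 else 1 with hu
  set v : Fin n → Bool → ℝ := fun i b => if T i = some (!b) then 1 / 2 else 1 with hv
  have hu' : ∀ a : Str n, ∏ i, u i (a i) = ind (Term.eval U a = true) := by
    intro a
    by_cases h : Term.eval U a = true
    · rw [ind_true h]
      refine Finset.prod_eq_one fun i _ => if_neg fun h' => ?_
      have := eval_eq_true_iff.1 h i _ h'
      simp at this
    · rw [ind_false h]
      rw [eval_eq_true_iff] at h
      push Not at h
      obtain ⟨i, b, h1, h2⟩ := h
      refine Finset.prod_eq_zero (Finset.mem_univ i) (if_pos ?_)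
      rw [h1]; congr 1; exact Bool.eq_not.2 h2.symm
  have hv' : ∀ a : Str n, ∏ i, v i (a i) = (1 / 2 : ℝ) ^ (violations a T).card := by
    intro a
    rw [hv]; dsimp only
    rw [Finset.prod_ite]; simp [violations]
  have hswap : ∀ c : Fin n → Bool → ℝ, ∑ a : Str n, ∏ i, c i (a i) = ∏ i, ∑ b, c i b := by
    intro c
    rw [Finset.prod_univ_sum, Fintype.piFinset_univ]
  have e1 : ∑ a ∈ sat (Term.eval U), (1 / 2 : ℝ) ^ (violations a T).card =
      ∏ i, ∑ b, u i b * v i b := by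
    rw [← hswap fun i b => u i b * v i b]
    simp only [Finset.prod_mul_distrib, hu', hv']
    rw [sat, Finset.sum_filter]
    refine Finset.sum_congr rfl fun a _ => ?_
    split_ifs with h
    · rw [ind_true h, one_mul]
    · rw [ind_false h, zero_mul]
  have e2 : ((sat (Term.eval U)).card : ℝ) = ∏ i, ∑ b, u i b := by
    rw [← hswap u]
    simp only [hu']
    rw [sat, Finset.card_filter, Nat.cast_sum]
    refine Finset.sum_congr rfl fun a _ => ?_
    split_ifs with h
    · rw [ind_true h, Nat.cast_one]
    · rw [ind_false h, Nat.cast_zero]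
  have e3 : (3 / 4 : ℝ) ^ (missing T U).card =
      ∏ i, (if (T i).isSome = true ∧ T i ≠ U i then 3 / 4 else 1) := by
    rw [Finset.prod_ite, Finset.prod_const, Finset.prod_const_one, mul_one, missing]
  rw [e1, e2, e3, ← Finset.prod_mul_distrib]
  refine Finset.prod_le_prod (fun i _ => Finset.sum_nonneg fun b _ => ?_) fun i _ => ?_
  · simp only [hu, hv]; split_ifs <;> norm_num
  · simp only [hu, hv, Fintype.sum_bool]
    rcases hT : T i with _ | (_ | _) <;> rcases hU : U i with _ | (_ | _) <;>
      simp <;> norm_num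

/-- The fraction of `Cube(a, b)` on which `f` holds. -/
noncomputable def frac (f : Str n → Bool) (a b : Str n) : ℝ :=
  𝔼 w, ind (f (mix w a b) = true)

theorem frac_nonneg (f : Str n → Bool) (a b : Str n) : 0 ≤ frac f a b :=
  Finset.expect_nonneg fun _ _ => ind_nonneg _

theorem frac_le_one (f : Str n → Bool) (a b : Str n) : frac f a b ≤ 1 :=
  (Finset.expect_le_expect fun _ _ => ind_le_one _).trans (by simp)

theorem frac_comm (f : Str n → Bool) (a b : Str n) : frac f a b = frac f b a := by
  rw [frac, frac, ← expect_involutive (fun w : Str n => fun i => !(w i)) (fun w => by simp)]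
  refine Finset.expect_congr rfl fun w _ => ?_
  have : mix (fun i => !(w i)) a b = mix w b a := by
    funext i
    simp only [mix]
    by_cases hw : w i = true <;> simp [hw]
  rw [this]

theorem eval_mix {T : Term n} {a b : Str n} (ha : Term.eval T a = true)
    (hb : Term.eval T b = true) (w : Str n) : Term.eval T (mix w a b) = true := by
  rw [eval_eq_true_iff] at ha hb ⊢
  intro i c hc
  simp only [mix]
  split_ifs
  · exact ha i c hc
  · exact hb i c hc

theorem frac_eq_one {D : Finset (Term n)} {T : Term n} (hT : T ∈ D) {a b : Str n}
    (ha : Term.eval T a = true) (hb : Term.eval T b = true) : frac (dnf D) a b = 1 := by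
  have : ∀ w, ind (dnf D (mix w a b) = true) = 1 := fun w =>
    ind_true (dnf_eq_true_iff.2 ⟨T, hT, eval_mix ha hb w⟩)
  simp [frac, this]

theorem expect_agree (S : Finset (Fin n)) (c : Bool) :
    𝔼 w : Str n, ind (∀ i ∈ S, w i = c) = (1 / 2 : ℝ) ^ S.card := by
  have hS : S.card ≤ n := by simpa using Finset.card_le_univ S
  rw [expect_ind_eq_card, card_agree S fun _ => c]
  simp only [Finset.card_univ, Fintype.card_pi, Fintype.card_bool, Finset.prod_const,
    Fintype.card_fin]
  push_cast
  rw [one_div, inv_pow, div_eq_iff (by positivity), ← div_eq_inv_mul, eq_div_iff (by positivity),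
    ← pow_add]
  congr 1; omega

theorem expect_eval_mix_le (T : Term n) (a b : Str n) :
    𝔼 w, ind (Term.eval T (mix w a b) = true) ≤ (1 / 2 : ℝ) ^ (violations a T).card := by
  rw [← expect_agree (violations a T) false]
  refine Finset.expect_le_expect fun w _ => ind_mono fun h i hi => ?_
  rw [violations, Finset.mem_filter] at hi
  by_contra hw
  have := eval_eq_true_iff.1 h i _ hi.2
  simp [mix, Bool.eq_true_of_not_eq_false hw] at this

theorem expect_eval_mix_comm (T : Term n) (a b : Str n) :
    𝔼 w, ind (Term.eval T (mix w a b) = true) = 𝔼 w, ind (Term.eval T (mix w b a) = true) :=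
  frac_comm (Term.eval T) a b

/-- If a noticeable part of `Cube(a, b)` satisfies the DNF, then some term is nearly satisfied by
both `a` and `b`. -/
theorem exists_term_of_frac {D : Finset (Term n)} {a b : Str n} {δ : ℝ}
    (h : D.card * δ ≤ frac (dnf D) a b) (hpos : 0 < frac (dnf D) a b) :
    ∃ T ∈ D, δ ≤ (1 / 2 : ℝ) ^ (violations a T).card ∧
      δ ≤ (1 / 2 : ℝ) ^ (violations b T).card := by
  have hle : frac (dnf D) a b ≤ ∑ T ∈ D, 𝔼 w, ind (Term.eval T (mix w a b) = true) := by
    rw [← Finset.expect_sum_comm]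
    refine Finset.expect_le_expect fun w _ => ?_
    by_cases hw : dnf D (mix w a b) = true
    · obtain ⟨T, hT, hTw⟩ := dnf_eq_true_iff.1 hw
      rw [ind_true hw, ← ind_true hTw]
      exact Finset.single_le_sum (f := fun T => ind (Term.eval T (mix w a b) = true))
        (fun _ _ => ind_nonneg _) hT
    · rw [ind_false hw]; exact Finset.sum_nonneg fun _ _ => ind_nonneg _
  by_contra! hc
  -- a term that `a` violates in `k` literals holds on at most a fraction `2 ^ (-k)` of the cube
  have hlt : ∀ T ∈ D, 𝔼 w, ind (Term.eval T (mix w a b) = true) < δ := by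
    intro T hT
    by_cases h1 : δ ≤ (1 / 2 : ℝ) ^ (violations a T).card
    · rw [expect_eval_mix_comm]
      exact (expect_eval_mix_le T b a).trans_lt (hc T hT h1)
    · exact (expect_eval_mix_le T a b).trans_lt (not_le.1 h1)
  have hD : D.Nonempty := by
    by_contra hD
    rw [Finset.not_nonempty_iff_eq_empty] at hD
    subst hD
    simp at hle; linarith
  have := Finset.sum_lt_sum_of_nonempty hD hlt
  rw [Finset.sum_const, nsmul_eq_mul] at this
  linarith

/-- A satisfying string of the DNF is generic if a term it nearly satisfies lacks few literals of
each term it satisfies, and none of the terms it satisfies has a very small weight. -/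
def Generic (D : Finset (Term n)) (N : ℝ) (a : Str n) : Prop :=
  (∀ U ∈ D, ∀ T ∈ D, Term.eval U a = true → 1 / N ^ 13 ≤ (1 / 2 : ℝ) ^ (violations a T).card →
    1 / N ^ 30 ≤ (3 / 4 : ℝ) ^ (missing T U).card) ∧
  ∀ U ∈ D, Term.eval U a = true → ((sat (dnf D)).card : ℝ) ≤ N ^ 8 * (sat (Term.eval U)).card

/-- Both defects are counted for each term `U`: few strings of `U` nearly satisfy a term that lacks
many literals of `U`, by `sum_sat_violations_le` and Markov's inequality; and few strings satisfy a
term `U` of very small weight. -/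
theorem expect_not_generic_le {D : Finset (Term n)} (hD : (sat (dnf D)).Nonempty) {N : ℝ}
    (hN : 1 ≤ N) (hDN : D.card ≤ N) :
    𝔼 a ∈ sat (dnf D), ind (¬ Generic D N a) ≤ 2 / N ^ 7 := by
  set F := sat (dnf D) with hF
  have hFc : (0 : ℝ) < F.card := Nat.cast_pos.2 hD.card_pos
  have hN0 : 0 < N := by linarith
  rw [Finset.expect_eq_sum_div_card, div_le_iff₀ hFc]
  have h1 : ∀ U ∈ D, ∀ T ∈ D, ∑ a ∈ F, ind (Term.eval U a = true ∧
      1 / N ^ 13 ≤ (1 / 2 : ℝ) ^ (violations a T).card ∧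
      ¬ 1 / N ^ 30 ≤ (3 / 4 : ℝ) ^ (missing T U).card) ≤ F.card / N ^ 17 := by
    intro U hU T _
    by_cases hm : 1 / N ^ 30 ≤ (3 / 4 : ℝ) ^ (missing T U).card
    · rw [Finset.sum_eq_zero fun a _ => ind_false fun h => h.2.2 hm]; positivity
    · rw [not_le] at hm
      have hUF : sat (Term.eval U) ⊆ F := sat_term_subset hU
      calc _ ≤ ∑ a ∈ sat (Term.eval U), N ^ 13 * (1 / 2 : ℝ) ^ (violations a T).card := by
            rw [← Finset.sum_subset hUF fun a _ ha => ind_false fun h => ha (mem_sat.2 h.1)]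
            refine Finset.sum_le_sum fun a _ => ?_
            by_cases h : 1 / N ^ 13 ≤ (1 / 2 : ℝ) ^ (violations a T).card
            · refine (ind_le_one _).trans ?_
              rw [div_le_iff₀ (by positivity)] at h; linarith
            · rw [ind_false fun h' => h h'.2.1]; positivity
        _ ≤ N ^ 13 * ((sat (Term.eval U)).card * (3 / 4 : ℝ) ^ (missing T U).card) := by
            rw [← Finset.mul_sum]
            exact mul_le_mul_of_nonneg_left (sum_sat_violations_le T U) (by positivity)
        _ ≤ N ^ 13 * (F.card * (1 / N ^ 30)) := by
            gcongr
        _ = F.card / N ^ 17 := by field_simp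
  have h2 : ∀ U ∈ D, ∑ a ∈ F, ind (Term.eval U a = true ∧
      ¬ ((F.card : ℝ) ≤ N ^ 8 * (sat (Term.eval U)).card)) ≤ F.card / N ^ 8 := by
    intro U hU
    by_cases hm : (F.card : ℝ) ≤ N ^ 8 * (sat (Term.eval U)).card
    · rw [Finset.sum_eq_zero fun a _ => ind_false fun h => h.2 hm]; positivity
    · have hUF : sat (Term.eval U) ⊆ F := sat_term_subset hU
      rw [← Finset.sum_subset hUF fun a _ ha => ind_false fun h => ha (mem_sat.2 h.1)]
      refine (Finset.sum_le_sum fun a _ => ind_le_one _).trans ?_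
      rw [Finset.sum_const, nsmul_eq_mul, mul_one, le_div_iff₀ (by positivity)]
      linarith
  have h3 : ∀ a, ind (¬ Generic D N a) ≤
      (∑ U ∈ D, ∑ T ∈ D, ind (Term.eval U a = true ∧
        1 / N ^ 13 ≤ (1 / 2 : ℝ) ^ (violations a T).card ∧
        ¬ 1 / N ^ 30 ≤ (3 / 4 : ℝ) ^ (missing T U).card)) +
      ∑ U ∈ D, ind (Term.eval U a = true ∧
        ¬ ((F.card : ℝ) ≤ N ^ 8 * (sat (Term.eval U)).card)) := by
    intro a
    have p1 : ∀ U : Term n, ∀ T : Term n, 0 ≤ ind (Term.eval U a = true ∧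
        1 / N ^ 13 ≤ (1 / 2 : ℝ) ^ (violations a T).card ∧
        ¬ 1 / N ^ 30 ≤ (3 / 4 : ℝ) ^ (missing T U).card) := fun _ _ => ind_nonneg _
    have p2 : ∀ U : Term n, 0 ≤ ind (Term.eval U a = true ∧
        ¬ ((F.card : ℝ) ≤ N ^ 8 * (sat (Term.eval U)).card)) := fun _ => ind_nonneg _
    have q1 := Finset.sum_nonneg (s := D) fun U _ => Finset.sum_nonneg (s := D) fun T _ => p1 U T
    have q2 := Finset.sum_nonneg (s := D) fun U _ => p2 U
    by_cases hg : Generic D N a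
    · rw [ind_false (not_not.2 hg)]; linarith
    · refine (ind_le_one _).trans ?_
      rw [Generic, not_and_or] at hg
      push Not at hg
      rcases hg with ⟨U, hU, T, hT, g1, g2, g3⟩ | ⟨U, hU, g1, g2⟩
      · have r1 := Finset.single_le_sum (fun T _ => p1 U T) hT
        rw [ind_true ⟨g1, g2, not_le.2 g3⟩] at r1
        have r2 := Finset.single_le_sum
          (fun U _ => Finset.sum_nonneg (s := D) fun T _ => p1 U T) hU
        linarith
      · have r1 := Finset.single_le_sum (fun U _ => p2 U) hU
        rw [ind_true ⟨g1, not_le.2 g2⟩] at r1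
        linarith
  calc ∑ a ∈ F, ind (¬ Generic D N a) ≤ _ := Finset.sum_le_sum fun a _ => h3 a
    _ = (∑ U ∈ D, ∑ T ∈ D, ∑ a ∈ F, ind (Term.eval U a = true ∧
        1 / N ^ 13 ≤ (1 / 2 : ℝ) ^ (violations a T).card ∧
        ¬ 1 / N ^ 30 ≤ (3 / 4 : ℝ) ^ (missing T U).card)) +
      ∑ U ∈ D, ∑ a ∈ F, ind (Term.eval U a = true ∧
        ¬ ((F.card : ℝ) ≤ N ^ 8 * (sat (Term.eval U)).card)) := by
        rw [Finset.sum_add_distrib, Finset.sum_comm]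
        congr 1
        · refine Finset.sum_congr rfl fun U _ => Finset.sum_comm
        · exact Finset.sum_comm
    _ ≤ (∑ U ∈ D, ∑ T ∈ D, (F.card : ℝ) / N ^ 17) + ∑ U ∈ D, (F.card : ℝ) / N ^ 8 :=
        add_le_add (Finset.sum_le_sum fun U hU => Finset.sum_le_sum fun T hT => h1 U hU T hT)
          (Finset.sum_le_sum fun U hU => h2 U hU)
    _ ≤ N * (N * (F.card / N ^ 17)) + N * (F.card / N ^ 8) := by
        simp only [Finset.sum_const, nsmul_eq_mul]; gcongr
    _ = F.card / N ^ 15 + F.card / N ^ 7 := by field_simp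
    _ ≤ F.card / N ^ 7 + F.card / N ^ 7 := by
        gcongr
        norm_num
    _ = 2 / N ^ 7 * F.card := by ring

theorem card_le_of_three_quarters_pow {N : ℝ} (hN : 1 ≤ N) {m : ℕ}
    (h : 1 / N ^ 30 ≤ (3 / 4 : ℝ) ^ m) : (m : ℝ) ≤ 75 * Real.logb 2 N := by
  have hN0 : 0 < N := by linarith
  have h2 : (m : ℝ) * Real.log (4 / 3) ≤ 30 * Real.log N := by
    have := Real.log_le_log (by positivity) h
    rw [one_div, Real.log_inv, Real.log_pow, Real.log_pow] at this
    rw [show (4 / 3 : ℝ) = (3 / 4)⁻¹ by norm_num, Real.log_inv]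
    push_cast at this; linarith
  have h3 : 2 * Real.log 2 ≤ 5 * Real.log (4 / 3) := by
    have := Real.log_le_log (by norm_num) (show (2 : ℝ) ^ 2 ≤ (4 / 3) ^ 5 by norm_num)
    rw [Real.log_pow, Real.log_pow] at this
    exact_mod_cast this
  have hl2 : 0 < Real.log 2 := Real.log_pos (by norm_num)
  rw [Real.logb, ← mul_div_assoc, le_div_iff₀ hl2]
  have hm : (0 : ℝ) ≤ m := Nat.cast_nonneg m
  nlinarith

/-- A satisfied term is not much longer than any other term. -/
theorem Generic.card_vars_le {D : Finset (Term n)} {N : ℝ} {a : Str n} (hN : 1 ≤ N)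
    (ha : Generic D N a) {U T : Term n} (hU : U ∈ D) (hT : T ∈ D) (hUa : Term.eval U a = true) :
    (U.vars.card : ℝ) ≤ T.vars.card + 8 * Real.logb 2 N := by
  have h1 : ((sat (Term.eval T)).card : ℝ) ≤ N ^ 8 * (sat (Term.eval U)).card :=
    (Nat.cast_le.2 (Finset.card_le_card (sat_term_subset hT))).trans (ha.2 U hU hUa)
  rw [card_sat_term, card_sat_term] at h1
  push_cast at h1
  have h2 := Real.log_le_log (by positivity) h1
  rw [Real.log_mul (by positivity) (by positivity), Real.log_pow, Real.log_pow, Real.log_pow,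
    Nat.cast_sub (Term.card_vars_le T), Nat.cast_sub (Term.card_vars_le U)] at h2
  have hl2 : 0 < Real.log 2 := Real.log_pos (by norm_num)
  rw [Real.logb, ← mul_div_assoc]
  have : (U.vars.card : ℝ) - T.vars.card ≤ 8 * Real.log N / Real.log 2 := by
    rw [le_div_iff₀ hl2]; push_cast at h2; linarith
  linarith

/-- The terms satisfied by two generic strings agree in most literals if a noticeable part of the
cube spanned by the strings satisfies the DNF. -/
theorem card_missing_le_of_frac {D : Finset (Term n)} {N : ℝ} {a b : Str n} (hN : 1 ≤ N)
    (hDN : D.card ≤ N) (ha : Generic D N a) (hb : Generic D N b)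
    (hab : 1 / N ^ 12 ≤ frac (dnf D) a b) {U V : Term n} (hU : U ∈ D) (hV : V ∈ D)
    (hUa : Term.eval U a = true) (hVb : Term.eval V b = true) :
    ((missing U V).card : ℝ) ≤ 158 * Real.logb 2 N := by
  have hN0 : 0 < N := by linarith
  obtain ⟨T, hT, h1, h2⟩ := exists_term_of_frac (D := D) (a := a) (b := b) (δ := 1 / N ^ 13)
    (le_trans (by
      calc (D.card : ℝ) * (1 / N ^ 13) ≤ N * (1 / N ^ 13) := by gcongr
        _ = 1 / N ^ 12 := by field_simp) hab) (lt_of_lt_of_le (by positivity) hab)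
  have h3 := card_le_of_three_quarters_pow hN (ha.1 U hU T hT hUa h1)
  have h4 := card_le_of_three_quarters_pow hN (hb.1 V hV T hT hVb h2)
  have h5 := ha.card_vars_le hN hU hT hUa
  have h6 : (U.vars.card : ℝ) + (missing T U).card = T.vars.card + (missing U T).card := by
    exact_mod_cast card_vars_add_card_missing T U
  have h7 : ((missing U V).card : ℝ) ≤ (missing U T).card + (missing T V).card := by
    exact_mod_cast card_missing_le T U V
  linarith

end Terms

/-! ### Linked families of terms are factored DNFs -/

section Linked

variable {n : ℕ}

/-- Any two terms of `H` are joined by a path of terms of `H` along which at most `c` literals are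
lost at each step. -/
def Linked (c : ℝ) (H : Finset (Term n)) : Prop :=
  ∀ U ∈ H, ∀ V ∈ H, Relation.ReflTransGen
    (fun U V => U ∈ H ∧ V ∈ H ∧ ((missing U V).card : ℝ) ≤ c) U V

/-- Two linked families are linked if some term of the one is close to some term of the other. -/
theorem Linked.union {c : ℝ} {H H' : Finset (Term n)} (h : Linked c H) (h' : Linked c H')
    {U V : Term n} (hU : U ∈ H) (hV : V ∈ H') (h1 : ((missing U V).card : ℝ) ≤ c)
    (h2 : ((missing V U).card : ℝ) ≤ c) : Linked c (H ∪ H') := by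
  have m1 : ∀ {A B : Term n}, A ∈ H → B ∈ H → Relation.ReflTransGen
      (fun U V => U ∈ H ∪ H' ∧ V ∈ H ∪ H' ∧ ((missing U V).card : ℝ) ≤ c) A B := fun hA hB =>
    (h _ hA _ hB).lift id fun _ _ h => ⟨Finset.mem_union_left _ h.1, Finset.mem_union_left _ h.2.1,
      h.2.2⟩
  have m2 : ∀ {A B : Term n}, A ∈ H' → B ∈ H' → Relation.ReflTransGen
      (fun U V => U ∈ H ∪ H' ∧ V ∈ H ∪ H' ∧ ((missing U V).card : ℝ) ≤ c) A B := fun hA hB =>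
    (h' _ hA _ hB).lift id fun _ _ h => ⟨Finset.mem_union_right _ h.1,
      Finset.mem_union_right _ h.2.1, h.2.2⟩
  have hU' := Finset.mem_union_left H' hU
  have hV' := Finset.mem_union_right H hV
  intro A hA B hB
  rcases Finset.mem_union.1 hA with hA | hA <;> rcases Finset.mem_union.1 hB with hB | hB
  · exact m1 hA hB
  · exact ((m1 hA hU).tail ⟨hU', hV', h1⟩).trans (m2 hV hB)
  · exact ((m2 hA hV).tail ⟨hV', hU', h2⟩).trans (m1 hU hB)
  · exact m2 hA hB

theorem exists_step_of_reflTransGen {α : Type*} {r : α → α → Prop} {Q : α → Prop} {a b : α}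
    (h : Relation.ReflTransGen r a b) (ha : Q a) (hb : ¬ Q b) : ∃ x y, r x y ∧ Q x ∧ ¬ Q y := by
  induction h with
  | refl => exact absurd ha hb
  | @tail c d _ hcd ih =>
    by_cases hc : Q c
    · exact ⟨c, d, hcd, hc, hb⟩
    · exact ih hc

/-- The head of the factored form consists of the literals common to all the terms. A literal of a
term that is not common to all of them is lost at some step of a path to another term. -/
theorem Linked.isFactoredDNF {c : ℝ} {H : Finset (Term n)} (hL : Linked c H) (hc : 0 ≤ c) {μ : ℕ}
    (hμ : (H.card : ℝ) ^ 2 * c ≤ μ) : IsFactoredDNF H.card μ (dnf H) := by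
  classical
  -- the coordinates on which all the terms have the same literal
  let common : Fin n → Prop := fun i => ∃ b, ∀ V ∈ H, V i = some b
  let head : Term n := fun i => if h : common i then some h.choose else none
  let tail : Term n → Term n := fun U i => if common i then none else U i
  have hhead : ∀ {i : Fin n} {b : Bool} {U : Term n}, U ∈ H → head i = some b → U i = some b := by
    intro i b U hU hb
    by_cases h : common i
    · simp only [head, dif_pos h] at hb
      rw [h.choose_spec U hU, hb]
    · simp [head, dif_neg h] at hb
  refine ⟨head, H.image tail, Finset.card_image_le, fun T hT => ?_, ?_, fun x => ?_⟩
  · obtain ⟨U, -, rfl⟩ := Finset.mem_image.1 hT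
    rw [Finset.disjoint_left]
    intro i h1 h2
    simp only [Term.vars, Finset.mem_filter, Finset.mem_univ, true_and] at h1 h2
    by_cases h : common i
    · simp [tail, h] at h2
    · simp [head, h] at h1
  · have hsub : (H.image tail).biUnion Term.vars ⊆
        ((H ×ˢ H).filter fun p => ((missing p.1 p.2).card : ℝ) ≤ c).biUnion
          fun p => missing p.1 p.2 := by
      intro i hi
      obtain ⟨T, hT, hiT⟩ := Finset.mem_biUnion.1 hi
      obtain ⟨U, hU, rfl⟩ := Finset.mem_image.1 hT
      simp only [Term.vars, Finset.mem_filter, Finset.mem_univ, true_and] at hiT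
      have hcom : ¬ common i := fun h => by simp [tail, h] at hiT
      simp only [tail, if_neg hcom] at hiT
      obtain ⟨b, hb⟩ := Option.isSome_iff_exists.1 hiT
      have : ∃ V ∈ H, V i ≠ U i := by
        by_contra! h'
        exact hcom ⟨b, fun V hV => (h' V hV).trans hb⟩
      obtain ⟨V, hV, hVU⟩ := this
      obtain ⟨A, B, ⟨hA, hB, hAB⟩, h1, h2⟩ :=
        exists_step_of_reflTransGen (Q := fun W : Term n => W i = U i) (hL U hU V hV) rfl hVU
      refine Finset.mem_biUnion.2 ⟨(A, B), Finset.mem_filter.2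
        ⟨Finset.mem_product.2 ⟨hA, hB⟩, hAB⟩, ?_⟩
      simp only [missing, Finset.mem_filter, Finset.mem_univ, true_and]
      refine ⟨by rw [h1]; exact hiT, fun h => h2 (h ▸ h1)⟩
    have h1 := (Finset.card_le_card hsub).trans Finset.card_biUnion_le
    have h2 : ((∑ p ∈ (H ×ˢ H).filter fun p => ((missing p.1 p.2).card : ℝ) ≤ c,
        (missing p.1 p.2).card : ℕ) : ℝ) ≤ μ := by
      rw [Nat.cast_sum]
      refine (Finset.sum_le_sum fun p hp => (Finset.mem_filter.1 hp).2).trans ?_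
      rw [Finset.sum_const, nsmul_eq_mul]
      refine le_trans (mul_le_mul_of_nonneg_right ?_ hc) hμ
      have := Finset.card_filter_le (H ×ˢ H) fun p => ((missing p.1 p.2).card : ℝ) ≤ c
      rw [Finset.card_product] at this
      rw [sq]; exact_mod_cast this
    exact h1.trans (by exact_mod_cast h2)
  · rw [Bool.eq_iff_iff, Bool.and_eq_true, dnf_eq_true_iff, dnf_eq_true_iff]
    constructor
    · rintro ⟨U, hU, hx⟩
      rw [eval_eq_true_iff] at hx
      refine ⟨eval_eq_true_iff.2 fun i b hb => hx i b (hhead hU hb), tail U,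
        Finset.mem_image_of_mem _ hU, eval_eq_true_iff.2 fun i b hb => ?_⟩
      by_cases h : common i
      · simp [tail, h] at hb
      · simp only [tail, if_neg h] at hb; exact hx i b hb
    · rintro ⟨h1, T, hT, h2⟩
      obtain ⟨U, hU, rfl⟩ := Finset.mem_image.1 hT
      rw [eval_eq_true_iff] at h1 h2
      refine ⟨U, hU, eval_eq_true_iff.2 fun i b hb => ?_⟩
      by_cases h : common i
      · refine h1 i b ?_
        simp only [head, dif_pos h]
        rw [← h.choose_spec U hU, hb]
      · exact h2 i b (by simp only [tail, if_neg h]; exact hb)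

end Linked

/-! ### Pools of samples -/

section Pools

variable {n m : ℕ}

open Classical in
/-- The terms of `D` that are satisfied by a sample of the pool `p`. -/
noncomputable def hitTerms (D : Finset (Term n)) (S : Fin m → Str n) (p : Finset (Fin m)) :
    Finset (Term n) :=
  D.filter fun U => ∃ i ∈ p, Term.eval U (S i) = true

theorem mem_hitTerms {D : Finset (Term n)} {S : Fin m → Str n} {p : Finset (Fin m)} {U : Term n} :
    U ∈ hitTerms D S p ↔ U ∈ D ∧ ∃ i ∈ p, Term.eval U (S i) = true := by
  rw [hitTerms, Finset.mem_filter]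

theorem hitTerms_union (D : Finset (Term n)) (S : Fin m → Str n) (p q : Finset (Fin m)) :
    hitTerms D S (p ∪ q) = hitTerms D S p ∪ hitTerms D S q := by
  ext U
  simp only [Finset.mem_union, mem_hitTerms, or_and_right, exists_or, and_or_left]

/-- The pools contain all the samples, the samples of different pools have no terms in common, and
the terms of each pool are linked. -/
structure IsPooling (D : Finset (Term n)) (S : Fin m → Str n) (c : ℝ)
    (G : Finset (Finset (Fin m))) : Prop where
  cover : ∀ i, ∃ p ∈ G, i ∈ p
  disjoint : ∀ p ∈ G, ∀ q ∈ G, p ≠ q → Disjoint (hitTerms D S p) (hitTerms D S q)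
  linked : ∀ p ∈ G, Linked c (hitTerms D S p)

variable {D : Finset (Term n)} {S : Fin m → Str n} {c : ℝ}

/-- The pools divide up the terms. -/
theorem IsPooling.sum_card_le {G : Finset (Finset (Fin m))} (h : IsPooling D S c G) :
    ∑ p ∈ G, (hitTerms D S p).card ≤ D.card := by
  classical
  rw [← Finset.card_biUnion fun p hp q hq hpq => h.disjoint p hp q hq hpq]
  refine Finset.card_le_card fun U hU => ?_
  obtain ⟨p, -, hp⟩ := Finset.mem_biUnion.1 hU
  exact (mem_hitTerms.1 hp).1

/-- Two pools may be merged if they contain terms that are close to each other. -/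
theorem IsPooling.merge {G : Finset (Finset (Fin m))} (h : IsPooling D S c G)
    {p q : Finset (Fin m)} (hp : p ∈ G) (hq : q ∈ G)
    {U V : Term n} (hU : U ∈ hitTerms D S p) (hV : V ∈ hitTerms D S q)
    (h1 : ((missing U V).card : ℝ) ≤ c) (h2 : ((missing V U).card : ℝ) ≤ c) :
    IsPooling D S c (insert (p ∪ q) ((G.erase p).erase q)) where
  cover i := by
    obtain ⟨r, hr, hi⟩ := h.cover i
    by_cases hrp : r = p
    · exact ⟨_, Finset.mem_insert_self _ _, Finset.mem_union_left _ (hrp ▸ hi)⟩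
    · by_cases hrq : r = q
      · exact ⟨_, Finset.mem_insert_self _ _, Finset.mem_union_right _ (hrq ▸ hi)⟩
      · exact ⟨r, Finset.mem_insert_of_mem (Finset.mem_erase.2 ⟨hrq,
          Finset.mem_erase.2 ⟨hrp, hr⟩⟩), hi⟩
  disjoint r hr t ht hrt := by
    have key : ∀ r ∈ (G.erase p).erase q,
        Disjoint (hitTerms D S (p ∪ q)) (hitTerms D S r) := by
      intro r hr
      obtain ⟨h3, hr⟩ := Finset.mem_erase.1 hr
      obtain ⟨h4, hr⟩ := Finset.mem_erase.1 hr
      rw [hitTerms_union, Finset.disjoint_union_left]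
      exact ⟨h.disjoint p hp r hr h4.symm, h.disjoint q hq r hr h3.symm⟩
    rcases Finset.mem_insert.1 hr with rfl | hr' <;> rcases Finset.mem_insert.1 ht with rfl | ht'
    · exact absurd rfl hrt
    · exact key t ht'
    · exact (key r hr').symm
    · exact h.disjoint r (Finset.mem_of_mem_erase (Finset.mem_of_mem_erase hr')) t
        (Finset.mem_of_mem_erase (Finset.mem_of_mem_erase ht')) hrt
  linked r hr := by
    rcases Finset.mem_insert.1 hr with rfl | hr'
    · rw [hitTerms_union]
      exact (h.linked p hp).union (h.linked q hq) hU hV h1 h2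
    · exact h.linked r (Finset.mem_of_mem_erase (Finset.mem_of_mem_erase hr'))

/-- What the initial graph on the samples has to satisfy: adjacent samples satisfy terms that are
close to each other, and samples that satisfy a common term are adjacent. -/
structure IsFaithfulGraph (D : Finset (Term n)) (S : Fin m → Str n) (c : ℝ)
    (E : Fin m → Fin m → Bool) : Prop where
  near : ∀ i j U V, i = j ∨ E i j = true ∨ E j i = true → U ∈ D → V ∈ D →
    Term.eval U (S i) = true → Term.eval V (S j) = true → ((missing U V).card : ℝ) ≤ c
  adj : ∀ i j, i < j → ∀ U ∈ D, Term.eval U (S i) = true → Term.eval U (S j) = true →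
    E i j = true

theorem mem_components {E : Fin m → Fin m → Bool} {p : Finset (Fin m)} :
    p ∈ components E ↔ ∃ i, ∀ j, j ∈ p ↔
      (SimpleGraph.fromRel fun a b => E a b = true).Reachable i j := by
  simp only [components, Finset.mem_image, Finset.mem_univ, true_and]
  refine exists_congr fun i => ⟨?_, fun h => ?_⟩
  · rintro rfl j; simp
  · ext j; simp [h j]

/-- Samples of different components share no term, as they would be adjacent, and a path between
samples of one component gives a path between the terms that they satisfy. -/
theorem IsFaithfulGraph.isPooling {E : Fin m → Fin m → Bool} (h : IsFaithfulGraph D S c E)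
    (hS : ∀ i, dnf D (S i) = true) : IsPooling D S c (components E) where
  cover i := by
    classical
    refine ⟨Finset.univ.filter fun j =>
      (SimpleGraph.fromRel fun a b => E a b = true).Reachable i j, ?_, ?_⟩
    · exact mem_components.2 ⟨i, fun j => by simp⟩
    · simp
  disjoint p hp q hq hpq := by
    rw [Finset.disjoint_left]
    intro U hU hV
    obtain ⟨i, hi⟩ := mem_components.1 hp
    obtain ⟨j, hj⟩ := mem_components.1 hq
    obtain ⟨hUD, a, ha, hUa⟩ := mem_hitTerms.1 hU
    obtain ⟨-, b, hb, hUb⟩ := mem_hitTerms.1 hV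
    have hab : (SimpleGraph.fromRel fun a b => E a b = true).Reachable a b := by
      rcases lt_trichotomy a b with hlt | heq | hlt
      · exact SimpleGraph.Adj.reachable ((SimpleGraph.fromRel_adj _ _ _).2
          ⟨hlt.ne, Or.inl (h.adj a b hlt U hUD hUa hUb)⟩)
      · rw [heq]
      · exact SimpleGraph.Adj.reachable ((SimpleGraph.fromRel_adj _ _ _).2
          ⟨hlt.ne', Or.inr (h.adj b a hlt U hUD hUb hUa)⟩)
    have hij := (((hi a).1 ha).trans hab).trans ((hj b).1 hb).symm
    refine hpq (Finset.ext fun k => ?_)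
    rw [hi, hj]
    exact ⟨fun h => hij.symm.trans h, fun h => hij.trans h⟩
  linked p hp := by
    obtain ⟨i, hi⟩ := mem_components.1 hp
    have key : ∀ a b, Relation.ReflTransGen
        (SimpleGraph.fromRel fun a b => E a b = true).Adj a b → a ∈ p →
        b ∈ p ∧ ∀ U ∈ D, ∀ V ∈ D, Term.eval U (S a) = true → Term.eval V (S b) = true →
          Relation.ReflTransGen (fun U V => U ∈ hitTerms D S p ∧ V ∈ hitTerms D S p ∧
            ((missing U V).card : ℝ) ≤ c) U V := by
      intro a b hab ha
      induction hab with
      | refl =>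
        exact ⟨ha, fun U hU V hV h1 h2 => Relation.ReflTransGen.single
          ⟨mem_hitTerms.2 ⟨hU, a, ha, h1⟩, mem_hitTerms.2 ⟨hV, a, ha, h2⟩,
            h.near a a U V (Or.inl rfl) hU hV h1 h2⟩⟩
      | @tail x y _ hxy ih =>
        obtain ⟨hx, ih⟩ := ih
        have hy : y ∈ p := (hi y).2 (((hi x).1 hx).trans (SimpleGraph.Adj.reachable hxy))
        refine ⟨hy, fun U hU V hV h1 h2 => ?_⟩
        obtain ⟨W, hW, hWx⟩ := dnf_eq_true_iff.1 (hS x)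
        refine (ih U hU W hW h1 hWx).tail ⟨mem_hitTerms.2 ⟨hW, x, hx, hWx⟩,
          mem_hitTerms.2 ⟨hV, y, hy, h2⟩, ?_⟩
        exact h.near x y W V (Or.inr ((SimpleGraph.fromRel_adj _ _ _).1 hxy).2) hW hV hWx h2
    intro U hU V hV
    obtain ⟨hUD, a, ha, hUa⟩ := mem_hitTerms.1 hU
    obtain ⟨hVD, b, hb, hVb⟩ := mem_hitTerms.1 hV
    have hab := ((hi a).1 ha).symm.trans ((hi b).1 hb)
    rw [SimpleGraph.reachable_iff_reflTransGen] at hab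
    exact (key a b hab ha).2 U hUD V hVD hUa hVb

/-- There are at most as many pools as terms. -/
theorem IsFaithfulGraph.card_components_le {E : Fin m → Fin m → Bool}
    (h : IsFaithfulGraph D S c E) (hS : ∀ i, dnf D (S i) = true) :
    (components E).card ≤ D.card := by
  have hp := h.isPooling hS
  refine le_trans ?_ hp.sum_card_le
  rw [Finset.card_eq_sum_ones]
  refine Finset.sum_le_sum fun p hp => Finset.card_pos.2 ?_
  obtain ⟨i, hi⟩ := mem_components.1 hp
  obtain ⟨U, hU, hUi⟩ := dnf_eq_true_iff.1 (hS i)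
  exact ⟨U, mem_hitTerms.2 ⟨hU, i, (hi i).2 (SimpleGraph.Reachable.refl i), hUi⟩⟩

end Pools

/-! ### Building and merging the pools -/

section Building

variable {n : ℕ}

/-- The answer `b` of Test-Equivalence tells apart the cubes of which at least half satisfies `f`
from those of which hardly anything does. -/
def FaithfulTest (f : Str n → Bool) (N : ℝ) (x y : Str n) (b : Bool) : Prop :=
  (b = true → 1 / N ^ 12 ≤ frac f x y) ∧ (1 / 2 ≤ frac f x y → b = true)

theorem half_pow_le {N : ℕ} (hN : 4 ≤ N) : (1 / 2 : ℝ) ^ N ^ 3 ≤ 1 / (N : ℝ) ^ 9 := by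
  rw [one_div, inv_pow, one_div]
  refine inv_anti₀ (by positivity) ?_
  have h1 : N < 2 ^ N := Nat.lt_two_pow_self
  have h2 : N ^ 9 ≤ 2 ^ N ^ 3 := by
    calc N ^ 9 ≤ N ^ N ^ 2 := Nat.pow_le_pow_right (by omega) (by nlinarith)
      _ ≤ (2 ^ N) ^ N ^ 2 := Nat.pow_le_pow_left h1.le _
      _ = 2 ^ N ^ 3 := by rw [← pow_mul]; congr 1; ring
  exact_mod_cast h2

theorem exp_neg_le {N : ℝ} (hN : 0 < N) : Real.exp (-N) ≤ 6 / N ^ 3 := by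
  have h := Real.pow_div_factorial_le_exp N hN.le 3
  rw [Real.exp_neg, ← inv_div]
  refine inv_anti₀ (by positivity) ?_
  simpa [Nat.factorial] using h

variable (f : Str n → Bool) (hf : (sat f).Nonempty)

/-- If half of the cube satisfies `f`, all `N ^ 3` queries fail to notice it with probability at
most `2 ^ (-N ^ 3)`; if hardly anything does, a union bound over the queries applies. -/
theorem risk_testEquivalence_le {N : ℕ} (hN : 4 ≤ N) (x y : Str n) :
    risk (World.ofFun f hf ∅) (testEquivalence N x y)
      (fun b => ind (¬ FaithfulTest f N x y b)) ≤ 2 / (N : ℝ) ^ 9 := by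
  have hN4 : (4 : ℝ) ≤ N := by exact_mod_cast hN
  have hN0 : (0 : ℝ) < N := by linarith
  have hq : ∀ φ : Bool → ℝ, risk (World.ofFun f hf ∅) (do
      let w ← Prog.unif (Str n)
      Prog.ask (mix w x y)) φ = 𝔼 w, φ (f (mix w x y)) := by
    intro φ
    rw [risk_bind, risk_unif]
    refine Finset.expect_congr rfl fun w _ => ?_
    rw [risk_ask, if_neg (by simp [World.ofFun])]; rfl
  rw [testEquivalence, risk_bind]
  simp only [risk_pure]
  have hle : (1 : ℝ) / N ^ 12 ≤ 1 / 2 := by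
    apply one_div_le_one_div_of_le (by norm_num)
    calc (2 : ℝ) ≤ N := by linarith
      _ ≤ N ^ 12 := le_self_pow₀ (by linarith) (by norm_num)
  have hmono : (1 : ℝ) / N ^ 9 ≤ 2 / N ^ 9 := by gcongr; norm_num
  by_cases h1 : 1 / 2 ≤ frac f x y
  · refine (risk_mono _ _ (ψ := fun b => ∏ j, ind (b j = false)) fun b => ?_).trans ?_
    · by_cases h : ∃ j, b j = true
      · rw [ind_false]
        · exact Finset.prod_nonneg fun _ _ => ind_nonneg _
        · rw [not_not, FaithfulTest, decide_eq_true h]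
          exact ⟨fun _ => hle.trans h1, fun _ => rfl⟩
      · push Not at h
        rw [Finset.prod_eq_one fun j _ => ind_true (Bool.eq_false_of_not_eq_true (h j))]
        exact ind_le_one _
    · rw [risk_tabulate_prod _ rfl _ fun _ b => ind (b = false)]
      simp only [hq]
      rw [Finset.prod_const, Finset.card_univ, Fintype.card_fin]
      have e : 𝔼 w, ind (f (mix w x y) = false) = 1 - frac f x y := by
        rw [frac, ← expect_ind_not _ Finset.univ_nonempty]
        simp only [Bool.not_eq_true]
      rw [e]
      refine le_trans (pow_le_pow_left₀ ?_ (by linarith) _) ((half_pow_le hN).trans hmono)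
      linarith [frac_le_one f x y]
  · by_cases h2 : 1 / (N : ℝ) ^ 12 ≤ frac f x y
    · have : ∀ b : Bool, ind (¬ FaithfulTest f N x y b) = 0 := fun b =>
        ind_false (not_not.2 ⟨fun _ => h2, fun h => absurd h h1⟩)
      simp only [this]
      rw [risk_const_of_safe _ rfl]; positivity
    · have h := risk_tabulate_union (World.ofFun f hf ∅) (fun _ : Fin (N ^ 3) => do
        let w ← Prog.unif (Str n)
        Prog.ask (mix w x y)) fun _ b => ¬ b = true
      simp only [hq, not_not] at h
      refine (risk_mono _ _ fun b => ind_mono fun hb => ?_).trans (h.trans ?_)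
      · intro hall
        refine hb ⟨fun hb' => ?_, fun h => absurd h h1⟩
        obtain ⟨j, hj⟩ := of_decide_eq_true hb'
        exact absurd hj (hall j)
      · change ∑ _j, frac f x y ≤ _
        rw [Finset.sum_const, Finset.card_univ, Fintype.card_fin, nsmul_eq_mul]
        push_cast
        rw [not_le] at h2
        calc (N : ℝ) ^ 3 * frac f x y ≤ (N : ℝ) ^ 3 * (1 / (N : ℝ) ^ 12) := by gcongr
          _ = 1 / (N : ℝ) ^ 9 := by field_simp
          _ ≤ _ := hmono

end Building

section Merging

variable {n : ℕ} {D : Finset (Term n)} (hf : (sat (dnf D)).Nonempty)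

/-- `x` satisfies the DNF and is generic. -/
def IsGoodSample (D : Finset (Term n)) (N : ℝ) (x : Str n) : Prop :=
  dnf D x = true ∧ Generic D N x

theorem risk_sample_not_good_le {N : ℝ} (hN : 1 ≤ N) (hDN : D.card ≤ N) :
    risk (World.ofFun (dnf D) hf ∅) Prog.sample (fun x => ind (¬ IsGoodSample D N x)) ≤
      2 / N ^ 7 := by
  rw [risk_sample_ofFun]
  refine le_trans (Finset.expect_le_expect fun x hx => ind_mono fun h h' => ?_)
    (expect_not_generic_le hf hN hDN)
  exact h ⟨mem_sat.1 hx, h'⟩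

/-- Several samples are unlikely to miss a set of noticeable weight. -/
theorem risk_samples_miss_le {f : Str n → Bool} (hf : (sat f).Nonempty) {Z : Finset (Str n)}
    (hZ : Z ⊆ sat f) (k : ℕ) {ρ : ℝ} (hρ : ρ * (sat f).card ≤ Z.card) :
    risk (World.ofFun f hf ∅) (Prog.tabulate fun _ : Fin k => Prog.sample)
      (fun z => ind (¬ ∃ j, z j ∈ Z)) ≤ Real.exp (-(ρ * k)) := by
  have hfc : (0 : ℝ) < (sat f).card := Nat.cast_pos.2 hf.card_pos
  have e : ∀ z : Fin k → Str n, ind (¬ ∃ j, z j ∈ Z) = ∏ j, ind (¬ z j ∈ Z) := by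
    intro z
    by_cases h : ∃ j, z j ∈ Z
    · obtain ⟨j, hj⟩ := h
      rw [ind_false (not_not.2 ⟨j, hj⟩),
        Finset.prod_eq_zero (Finset.mem_univ j) (ind_false (not_not.2 hj))]
    · rw [ind_true h, Finset.prod_eq_one fun j _ => ind_true fun h' => h ⟨j, h'⟩]
  simp only [e]
  rw [risk_tabulate_prod _ rfl _ fun _ x => ind (¬ x ∈ Z)]
  simp only [risk_sample_ofFun]
  rw [Finset.prod_const, Finset.card_univ, Fintype.card_fin, expect_ind_not _ hf]
  classical
  have e2 : 𝔼 x ∈ sat f, ind (x ∈ Z) = (Z.card : ℝ) / (sat f).card := by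
    rw [expect_ind_eq_card, Finset.filter_mem_eq_inter, Finset.inter_eq_right.2 hZ]
  have hle : (Z.card : ℝ) / (sat f).card ≤ 1 := by
    rw [div_le_one hfc]; exact_mod_cast Finset.card_le_card hZ
  have hge : ρ ≤ (Z.card : ℝ) / (sat f).card := by rwa [le_div_iff₀ hfc]
  rw [e2]
  have h := one_add_pow_le_exp (a := -((Z.card : ℝ) / (sat f).card)) (by linarith) k
  rw [← sub_eq_add_neg] at h
  refine h.trans ?_
  rw [Real.exp_le_exp, neg_mul, neg_le_neg_iff]
  exact mul_le_mul_of_nonneg_right hge (Nat.cast_nonneg _)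

/-- The bound on the number of literals that are lost between neighbouring terms of a pool. -/
noncomputable def linkBound (N : ℕ) : ℝ := 316 * Real.logb 2 N

open Classical in
/-- The satisfying strings that look equivalent to samples of two different pools. -/
noncomputable def confused {m : ℕ} (f : Str n → Bool) (S : Fin m → Str n)
    (G : Finset (Finset (Fin m))) : Finset (Str n) :=
  (sat f).filter fun z => ∃ p ∈ G, ∃ q ∈ G, p ≠ q ∧ (∃ i ∈ p, 1 / 2 ≤ frac f (S i) z) ∧
    ∃ i ∈ q, 1 / 2 ≤ frac f (S i) z

/-- What the merging phase achieves. -/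
def WellMerged {m : ℕ} (D : Finset (Term n)) (N : ℕ) (S : Fin m → Str n)
    (G : Finset (Finset (Fin m))) : Prop :=
  IsPooling D S (linkBound N) G ∧
    ((confused (dnf D) S G).card : ℝ) ≤ 1 / (N : ℝ) ^ 4 * (sat (dnf D)).card

/-- In each round, either two pools with close terms are merged, or no sample of the round is
confused, which is unlikely if many strings are. As each round but the last decreases the number of
pools, `k` rounds suffice. -/
theorem risk_mergePhase_le {N : ℕ} (hN : 4 ≤ N) (hDN : D.card ≤ N) (S : Fin (N ^ 3) → Str n)
    (hS : ∀ i, IsGoodSample D N (S i)) (k : ℕ) (G : Finset (Finset (Fin (N ^ 3))))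
    (hG : IsPooling D S (linkBound N) G) (hk : G.card ≤ k) :
    risk (World.ofFun (dnf D) hf ∅) (mergePhase N S k G)
      (fun G' => ind (¬ WellMerged D N S G')) ≤ k * (10 / (N : ℝ)) := by
  classical
  have hN4 : (4 : ℝ) ≤ N := by exact_mod_cast hN
  have hN1 : (1 : ℝ) ≤ N := by linarith
  have hN0 : (0 : ℝ) < N := by linarith
  have hDN' : (D.card : ℝ) ≤ N := by exact_mod_cast hDN
  have hlog : 0 ≤ Real.logb 2 (N : ℝ) := Real.logb_nonneg (by norm_num) hN1
  set f := dnf D with hfD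
  induction k generalizing G with
  | zero =>
    rw [mergePhase, risk_pure, ind_false]
    · simp
    · rw [not_not]
      refine ⟨hG, ?_⟩
      have h0 : G = ∅ := Finset.card_eq_zero.1 (by omega)
      subst h0
      rw [confused]; simp; positivity
  | succ k ih =>
    rw [mergePhase]
    have hk0 : 0 ≤ k * (10 / (N : ℝ)) := by positivity
    -- the samples of this round
    refine (risk_bind_le _ (fun z => (∀ j, IsGoodSample D N (z j)) ∧
      (¬ ((confused f S G).card : ℝ) ≤ 1 / (N : ℝ) ^ 4 * (sat f).card →
        ∃ j, z j ∈ confused f S G)) (δ₁ := 8 / N) (δ₂ := 2 / N + k * (10 / (N : ℝ)))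
      (fun _ => ind_le_one _) (by positivity) ?_ fun z hz => ?_).trans (le_of_eq ?_)
    · refine (risk_mono _ _ (ψ := fun z => ind (¬ ∀ j, IsGoodSample D N (z j)) +
        ind (¬ ((confused f S G).card : ℝ) ≤ 1 / (N : ℝ) ^ 4 * (sat f).card ∧
          ¬ ∃ j, z j ∈ confused f S G)) fun z => ?_).trans ?_
      · refine (ind_mono fun h => ?_).trans (ind_or_le _ _)
        by_contra! hc
        exact h ⟨hc.1, fun h' => hc.2 (not_le.1 h')⟩
      · rw [risk_add_of_safe _ rfl]
        have r1 := risk_tabulate_union (World.ofFun f hf ∅)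
          (fun _ : Fin (N ^ 5) => Prog.sample) fun _ x => IsGoodSample D N x
        have r2 : ∑ _j : Fin (N ^ 5), risk (World.ofFun f hf ∅) Prog.sample
            (fun x => ind (¬ IsGoodSample D N x)) ≤ 2 / N := by
          rw [Finset.sum_const, Finset.card_univ, Fintype.card_fin, nsmul_eq_mul]
          calc ((N ^ 5 : ℕ) : ℝ) * risk (World.ofFun f hf ∅) Prog.sample
                (fun x => ind (¬ IsGoodSample D N x)) ≤ ((N ^ 5 : ℕ) : ℝ) * (2 / N ^ 7) :=
                mul_le_mul_of_nonneg_left (risk_sample_not_good_le hf hN1 hDN')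
                  (Nat.cast_nonneg _)
            _ = 2 / N ^ 2 := by push_cast; field_simp
            _ ≤ 2 / N := by gcongr; exact le_self_pow₀ hN1 (by norm_num)
        have r3 : risk (World.ofFun f hf ∅) (Prog.tabulate fun _ : Fin (N ^ 5) => Prog.sample)
            (fun z => ind (¬ ((confused f S G).card : ℝ) ≤ 1 / (N : ℝ) ^ 4 * (sat f).card ∧
              ¬ ∃ j, z j ∈ confused f S G)) ≤ 6 / N := by
          by_cases hc : ((confused f S G).card : ℝ) ≤ 1 / (N : ℝ) ^ 4 * (sat f).card
          · simp only [hc, not_true_eq_false, false_and]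
            rw [risk_const_of_safe _ rfl, ind_false id]; positivity
          · simp only [hc, not_false_eq_true, true_and]
            refine (risk_samples_miss_le hf (Z := confused f S G) (Finset.filter_subset _ _) _
              (ρ := 1 / (N : ℝ) ^ 4) (not_le.1 hc).le).trans ?_
            have : 1 / (N : ℝ) ^ 4 * ((N ^ 5 : ℕ) : ℝ) = N := by push_cast; field_simp
            rw [this]
            refine (exp_neg_le hN0).trans ?_
            gcongr; exact le_self_pow₀ hN1 (by norm_num)
        calc _ ≤ 2 / (N : ℝ) + 6 / N := add_le_add (r1.trans r2) r3
          _ = 8 / N := by ring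
    · -- the tests of this round
      refine risk_bind_le _ (fun t => ∀ i j, FaithfulTest f N (S i) (z j) (t i j))
        (fun _ => ind_le_one _) hk0 ?_ fun t ht => ?_
      · refine (risk_tabulate_union _ _ fun i (b : Fin (N ^ 5) → Bool) =>
          ∀ j, FaithfulTest f N (S i) (z j) (b j)).trans ?_
        calc _ ≤ (∑ _i : Fin (N ^ 3), ∑ _j : Fin (N ^ 5), 2 / (N : ℝ) ^ 9 : ℝ) := by
              refine Finset.sum_le_sum fun i _ => ?_
              refine (risk_tabulate_union _ _ fun j b =>
                FaithfulTest f N (S i) (z j) b).trans ?_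
              exact Finset.sum_le_sum fun j _ => risk_testEquivalence_le f hf hN _ _
          _ = 2 / (N : ℝ) := by
              simp only [Finset.sum_const, Finset.card_univ, Fintype.card_fin, nsmul_eq_mul]
              push_cast; field_simp
      · split_ifs with h
        · obtain ⟨h1, h2, h3, j, ⟨i, hi, hti⟩, ⟨i', hi', hti'⟩⟩ := h.choose_spec
          have g1 := (ht i j).1 hti
          have g2 := (ht i' j).1 hti'
          obtain ⟨U, hU, hUi⟩ := dnf_eq_true_iff.1 (hS i).1
          obtain ⟨V, hV, hVi⟩ := dnf_eq_true_iff.1 (hS i').1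
          -- The two pools meet at the sample `z j`: the term `W` that it satisfies is close to the
          -- terms `U` and `V` of the pools, so these are close to each other.
          obtain ⟨W, hW, hWj⟩ := dnf_eq_true_iff.1 (hz.1 j).1
          have a1 := card_missing_le_of_frac hN1 hDN' (hS i).2 (hz.1 j).2 g1 hU hW hUi hWj
          have a2 := card_missing_le_of_frac hN1 hDN' (hS i').2 (hz.1 j).2 g2 hV hW hVi hWj
          rw [frac_comm] at g1 g2
          have a3 := card_missing_le_of_frac hN1 hDN' (hz.1 j).2 (hS i).2 g1 hW hU hWj hUi
          have a4 := card_missing_le_of_frac hN1 hDN' (hz.1 j).2 (hS i').2 g2 hW hV hWj hVi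
          have b1 : ((missing U V).card : ℝ) ≤ (missing U W).card + (missing W V).card := by
            exact_mod_cast card_missing_le W U V
          have b2 : ((missing V U).card : ℝ) ≤ (missing V W).card + (missing W U).card := by
            exact_mod_cast card_missing_le W V U
          refine ih _ (hG.merge h1 h2 (U := U) (V := V) (mem_hitTerms.2 ⟨hU, i, hi, hUi⟩)
            (mem_hitTerms.2 ⟨hV, i', hi', hVi⟩) ?_ ?_) ?_
          · rw [linkBound]; linarith
          · rw [linkBound]; linarith
          · have := card_merge_lt G h1 h2 h3
            omega
        · rw [risk_pure, ind_false]
          · exact hk0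
          · rw [not_not]
            refine ⟨hG, ?_⟩
            by_contra hc
            obtain ⟨j, hj⟩ := hz.2 hc
            obtain ⟨-, p, hp, q, hq, hpq, ⟨i, hi, hfi⟩, ⟨i', hi', hfi'⟩⟩ := Finset.mem_filter.1 hj
            -- a confused sample would have caused two pools to be merged
            exact h ⟨(p, q), hp, hq, hpq, j, ⟨i, hi, (ht i j).2 hfi⟩,
              ⟨i', hi', (ht i' j).2 hfi'⟩⟩
    · push_cast; ring

/-- The terms of noticeable weight are satisfied by some sample. -/
def HitsHeavyTerms {m : ℕ} (D : Finset (Term n)) (N : ℝ) (S : Fin m → Str n) : Prop :=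
  ∀ U ∈ D, 1 / N ^ 2 * (sat (dnf D)).card ≤ (sat (Term.eval U)).card →
    ∃ i, Term.eval U (S i) = true

/-- The initial samples are generic, and they hit all the terms of noticeable weight. -/
theorem risk_initial_samples_le {N : ℕ} (hN : 4 ≤ N) (hDN : D.card ≤ N) :
    risk (World.ofFun (dnf D) hf ∅) (Prog.tabulate fun _ : Fin (N ^ 3) => Prog.sample)
      (fun S => ind (¬ ((∀ i, IsGoodSample D N (S i)) ∧ HitsHeavyTerms D N S))) ≤
      8 / (N : ℝ) := by
  classical
  have hN4 : (4 : ℝ) ≤ N := by exact_mod_cast hN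
  have hN1 : (1 : ℝ) ≤ N := by linarith
  have hN0 : (0 : ℝ) < N := by linarith
  have hDN' : (D.card : ℝ) ≤ N := by exact_mod_cast hDN
  set w := World.ofFun (dnf D) hf ∅ with hw
  set F := sat (dnf D) with hF
  refine (risk_mono _ _ (ψ := fun S => ind (¬ ∀ i, IsGoodSample D N (S i)) +
    ∑ U : {U // U ∈ D}, ind (1 / (N : ℝ) ^ 2 * F.card ≤ (sat (Term.eval U.1)).card ∧
      ¬ ∃ i, S i ∈ sat (Term.eval U.1))) fun S => ?_).trans ?_
  · refine le_trans ?_ (add_le_add le_rfl (ind_exists_le _))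
    refine (ind_mono fun h => ?_).trans (ind_or_le _ _)
    by_contra! hc
    refine h ⟨hc.1, fun U hU hUF => ?_⟩
    obtain ⟨i, hi⟩ := hc.2 ⟨U, hU⟩ hUF
    exact ⟨i, mem_sat.1 hi⟩
  · rw [risk_add_of_safe _ rfl, risk_sum_of_safe _ rfl]
    have r1 := risk_tabulate_union w
      (fun _ : Fin (N ^ 3) => Prog.sample) fun _ x => IsGoodSample D N x
    have r2 : ∑ _j : Fin (N ^ 3), risk w Prog.sample
        (fun x => ind (¬ IsGoodSample D N x)) ≤ 2 / N := by
      rw [Finset.sum_const, Finset.card_univ, Fintype.card_fin, nsmul_eq_mul]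
      calc ((N ^ 3 : ℕ) : ℝ) * risk w Prog.sample
            (fun x => ind (¬ IsGoodSample D N x)) ≤ ((N ^ 3 : ℕ) : ℝ) * (2 / N ^ 7) :=
            mul_le_mul_of_nonneg_left (risk_sample_not_good_le hf hN1 hDN') (Nat.cast_nonneg _)
        _ = 2 / N ^ 4 := by push_cast; field_simp
        _ ≤ 2 / N := by gcongr; exact le_self_pow₀ hN1 (by norm_num)
    have r3 : ∀ U : {U // U ∈ D}, risk w (Prog.tabulate fun _ : Fin (N ^ 3) => Prog.sample)
        (fun S => ind (1 / (N : ℝ) ^ 2 * F.card ≤ (sat (Term.eval U.1)).card ∧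
          ¬ ∃ i, S i ∈ sat (Term.eval U.1))) ≤ 6 / N ^ 3 := by
      intro U
      by_cases hc : 1 / (N : ℝ) ^ 2 * F.card ≤ (sat (Term.eval U.1)).card
      · simp only [hc, true_and]
        refine (risk_samples_miss_le hf (sat_term_subset U.2) _
          (ρ := 1 / (N : ℝ) ^ 2) hc).trans ?_
        have : 1 / (N : ℝ) ^ 2 * ((N ^ 3 : ℕ) : ℝ) = N := by push_cast; field_simp
        rw [this]
        exact exp_neg_le hN0
      · simp only [hc, false_and]
        rw [risk_const_of_safe _ rfl, ind_false id]; positivity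
    calc _ ≤ 2 / (N : ℝ) + ∑ _U : {U // U ∈ D}, 6 / (N : ℝ) ^ 3 :=
          add_le_add (r1.trans r2) (Finset.sum_le_sum fun U _ => r3 U)
      _ = 2 / (N : ℝ) + D.card * (6 / (N : ℝ) ^ 3) := by
          rw [Finset.sum_const, Finset.card_univ, Fintype.card_coe, nsmul_eq_mul]
      _ ≤ 2 / (N : ℝ) + N * (6 / (N : ℝ) ^ 3) := by gcongr
      _ = 2 / (N : ℝ) + 6 / N ^ 2 := by field_simp
      _ ≤ 2 / (N : ℝ) + 6 / N := by gcongr; exact le_self_pow₀ hN1 (by norm_num)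
      _ = 8 / N := by ring

/-- If all tests are faithful, adjacent samples have close terms by `card_missing_le_of_frac`, and
samples with a common term span a cube on which the DNF is constantly `1`. -/
theorem risk_initial_graph_le {N : ℕ} (hN : 4 ≤ N) (hDN : D.card ≤ N) (S : Fin (N ^ 3) → Str n)
    (hS : ∀ i, IsGoodSample D N (S i)) :
    risk (World.ofFun (dnf D) hf ∅)
      (Prog.tabulate fun i : Fin (N ^ 3) => Prog.tabulate fun j : Fin (N ^ 3) =>
        if i < j then testEquivalence N (S i) (S j) else pure false)
      (fun E => ind (¬ IsFaithfulGraph D S (linkBound N) E)) ≤ 2 / (N : ℝ) := by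
  have hN4 : (4 : ℝ) ≤ N := by exact_mod_cast hN
  have hN1 : (1 : ℝ) ≤ N := by linarith
  have hN0 : (0 : ℝ) < N := by linarith
  have hDN' : (D.card : ℝ) ≤ N := by exact_mod_cast hDN
  have hlog : 0 ≤ Real.logb 2 (N : ℝ) := Real.logb_nonneg (by norm_num) hN1
  set Q : Fin (N ^ 3) → Fin (N ^ 3) → Bool → Prop := fun i j b =>
    if i < j then FaithfulTest (dnf D) N (S i) (S j) b else b = false with hQ
  refine (risk_mono _ _ (ψ := fun E => ind (¬ ∀ i j, Q i j (E i j))) fun E =>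
    ind_mono (mt fun h => ?_)).trans ?_
  · have hE : ∀ i j, E i j = true → i < j ∧ 1 / (N : ℝ) ^ 12 ≤ frac (dnf D) (S i) (S j) := by
      intro i j hij
      have := h i j
      simp only [hQ] at this
      split_ifs at this with hlt
      · exact ⟨hlt, this.1 hij⟩
      · rw [this] at hij; exact absurd hij (by simp)
    have hfr : ∀ i j U, i = j ∨ E i j = true ∨ E j i = true → U ∈ D →
        Term.eval U (S i) = true → 1 / (N : ℝ) ^ 12 ≤ frac (dnf D) (S i) (S j) := by
      rintro i j U (rfl | hij | hij) hU hUi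
      · rw [frac_eq_one hU hUi hUi, div_le_one (by positivity)]
        exact one_le_pow₀ hN1
      · exact (hE i j hij).2
      · rw [frac_comm]; exact (hE j i hij).2
    refine ⟨fun i j U V hij hU hV hUi hVj => ?_, fun i j hij U hU hUi hUj => ?_⟩
    · have := card_missing_le_of_frac hN1 hDN' (hS i).2 (hS j).2 (hfr i j U hij hU hUi) hU hV
        hUi hVj
      rw [linkBound]; linarith
    · have := h i j
      simp only [hQ, if_pos hij] at this
      exact this.2 (by rw [frac_eq_one hU hUi hUj]; norm_num)
  · refine (risk_tabulate_union _ _ fun i (b : Fin (N ^ 3) → Bool) => ∀ j, Q i j (b j)).trans ?_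
    calc _ ≤ (∑ _i : Fin (N ^ 3), ∑ _j : Fin (N ^ 3), 2 / (N : ℝ) ^ 9 : ℝ) := by
          refine Finset.sum_le_sum fun i _ => ?_
          refine (risk_tabulate_union _ _ fun j b => Q i j b).trans ?_
          refine Finset.sum_le_sum fun j _ => ?_
          simp only [hQ]
          split_ifs with hij
          · exact risk_testEquivalence_le _ hf hN _ _
          · rw [risk_pure, ind_false (by simp)]; positivity
      _ = 2 / (N : ℝ) ^ 3 := by
          simp only [Finset.sum_const, Finset.card_univ, Fintype.card_fin, nsmul_eq_mul]
          push_cast; field_simp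
      _ ≤ 2 / (N : ℝ) := by gcongr; exact le_self_pow₀ hN1 (by norm_num)

end Merging

/-! ### Pools of a DNF -/

section DNFPools

variable {n m : ℕ}

theorem expect_prod_eq_pow {κ : Type} [Fintype κ] (φ : κ → ℝ) :
    𝔼 ρ : Fin m → κ, ∏ j, φ (ρ j) = (𝔼 k, φ k) ^ m := by
  rw [Fintype.expect_eq_sum_div_card, Fintype.expect_eq_sum_div_card, div_pow,
    ← Fintype.piFinset_univ, ← Finset.prod_univ_sum (fun _ => Finset.univ) fun _ => φ]
  simp

/-- A string that is equivalent to no sample of the pool is rarely put into the pool. -/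
theorem expect_inPoolVal_le (f : Str n → Bool) (z : Str n) (P : Finset (Str n)) {δ : ℝ}
    (hδ : ∀ b ∈ P, frac f z b ≤ δ) :
    𝔼 str : Str n → Str n → Fin m → Str n, ind (inPoolVal f z P (str z) = true) ≤
      P.card * δ ^ m := by
  classical
  have h1 : ∀ ρ : Str n → Fin m → Str n, ind (inPoolVal f z P ρ = true) ≤
      ∑ b ∈ P, ∏ j, ind (f (mix (ρ b j) z b) = true) := by
    intro ρ
    have h0 : ∀ b, 0 ≤ ∏ j, ind (f (mix (ρ b j) z b) = true) := fun b =>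
      Finset.prod_nonneg fun _ _ => ind_nonneg _
    by_cases h : ∃ b ∈ P, ∀ j, f (mix (ρ b j) z b) = true
    · obtain ⟨b, hb, hj⟩ := h
      refine (ind_le_one _).trans ?_
      rw [← Finset.prod_eq_one (s := Finset.univ) fun j _ => ind_true (hj j)]
      exact Finset.single_le_sum (fun b _ => h0 b) hb
    · rw [ind_false]
      · exact Finset.sum_nonneg fun b _ => h0 b
      · rw [inPoolVal, decide_eq_true_eq]; exact h
  have h2 : 𝔼 str : Str n → Str n → Fin m → Str n, ind (inPoolVal f z P (str z) = true) =
      𝔼 ρ : Str n → Fin m → Str n, ind (inPoolVal f z P ρ = true) :=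
    expect_apply z fun ρ => ind (inPoolVal f z P ρ = true)
  rw [h2]
  refine (Finset.expect_le_expect fun ρ _ => h1 ρ).trans ?_
  rw [Finset.expect_sum_comm]
  calc _ ≤ ∑ _b ∈ P, δ ^ m := by
        refine Finset.sum_le_sum fun b hb => ?_
        rw [expect_apply b fun r : Fin m → Str n => ∏ j, ind (f (mix (r j) z b) = true),
          expect_prod_eq_pow fun w => ind (f (mix w z b) = true)]
        exact pow_le_pow_left₀ (frac_nonneg f z b) (hδ b hb) m
    _ = P.card * δ ^ m := by rw [Finset.sum_const, nsmul_eq_mul]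

theorem half_pow_poolReps_le {N : ℕ} (hN : 1 ≤ N) :
    (1 / 2 : ℝ) ^ poolReps N ≤ 1 / (N : ℝ) ^ 10 := by
  have hN0 : (0 : ℝ) < N := by exact_mod_cast hN
  have h := Nat.le_ceil (10 * alpha N)
  rw [one_div, inv_pow, one_div]
  refine inv_anti₀ (by positivity) ?_
  have h2 : (0 : ℝ) < Real.log 2 := Real.log_pos (by norm_num)
  rw [← Real.log_le_log_iff (by positivity) (by positivity), Real.log_pow, Real.log_pow]
  have h3 : Real.log N = alpha N * Real.log 2 := by
    rw [alpha, Real.logb, div_mul_cancel₀ _ h2.ne']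
  rw [h3]
  have := mul_le_mul_of_nonneg_right h h2.le
  rw [poolReps]; push_cast; linarith

variable {D : Finset (Term n)} {S : Fin m → Str n}

/-- A string that shares a term with a sample of the pool is always put into the pool. -/
theorem sat_hitTerms_subset {k : ℕ} (p : Finset (Fin m))
    (str : Str n → Str n → Fin k → Str n) :
    sat (dnf (hitTerms D S p)) ⊆ sat (poolFun (dnf D) (p.image S) str) := by
  intro z hz
  rw [mem_sat, dnf_eq_true_iff] at hz
  obtain ⟨U, hU, hUz⟩ := hz
  obtain ⟨hUD, i, hi, hUi⟩ := mem_hitTerms.1 hU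
  rw [mem_sat, poolFun, Bool.and_eq_true]
  refine ⟨dnf_eq_true_iff.2 ⟨U, hUD, hUz⟩, ?_⟩
  rw [inPoolVal, decide_eq_true_eq]
  exact ⟨S i, Finset.mem_image_of_mem S hi, fun j =>
    dnf_eq_true_iff.2 ⟨U, hUD, eval_mix hUz hUi _⟩⟩

open Classical in
/-- The satisfying strings that satisfy none of the terms that were hit. -/
noncomputable def missed (D : Finset (Term n)) (S : Fin m → Str n)
    (G : Finset (Finset (Fin m))) : Finset (Str n) :=
  (sat (dnf D)).filter fun z => ∀ p ∈ G, dnf (hitTerms D S p) z = false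

/-- The terms that were not hit have a small weight. -/
theorem card_missed_le {N : ℝ} {c : ℝ} {G : Finset (Finset (Fin m))} (hN : 0 < N)
    (hG : IsPooling D S c G) (hH : HitsHeavyTerms D N S) :
    ((missed D S G).card : ℝ) ≤ D.card * (1 / N ^ 2 * (sat (dnf D)).card) := by
  classical
  have hsub : missed D S G ⊆
      (D.filter fun U => ((sat (Term.eval U)).card : ℝ) ≤ 1 / N ^ 2 * (sat (dnf D)).card).biUnion
        fun U => sat (Term.eval U) := by
    intro z hz
    obtain ⟨hzf, hz⟩ := Finset.mem_filter.1 hz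
    obtain ⟨U, hU, hUz⟩ := dnf_eq_true_iff.1 (mem_sat.1 hzf)
    refine Finset.mem_biUnion.2 ⟨U, Finset.mem_filter.2 ⟨hU, ?_⟩, mem_sat.2 hUz⟩
    by_contra! hc
    obtain ⟨i, hi⟩ := hH U hU hc.le
    obtain ⟨p, hp, hip⟩ := hG.cover i
    have h1 := hz p hp
    have h2 : dnf (hitTerms D S p) z = true :=
      dnf_eq_true_iff.2 ⟨U, mem_hitTerms.2 ⟨hU, i, hip, hi⟩, hUz⟩
    rw [h1] at h2; exact absurd h2 (by simp)
  have h1 : ((missed D S G).card : ℝ) ≤ ∑ U ∈ D.filter fun U =>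
      ((sat (Term.eval U)).card : ℝ) ≤ 1 / N ^ 2 * (sat (dnf D)).card,
      ((sat (Term.eval U)).card : ℝ) := by
    exact_mod_cast (Finset.card_le_card hsub).trans Finset.card_biUnion_le
  refine h1.trans ((Finset.sum_le_sum fun U hU => (Finset.mem_filter.1 hU).2).trans ?_)
  rw [Finset.sum_const, nsmul_eq_mul]
  refine mul_le_mul_of_nonneg_right ?_ (by positivity)
  exact_mod_cast Finset.card_filter_le _ _

/-- A string of a pool that satisfies none of the terms of the pool is confused, or satisfies no
term that was hit, or was put into the pool only by an unlucky choice of random bits. -/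
theorem expect_excess_le {N : ℕ} (hN : 4 ≤ N) {S : Fin (N ^ 3) → Str n}
    (hD : 1 ≤ D.card) {G : Finset (Finset (Fin (N ^ 3)))} (hG : WellMerged D N S G)
    (hH : HitsHeavyTerms D N S) {p : Finset (Fin (N ^ 3))} (hp : p ∈ G) :
    𝔼 str : Str n → Str n → Fin (poolReps N) → Str n,
      ((sat (poolFun (dnf D) (p.image S) str) \ sat (dnf (hitTerms D S p))).card : ℝ) ≤
      3 * D.card / (N : ℝ) ^ 2 * (sat (dnf D)).card := by
  classical
  have hN4 : (4 : ℝ) ≤ N := by exact_mod_cast hN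
  have hN1 : (1 : ℝ) ≤ N := by linarith
  have hN0 : (0 : ℝ) < N := by linarith
  set f := dnf D with hf
  set h := dnf (hitTerms D S p) with hh
  -- a string of `far` is put into the pool only by an unlucky choice of random bits
  set far : Str n → Prop := fun z => ∀ b ∈ p.image S, frac f z b ≤ 1 / 2 with hfar
  have hpt : ∀ str : Str n → Str n → Fin (poolReps N) → Str n,
      ((sat (poolFun f (p.image S) str) \ sat h).card : ℝ) ≤
      ((confused f S G).card : ℝ) + (missed D S G).card +
      ∑ z ∈ (sat f).filter far, ind (inPoolVal f z (p.image S) (str z) = true) := by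
    intro str
    have hsub : sat (poolFun f (p.image S) str) \ sat h ⊆
        (confused f S G ∪ missed D S G) ∪
        ((sat f).filter far).filter fun z => inPoolVal f z (p.image S) (str z) = true := by
      intro z hz
      obtain ⟨hz1, hz2⟩ := Finset.mem_sdiff.1 hz
      have hzf := sat_poolFun_subset f _ _ hz1
      rw [mem_sat, poolFun, Bool.and_eq_true] at hz1
      by_cases hc : z ∈ confused f S G
      · exact Finset.mem_union_left _ (Finset.mem_union_left _ hc)
      by_cases hm : z ∈ missed D S G
      · exact Finset.mem_union_left _ (Finset.mem_union_right _ hm)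
      refine Finset.mem_union_right _ (Finset.mem_filter.2 ⟨Finset.mem_filter.2 ⟨hzf, ?_⟩, hz1.2⟩)
      intro b hb
      obtain ⟨i, hi, rfl⟩ := Finset.mem_image.1 hb
      have : ∃ q ∈ G, dnf (hitTerms D S q) z = true := by
        by_contra! hc'
        exact hm (Finset.mem_filter.2 ⟨hzf, fun q hq => Bool.eq_false_of_not_eq_true (hc' q hq)⟩)
      -- `z` satisfies a term hit by the pool `q`, so it looks equivalent to a sample of `q`; if it
      -- also looks equivalent to a sample of `p`, it is confused
      obtain ⟨q, hq, hqz⟩ := this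
      obtain ⟨U, hU, hUz⟩ := dnf_eq_true_iff.1 hqz
      obtain ⟨hUD, i', hi', hUi'⟩ := mem_hitTerms.1 hU
      by_contra! hlt
      refine hc (Finset.mem_filter.2 ⟨hzf, p, hp, q, hq, ?_, ⟨i, hi, ?_⟩, ⟨i', hi', ?_⟩⟩)
      · rintro rfl; exact hz2 (mem_sat.2 hqz)
      · rw [frac_comm]; exact hlt.le
      · rw [hf, frac_eq_one hUD hUi' hUz]; norm_num
    have h1 := (Finset.card_le_card hsub).trans ((Finset.card_union_le _ _).trans
      (add_le_add (Finset.card_union_le _ _) le_rfl))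
    have h2 : ((((sat f).filter far).filter fun z =>
        inPoolVal f z (p.image S) (str z) = true).card : ℝ) =
        ∑ z ∈ (sat f).filter far, ind (inPoolVal f z (p.image S) (str z) = true) := by
      rw [Finset.card_filter, Nat.cast_sum]
      refine Finset.sum_congr rfl fun z _ => ?_
      split_ifs with hz
      · rw [ind_true hz, Nat.cast_one]
      · rw [ind_false hz, Nat.cast_zero]
    rw [← h2]; exact_mod_cast h1
  have hPc : ((p.image S).card : ℝ) ≤ (N : ℝ) ^ 3 := by
    exact_mod_cast Finset.card_image_le.trans
      ((Finset.card_le_univ p).trans (Fintype.card_fin _).le)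
  have hunl : 𝔼 str : Str n → Str n → Fin (poolReps N) → Str n,
      ∑ z ∈ (sat f).filter far, ind (inPoolVal f z (p.image S) (str z) = true) ≤
      (sat f).card * (1 / (N : ℝ) ^ 2) := by
    rw [Finset.expect_sum_comm]
    calc _ ≤ ∑ _z ∈ (sat f).filter far, 1 / (N : ℝ) ^ 2 := by
          refine Finset.sum_le_sum fun z hz => ?_
          refine (expect_inPoolVal_le f z _ (Finset.mem_filter.1 hz).2).trans ?_
          calc ((p.image S).card : ℝ) * (1 / 2) ^ poolReps N
              ≤ (N : ℝ) ^ 3 * (1 / (N : ℝ) ^ 10) :=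
                mul_le_mul hPc (half_pow_poolReps_le (by omega)) (by positivity) (by positivity)
            _ = 1 / (N : ℝ) ^ 7 := by field_simp
            _ ≤ 1 / (N : ℝ) ^ 2 := by gcongr; norm_num
      _ ≤ (sat f).card * (1 / (N : ℝ) ^ 2) := by
          rw [Finset.sum_const, nsmul_eq_mul]
          refine mul_le_mul_of_nonneg_right ?_ (by positivity)
          exact_mod_cast Finset.card_filter_le _ _
  refine (Finset.expect_le_expect fun str _ => hpt str).trans ?_
  rw [Finset.expect_add_distrib, Finset.expect_const Finset.univ_nonempty]
  have h1 := hG.2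
  have h2 := card_missed_le (D := D) hN0 hG.1 hH
  have hD1 : (1 : ℝ) ≤ D.card := by exact_mod_cast hD
  have h4 : 1 / (N : ℝ) ^ 4 * (sat f).card ≤ D.card * (1 / (N : ℝ) ^ 2 * (sat f).card) := by
    have : 1 / (N : ℝ) ^ 4 ≤ 1 / (N : ℝ) ^ 2 := by gcongr; norm_num
    calc 1 / (N : ℝ) ^ 4 * (sat f).card ≤ 1 / (N : ℝ) ^ 2 * (sat f).card := by gcongr
      _ ≤ _ := le_mul_of_one_le_left (by positivity) hD1
  have h5 : (sat f).card * (1 / (N : ℝ) ^ 2) ≤ D.card * (1 / (N : ℝ) ^ 2 * (sat f).card) := by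
    rw [mul_comm ((sat f).card : ℝ)]
    exact le_mul_of_one_le_left (by positivity) hD1
  calc _ ≤ (D.card * (1 / (N : ℝ) ^ 2 * (sat f).card) +
        D.card * (1 / (N : ℝ) ^ 2 * (sat f).card)) +
        D.card * (1 / (N : ℝ) ^ 2 * (sat f).card) :=
        add_le_add (add_le_add (h1.trans h4) h2) (hunl.trans h5)
    _ = _ := by ring

/-- Markov's inequality for the excess of the In-Pool function over the disjunction of the terms. -/
theorem risk_unif_excess_le (hf : (sat (dnf D)).Nonempty) {N : ℕ} (hN : 4 ≤ N)
    {S : Fin (N ^ 3) → Str n} {G : Finset (Finset (Fin (N ^ 3)))} (hG : WellMerged D N S G)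
    (hH : HitsHeavyTerms D N S) {p : Finset (Fin (N ^ 3))} (hp : p ∈ G) :
    risk (World.ofFun (dnf D) hf ∅) (Prog.unif (Str n → Str n → Fin (poolReps N) → Str n))
      (fun str => ind (¬ ((sat (poolFun (dnf D) (p.image S) str) \
        sat (dnf (hitTerms D S p))).card : ℝ) ≤ 1 / (N : ℝ) * (sat (dnf D)).card)) ≤
      3 * D.card / (N : ℝ) := by
  have hN4 : (4 : ℝ) ≤ N := by exact_mod_cast hN
  have hN0 : (0 : ℝ) < N := by linarith
  have hfc : (0 : ℝ) < (sat (dnf D)).card := Nat.cast_pos.2 hf.card_pos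
  have hD : 1 ≤ D.card := by
    obtain ⟨z, hz⟩ := hf
    obtain ⟨U, hU, -⟩ := dnf_eq_true_iff.1 (mem_sat.1 hz)
    exact Finset.card_pos.2 ⟨U, hU⟩
  rw [risk_unif]
  simp only [not_le]
  refine (Finset.expect_le_expect fun str _ => ind_lt_le (by positivity)
    (Nat.cast_nonneg _)).trans ?_
  rw [← Finset.expect_div, div_le_iff₀ (by positivity)]
  refine (expect_excess_le hN hD hG hH hp).trans (le_of_eq ?_)
  field_simp

end DNFPools

/-! ### Completeness: the guarantee for a DNF -/

section Completeness

variable {n : ℕ}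

/-- The outputs of Find-Factored-DNFs that are required for an `s`-term DNF: simulators of factored
DNFs with at most `s` terms in total, adequate with respect to the algorithms `alg`. -/
def GoodOutputs (f : Str n → Bool) (hf : (sat f).Nonempty) (s μ : ℕ) (alg : ℕ → Prog n Bool) :
    Set (Option (List ((Str n → Prog n Bool) × Prog n (Str n)))) :=
  {out | ∃ l, out = some l ∧
    ∃ (k : Fin l.length → ℕ) (h : Fin l.length → Str n → Bool) (hh : ∀ i, (sat (h i)).Nonempty),
      (∀ i, IsTermDNF (k i) (h i)) ∧ ∑ i, k i ≤ s ∧ (∀ i, IsFactoredDNF (k i) μ (h i)) ∧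
      ∀ i, IsAdequate f hf (l.get i).1 (l.get i).2 (h i) (hh i) (alg (k i))}

/-- `q` bounds the queries of the algorithms `alg k`, and on factored DNFs these algorithms avoid
sets of points of density at most `β`. -/
structure IsRobust (s μ q : ℕ) (β : ℝ) (alg : ℕ → Prog n Bool) : Prop where
  queries : ∀ k, 1 ≤ k → k ≤ s → Prog.QueriesAtMost q (alg k)
  avoid : ∀ k (h : Str n → Bool) (hh : (sat h).Nonempty) (B : Set (Str n)), 1 ≤ k → k ≤ s →
    IsFactoredDNF k μ h → badRatio h B ≤ β →
    risk (World.ofFun h hh B) (alg k) (fun _ => 0) ≤ 7 / 100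

variable {D : Finset (Term n)} (hf : (sat (dnf D)).Nonempty)

/-- The simulators of a pool of substantial weight are adequate for the disjunction of the terms
that the pool has hit. -/
theorem isAdequate_of_pool {s N q μ : ℕ} {ε β : ℝ} (hs : 1 ≤ s) (hε : 0 < ε) (hN : 1 ≤ N)
    (hNx : 80 * (s / ε) ≤ N) (hβ : 80 * (s / ε) / N ≤ β)
    (hqN : q * (1 / (N : ℝ) ^ 2 + 40 * (s / ε) / N) ≤ 3 / 100) {alg : ℕ → Prog n Bool}
    (halg : IsRobust s μ q β alg) {m r : ℕ} (P : Finset (Str n))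
    (str : Str n → Str n → Fin m → Str n) (h : Str n → Bool)
    (hsub : sat h ⊆ sat (poolFun (dnf D) P str))
    (hw : ε / (40 * s) ≤ poolWeight (dnf D) P str)
    (hex : ((sat (poolFun (dnf D) P str) \ sat h).card : ℝ) ≤ 1 / N * (sat (dnf D)).card)
    (hfac : (sat h).Nonempty → 1 ≤ r ∧ r ≤ s ∧ IsFactoredDNF r μ h) :
    ∃ hh : (sat h).Nonempty, IsAdequate (dnf D) hf (mqStar P str)
      (sampStar P str ⌈100 * ((s : ℝ) / ε) * alpha N⌉₊) h hh (alg r) := by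
  classical
  have hs' : (1 : ℝ) ≤ s := by exact_mod_cast hs
  have hN' : (1 : ℝ) ≤ N := by exact_mod_cast hN
  have hN0 : (0 : ℝ) < N := by linarith
  have hx : 0 < (s : ℝ) / ε := by positivity
  have hfc : (0 : ℝ) < (sat (dnf D)).card := Nat.cast_pos.2 hf.card_pos
  set f := dnf D with hfD
  set g := poolFun f P str with hg
  set x := (s : ℝ) / ε with hxdef
  have hwx : ε / (40 * s) = 1 / (40 * x) := by rw [hxdef]; field_simp
  rw [hwx] at hw
  have hg1 : (sat f).card / (40 * x) ≤ ((sat g).card : ℝ) := by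
    rw [poolWeight, le_div_iff₀ hfc] at hw
    calc _ = 1 / (40 * x) * (sat f).card := by ring
      _ ≤ _ := hw
  have hcard : ((sat g).card : ℝ) = (sat g \ sat h).card + (sat h).card := by
    have := Finset.card_sdiff_add_card_eq_card hsub
    exact_mod_cast this.symm
  -- the excess `1 / N` is at most half of the weight `1 / (40 x)` of the pool
  have hh1 : (sat f).card / (80 * x) ≤ ((sat h).card : ℝ) := by
    have e1 : 1 / (N : ℝ) * (sat f).card ≤ (sat f).card / (80 * x) := by
      rw [div_mul_eq_mul_div, one_mul]
      exact div_le_div_of_nonneg_left hfc.le (by positivity) hNx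
    have e2 : ((sat f).card : ℝ) / (40 * x) = 2 * ((sat f).card / (80 * x)) := by
      field_simp; norm_num
    linarith
  have hhpos : (0 : ℝ) < (sat h).card := lt_of_lt_of_le (by positivity) hh1
  have hgpos : (0 : ℝ) < (sat g).card := lt_of_lt_of_le (by positivity) hg1
  have hh : (sat h).Nonempty := Finset.card_pos.1 (by exact_mod_cast hhpos)
  obtain ⟨hr1, hrs, hfac⟩ := hfac hh
  refine ⟨hh, isAdequate_of_risk_le f hf P str _ h hh hsub (alg r) q (halg.queries r hr1 hrs)
    (δ := 7 / 100) (τ := 1 / (N : ℝ) ^ 2 + 40 * x / N)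
    (halg.avoid r h hh _ hr1 hrs hfac ?_) ?_ (by linarith)⟩
  · refine le_trans ?_ hβ
    -- as `h` lies below `g`, they differ on the excess
    have hB : ∑ y, ind (y ∈ {y | h y ≠ g y}) = ((sat g \ sat h).card : ℝ) := by
      rw [← Finset.sum_subset (Finset.subset_univ (sat g \ sat h))]
      · rw [Finset.sum_congr rfl fun y hy => ind_true ?_]
        · simp
        · obtain ⟨h1, h2⟩ := Finset.mem_sdiff.1 hy
          rw [mem_sat] at h1 h2
          intro h3; exact h2 (h3.trans h1)
      · intro y _ hy
        refine ind_false fun hne => hy ?_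
        rw [Finset.mem_sdiff, mem_sat, mem_sat]
        by_cases h1 : h y = true
        · exact absurd (h1.trans (mem_sat.1 (hsub (mem_sat.2 h1))).symm) hne
        · exact ⟨by
            by_contra h2
            exact hne ((Bool.eq_false_of_not_eq_true h1).trans
              (Bool.eq_false_of_not_eq_true h2).symm), h1⟩
    rw [badRatio, hB, div_le_iff₀ hhpos]
    calc ((sat g \ sat h).card : ℝ) ≤ 1 / N * (sat f).card := hex
      _ = 80 * x / N * ((sat f).card / (80 * x)) := by field_simp
      _ ≤ 80 * x / N * (sat h).card := by gcongr
  · refine add_le_add (sampStar_failure_le hs hε hN (by rw [hwx]; exact hw)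
      (poolWeight_nonneg_le_one f hf P str).2) ?_
    have e : 1 - ((sat h).card : ℝ) / (sat g).card = (sat g \ sat h).card / (sat g).card := by
      rw [hcard]; rw [hcard] at hgpos; field_simp; ring
    rw [e, div_le_iff₀ hgpos]
    calc ((sat g \ sat h).card : ℝ) ≤ 1 / N * (sat f).card := hex
      _ = 40 * x / N * ((sat f).card / (40 * x)) := by field_simp
      _ ≤ 40 * x / N * (sat g).card := by gcongr

/-- If the pools of a DNF are well merged, the heavy pools yield simulators of the disjunctions of
their terms. -/
theorem risk_selectPools_dnf {s N q μ : ℕ} {ε β : ℝ} (hs : 1 ≤ s) (hε : 0 < ε) (hN : 4 ≤ N)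
    (hDs : D.card ≤ s) (ω : ℕ)
    (hNx : 80 * (s / ε) ≤ N) (hβ : 80 * (s / ε) / N ≤ β)
    (hqN : q * (1 / (N : ℝ) ^ 2 + 40 * (s / ε) / N) ≤ 3 / 100) {alg : ℕ → Prog n Bool}
    (halg : IsRobust s μ q β alg) (hμ : (s : ℝ) ^ 2 * linkBound N ≤ μ)
    {S : Fin (N ^ 3) → Str n} {G : Finset (Finset (Fin (N ^ 3)))} (hG : WellMerged D N S G)
    (hH : HitsHeavyTerms D N S) (hGs : G.card ≤ s) :
    risk (World.ofFun (dnf D) hf ∅) (selectPools s ε N ω (G.toList.map fun A => A.image S))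
      (fun out => ind (out ∉ GoodOutputs (dnf D) hf s μ alg)) ≤
      s * (3 * s / (N : ℝ)) + (ω * (s / (N : ℝ) ^ 2) +
        (2 * s + 1) * Real.exp (-(ε / (20 * s) * ω / 6))) := by
  classical
  have hN4 : (4 : ℝ) ≤ N := by exact_mod_cast hN
  have hN1 : (1 : ℝ) ≤ N := by linarith
  have hN0 : (0 : ℝ) < N := by linarith
  have hs' : (1 : ℝ) ≤ s := by exact_mod_cast hs
  have hDs' : (D.card : ℝ) ≤ s := by exact_mod_cast hDs
  have hfc : (0 : ℝ) < (sat (dnf D)).card := Nat.cast_pos.2 hf.card_pos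
  have hlink : 0 ≤ linkBound N :=
    mul_nonneg (by norm_num) (Real.logb_nonneg (by norm_num) hN1)
  set θ := ε / (20 * (s : ℝ)) with hθ
  have hθ0 : 0 < θ := by rw [hθ]; positivity
  set f := dnf D with hfD
  set P := G.toList.map fun A => A.image S with hP
  have hPlen : P.length ≤ s := by rw [hP, List.length_map, Finset.length_toList]; exact hGs
  have hPlen' : (P.length : ℝ) ≤ s := by exact_mod_cast hPlen
  obtain ⟨pool, hp1, hp2, hp3, hp4⟩ : ∃ pool : Fin P.length → Finset (Fin (N ^ 3)),
      (∀ j, P.get j = (pool j).image S) ∧ (∀ j, pool j ∈ G.toList) ∧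
      (∀ p ∈ G.toList, ∃ j, pool j = p) ∧ (G.toList.Nodup → Function.Injective pool) :=
    exists_index_map G.toList fun A => A.image S
  have hpG : ∀ i, pool i ∈ G := fun i => Finset.mem_toList.1 (hp2 i)
  have hpinj : Function.Injective pool := hp4 G.nodup_toList
  rw [selectPools]
  refine risk_bind_le _ (fun str => ∀ i, ((sat (poolFun f ((pool i).image S) (str i)) \
    sat (dnf (hitTerms D S (pool i)))).card : ℝ) ≤ 1 / (N : ℝ) * (sat f).card)
    (fun _ => ind_le_one _) (by positivity) ?_ fun str hstr => ?_
  · refine (risk_tabulate_union _ _ fun i str => ((sat (poolFun f ((pool i).image S) str) \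
      sat (dnf (hitTerms D S (pool i)))).card : ℝ) ≤ 1 / (N : ℝ) * (sat f).card).trans ?_
    refine (Finset.sum_le_sum fun i _ => risk_unif_excess_le hf hN hG hH (hpG i)).trans ?_
    rw [Finset.sum_const, Finset.card_univ, Fintype.card_fin, nsmul_eq_mul]
    gcongr
  · have hsub : ∀ i, sat (dnf (hitTerms D S (pool i))) ⊆
        sat (poolFun f (P.get i) (str i)) := by
      intro i; rw [hp1]; exact sat_hitTerms_subset _ _
    refine (risk_bind_le _ (fun b => FaithfulHits f P str θ b ∧ ¬ ∃ t, ∀ i, b t i = false)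
      (fun _ => ind_le_one _) (δ₂ := 0) le_rfl (δ₁ := (ω * (s / (N : ℝ) ^ 2) +
        (2 * s + 1) * Real.exp (-(θ * ω / 6)))) ?_ fun b hb => ?_).trans (add_zero _).le
    · refine (risk_mono _ _ (ψ := fun b => ind (∃ t, ∀ i, b t i = false) +
        ind (¬ FaithfulHits f P str θ b)) fun b => ?_).trans ?_
      · refine (ind_mono fun h => ?_).trans (ind_or_le _ _)
        by_contra hc
        rw [not_or, not_not] at hc
        exact h ⟨hc.2, hc.1⟩
      · rw [risk_add_of_safe _ rfl]
        refine add_le_add ((risk_poolHits_reject f hf P str ω).trans ?_)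
          ((risk_poolHits_faithful f hf P str ω hθ0.le).trans ?_)
        · refine mul_le_mul_of_nonneg_left ?_ (Nat.cast_nonneg _)
          have h1 := card_missed_le (D := D) hN0 hG.1 hH
          calc uncovered f P str ≤ 𝔼 z ∈ sat f, ind (∀ p ∈ G, dnf (hitTerms D S p) z = false) := by
                refine Finset.expect_le_expect fun z _ => ind_mono fun hz p hp => ?_
                obtain ⟨i, rfl⟩ := hp3 p (Finset.mem_toList.2 hp)
                by_contra hne
                have := mem_sat.1 (hsub i (mem_sat.2 (Bool.eq_true_of_not_eq_false hne)))
                rw [hz i] at this; exact absurd this (by simp)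
            _ = ((missed D S G).card : ℝ) / (sat f).card := expect_ind_eq_card _ _
            _ ≤ s / (N : ℝ) ^ 2 := by
                rw [div_le_iff₀ hfc]
                refine h1.trans ?_
                calc (D.card : ℝ) * (1 / (N : ℝ) ^ 2 * (sat f).card)
                    ≤ s * (1 / (N : ℝ) ^ 2 * (sat f).card) := by gcongr
                  _ = s / (N : ℝ) ^ 2 * (sat f).card := by ring
        · gcongr
    · rw [if_neg hb.2, risk_pure]
      refine (ind_false (not_not.2 (show _ ∈ GoodOutputs f hf s μ alg from ?_))).le
      refine ⟨_, rfl, ?_⟩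
      obtain ⟨idx, h1, h2, -, h4⟩ := exists_index_map
        ((List.finRange P.length).filter fun i =>
          decide (ε / (20 * (s : ℝ)) * (ω : ℝ) ≤
            ((Finset.univ.filter fun t => b t i = true).card : ℝ)))
        (fun i => (mqStar (P.get i) (str i),
          sampStar (P.get i) (str i) ⌈100 * ((s : ℝ) / ε) * alpha N⌉₊))
      have hinj : Function.Injective fun j => pool (idx j) :=
        hpinj.comp (h4 ((List.nodup_finRange _).filter _))
      have hheavy : ∀ j, θ / 2 < poolWeight f (P.get (idx j)) (str (idx j)) := by
        intro j
        by_contra! hc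
        have := h2 j
        simp only [List.mem_filter, List.mem_finRange, true_and, decide_eq_true_eq] at this
        exact (hb.1.2 (idx j)).1 hc this
      have hcards : ∀ p ∈ G, (hitTerms D S p).card ≤ s := fun p hp =>
        (Finset.card_filter_le _ _).trans hDs
      have hfac : ∀ p ∈ G, IsFactoredDNF (hitTerms D S p).card μ (dnf (hitTerms D S p)) := by
        intro p hp
        refine (hG.1.linked p hp).isFactoredDNF hlink (le_trans ?_ hμ)
        have : ((hitTerms D S p).card : ℝ) ≤ s := by exact_mod_cast hcards p hp
        gcongr
      have hade : ∀ j, ∃ hh : (sat (dnf (hitTerms D S (pool (idx j))))).Nonempty,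
          IsAdequate f hf (mqStar (P.get (idx j)) (str (idx j)))
            (sampStar (P.get (idx j)) (str (idx j)) ⌈100 * ((s : ℝ) / ε) * alpha N⌉₊)
            (dnf (hitTerms D S (pool (idx j)))) hh (alg (hitTerms D S (pool (idx j))).card) := by
        intro j
        refine isAdequate_of_pool hf hs hε (by omega) hNx hβ hqN halg _ _ _ (hsub _) ?_ ?_ ?_
        · refine le_trans (le_of_eq ?_) (hheavy j).le
          rw [hθ]; field_simp; norm_num
        · rw [hp1]; exact hstr (idx j)
        · rintro ⟨z, hz⟩
          obtain ⟨U, hU, -⟩ := dnf_eq_true_iff.1 (mem_sat.1 hz)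
          exact ⟨Finset.card_pos.2 ⟨U, hU⟩, hcards _ (hpG _), hfac _ (hpG _)⟩
      choose hh hade using hade
      refine ⟨fun j => (hitTerms D S (pool (idx j))).card,
        fun j => dnf (hitTerms D S (pool (idx j))), hh, fun j => ⟨_, le_rfl, rfl⟩, ?_,
        fun j => hfac _ (hpG _), fun j => ?_⟩
      · refine le_trans ?_ (hG.1.sum_card_le.trans hDs)
        rw [← Finset.sum_image (s := Finset.univ) (g := fun j => pool (idx j))
          (f := fun p => (hitTerms D S p).card) fun a _ b _ h => hinj h]
        refine Finset.sum_le_sum_of_subset fun p hp => ?_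
        obtain ⟨j, -, rfl⟩ := Finset.mem_image.1 hp
        exact hpG _
      · rw [h1 j]; exact hade j

/-- The guarantee of Find-Factored-DNFs for a DNF. -/
theorem risk_findFactoredDNFs_dnf (c : FinderConsts) {s q N ω μ : ℕ} {ε β : ℝ}
    (hNc : c.bigN s ε = N) (hω : c.omega s ε = ω) (hs : 1 ≤ s) (hε : 0 < ε) (hN : 4 ≤ N)
    (hDs : D.card ≤ s) (hsN : s ≤ N)
    (hNx : 80 * (s / ε) ≤ N) (hβ : 80 * (s / ε) / N ≤ β)
    (hqN : q * (1 / (N : ℝ) ^ 2 + 40 * (s / ε) / N) ≤ 3 / 100) {alg : ℕ → Prog n Bool}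
    (halg : IsRobust s μ q β alg) (hμ : (s : ℝ) ^ 2 * linkBound N ≤ μ) :
    risk (World.ofFun (dnf D) hf ∅) (findFactoredDNFs c s ε)
      (fun out => ind (out ∉ GoodOutputs (dnf D) hf s μ alg)) ≤
      8 / (N : ℝ) + (2 / N + (s * (10 / N) + (s * (3 * s / (N : ℝ)) + (ω * (s / (N : ℝ) ^ 2) +
        (2 * s + 1) * Real.exp (-(ε / (20 * s) * ω / 6)))))) := by
  have hN4 : (4 : ℝ) ≤ N := by exact_mod_cast hN
  rw [findFactoredDNFs_eq, hNc, hω]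
  refine risk_bind_le _ _ (fun _ => ind_le_one _) (by positivity)
    (risk_initial_samples_le hf hN (hDs.trans hsN)) fun S hS => ?_
  obtain ⟨hS, hH⟩ := hS
  refine risk_bind_le _ _ (fun _ => ind_le_one _) (by positivity)
    (risk_initial_graph_le hf hN (hDs.trans hsN) S hS) fun E hE => ?_
  have hcomp := (hE.card_components_le fun i => (hS i).1).trans hDs
  rw [if_neg (not_lt.2 hcomp)]
  refine risk_bind_le _ (fun G' => WellMerged D N S G' ∧ G'.card ≤ (components E).card)
    (fun _ => ind_le_one _) (by positivity) ?_ fun G' hG' => ?_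
  · refine (risk_mono _ _ (ψ := fun G' => ind (¬ WellMerged D N S G') +
      ind (¬ G'.card ≤ (components E).card)) fun G' => ?_).trans ?_
    · refine (ind_mono fun h => ?_).trans (ind_or_le _ _)
      by_contra! hc
      exact h hc
    · rw [risk_add_of_safe _ rfl, (meets_mergePhase N S _ _).risk_eq_zero _ rfl, add_zero]
      refine (risk_mergePhase_le hf hN (hDs.trans hsN) S hS _ _
        (hE.isPooling fun i => (hS i).1) le_rfl).trans ?_
      gcongr
  · exact risk_selectPools_dnf hf hs hε hN hDs ω hNx hβ hqN halg hμ hG'.1 hH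
      (hG'.2.trans hcomp)

end Completeness

/-! ### The parameters -/

section Parameters

theorem logb_two_le {t : ℝ} (ht : 0 < t) : Real.logb 2 t ≤ 2 * t := by
  rw [Real.logb, div_le_iff₀ (Real.log_pos (by norm_num))]
  nlinarith [Real.log_le_sub_one_of_pos ht, Real.log_two_gt_d9]

theorem logb_two_nonneg {t : ℝ} (ht : 1 ≤ t) : 0 ≤ Real.logb 2 t :=
  Real.logb_nonneg (by norm_num) ht

/-- An upper bound for all the constants of Test-Factored-DNF. -/
def TesterConsts.total (c : TesterConsts) : ℕ :=
  c.start + c.blocks + c.extract + c.juntaBlocks + c.juntaRounds + c.juntaReps + c.verify +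
    c.verify' + c.gamma + c.conj + c.conj' + 1

/-- The admissible range of `s` and `ε`, for a lower bound `L` on `s / ε`. -/
structure Admissible (s : ℕ) (ε L : ℝ) : Prop where
  one_le : 1 ≤ s
  pos : 0 < ε
  le_half : ε ≤ 1 / 2
  le_ratio : L ≤ (s : ℝ) / ε

variable {s : ℕ} {ε L : ℝ}

theorem Admissible.cast_le (h : Admissible s ε L) : (s : ℝ) ≤ s / ε := by
  rw [le_div_iff₀ h.pos]
  have : (0 : ℝ) ≤ s := Nat.cast_nonneg s
  nlinarith [h.le_half]

theorem Admissible.one_le_logb (h : Admissible s ε L) : 1 ≤ Real.logb 2 ((s : ℝ) / ε) := by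
  have hs : (1 : ℝ) ≤ s := by exact_mod_cast h.one_le
  rw [Real.le_logb_iff_rpow_le (by norm_num) (div_pos (by linarith) h.pos), Real.rpow_one,
    le_div_iff₀ h.pos]
  nlinarith [h.le_half]

theorem Admissible.two_le_paramMu (h : Admissible s ε L) : 2 ≤ paramMu s ε := by
  have hs : (1 : ℝ) ≤ s := by exact_mod_cast h.one_le
  rw [paramMu, paramK]
  refine Nat.le_floor ?_
  have h1 : (1 : ℝ) ≤ (s : ℝ) ^ 2 := one_le_pow₀ hs
  have h2 : (1 : ℝ) ≤ Real.logb 2 ((s : ℝ) / ε) ^ 2 := one_le_pow₀ h.one_le_logb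
  have h3 := one_le_mul_of_one_le_of_one_le h1 h2
  push_cast; nlinarith

theorem Admissible.paramMu_le (h : Admissible s ε L) :
    (paramMu s ε : ℝ) ≤ 64 * ((s : ℝ) / ε) ^ 4 := by
  have hs : (1 : ℝ) ≤ s := by exact_mod_cast h.one_le
  have hx : 0 < (s : ℝ) / ε := div_pos (by linarith) h.pos
  rw [paramMu, paramK]
  refine (Nat.floor_le (by positivity)).trans ?_
  have h1 : Real.logb 2 ((s : ℝ) / ε) ^ 2 ≤ (2 * ((s : ℝ) / ε)) ^ 2 :=
    pow_le_pow_left₀ (zero_le_one.trans h.one_le_logb) (logb_two_le hx) 2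
  calc 16 * (s : ℝ) ^ 2 * Real.logb 2 ((s : ℝ) / ε) ^ 2
      ≤ 16 * ((s : ℝ) / ε) ^ 2 * (2 * ((s : ℝ) / ε)) ^ 2 := by
        gcongr; exact h.cast_le
    _ = _ := by ring

theorem kappa_eq (h : Admissible s ε L) : kappa (ε / (2 * s)) = 1 / (4 * ((s : ℝ) / ε) ^ 2) := by
  have hs : (1 : ℝ) ≤ s := by exact_mod_cast h.one_le
  have := h.pos
  rw [kappa]; field_simp; norm_num

theorem logb_hundred (a : ℕ) : Real.logb 2 (100 * 2 ^ a) = Real.logb 2 100 + a := by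
  rw [Real.logb_mul (by norm_num) (by positivity), Real.logb_pow]; simp

theorem logb_hundred_bounds : 6 ≤ Real.logb 2 100 ∧ Real.logb 2 100 ≤ 7 := by
  constructor
  · rw [Real.le_logb_iff_rpow_le (by norm_num) (by norm_num)]; norm_num
  · rw [Real.logb_le_iff_le_rpow (by norm_num) (by norm_num)]; norm_num

theorem one_div_xi (h : Admissible s ε L) (r μ : ℕ) : 1 / xi r μ (ε / (2 * s)) =
    16000 * ((s : ℝ) / ε) ^ 2 * (Real.logb 2 100 + (2 * μ * r : ℕ)) := by
  have hs : (1 : ℝ) ≤ s := by exact_mod_cast h.one_le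
  have hx : 0 < (s : ℝ) / ε := div_pos (by linarith) h.pos
  have hl : (0 : ℝ) < Real.logb 2 100 + (2 * μ * r : ℕ) := by
    have := logb_hundred_bounds.1; positivity
  rw [xi, kappa_eq h, logb_hundred]
  field_simp; norm_num

theorem xi_pos (h : Admissible s ε L) (r μ : ℕ) : 0 < xi r μ (ε / (2 * s)) := by
  have hs : (1 : ℝ) ≤ s := by exact_mod_cast h.one_le
  have hx : 0 < (s : ℝ) / ε := div_pos (by linarith) h.pos
  have hl : (0 : ℝ) < Real.logb 2 100 + (2 * μ * r : ℕ) := by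
    have := logb_hundred_bounds.1; positivity
  rw [← one_div_pos, one_div_xi h]
  positivity

/-- The bound on all the parameters of Test-Factored-DNF. -/
noncomputable def paramM (s : ℕ) (ε : ℝ) : ℕ := ⌈(s : ℝ) / ε⌉₊ ^ 20

theorem ceil_le_paramM {t B : ℝ} (h : Admissible s ε L) (hB : 1 ≤ B) (hL : 10 ^ 9 * B ≤ L)
    (ht : t ≤ 10 ^ 12 * B * ((s : ℝ) / ε) ^ 15) : ⌈t⌉₊ + 1 ≤ paramM s ε := by
  set x := (s : ℝ) / ε with hx
  have hxB : 10 ^ 9 * B ≤ x := hL.trans h.le_ratio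
  have hx1 : 10 ^ 9 ≤ x := by linarith
  have h1 : t + 2 ≤ x ^ 20 := by
    have h2 : 10 ^ 12 * B * x ^ 15 ≤ (x * x * (x ^ 15)) := by
      refine mul_le_mul_of_nonneg_right ?_ (by positivity)
      nlinarith
    have h3 : x * x * x ^ 15 = x ^ 17 := by ring
    have h4 : x ^ 17 + 2 ≤ x ^ 20 := by
      have h5 : 1 ≤ x ^ 17 := one_le_pow₀ (by linarith)
      have h6 : (3 : ℝ) ≤ x ^ 3 := (by linarith : (3 : ℝ) ≤ x).trans
        (le_self_pow₀ (by linarith) (by norm_num))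
      calc x ^ 17 + 2 ≤ x ^ 17 * 3 := by linarith
        _ ≤ x ^ 17 * x ^ 3 := by gcongr
        _ = x ^ 20 := by ring
    linarith
  have h2 : x ^ 20 ≤ (paramM s ε : ℝ) := by
    rw [paramM]; push_cast
    exact pow_le_pow_left₀ (by linarith) (Nat.le_ceil _) 20
  rcases le_or_gt t 0 with h0 | h0
  · rw [Nat.ceil_eq_zero.2 h0]
    rw [zero_add, paramM]
    refine Nat.one_le_pow _ _ (Nat.ceil_pos.2 (by linarith))
  · have h3 := Nat.ceil_lt_add_one h0.le
    have : ((⌈t⌉₊ + 1 : ℕ) : ℝ) ≤ paramM s ε := by push_cast; linarith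
    exact_mod_cast this

theorem ceil_add_one_le_paramM {t A B : ℝ} (h : Admissible s ε L) (hB : 1 ≤ B)
    (hL : 10 ^ 9 * B ≤ L) (k : ℕ) (hA : A ≤ 10 ^ 12) (hk : k ≤ 15)
    (ht : t ≤ A * B * ((s : ℝ) / ε) ^ k) : ⌈t⌉₊ + 1 ≤ paramM s ε := by
  have hx1 : 1 ≤ (s : ℝ) / ε := by linarith [h.le_ratio]
  refine ceil_le_paramM h hB hL (ht.trans ?_)
  gcongr

/-- The inverse of `ξ` is polynomial in `s / ε`. -/
theorem one_div_xi_le (h : Admissible s ε L) {r : ℕ} (hr : r ≤ s) :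
    1 / xi r (paramMu s ε) (ε / (2 * s)) ≤ 2160000 * ((s : ℝ) / ε) ^ 7 := by
  have hs : (1 : ℝ) ≤ s := by exact_mod_cast h.one_le
  set x := (s : ℝ) / ε with hx
  have hx1 : 1 ≤ x := hs.trans h.cast_le
  have hr' : (r : ℝ) ≤ x := le_trans (by exact_mod_cast hr) h.cast_le
  have hμ := h.paramMu_le
  have hx5 : 1 ≤ x ^ 5 := one_le_pow₀ hx1
  rw [one_div_xi h]
  have h1 : Real.logb 2 100 + (2 * paramMu s ε * r : ℕ) ≤ 135 * x ^ 5 := by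
    push_cast
    calc Real.logb 2 100 + 2 * (paramMu s ε : ℝ) * r ≤ 7 + 2 * (64 * x ^ 4) * x := by
          gcongr; exact logb_hundred_bounds.2
      _ = 7 + 128 * x ^ 5 := by ring
      _ ≤ 135 * x ^ 5 := by linarith
  calc 16000 * x ^ 2 * (Real.logb 2 100 + (2 * paramMu s ε * r : ℕ))
      ≤ 16000 * x ^ 2 * (135 * x ^ 5) := by gcongr
    _ = _ := by ring

/-- All repetitions, samples and blocks are polynomial in `s / ε`, and the constants are absorbed by
the lower bound on `s / ε`. -/
theorem paramBound (c : TesterConsts) (h : Admissible s ε L) (hL : 10 ^ 9 * (c.total : ℝ) ≤ L)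
    {r : ℕ} (hr : r ≤ s) :
    ParamBound c r (paramMu s ε) (ε / (2 * s)) (paramM s ε) := by
  have hs : (1 : ℝ) ≤ s := by exact_mod_cast h.one_le
  have hε := h.pos
  set x := (s : ℝ) / ε with hx
  set B : ℝ := (c.total : ℝ) with hBdef
  have hB : 1 ≤ B := by
    rw [hBdef, TesterConsts.total]; push_cast; linarith [
      (by positivity : (0 : ℝ) ≤ c.start + c.blocks + c.extract + c.juntaBlocks + c.juntaRounds +
        c.juntaReps + c.verify + c.verify' + c.gamma + c.conj + c.conj')]
  have hle : ∀ a : ℕ, a ≤ c.total → (a : ℝ) ≤ B := fun a ha => by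
    rw [hBdef]; exact_mod_cast ha
  have hx1 : 1 ≤ x := hs.trans h.cast_le
  have hx0 : 0 < x := by linarith
  have hμ : (paramMu s ε : ℝ) ≤ 64 * x ^ 4 := h.paramMu_le
  have hμ2 : (2 : ℝ) ≤ paramMu s ε := by exact_mod_cast h.two_le_paramMu
  have hlog : Real.logb 2 (paramMu s ε : ℝ) ≤ 2 * (64 * x ^ 4) :=
    (logb_two_le (by linarith only [hμ2])).trans (by linarith only [hμ])
  have hlog0 : 0 ≤ Real.logb 2 (paramMu s ε : ℝ) := logb_two_nonneg (by linarith only [hμ2])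
  have hμlog0 : 0 ≤ (paramMu s ε : ℝ) * Real.logb 2 (paramMu s ε : ℝ) :=
    mul_nonneg (Nat.cast_nonneg _) hlog0
  have hxi := one_div_xi_le h hr
  have hxi0 := xi_pos h r (paramMu s ε)
  rw [← hx] at hxi
  set μ := paramMu s ε with hμdef
  set ξ := xi r μ (ε / (2 * s)) with hξ
  have heps : 1 / (ε / (2 * s)) = 2 * x := by rw [hx]; field_simp
  have key : ∀ {t A : ℝ} (k : ℕ), A ≤ 10 ^ 12 → k ≤ 15 → t ≤ A * B * x ^ k →
      ⌈t⌉₊ + 1 ≤ paramM s ε := fun {t A} k hA hk ht => ceil_add_one_le_paramM h hB hL k hA hk ht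
  have key' : ∀ {t A : ℝ} (k : ℕ), A ≤ 10 ^ 12 → k ≤ 15 → t ≤ A * B * x ^ k →
      ⌈t⌉₊ ≤ paramM s ε := fun {t A} k hA hk ht => (Nat.le_succ _).trans (key k hA hk ht)
  have keyn : ∀ {a : ℕ} {A : ℝ} (k : ℕ), A ≤ 10 ^ 12 → k ≤ 15 → (a : ℝ) ≤ A * B * x ^ k →
      a + 1 ≤ paramM s ε := fun {a A} k hA hk ht => by
    have := key k hA hk ht
    rwa [Nat.ceil_natCast] at this
  have hBx : ∀ {A : ℝ} (k : ℕ), 0 ≤ A → A * x ^ k ≤ A * B * x ^ k := fun {A} k hA => by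
    gcongr; exact le_mul_of_one_le_right hA hB
  constructor
  · refine (Nat.le_succ _).trans (keyn (A := 100) 0 (by norm_num) (by norm_num) ?_)
    push_cast; linarith
  · refine (Nat.le_succ _).trans (keyn (A := 64) 4 (by norm_num) (by norm_num) ?_)
    exact hμ.trans (hBx 4 (by norm_num))
  · refine key' (A := 17694720000) 15 (by norm_num) (by norm_num) ?_
    rw [div_eq_mul_one_div]
    calc (c.start : ℝ) * ((μ : ℝ) * Real.logb 2 μ) * (1 / ξ)
        ≤ B * ((64 * x ^ 4) * (2 * (64 * x ^ 4))) * (2160000 * x ^ 7) := by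
          gcongr
          exact hle _ (by unfold TesterConsts.total; omega)
      _ = _ := by ring
  · refine keyn (A := 4096) 8 (by norm_num) (by norm_num) ?_
    push_cast
    calc (c.blocks : ℝ) * (μ : ℝ) ^ 2 ≤ B * (64 * x ^ 4) ^ 2 := by
          gcongr
          exact hle _ (by unfold TesterConsts.total; omega)
      _ = _ := by ring
  · refine (add_le_add_left (Nat.floor_le_ceil _) 1).trans
      (key (A := 138240000000) 11 (by norm_num) (by norm_num) ?_)
    rw [div_eq_mul_one_div]
    refine le_trans ?_ (hBx 11 (by norm_num))
    calc 5 * Real.log (200 * (μ : ℝ)) * (1 / ξ)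
        ≤ 5 * (200 * (64 * x ^ 4)) * (2160000 * x ^ 7) := by
          gcongr
          have := Real.log_le_sub_one_of_pos (show (0 : ℝ) < 200 * μ by linarith only [hμ2])
          linarith only [this, hμ]
      _ = _ := by ring
  · refine key' (A := 2160000) 7 (by norm_num) (by norm_num) ?_
    refine le_trans ?_ (hBx 7 (by norm_num))
    refine le_trans ?_ hxi
    exact one_div_le_one_div_of_le hxi0 (by linarith only [hxi0])
  · refine key' (A := 256) 4 (by norm_num) (by norm_num) ?_
    calc (c.extract : ℝ) * Real.logb 2 ((μ : ℝ) / (1 / 2)) ≤ B * (2 * (2 * (64 * x ^ 4))) := by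
          have : (μ : ℝ) / (1 / 2) = 2 * μ := by ring
          rw [this]
          have h1 : 0 ≤ Real.logb 2 (2 * (μ : ℝ)) := logb_two_nonneg (by linarith only [hμ2])
          have h2 : Real.logb 2 (2 * (μ : ℝ)) ≤ 2 * (2 * (64 * x ^ 4)) :=
            (logb_two_le (by linarith only [hμ2])).trans (by linarith only [hμ])
          gcongr
          exact hle _ (by unfold TesterConsts.total; omega)
      _ = _ := by ring
  · refine key' (A := 512) 6 (by norm_num) (by norm_num) ?_
    calc (c.extract : ℝ) * Real.logb 2 ((μ : ℝ) / kappa (ε / (2 * s)))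
        ≤ B * (2 * ((64 * x ^ 4) * (4 * x ^ 2))) := by
          rw [kappa_eq h, ← hx]
          have : (μ : ℝ) / (1 / (4 * x ^ 2)) = μ * (4 * x ^ 2) := by field_simp
          rw [this]
          have h1 : (1 : ℝ) ≤ x ^ 2 := one_le_pow₀ hx1
          have h2 : (1 : ℝ) ≤ μ * (4 * x ^ 2) :=
            one_le_mul_of_one_le_of_one_le (by linarith only [hμ2]) (by linarith only [h1])
          have h3 := logb_two_nonneg h2
          have h4 : Real.logb 2 (μ * (4 * x ^ 2)) ≤ 2 * ((64 * x ^ 4) * (4 * x ^ 2)) :=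
            (logb_two_le (by linarith only [h2])).trans (by gcongr)
          gcongr
          exact hle _ (by unfold TesterConsts.total; omega)
      _ = _ := by ring
  · refine key' (A := 7) 0 (by norm_num) (by norm_num) ?_
    have : (1 : ℝ) / (1 / 100) = 100 := by norm_num
    rw [this]
    calc (c.juntaReps : ℝ) * Real.logb 2 100 ≤ B * 7 := by
          have h1 := logb_hundred_bounds.2
          have h2 : 0 ≤ Real.logb 2 100 := by linarith only [logb_hundred_bounds.1]
          gcongr
          exact hle _ (by unfold TesterConsts.total; omega)
      _ = _ := by ring
  · refine key (A := 24300000) 0 (by norm_num) (by norm_num) ?_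
    calc (c.juntaBlocks : ℝ) * ((1 : ℕ) : ℝ) ^ 9 / (1 / 30) ^ 5 = c.juntaBlocks * 24300000 := by
          norm_num; ring
      _ ≤ B * 24300000 := by
          gcongr; exact hle _ (by unfold TesterConsts.total; omega)
      _ = _ := by ring
  · refine key' (A := 60) 0 (by norm_num) (by norm_num) ?_
    calc (c.juntaRounds : ℝ) * (((1 : ℕ) : ℝ) + 1) / (1 / 30) = c.juntaRounds * 60 := by
          norm_num; ring
      _ ≤ B * 60 := by
          gcongr; exact hle _ (by unfold TesterConsts.total; omega)
      _ = _ := by ring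
  · refine key' (A := 2) 1 (by norm_num) (by norm_num) ?_
    rw [div_eq_mul_one_div, heps]
    calc (c.verify : ℝ) * (2 * x) ≤ B * (2 * x) := by
          gcongr; exact hle _ (by unfold TesterConsts.total; omega)
      _ = _ := by ring
  · refine key' (A := 2) 1 (by norm_num) (by norm_num) ?_
    rw [div_eq_mul_one_div, heps]
    calc (c.verify' : ℝ) * (2 * x) ≤ B * (2 * x) := by
          gcongr; exact hle _ (by unfold TesterConsts.total; omega)
      _ = _ := by ring
  · refine key' (A := 4) 1 (by norm_num) (by norm_num) ?_
    rw [heps]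
    calc (c.gamma : ℝ) * Real.logb 2 (2 * x) ≤ B * (2 * (2 * x)) := by
          have h1 : 0 ≤ Real.logb 2 (2 * x) := logb_two_nonneg (by linarith only [hx1])
          have h2 : Real.logb 2 (2 * x) ≤ 2 * (2 * x) := logb_two_le (by linarith only [hx1])
          gcongr
          exact hle _ (by unfold TesterConsts.total; omega)
      _ = _ := by ring
  · refine key' (A := 20) 1 (by norm_num) (by norm_num) ?_
    have : (c.conj : ℝ) / (ε / (2 * s) / 10) = c.conj * (10 * (2 * x)) := by
      rw [← heps]; field_simp
    rw [this]
    calc (c.conj : ℝ) * (10 * (2 * x)) ≤ B * (10 * (2 * x)) := by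
          gcongr; exact hle _ (by unfold TesterConsts.total; omega)
      _ = _ := by ring
  · refine (Nat.le_succ _).trans (keyn (A := 1) 0 (by norm_num) (by norm_num) ?_)
    rw [pow_zero, mul_one, one_mul]
    exact hle _ (by unfold TesterConsts.total; omega)

/-- The hypothesis class of FindCandidate is small compared to the number of samples. -/
theorem occam_bound (h : Admissible s ε L) (r μ : ℕ) :
    (4 : ℝ) ^ (μ * r) * (1 / 2) ^ ⌈1 / (200 * xi r μ (ε / (2 * s)))⌉₊ ≤ 1 / 100 := by
  have hs : (1 : ℝ) ≤ s := by exact_mod_cast h.one_le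
  have hx1 : 1 ≤ (s : ℝ) / ε := hs.trans h.cast_le
  have hl := logb_hundred_bounds.1
  set y : ℝ := Real.logb 2 100 + (2 * μ * r : ℕ) with hy
  have hy0 : 0 ≤ y := by positivity
  have h1 : y ≤ ⌈1 / (200 * xi r μ (ε / (2 * s)))⌉₊ := by
    refine le_trans ?_ (Nat.le_ceil _)
    have : 1 / (200 * xi r μ (ε / (2 * s))) = 80 * ((s : ℝ) / ε) ^ 2 * y := by
      rw [one_div, mul_inv, ← one_div (xi r μ _), one_div_xi h]; ring
    rw [this]
    have h2 : 1 ≤ ((s : ℝ) / ε) ^ 2 := one_le_pow₀ hx1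
    nlinarith
  have h2 : (2 : ℝ) ^ y = 100 * 2 ^ (2 * μ * r) := by
    rw [hy, ← logb_hundred, Real.rpow_logb (by norm_num) (by norm_num) (by positivity)]
  have h3 : (2 : ℝ) ^ y ≤ 2 ^ ⌈1 / (200 * xi r μ (ε / (2 * s)))⌉₊ := by
    rw [← Real.rpow_natCast]
    exact Real.rpow_le_rpow_of_exponent_le (by norm_num) h1
  rw [h2] at h3
  have h4 : (4 : ℝ) ^ (μ * r) = 2 ^ (2 * μ * r) := by
    rw [show (4 : ℝ) = 2 ^ 2 by norm_num, ← pow_mul, mul_assoc]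
  rw [h4, one_div, inv_pow, ← div_eq_mul_inv, div_le_div_iff₀ (by positivity) (by norm_num)]
  linarith

/-- The initial samples of Test-Factored-DNF vary on all coordinates that are far from constant. -/
theorem start_bound (c : TesterConsts) (h : Admissible s ε L) {r : ℕ} (hr : 1 ≤ r)
    (hc : 100 ≤ c.start) : (paramMu s ε : ℝ) * (2 * (1 - 1 / (4 * (paramMu s ε : ℝ))) ^
      ⌈(c.start : ℝ) * ((paramMu s ε : ℝ) * Real.logb 2 (paramMu s ε : ℝ)) /
        xi r (paramMu s ε) (ε / (2 * s))⌉₊) ≤ 1 / 100 := by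
  have hs : (1 : ℝ) ≤ s := by exact_mod_cast h.one_le
  have hx1 : 1 ≤ (s : ℝ) / ε := hs.trans h.cast_le
  have hμ2 : (2 : ℝ) ≤ paramMu s ε := by exact_mod_cast h.two_le_paramMu
  have hxi0 := xi_pos h r (paramMu s ε)
  have hxi := one_div_xi h r (paramMu s ε)
  set μ := paramMu s ε
  set ξ := xi r μ (ε / (2 * s))
  have hr' : (1 : ℝ) ≤ r := by exact_mod_cast hr
  have hc' : (100 : ℝ) ≤ c.start := by exact_mod_cast hc
  have h1 : 800 * (μ : ℝ) ≤ 1 / ξ := by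
    rw [hxi]
    have h2 : 1 ≤ ((s : ℝ) / ε) ^ 2 := one_le_pow₀ hx1
    have h3 : (μ : ℝ) ≤ Real.logb 2 100 + (2 * μ * r : ℕ) := by
      push_cast
      nlinarith [logb_hundred_bounds.1]
    calc 800 * (μ : ℝ) ≤ 16000 * 1 * μ := by linarith
      _ ≤ _ := by gcongr
  have hlog : 1 ≤ Real.logb 2 (μ : ℝ) := by
    rw [Real.le_logb_iff_rpow_le (by norm_num) (by linarith), Real.rpow_one]; exact hμ2
  set T := ⌈(c.start : ℝ) * ((μ : ℝ) * Real.logb 2 (μ : ℝ)) / ξ⌉₊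
  have hT : 800 * (μ : ℝ) ^ 2 * 100 ≤ T := by
    refine le_trans ?_ (Nat.le_ceil _)
    rw [div_eq_mul_one_div]
    calc 800 * (μ : ℝ) ^ 2 * 100 = 100 * (μ * 1) * (800 * μ) := by ring
      _ ≤ _ := by gcongr
  have hμ0 : (0 : ℝ) < μ := by linarith
  have hq : 1 / (4 * (μ : ℝ)) ≤ 1 := by
    rw [div_le_one (by positivity)]; linarith
  have h4 := one_add_pow_le_exp (a := -(1 / (4 * (μ : ℝ)))) (by linarith) T
  rw [← sub_eq_add_neg] at h4
  have h5 : Real.exp (-(1 / (4 * (μ : ℝ))) * T) ≤ Real.exp (-(200 * μ)) := by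
    rw [Real.exp_le_exp, neg_mul, neg_le_neg_iff, one_div_mul_eq_div, le_div_iff₀ (by positivity)]
    nlinarith
  have h6 : Real.exp (-(200 * (μ : ℝ))) ≤ 1 / (200 * μ) := by
    rw [Real.exp_neg, one_div]
    exact inv_anti₀ (by positivity) (by linarith [Real.add_one_le_exp (200 * (μ : ℝ))])
  calc (μ : ℝ) * (2 * (1 - 1 / (4 * (μ : ℝ))) ^ T) ≤ μ * (2 * (1 / (200 * μ))) := by
        gcongr; exact h4.trans (h5.trans h6)
    _ = 1 / 100 := by field_simp; norm_num

theorem one_le_ceil_extract (c : TesterConsts) (hc : 100 ≤ c.extract) {t : ℝ} (ht : 2 ≤ t) :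
    1 ≤ ⌈(c.extract : ℝ) * Real.logb 2 t⌉₊ := by
  have hc' : (100 : ℝ) ≤ c.extract := by exact_mod_cast hc
  have : 1 ≤ Real.logb 2 t := by
    rw [Real.le_logb_iff_rpow_le (by norm_num) (by linarith), Real.rpow_one]; exact ht
  exact Nat.ceil_pos.2 (by nlinarith)

/-- Test-Factored-DNF with the parameters of the reduction makes few queries, and on factored DNFs
it avoids sets of small density. -/
theorem isRobust_testFactoredDNF {n : ℕ} (c : TesterConsts) (hc : c.AtLeast 100)
    (h : Admissible s ε L) (hL : 10 ^ 9 * (c.total : ℝ) ≤ L) :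
    IsRobust (n := n) s (paramMu s ε) (paramM s ε ^ 6)
      ((1 / (100 * (paramM s ε : ℝ) ^ 5)) ^ 2)
      fun r => testFactoredDNF c r (paramMu s ε) (ε / (2 * s)) where
  queries k _ hk := (meets_testFactoredDNF (paramBound c h hL hk)).queriesAtMost
  avoid k g hg B hk1 hk hfac hB := by
    have hp := paramBound c h hL hk
    have hM : (100 : ℝ) ≤ paramM s ε := by exact_mod_cast hp.hundred
    have hs : (1 : ℝ) ≤ s := by exact_mod_cast h.one_le
    have hx1 : 1 ≤ (s : ℝ) / ε := hs.trans h.cast_le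
    have hμ2 : (2 : ℝ) ≤ paramMu s ε := by exact_mod_cast h.two_le_paramMu
    have hM5 : (1 : ℝ) ≤ (paramM s ε : ℝ) ^ 5 := one_le_pow₀ (by linarith)
    refine risk_testFactoredDNF_le g hg B hp hfac.isHeadTail
      (by have := h.two_le_paramMu; omega) hc.2.1 (one_le_ceil_extract c hc.2.2.1 (by linarith))
      (one_le_ceil_extract c hc.2.2.1 ?_) (occam_bound h _ _) (start_bound c h hk1 hc.1)
      (η := 1 / (100 * (paramM s ε : ℝ) ^ 5)) (by positivity) ?_ hB (le_of_eq ?_)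
    · rw [kappa_eq h, div_div_eq_mul_div, div_one]
      have h2 : 1 ≤ ((s : ℝ) / ε) ^ 2 := one_le_pow₀ hx1
      nlinarith
    · rw [div_le_one (by positivity)]; linarith
    · field_simp

end Parameters

/-! ### The parameters of Find-Factored-DNFs -/

section FinderParameters

variable {s : ℕ} {ε L : ℝ} {c : FinderConsts}

/-- The sizes of the parameters of Find-Factored-DNFs in terms of `s / ε` and its integer
upper bound. -/
structure FinderScale (c : FinderConsts) (s : ℕ) (ε : ℝ) : Prop where
  one_le : 1 ≤ s
  pos : 0 < ε
  large : (10 : ℝ) ^ 9 ≤ (s : ℝ) / ε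
  cast_le : (s : ℝ) ≤ (s : ℝ) / ε
  degree : 300 ≤ c.degree
  draws : 300 ≤ c.draws
  draws_le : (c.draws : ℝ) ≤ (s : ℝ) / ε
  degree_le : 40 * (c.degree : ℝ) ≤ Real.logb 2 ((s : ℝ) / ε)

theorem Admissible.finderScale (h : Admissible s ε L) (hL : 10 ^ 9 ≤ L)
    (hd : 300 ≤ c.degree) (hd' : 300 ≤ c.draws) (hLd : 2 ^ (40 * c.degree) ≤ L)
    (hLd' : (c.draws : ℝ) ≤ L) : FinderScale c s ε where
  one_le := h.one_le
  pos := h.pos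
  large := hL.trans h.le_ratio
  cast_le := h.cast_le
  degree := hd
  draws := hd'
  draws_le := hLd'.trans h.le_ratio
  degree_le := by
    have h1 : (0 : ℝ) < (s : ℝ) / ε := by linarith [h.le_ratio]
    rw [Real.le_logb_iff_rpow_le (by norm_num) h1]
    have : (2 : ℝ) ^ (40 * (c.degree : ℝ)) = 2 ^ (40 * c.degree) := by
      rw [← Real.rpow_natCast]; push_cast; rfl
    rw [this]
    exact hLd.trans h.le_ratio

namespace FinderScale

variable (h : FinderScale c s ε)

theorem le_ceil (h : FinderScale c s ε) : (10 : ℝ) ^ 9 ≤ (⌈(s : ℝ) / ε⌉₊ : ℝ) :=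
  h.large.trans (Nat.le_ceil _)

theorem ceil_le (h : FinderScale c s ε) : (⌈(s : ℝ) / ε⌉₊ : ℝ) ≤ ((s : ℝ) / ε) ^ 2 := by
  have := h.large
  have := Nat.ceil_lt_add_one (show 0 ≤ (s : ℝ) / ε by linarith)
  nlinarith

theorem pow_le_bigN (h : FinderScale c s ε) {k : ℕ} (hk : k ≤ 300) :
    (⌈(s : ℝ) / ε⌉₊ : ℝ) ^ k ≤ c.bigN s ε := by
  rw [FinderConsts.bigN]; push_cast
  exact pow_le_pow_right₀ (by linarith [h.le_ceil]) (hk.trans h.degree)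

theorem cast_le_ceil (h : FinderScale c s ε) : (s : ℝ) ≤ (⌈(s : ℝ) / ε⌉₊ : ℝ) :=
  h.cast_le.trans (Nat.le_ceil _)

theorem sq_le_bigN (h : FinderScale c s ε) : (10 : ℝ) ^ 9 * ⌈(s : ℝ) / ε⌉₊ ≤ c.bigN s ε := by
  have h1 := h.pow_le_bigN (k := 2) (by norm_num)
  have h2 := h.le_ceil
  nlinarith

theorem bigN_le (h : FinderScale c s ε) :
    (c.bigN s ε : ℝ) ≤ ((s : ℝ) / ε) ^ (2 * c.degree) := by
  rw [FinderConsts.bigN, pow_mul]; push_cast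
  exact pow_le_pow_left₀ (Nat.cast_nonneg _) h.ceil_le _

theorem omega_le (h : FinderScale c s ε) : (c.omega s ε : ℝ) ≤ c.bigN s ε := by
  have hx := h.large
  have hd := h.draws_le
  have hl := h.degree_le
  rw [FinderConsts.omega]
  set x := (s : ℝ) / ε with hxdef
  have hlog : Real.logb 2 x ≤ 2 * x := logb_two_le (by linarith)
  have hlog0 : 0 ≤ Real.logb 2 x := logb_two_nonneg (by linarith)
  have h1 : (c.draws : ℝ) * x * Real.logb 2 x ≤ x * x * (2 * x) := by gcongr
  have h2 := Nat.ceil_lt_add_one (show 0 ≤ (c.draws : ℝ) * x * Real.logb 2 x by positivity)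
  have h3 : (1 : ℝ) ≤ x ^ 3 := one_le_pow₀ (by linarith)
  have h4 : x ^ 4 ≤ c.bigN s ε :=
    (pow_le_pow_left₀ (by linarith) (Nat.le_ceil x) 4).trans (h.pow_le_bigN (by norm_num))
  have h5 : 3 * x ^ 3 ≤ x ^ 4 := by
    calc 3 * x ^ 3 ≤ x * x ^ 3 := by gcongr; linarith
      _ = x ^ 4 := by ring
  have h6 : x * x * (2 * x) = 2 * x ^ 3 := by ring
  linarith

/-- The heavy pools are recognized correctly, except with probability `O(ε / s)`. -/
theorem exp_le (h : FinderScale c s ε) :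
    (2 * s + 1) * Real.exp (-(ε / (20 * s) * c.omega s ε / 6)) ≤ 1 / 100 := by
  have hs : (1 : ℝ) ≤ s := by exact_mod_cast h.one_le
  have hε := h.pos
  have hx := h.large
  have hsx := h.cast_le
  have hD : (300 : ℝ) ≤ c.draws := by exact_mod_cast h.draws
  have hlog0 : 0 ≤ Real.logb 2 ((s : ℝ) / ε) := logb_two_nonneg (by linarith)
  have hln : Real.log ((s : ℝ) / ε) ≤ Real.logb 2 ((s : ℝ) / ε) := by
    rw [Real.logb, le_div_iff₀ (Real.log_pos (by norm_num))]
    have := Real.log_nonneg (show 1 ≤ (s : ℝ) / ε by linarith)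
    nlinarith [Real.log_two_lt_d9]
  have hω : (c.draws : ℝ) * ((s : ℝ) / ε) * Real.logb 2 ((s : ℝ) / ε) ≤ c.omega s ε := Nat.le_ceil _
  have h1 : 2 * Real.log ((s : ℝ) / ε) ≤ ε / (20 * s) * c.omega s ε / 6 := by
    calc 2 * Real.log ((s : ℝ) / ε) ≤ 300 * Real.logb 2 ((s : ℝ) / ε) / 120 := by linarith
      _ ≤ c.draws * Real.logb 2 ((s : ℝ) / ε) / 120 := by gcongr
      _ = ε / (20 * s) * (c.draws * ((s : ℝ) / ε) * Real.logb 2 ((s : ℝ) / ε)) / 6 := by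
          field_simp; ring
      _ ≤ _ := by gcongr
  set x := (s : ℝ) / ε
  have hx0 : 0 < x := by linarith
  have h2 : Real.exp (-(ε / (20 * s) * c.omega s ε / 6)) ≤ (x ^ 2)⁻¹ := by
    rw [← Real.exp_log (show 0 < (x ^ 2)⁻¹ by positivity), Real.exp_le_exp, Real.log_inv,
      Real.log_pow]
    push_cast; linarith
  calc (2 * s + 1) * Real.exp (-(ε / (20 * s) * c.omega s ε / 6)) ≤ (3 * x) * (x ^ 2)⁻¹ := by
        gcongr; linarith
    _ = 3 / x := by field_simp
    _ ≤ 1 / 100 := by rw [div_le_div_iff₀ hx0 (by norm_num)]; linarith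

/-- The excess of the In-Pool functions is a set that Test-Factored-DNF tolerates. -/
theorem weight_le_density (h : FinderScale c s ε) :
    80 * ((s : ℝ) / ε) / c.bigN s ε ≤ (1 / (100 * (paramM s ε : ℝ) ^ 5)) ^ 2 := by
  have hy := h.le_ceil
  have h1 := h.pow_le_bigN (k := 202) (by norm_num)
  have hxy : (s : ℝ) / ε ≤ ⌈(s : ℝ) / ε⌉₊ := Nat.le_ceil _
  have hx := h.large
  rw [paramM]; push_cast
  set y : ℝ := (⌈(s : ℝ) / ε⌉₊ : ℝ)
  have hy0 : 0 < y := by linarith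
  have hN : (0 : ℝ) < c.bigN s ε := lt_of_lt_of_le (by positivity) h1
  rw [div_pow, one_pow, div_le_div_iff₀ hN (by positivity)]
  calc 80 * ((s : ℝ) / ε) * (100 * (y ^ 20) ^ 5) ^ 2 = 800000 * ((s : ℝ) / ε) * y ^ 200 := by ring
    _ ≤ y * y * y ^ 200 := by gcongr; linarith
    _ = y ^ 202 := by ring
    _ ≤ 1 * c.bigN s ε := by linarith

/-- Test-Factored-DNF makes too few queries to notice that the sample law of the simulators is
slightly wrong. -/
theorem queries_mul_le (h : FinderScale c s ε) :
    ((paramM s ε ^ 6 : ℕ) : ℝ) * (1 / (c.bigN s ε : ℝ) ^ 2 + 40 * ((s : ℝ) / ε) / c.bigN s ε)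
      ≤ 3 / 100 := by
  have hy := h.le_ceil
  have h1 := h.pow_le_bigN (k := 122) (by norm_num)
  have h2 := h.sq_le_bigN
  have hxy : (s : ℝ) / ε ≤ ⌈(s : ℝ) / ε⌉₊ := Nat.le_ceil _
  rw [paramM]; push_cast
  set y : ℝ := (⌈(s : ℝ) / ε⌉₊ : ℝ)
  have hy0 : 0 < y := by linarith
  set N : ℝ := (c.bigN s ε : ℝ)
  have hN : 1 ≤ N := by linarith
  have h3 : 1 / N ^ 2 + 40 * ((s : ℝ) / ε) / N ≤ 41 * y / N := by
    have h4 : 1 / N ^ 2 ≤ y / N := by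
      rw [div_le_div_iff₀ (by positivity) (by positivity)]
      nlinarith
    calc 1 / N ^ 2 + 40 * ((s : ℝ) / ε) / N ≤ y / N + 40 * y / N := by gcongr
      _ = 41 * y / N := by ring
  calc ((y ^ 20) ^ 6) * (1 / N ^ 2 + 40 * ((s : ℝ) / ε) / N) ≤ ((y ^ 20) ^ 6) * (41 * y / N) := by
        gcongr
    _ = 41 * y ^ 121 / N := by ring
    _ ≤ 3 / 100 := by
        rw [div_le_div_iff₀ (by linarith) (by norm_num)]
        calc 41 * y ^ 121 * 100 = 4100 * y ^ 121 := by ring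
          _ ≤ y * y ^ 121 := by gcongr; linarith
          _ = y ^ 122 := by ring
          _ ≤ 3 * N := by linarith

theorem queries_mul_sq_le (h : FinderScale c s ε) :
    ((paramM s ε ^ 6 : ℕ) : ℝ) * (1 / (c.bigN s ε : ℝ) ^ 2) ≤ 1 / 10 := by
  refine le_trans (mul_le_mul_of_nonneg_left ?_ (Nat.cast_nonneg _))
    (h.queries_mul_le.trans (by norm_num))
  have := h.pos
  linarith [show 0 ≤ 40 * ((s : ℝ) / ε) / c.bigN s ε by positivity]

/-- The tail of the factored DNFs has at most `μ` variables, since `log N` is of order `log (s / ε)`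
and `log² (s / ε)` exceeds any constant multiple of it. -/
theorem linkBound_le (h : FinderScale c s ε) :
    (s : ℝ) ^ 2 * linkBound (c.bigN s ε) ≤ paramMu s ε := by
  have hs : (1 : ℝ) ≤ s := by exact_mod_cast h.one_le
  have hd : (300 : ℝ) ≤ c.degree := by exact_mod_cast h.degree
  have hl := h.degree_le
  have hx := h.large
  have hy := h.le_ceil
  have hs2 : (1 : ℝ) ≤ (s : ℝ) ^ 2 := one_le_pow₀ hs
  have h1 : Real.logb 2 (c.bigN s ε : ℝ) ≤ c.degree * (2 * Real.logb 2 ((s : ℝ) / ε)) := by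
    rw [FinderConsts.bigN]; push_cast
    rw [Real.logb_pow]
    gcongr
    calc Real.logb 2 (⌈(s : ℝ) / ε⌉₊ : ℝ) ≤ Real.logb 2 (((s : ℝ) / ε) ^ 2) :=
          Real.logb_le_logb_of_le (by norm_num) (by linarith) h.ceil_le
      _ = _ := by rw [Real.logb_pow]; norm_num
  rw [linkBound, paramMu, paramK]
  have h2 := Nat.lt_floor_add_one (16 * (s : ℝ) ^ 2 * Real.logb 2 ((s : ℝ) / ε) ^ 2)
  set l := Real.logb 2 ((s : ℝ) / ε)
  have hl1 : 1 ≤ l := by linarith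
  have h3 : (640 * c.degree * (s : ℝ) ^ 2) * l ≤ 16 * (s : ℝ) ^ 2 * l ^ 2 := by
    calc (640 * c.degree * (s : ℝ) ^ 2) * l = 16 * (s : ℝ) ^ 2 * (40 * c.degree * l) := by ring
      _ ≤ 16 * (s : ℝ) ^ 2 * (l * l) := by gcongr
      _ = _ := by ring
  have h4 : (s : ℝ) ^ 2 * (316 * Real.logb 2 (c.bigN s ε : ℝ)) ≤
      632 * c.degree * (s : ℝ) ^ 2 * l := by
    calc (s : ℝ) ^ 2 * (316 * Real.logb 2 (c.bigN s ε : ℝ))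
        ≤ (s : ℝ) ^ 2 * (316 * (c.degree * (2 * l))) := by gcongr
      _ = _ := by ring
  have h5 : 1 ≤ (c.degree : ℝ) * (s : ℝ) ^ 2 * l :=
    one_le_mul_of_one_le_of_one_le
      (one_le_mul_of_one_le_of_one_le (by linarith) hs2) hl1
  linarith

/-- The total failure probability in the case of a DNF. -/
theorem failure_le (h : FinderScale c s ε) :
    8 / (c.bigN s ε : ℝ) + (2 / (c.bigN s ε : ℝ) + (s * (10 / (c.bigN s ε : ℝ)) +
      (s * (3 * s / (c.bigN s ε : ℝ)) + (c.omega s ε * (s / (c.bigN s ε : ℝ) ^ 2) +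
        (2 * s + 1) * Real.exp (-(ε / (20 * s) * c.omega s ε / 6)))))) ≤ 1 / 10 := by
  have hs : (1 : ℝ) ≤ s := by exact_mod_cast h.one_le
  have hy := h.le_ceil
  have hsy := h.cast_le_ceil
  have h3 := h.pow_le_bigN (k := 3) (by norm_num)
  have hω := h.omega_le
  have hexp := h.exp_le
  have hN := h.sq_le_bigN
  set y : ℝ := (⌈(s : ℝ) / ε⌉₊ : ℝ)
  set N : ℝ := (c.bigN s ε : ℝ)
  have hN0 : 0 < N := by linarith
  have hs2 : (s : ℝ) ^ 2 / N ≤ 1 / 10 ^ 9 := by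
    rw [div_le_div_iff₀ hN0 (by norm_num)]
    have h5 : (s : ℝ) ^ 2 ≤ y ^ 2 := pow_le_pow_left₀ (by linarith) hsy 2
    calc (s : ℝ) ^ 2 * 10 ^ 9 ≤ y ^ 2 * y := by gcongr
      _ = y ^ 3 := by ring
      _ ≤ 1 * N := by linarith
  have h1 : 1 / N ≤ (s : ℝ) ^ 2 / N := by gcongr; exact one_le_pow₀ hs
  have h2 : (s : ℝ) / N ≤ (s : ℝ) ^ 2 / N := by gcongr; exact le_self_pow₀ hs (by norm_num)
  have h4 : (c.omega s ε : ℝ) * (s / N ^ 2) ≤ s / N := by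
    calc (c.omega s ε : ℝ) * (s / N ^ 2) ≤ N * (s / N ^ 2) := by gcongr
      _ = s / N := by field_simp
  have e1 : 8 / N = 8 * (1 / N) := by ring
  have e2 : 2 / N = 2 * (1 / N) := by ring
  have e3 : s * (10 / N) = 10 * (s / N) := by ring
  have e4 : s * (3 * s / N) = 3 * ((s : ℝ) ^ 2 / N) := by ring
  rw [e1, e2, e3, e4]
  norm_num at hs2 ⊢
  norm_num at h1 h2 h4 hexp
  linarith

theorem le_bigN (h : FinderScale c s ε) : s ≤ c.bigN s ε := by
  have := h.sq_le_bigN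
  have := h.cast_le_ceil
  have : (s : ℝ) ≤ c.bigN s ε := by linarith [h.le_ceil]
  exact_mod_cast this

theorem two_hundred_mul_le (h : FinderScale c s ε) : 200 * ⌈(s : ℝ) / ε⌉₊ ≤ c.bigN s ε := by
  have := h.sq_le_bigN
  have : (200 : ℝ) * ⌈(s : ℝ) / ε⌉₊ ≤ c.bigN s ε := by linarith [h.le_ceil]
  exact_mod_cast this

theorem twenty_le_bigN (h : FinderScale c s ε) : 20 ≤ c.bigN s ε := by
  have := h.sq_le_bigN
  have : (20 : ℝ) ≤ c.bigN s ε := by linarith [h.le_ceil]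
  exact_mod_cast this

theorem poolReps_le (h : FinderScale c s ε) : poolReps (c.bigN s ε) ≤ c.bigN s ε ^ 2 := by
  have h20 := h.twenty_le_bigN
  set N := c.bigN s ε
  rw [poolReps, alpha, Nat.ceil_le]
  have h1 := logb_two_le (show (0 : ℝ) < N by exact_mod_cast (by omega : 0 < N))
  have h2 : (20 : ℝ) ≤ N := by exact_mod_cast h20
  push_cast; nlinarith

theorem sampDraws_le (h : FinderScale c s ε) :
    ⌈100 * ((s : ℝ) / ε) * alpha (c.bigN s ε)⌉₊ ≤ c.bigN s ε ^ 2 := by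
  have h20 := h.twenty_le_bigN
  have h200 := h.two_hundred_mul_le
  have hxy : (s : ℝ) / ε ≤ ⌈(s : ℝ) / ε⌉₊ := Nat.le_ceil _
  have hx := h.large
  set N := c.bigN s ε
  have hN : (0 : ℝ) < N := by exact_mod_cast (by omega : 0 < N)
  rw [alpha, Nat.ceil_le]
  have h1 := logb_two_le hN
  have h2 : 200 * (⌈(s : ℝ) / ε⌉₊ : ℝ) ≤ N := by exact_mod_cast h200
  push_cast
  calc 100 * ((s : ℝ) / ε) * Real.logb 2 (N : ℝ) ≤ 100 * ((s : ℝ) / ε) * (2 * N) := by gcongr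
    _ = 200 * ((s : ℝ) / ε) * N := by ring
    _ ≤ N * N := by gcongr; linarith
    _ = (N : ℝ) ^ 2 := by ring

theorem pow_bigN_le (h : FinderScale c s ε) :
    c.bigN s ε ^ 13 ≤ ⌊((s : ℝ) / ε) ^ (26 * c.degree)⌋₊ := by
  refine Nat.le_floor ?_
  push_cast
  calc (c.bigN s ε : ℝ) ^ 13 ≤ (((s : ℝ) / ε) ^ (2 * c.degree)) ^ 13 :=
        pow_le_pow_left₀ (Nat.cast_nonneg _) h.bigN_le 13
    _ = _ := by rw [← pow_mul]; congr 1; ring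

/-- The query bounds, for the algorithm itself and for the simulators that it returns. -/
theorem meets {n : ℕ} (h : FinderScale c s ε) :
    Meets ⌊((s : ℝ) / ε) ^ (26 * c.degree)⌋₊
      (SmallSimulators s ⌊((s : ℝ) / ε) ^ (26 * c.degree)⌋₊)
      (findFactoredDNFs (n := n) c s ε) := by
  have hR := h.poolReps_le
  have hS := h.sampDraws_le
  have h20 := h.twenty_le_bigN
  have hs := h.le_bigN
  have hω : c.omega s ε ≤ c.bigN s ε := by exact_mod_cast h.omega_le
  have hQ := h.pow_bigN_le
  set N := c.bigN s ε with hN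
  have hN1 : 1 ≤ N := by omega
  have hp : ∀ {a b : ℕ}, a ≤ b → N ^ a ≤ N ^ b := fun hab => Nat.pow_le_pow_right hN1 hab
  have h5 : N ^ 3 * poolReps N ≤ N ^ 5 :=
    (Nat.mul_le_mul_left _ hR).trans_eq (by ring)
  have hstep : ∀ {a b : ℕ} {t : ℕ}, t ≤ 20 * N ^ a → a + 1 ≤ b → t ≤ N ^ b := fun {a b t} ht hab =>
    ht.trans ((Nat.mul_le_mul_right _ h20).trans ((by rw [pow_succ, mul_comm] :
      N * N ^ a = N ^ (a + 1)).trans_le (hp hab)))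
  have h1 : 1 ≤ N ^ 5 := Nat.one_le_pow _ _ hN1
  have hq1 : 1 + N ^ 3 * poolReps N ≤ N ^ 13 := hstep (a := 5) (by omega) (by norm_num)
  have hq2 : ⌈100 * ((s : ℝ) / ε) * alpha N⌉₊ * (2 + N ^ 3 * poolReps N) ≤ N ^ 13 := by
    have h2 : 2 + N ^ 3 * poolReps N ≤ N ^ 6 := hstep (a := 5) (by omega) (by norm_num)
    exact (Nat.mul_le_mul hS h2).trans ((by ring : N ^ 2 * N ^ 6 = N ^ 8).trans_le
      (hp (by norm_num)))
  refine (meets_findFactoredDNFs c s ε rfl rfl (hq1.trans hQ) (hq2.trans hQ)).mono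
    (le_trans (hstep (a := 12) ?_ (by norm_num)) hQ) fun _ h => h
  have h3 : s * (N ^ 5 + N ^ 11) ≤ N ^ 6 + N ^ 12 :=
    (Nat.mul_le_mul_right _ hs).trans_eq (by ring)
  have h4 : c.omega s ε * (1 + s * (N ^ 3 * poolReps N)) ≤ N + N ^ 7 :=
    (Nat.mul_le_mul hω (add_le_add_right (Nat.mul_le_mul hs h5) 1)).trans_eq (by ring)
  have h6 := hp (show 3 ≤ 12 by norm_num)
  have h7 := hp (show 9 ≤ 12 by norm_num)
  have h8 := hp (show 6 ≤ 12 by norm_num)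
  have h9 := hp (show 7 ≤ 12 by norm_num)
  have h10 := hp (show 1 ≤ 12 by norm_num)
  rw [pow_one] at h10
  linarith

end FinderScale

end FinderParameters

end RelDNF

open RelDNF
theorem mainTheorem3 :
    -- for all sufficiently large constants in Test-Factored-DNF
    ∃ c₀ : ℕ, ∀ c : TesterConsts, c.AtLeast c₀ →
    -- for all sufficiently large constants in Find-Factored-DNFs
    ∃ d₀ : ℕ, ∀ d : FinderConsts, d₀ ≤ d.degree → d₀ ≤ d.draws →
    -- the exponent of the query bounds and the lower bound on `s / ε`
    ∃ (C : ℕ) (L : ℝ), ∀ (n s : ℕ) (ε : ℝ), 1 ≤ s → 0 < ε → ε ≤ 1 / 2 → L ≤ (s : ℝ) / ε →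
      -- query complexity of Find-Factored-DNFs
      Prog.QueriesAtMost ⌊((s : ℝ) / ε) ^ C⌋₊ (findFactoredDNFs (n := n) d s ε) ∧
      ∀ (f : Str n → Bool) (hf : (sat f).Nonempty),
        -- at most `s` pairs are returned, and the simulators have small query complexity
        (∀ l, some l ∈ (Prog.run f hf (findFactoredDNFs d s ε)).support →
          l.length ≤ s ∧
          ∀ p ∈ l, (∀ x, Prog.QueriesAtMost ⌊((s : ℝ) / ε) ^ C⌋₊ (p.1 x)) ∧
            Prog.QueriesAtMost ⌊((s : ℝ) / ε) ^ C⌋₊ p.2) ∧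
        -- the case of an `s`-term DNF
        (IsTermDNF s f →
          9 / 10 ≤ (Prog.run f hf (findFactoredDNFs d s ε)).toOuterMeasure
            {out | ∃ l, out = some l ∧
              ∃ (k : Fin l.length → ℕ) (h : Fin l.length → Str n → Bool)
                (hh : ∀ i, (sat (h i)).Nonempty),
                (∀ i, IsTermDNF (k i) (h i)) ∧ ∑ i, k i ≤ s ∧
                (∀ i, IsFactoredDNF (k i) (paramMu s ε) (h i)) ∧
                ∀ i, IsAdequate f hf (l.get i).1 (l.get i).2 (h i) (hh i)
                  (testFactoredDNF c (k i) (paramMu s ε) (ε / (2 * (s : ℝ))))}) ∧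
        -- the case of a function that is `ε`-far from every `s`-term DNF
        ((∀ g : Str n → Bool, IsTermDNF s g → ε ≤ reldist f g) →
          9 / 10 ≤ (Prog.run f hf (findFactoredDNFs d s ε)).toOuterMeasure
            {out | out = none ∨ ∃ l, out = some l ∧
              ∃ (h : Fin l.length → Str n → Bool) (hh : ∀ i, (sat (h i)).Nonempty),
                (∀ i, sat (h i) ⊆ sat f) ∧
                ((sat f \ Finset.univ.biUnion fun i => sat (h i)).card : ℝ) / ((sat f).card : ℝ)
                  ≤ ε / 2 ∧
                ∀ i, ∀ r, 1 ≤ r → r ≤ s →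
                  IsAdequate f hf (l.get i).1 (l.get i).2 (h i) (hh i)
                    (testFactoredDNF c r (paramMu s ε) (ε / (2 * (s : ℝ))))}) := by

  -- The exponent of `N` is at least 300, so that Test-Factored-DNF with at most `⌈s / ε⌉ ^ 120` queries
  -- cannot notice events of probability about `1 / N`. The bound on `s / ε` absorbs the constants of
  -- Test-Factored-DNF, makes `log (s / ε)` larger than a multiple of the exponent, and exceeds `d'`.
  refine ⟨100, fun c hc => ⟨300, fun d hd hd' => ⟨26 * d.degree,
    10 ^ 9 * (c.total : ℝ) + 2 ^ (40 * d.degree) + d.draws, fun n s ε hs hε hε2 hL => ?_⟩⟩⟩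
  have hadm : Admissible s ε (10 ^ 9 * (c.total : ℝ) + 2 ^ (40 * d.degree) + d.draws) :=
    ⟨hs, hε, hε2, hL⟩
  have htot : (1 : ℝ) ≤ c.total := by
    exact_mod_cast (by unfold TesterConsts.total; omega : 1 ≤ c.total)
  have hpow : (0 : ℝ) < 2 ^ (40 * d.degree) := by positivity
  have hdraws : (0 : ℝ) ≤ d.draws := Nat.cast_nonneg _
  have hsc : FinderScale d s ε := hadm.finderScale (by linarith) hd hd' (by linarith)
    (by linarith)
  have hrob := isRobust_testFactoredDNF (n := n) c hc hadm (by linarith)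
  have hN : 20 ≤ d.bigN s ε := hsc.twenty_le_bigN
  have hNx : 80 * ((s : ℝ) / ε) ≤ d.bigN s ε := by
    have h1 := hsc.sq_le_bigN
    have h2 : (s : ℝ) / ε ≤ ⌈(s : ℝ) / ε⌉₊ := Nat.le_ceil _
    linarith [hsc.le_ceil]
  refine ⟨hsc.meets.queriesAtMost, fun f hf =>
    ⟨fun l hl => hsc.meets.of_mem_support f hf hl l rfl, ?_, fun _ => ?_⟩⟩
  · rintro ⟨D, hD, rfl⟩
    have h := (risk_findFactoredDNFs_dnf hf d rfl rfl hs hε (by omega) hD hsc.le_bigN hNx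
      hsc.weight_le_density hsc.queries_mul_le hrob hsc.linkBound_le).trans hsc.failure_le
    exact le_run_toOuterMeasure _ hf _ _ h
  · have h := le_run_toOuterMeasure f hf _ _ (risk_findFactoredDNFs_arbitrary f hf d rfl rfl hs hε
      (by omega) {alg | ∃ r, 1 ≤ r ∧ r ≤ s ∧ alg = testFactoredDNF c r (paramMu s ε) (ε / (2 * s))}
      (by rintro _ ⟨r, hr1, hr, rfl⟩; exact hrob.queries r hr1 hr) hsc.queries_mul_sq_le
      (hsc.exp_le.trans (by norm_num)))
    refine h.trans (MeasureTheory.OuterMeasure.mono _ ?_)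
    rintro out (hout | ⟨l, hl, g, hg, hsub, hcov, had⟩)
    · exact Or.inl hout
    · exact Or.inr ⟨l, hl, g, hg, hsub, hcov, fun i r hr1 hr => had i _ ⟨r, hr1, hr, rfl⟩⟩
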